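/- **Setting.** Let $L(x)=\sum_i L_ix^i$ and $R(x)=\sum_j R_jx^j$ be degree distribution polynomials ($i,j\ge 1$), and let $\lambda(x)=L'(x)/L'(1)$ and $\rho(x)=R'(x)/R'(1)$. For a blocklength $n$ for which this is possible, fix $n$ variable nodes, a fraction $L_i$ of which has $i$ sockets, and $m=nL'(1)/R'(1)$ check nodes, a fraction $R_j$ of which has $j$ sockets. A Tanner graph of the ensemble is a uniformly random bijection between variable-node sockets and check-node sockets (its edges). The depth-$t$ neighborhood graph of a uniformly random root $v_0$ consists of the variable nodes joined to $v_0$ by a path of at most $2t$ edges, the check nodes joined to $v_0$ by a path of at most $2t-1$ edges, and the edges between these nodes. Two neighborhood graphs are equivalent if there are bijections between their sockets that respect edges, map the socket tuple of the root to that of the root, and map the socket tuple of every other node to such a tuple up to a cyclic shift; $\mathbb P_n(G)$ is the probability of the equivalence class of $G$. The number of cycles of $G$ is its number of edges minus its number of nodes other than the root, and $\mathcal S_t$ is the set of (classes of) neighborhood graphs $G$ of depth $t$ with exactly one cycle. $\mathrm P_b(\epsilon,G)$ is the probability that the root of $G$ is still erased after $t$ iterations of belief propagation on $G$ when each channel output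 is erased independently with probability $\epsilon\in[0,1]$. The depth of a variable (check) node at graph distance $2d$ (resp. $2d+1$) from the root is $d$. For $G\in\mathcal S_t$ let $s_2+1$ be the number of nodes on a shortest path from the root to the deepest node of the cycle. Let $\mathcal S_v(t,s_1,s_2)$ and $\mathcal S_c(t,s_1,s_2)$ be the sets of $G\in\mathcal S_t$ with this $s_2$ for which the shallowest node of the cycle is a non-root variable node, respectively a check node, of depth $s_1$; let $\mathcal S_r(t,s)$ be the set of those for which it is the root and $s_2=s$. **Formulas.** Let $P_\epsilon(0)=1$, and for $t\ge1$ let $Q_\epsilon(t)=\epsilon\lambda(P_\epsilon(t-1))$ and $P_\epsilon(t)=1-\rho(1-Q_\epsilon(t))$. Put $a(t)=\epsilon\frac{\lambda'(P_\epsilon(t))}{\lambda'(1)}$ and $b(t)=\frac{\rho'(1-Q_\epsilon(t))}{\rho'(1)}$, and define $$f(t,s,p)=\begin{cases}\epsilon,&t=0\\ a(t)\,g(t,s-1,p),&t>0\end{cases}\qquad g(t,s,p)=\begin{cases}p,&s=0\\ 1-b(t)\,(1-f(t-1,s,p)),&s>0\end{cases}$$ $$G_1(t,s)=\begin{cases}1,&s=0\\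 (1-b(t))^2+2b(t)(1-b(t))f(t-1,s,1)+b(t)^2G_2(t-1,s-1),&s>0\end{cases}$$ $$G_2(t,s)=\begin{cases}a(t),&s=0\\ a(t)^2G_1(t,s-1),&s>0\end{cases}\qquad G_3(t,s)=\begin{cases}1-a(t),&s=0\\ 1-2f(t,s+1,1)+a(t)^2G_1(t,s-1),&s>0\end{cases}$$ $$F_v(t,s_1,s_2)=\tfrac12\lambda''(1)\rho'(1)^2(\lambda'(1)\rho'(1))^{s_2-s_1-2}Q_\epsilon(t+1)\,g\Big(t,s_1-1,1-b(t-s_1+1)\Big(1-\epsilon\tfrac{\lambda''(P_\epsilon(t-s_1))}{\lambda''(1)}G_1(t-s_1,s_2-2s_1-1)\Big)\Big)$$ $$F_c(t,s_1,s_2)=\tfrac12\rho''(1)\lambda'(1)(\lambda'(1)\rho'(1))^{s_2-s_1-2}Q_\epsilon(t+1)\,g\Big(t,s_1,1-\tfrac{\rho''(1-Q_\epsilon(t-s_1))}{\rho''(1)}G_3(t-s_1-1,s_2-2s_1-2)\Big)$$ $$F_r(t,s)=\tfrac12(\lambda'(1)\rho'(1))^{s}\,a(t)\,G_1(t,s-1).$$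 Here $F_v:=0$ if $\lambda''(1)=0$; likewise $F_c:=0$ if $\rho''(1)=0$, and $F_v=F_c=F_r:=0$ if $\lambda'(1)\rho'(1)=0$. **Theorem.** For every $\epsilon\in[0,1]$ and $t\ge0$, as $n\to\infty$ through blocklengths of $(n,L,R)$-irregular ensembles, the limit $\gamma(\epsilon,t)=\lim_{n\to\infty}n\sum_{G\in\mathcal S_t}\mathbb P_n(G)\mathrm P_b(\epsilon,G)$ exists and $$\gamma(\epsilon,t)=\sum_{s_1=1}^{t-1}\sum_{s_2=2s_1+1}^{2t}F_v(t,s_1,s_2)+\sum_{s_1=0}^{t-1}\sum_{s_2=2s_1+2}^{2t}F_c(t,s_1,s_2)+\sum_{s=1}^{2t}F_r(t,s).$$ Moreover, for the parameters occurring in these sums, $F_v(t,s_1,s_2)$, $F_c(t,s_1,s_2)$ and $F_r(t,s)$ are the limits of $n\sum_G\mathbb P_n(G)\mathrm P_b(\epsilon,G)$ over $G$ in $\mathcal S_v(t,s_1,s_2)$, $\mathcal S_c(t,s_1,s_2)$ and $\mathcal S_r(t,s)$, respectively. -/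

import Mathlib

open Filter Topology
open scoped Polynomial

noncomputable section

namespace LDPC

/-! ### Tanner graphs with sockets -/

/-- The tuple of sockets of the node `a`: a node `a` of degree `d a` owns the sockets
`⟨a, 0⟩, …, ⟨a, d a - 1⟩`, in this order. -/
def tuple {α : Type*} (d : α → ℕ) (a : α) : List (Σ a, Fin (d a)) :=
  List.ofFn fun i : Fin (d a) => (⟨a, i⟩ : Σ a, Fin (d a))

theorem mem_tuple {α : Type*} {d : α → ℕ} {a : α} {s : Σ a, Fin (d a)} :
    s ∈ tuple d a ↔ s.1 = a := by
  constructor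
  · intro h
    obtain ⟨i, rfl⟩ := (List.mem_ofFn' _ _).1 h
    rfl
  · rintro rfl
    exact (List.mem_ofFn' _ _).2 ⟨s.2, rfl⟩

/-- The nodes and sockets shared by all the Tanner graphs of one ensemble: `n` variable nodes and
`m` check nodes, each with its (positive) number of sockets; in total there are as many
variable-node sockets as check-node sockets. -/
structure Sockets where
  /-- the blocklength -/
  n : ℕ
  /-- the number of check nodes -/
  m : ℕ
  /-- the degree of each variable node -/
  varDeg : Fin n → ℕ
  /-- the degree of each check node -/
  chkDeg : Fin m → ℕ
  varDeg_pos : ∀ v, 0 < varDeg v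
  chkDeg_pos : ∀ c, 0 < chkDeg c
  sum_eq : ∑ v, varDeg v = ∑ c, chkDeg c

namespace Sockets

/-- The `(n, L(x), R(x))`-irregular ensemble: for all `i`, `j`, a fraction `L_i` of the variable
nodes has degree `i` and a fraction `R_j` of the check nodes has degree `j`. (As soon as `n > 0`,
this forces `L` and `R` to have nonnegative coefficients, `L(0) = R(0) = 0` and
`L(1) = R(1) = 1`.) -/
structure HasDegreeDistributions (S : Sockets) (L R : ℝ[X]) : Prop where
  var : ∀ i : ℕ, ((Finset.univ.filter fun v => S.varDeg v = i).card : ℝ) = S.n * L.coeff i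
  chk : ∀ j : ℕ, ((Finset.univ.filter fun c => S.chkDeg c = j).card : ℝ) = S.m * R.coeff j

variable (S : Sockets)

/-- variable-node sockets -/
abbrev VSocket := Σ v : Fin S.n, Fin (S.varDeg v)

/-- check-node sockets -/
abbrev CSocket := Σ c : Fin S.m, Fin (S.chkDeg c)

/-- An edge is a pair of a variable-node socket and a check-node socket. -/
abbrev Edge := S.VSocket × S.CSocket

/-- variable nodes (`Sum.inl`) and check nodes (`Sum.inr`) -/
abbrev Node := Fin S.n ⊕ Fin S.m

/-- A Tanner graph of the ensemble: every socket carries exactly one edge, so that the edge set is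
(the graph of) a bijection between the sockets of both sides. The ensemble is uniform on these. -/
abbrev TannerGraph := S.VSocket ≃ S.CSocket

variable {S}

/-- the variable node of an edge -/
def Edge.var (e : S.Edge) : Fin S.n := e.1.1

/-- the check node of an edge -/
def Edge.chk (e : S.Edge) : Fin S.m := e.2.1

/-- the edge `e` is incident to the node `x` -/
def Incident (e : S.Edge) (x : S.Node) : Prop :=
  x = Sum.inl (Edge.var e) ∨ x = Sum.inr (Edge.chk e)

/-- The bipartite graph on the nodes given by a set of edges (multiplicities forgotten); used for
distances only. -/
def edgeGraph (F : Finset S.Edge) : SimpleGraph S.Node :=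
  SimpleGraph.fromRel fun x y =>
    ∃ e ∈ F, x = Sum.inl (Edge.var e) ∧ y = Sum.inr (Edge.chk e)

/-- the edge set of a Tanner graph -/
def TannerGraph.edges (T : S.TannerGraph) : Finset S.Edge :=
  Finset.univ.map ⟨fun s => (s, T s), fun _ _ h => congrArg Prod.fst h⟩

/-! ### Neighborhood graphs -/

variable (S) in
/-- Data of a rooted graph within the nodes and sockets `S`: sets of variable nodes and of check
nodes (these determine its sockets), a root and a set of edges. -/
@[ext] structure RootedGraph where
  varNodes : Finset (Fin S.n)
  chkNodes : Finset (Fin S.m)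
  root : Fin S.n
  edges : Finset S.Edge

instance : Finite (RootedGraph S) :=
  Finite.of_injective
    (fun G : RootedGraph S => (G.varNodes, G.chkNodes, G.root, G.edges)) (by
      rintro ⟨a, b, c, d⟩ ⟨a', b', c', d'⟩ h
      simp only [Prod.mk.injEq] at h
      obtain ⟨rfl, rfl, rfl, rfl⟩ := h
      rfl)

instance : Fintype (RootedGraph S) := Fintype.ofFinite _

open Classical in
/-- The neighborhood graph of depth `t` of the variable node `v₀`. The distance of two nodes is the
number of check nodes, not counting the end points, on a shortest path between them: a variable
node has distance at most `t` from `v₀` iff it is at most `2 * t` edges away, and a check node has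
distance at most `t - 1` iff it is at most `2 * t - 1` edges away. The edges are those between
the nodes so chosen. -/
def nbhd (t : ℕ) (v₀ : Fin S.n) (T : S.TannerGraph) : RootedGraph S where
  varNodes := Finset.univ.filter fun v =>
    (edgeGraph T.edges).edist (Sum.inl v₀) (Sum.inl v) ≤ (2 * t : ℕ)
  chkNodes := Finset.univ.filter fun c =>
    (edgeGraph T.edges).edist (Sum.inl v₀) (Sum.inr c) + 1 ≤ (2 * t : ℕ)
  root := v₀
  edges := T.edges.filter fun e =>
    (edgeGraph T.edges).edist (Sum.inl v₀) (Sum.inl (Edge.var e)) ≤ (2 * t : ℕ) ∧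
    (edgeGraph T.edges).edist (Sum.inl v₀) (Sum.inr (Edge.chk e)) + 1 ≤ (2 * t : ℕ)

open Classical in
/-- `ℚ_n(G)`: the probability that the depth-`t` neighborhood graph of a uniformly chosen variable
node in a uniformly chosen Tanner graph is `G`. -/
def labelledProb (t : ℕ) (G : RootedGraph S) : ℝ :=
  ((Finset.univ.filter fun x : Fin S.n × S.TannerGraph => nbhd t x.1 x.2 = G).card : ℝ) /
    Fintype.card (Fin S.n × S.TannerGraph)

namespace RootedGraph

/-- Equivalence of rooted graphs: bijections `σV`, `σC` between the sockets of `G` and those of `G'`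
(written as restrictions of permutations of all sockets) that respect the edges, send the socket
tuple of the root to that of the root, and send the socket tuples of all other variable nodes and
of all check nodes to such tuples up to a cyclic shift. -/
def Equivalent (G G' : RootedGraph S) : Prop :=
  ∃ (σV : Equiv.Perm S.VSocket) (σC : Equiv.Perm S.CSocket),
    (∀ s, s.1 ∈ G.varNodes ↔ (σV s).1 ∈ G'.varNodes) ∧
    (∀ s, s.1 ∈ G.chkNodes ↔ (σC s).1 ∈ G'.chkNodes) ∧
    (∀ s s', (s, s') ∈ G.edges ↔ (σV s, σC s') ∈ G'.edges) ∧
    (tuple S.varDeg G.root).map σV = tuple S.varDeg G'.root ∧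
    (∀ v ∈ G.varNodes, v ≠ G.root → ∃ v' ∈ G'.varNodes, v' ≠ G'.root ∧
      List.IsRotated ((tuple S.varDeg v).map σV) (tuple S.varDeg v')) ∧
    (∀ c ∈ G.chkNodes, ∃ c' ∈ G'.chkNodes,
      List.IsRotated ((tuple S.chkDeg c).map σC) (tuple S.chkDeg c'))

theorem Equivalent.refl (G : RootedGraph S) : G.Equivalent G :=
  ⟨1, 1, by simp, by simp, by simp, by simp,
    fun v hv h => ⟨v, hv, h, by simpa using List.IsRotated.refl _⟩,
    fun c hc => ⟨c, hc, by simpa using List.IsRotated.refl _⟩⟩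

theorem Equivalent.symm {G G' : RootedGraph S} (h : G.Equivalent G') : G'.Equivalent G := by
  obtain ⟨σV, σC, hV, hC, hE, hr, hv, hc⟩ := h
  refine ⟨σV⁻¹, σC⁻¹, fun s => ?_, fun s => ?_, fun s s' => ?_, ?_, fun v' hv' hne => ?_,
    fun c' hc' => ?_⟩
  · rw [hV]; simp
  · rw [hC]; simp
  · rw [hE]; simp
  · rw [← hr]; simp [Function.comp_def]
  · have hs : σV (σV⁻¹ ⟨v', ⟨0, S.varDeg_pos v'⟩⟩) = ⟨v', ⟨0, S.varDeg_pos v'⟩⟩ := by simp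
    set s := σV⁻¹ ⟨v', ⟨0, S.varDeg_pos v'⟩⟩
    have hmem : s.1 ∈ G.varNodes := by rw [hV, hs]; exact hv'
    have hnr : s.1 ≠ G.root := by
      intro h
      have h1 : σV s ∈ (tuple S.varDeg G.root).map σV :=
        List.mem_map_of_mem (mem_tuple.2 h)
      rw [hr, hs] at h1
      exact hne (mem_tuple.1 h1)
    obtain ⟨v'', hv'', -, hrot⟩ := hv _ hmem hnr
    have h1 : σV s ∈ (tuple S.varDeg s.1).map σV := List.mem_map_of_mem (mem_tuple.2 rfl)
    rw [hrot.mem_iff, hs] at h1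
    obtain rfl : v' = v'' := mem_tuple.1 h1
    refine ⟨s.1, hmem, hnr, ?_⟩
    simpa [Function.comp_def] using (hrot.symm.map (σV⁻¹ : Equiv.Perm _))
  · have hs : σC (σC⁻¹ ⟨c', ⟨0, S.chkDeg_pos c'⟩⟩) = ⟨c', ⟨0, S.chkDeg_pos c'⟩⟩ := by simp
    set s := σC⁻¹ ⟨c', ⟨0, S.chkDeg_pos c'⟩⟩
    have hmem : s.1 ∈ G.chkNodes := by rw [hC, hs]; exact hc'
    obtain ⟨c'', hc'', hrot⟩ := hc _ hmem
    have h1 : σC s ∈ (tuple S.chkDeg s.1).map σC := List.mem_map_of_mem (mem_tuple.2 rfl)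
    rw [hrot.mem_iff, hs] at h1
    obtain rfl : c' = c'' := mem_tuple.1 h1
    refine ⟨s.1, hmem, ?_⟩
    simpa [Function.comp_def] using (hrot.symm.map (σC⁻¹ : Equiv.Perm _))

theorem Equivalent.trans {G G' G'' : RootedGraph S} (h : G.Equivalent G')
    (h' : G'.Equivalent G'') : G.Equivalent G'' := by
  obtain ⟨σV, σC, hV, hC, hE, hr, hv, hc⟩ := h
  obtain ⟨τV, τC, hV', hC', hE', hr', hv', hc'⟩ := h'
  refine ⟨τV * σV, τC * σC, fun s => ?_, fun s => ?_, fun s s' => ?_, ?_, fun v hm hne => ?_,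
    fun c hm => ?_⟩
  · rw [hV, hV']; rfl
  · rw [hC, hC']; rfl
  · rw [hE, hE']; rfl
  · rw [← hr', ← hr]; simp [Function.comp_def]
  · obtain ⟨v1, h1, h2, h3⟩ := hv v hm hne
    obtain ⟨v2, h4, h5, h6⟩ := hv' v1 h1 h2
    exact ⟨v2, h4, h5, by simpa [Function.comp_def] using (h3.map τV).trans h6⟩
  · obtain ⟨c1, h1, h3⟩ := hc c hm
    obtain ⟨c2, h4, h6⟩ := hc' c1 h1
    exact ⟨c2, h4, by simpa [Function.comp_def] using (h3.map τC).trans h6⟩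

variable (S) in
/-- the equivalence relation on rooted graphs -/
def equivalence : Setoid (RootedGraph S) :=
  ⟨Equivalent, Equivalent.refl, Equivalent.symm, Equivalent.trans⟩

instance : Fintype (Quotient (equivalence S)) :=
  @Fintype.ofFinite _ (Quotient.finite _)

open Classical in
/-- `ℙ_n(G)`: the probability of the equivalence class of `G` in the depth-`t` neighborhood graph
ensemble. -/
def prob (t : ℕ) (G : RootedGraph S) : ℝ :=
  ∑ G' with G'.Equivalent G, labelledProb t G'

/-! ### Belief propagation on the erasure channel -/

/-- `G.chkErased A τ e`: in the `τ`-th iteration of BP decoding, with `A` the set of variable nodes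
whose channel output is erased, the message along the edge `e` from its check node to its variable
node is an erasure. Before the first iteration these messages carry no information. In each
iteration, a variable node sends an erasure along `e'` iff its channel output and all its messages
from the previous iteration on edges other than `e'` are erasures; then a check node sends an
erasure along `e` iff it received one on some edge other than `e`. -/
def chkErased (G : RootedGraph S) (A : Finset (Fin S.n)) : ℕ → S.Edge → Prop
  | 0, _ => True
  | τ + 1, e => ∃ e' ∈ G.edges, e' ≠ e ∧ Edge.chk e' = Edge.chk e ∧
      Edge.var e' ∈ A ∧
      ∀ e'' ∈ G.edges, e'' ≠ e' → Edge.var e'' = Edge.var e' → G.chkErased A τ e''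

/-- the root is still erased after `t` iterations -/
def rootErased (G : RootedGraph S) (A : Finset (Fin S.n)) (t : ℕ) : Prop :=
  G.root ∈ A ∧ ∀ e ∈ G.edges, Edge.var e = G.root → G.chkErased A t e

open Classical in
/-- `P_b(ε, G)`: the error probability of the root of `G` after `t` iterations, if the channel
output of each variable node of `G` is erased independently with probability `ε`. -/
def errorProb (ε : ℝ) (t : ℕ) (G : RootedGraph S) : ℝ :=
  ∑ A ∈ G.varNodes.powerset.filter fun A => G.rootErased A t,
    ε ^ A.card * (1 - ε) ^ (G.varNodes.card - A.card)

/-! ### Single-cycle neighborhood graphs and their types -/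

/-- the number of cycles: the number of edges minus the number of nodes other than the root -/
def numCycles (G : RootedGraph S) : ℤ :=
  G.edges.card - (G.varNodes.card + G.chkNodes.card - 1)

open Classical in
/-- The node `x` lies on a cycle of `G`: it is incident to a set of edges of which every node is
incident to none or exactly two. (Two parallel edges form a cycle.) -/
def OnCycle (G : RootedGraph S) (x : S.Node) : Prop :=
  ∃ Z ⊆ G.edges, (∃ e ∈ Z, Incident e x) ∧
    ∀ e ∈ Z, ∀ y, Incident e y → (Z.filter fun e' => Incident e' y).card = 2

/-- The number of edges on a shortest path from the root to `x`, which is one less than the number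
of nodes on it. This is `2 * d` for a variable node of depth `d` and `2 * d + 1` for a check node
of depth `d`. -/
def rootDist (G : RootedGraph S) (x : S.Node) : ℕ∞ :=
  (edgeGraph G.edges).edist (Sum.inl G.root) x

/-- `x` is a shallowest node of the cycle -/
def IsShallowest (G : RootedGraph S) (x : S.Node) : Prop :=
  G.OnCycle x ∧ ∀ y, G.OnCycle y → G.rootDist x ≤ G.rootDist y

/-- `x` is a deepest node of the cycle -/
def IsDeepest (G : RootedGraph S) (x : S.Node) : Prop :=
  G.OnCycle x ∧ ∀ y, G.OnCycle y → G.rootDist y ≤ G.rootDist x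

variable (S)

/-- single-cycle graphs -/
def singleCycle : Set (RootedGraph S) := {G | G.numCycles = 1}

/-- Types I and II: the shallowest node in the cycle is a variable node `w` other than the root, of
depth `s₁`, and the shortest path from the root to the deepest node in the cycle has `s₂ + 1`
nodes. -/
def singleCycleV (s₁ s₂ : ℕ) : Set (RootedGraph S) :=
  {G | G ∈ singleCycle S ∧
    (∃ w, w ≠ G.root ∧ G.IsShallowest (Sum.inl w) ∧ G.rootDist (Sum.inl w) = (2 * s₁ : ℕ)) ∧
    ∃ y, G.IsDeepest y ∧ G.rootDist y = s₂}

/-- Types III and IV: the shallowest node in the cycle is a check node, of depth `s₁`, and the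
shortest path from the root to the deepest node in the cycle has `s₂ + 1` nodes. -/
def singleCycleC (s₁ s₂ : ℕ) : Set (RootedGraph S) :=
  {G | G ∈ singleCycle S ∧
    (∃ c, G.IsShallowest (Sum.inr c) ∧ G.rootDist (Sum.inr c) = (2 * s₁ + 1 : ℕ)) ∧
    ∃ y, G.IsDeepest y ∧ G.rootDist y = s₂}

/-- Types V and VI: the shallowest node in the cycle is the root, and the shortest path from the
root to the deepest node in the cycle has `s + 1` nodes. -/
def singleCycleR (s : ℕ) : Set (RootedGraph S) :=
  {G | G ∈ singleCycle S ∧ G.IsShallowest (Sum.inl G.root) ∧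
    ∃ y, G.IsDeepest y ∧ G.rootDist y = s}

end RootedGraph

variable (S) in
open Classical in
/-- `∑_{G ∈ X} ℙ_n(G) P_b(ε, G)`, a sum over depth-`t` neighborhood graphs up to equivalence. -/
def contribution (X : Set (RootedGraph S)) (ε : ℝ) (t : ℕ) : ℝ :=
  ∑ q : Quotient (RootedGraph.equivalence S) with q.out ∈ X,
    q.out.prob t * q.out.errorProb ε t

end Sockets

/-! ### The recursive formulas -/

/-- the degree distribution from edge perspective: `L'(x) / L'(1)` -/
def edgePerspective (L : ℝ[X]) : ℝ[X] :=
  Polynomial.C (L.derivative.eval 1)⁻¹ * L.derivative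

section formulas

/- Below, `lam` is `λ(x)` and `rho` is `ρ(x)`. -/
variable (lam rho : ℝ[X]) (ε : ℝ)

/-- density evolution: `P_ε(0) = 1` and `P_ε(t) = 1 - ρ(1 - Q_ε(t))` for `t ≥ 1`, where
`Q_ε(t) = ε λ(P_ε(t - 1))` -/
def deP : ℕ → ℝ
  | 0 => 1
  | t + 1 => 1 - rho.eval (1 - ε * lam.eval (deP t))

/-- density evolution: `Q_ε(t) = ε λ(P_ε(t - 1))`, used for `t ≥ 1` only -/
def deQ (t : ℕ) : ℝ := ε * lam.eval (deP lam rho ε (t - 1))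

/-- `ε λ'(P_ε(t)) / λ'(1)` -/
def ratioV (t : ℕ) : ℝ :=
  ε * (lam.derivative.eval (deP lam rho ε t) / lam.derivative.eval 1)

/-- `ρ'(1 - Q_ε(t)) / ρ'(1)` -/
def ratioC (t : ℕ) : ℝ :=
  rho.derivative.eval (1 - deQ lam rho ε t) / rho.derivative.eval 1

/-- `f(t, s, p)`, used for `s ≥ 1` only; the factor in parentheses is `g(t, s - 1, p)` -/
def f : ℕ → ℕ → ℝ → ℝ
  | 0, _, _ => ε
  | t + 1, s, p => ratioV lam rho ε (t + 1) *
      (if s - 1 = 0 then p else 1 - ratioC lam rho ε (t + 1) * (1 - f t (s - 1) p))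

/-- `g(t, s, p)` -/
def g (t s : ℕ) (p : ℝ) : ℝ :=
  if s = 0 then p else 1 - ratioC lam rho ε t * (1 - f lam rho ε (t - 1) s p)

theorem f_eq (t s : ℕ) (p : ℝ) : f lam rho ε t s p =
    if t = 0 then ε else ratioV lam rho ε t * g lam rho ε t (s - 1) p := by
  cases t <;> rfl

mutual

/-- `G₁(t, s)`, used for `s ≤ 2 * t` only -/
def G₁ : ℕ → ℕ → ℝ
  | _, 0 => 1
  | t, s + 1 => (1 - ratioC lam rho ε t) ^ 2
      + 2 * ratioC lam rho ε t * (1 - ratioC lam rho ε t) * f lam rho ε (t - 1) (s + 1) 1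
      + ratioC lam rho ε t ^ 2 * G₂ (t - 1) s

/-- `G₂(t, s)` -/
def G₂ : ℕ → ℕ → ℝ
  | t, 0 => ratioV lam rho ε t
  | t, s + 1 => ratioV lam rho ε t ^ 2 * G₁ t s

end

/-- `G₃(t, s)` -/
def G₃ (t s : ℕ) : ℝ :=
  if s = 0 then 1 - ratioV lam rho ε t
  else 1 - 2 * f lam rho ε t (s + 1) 1 + ratioV lam rho ε t ^ 2 * G₁ lam rho ε t (s - 1)

/-- `F_v(t, s₁, s₂)`, for `1 ≤ s₁ < t` and `2 * s₁ + 1 ≤ s₂ ≤ 2 * t`; it is `0` if `λ''(1) = 0` -/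
def Fv (t s₁ s₂ : ℕ) : ℝ :=
  if lam.derivative.derivative.eval 1 = 0 then 0 else
  1 / 2 * lam.derivative.derivative.eval 1 * rho.derivative.eval 1 ^ 2
    * (lam.derivative.eval 1 * rho.derivative.eval 1) ^ (s₂ - s₁ - 2)
    * deQ lam rho ε (t + 1)
    * g lam rho ε t (s₁ - 1)
        (1 - ratioC lam rho ε (t - s₁ + 1) *
          (1 - ε * (lam.derivative.derivative.eval (deP lam rho ε (t - s₁))
                / lam.derivative.derivative.eval 1)
              * G₁ lam rho ε (t - s₁) (s₂ - 2 * s₁ - 1)))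

/-- `F_c(t, s₁, s₂)`, for `s₁ < t` and `2 * s₁ + 2 ≤ s₂ ≤ 2 * t` -/
def Fc (t s₁ s₂ : ℕ) : ℝ :=
  1 / 2 * rho.derivative.derivative.eval 1 * lam.derivative.eval 1
    * (lam.derivative.eval 1 * rho.derivative.eval 1) ^ (s₂ - s₁ - 2)
    * deQ lam rho ε (t + 1)
    * g lam rho ε t s₁
        (1 - rho.derivative.derivative.eval (1 - deQ lam rho ε (t - s₁))
              / rho.derivative.derivative.eval 1
            * G₃ lam rho ε (t - s₁ - 1) (s₂ - 2 * s₁ - 2))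

/-- `F_r(t, s)`, for `1 ≤ s ≤ 2 * t` -/
def Fr (t s : ℕ) : ℝ :=
  1 / 2 * (lam.derivative.eval 1 * rho.derivative.eval 1) ^ s
    * ratioV lam rho ε t * G₁ lam rho ε t (s - 1)

end formulas

end LDPC

end

/-!
The probability that the neighborhood of a node contains a cycle is of order `1 / n`, so `γ` is a
first-order correction, and it is governed by the expected number of cycles near the root, each
weighted with the probability that belief propagation fails in its presence.

*Lassos.* A cycle of which the root can see both the shallowest node, at distance `ℓ`, and the
deepest node, at distance `ℓ + k`, is the loop of a *lasso*: a walk along `r = ℓ + 2 * k` edges that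
starts at the root, goes to the shallowest node of the cycle and then once around the cycle. A
neighborhood with one cycle has exactly one node `y` with two neighboring edges towards the root,
namely the deepest node of the cycle; descending from `y` along these two edges until the paths meet
gives exactly two lassos, one for each direction (`Unicyclic.card_lassos`), and their `ℓ` and `k`
are what the types `𝒮_v`, `𝒮_c`, `𝒮_r` prescribe (`RootedLasso.mem_singleCycleV_iff` and its
companions). A neighborhood without cycles has no lasso (`not_rootedLasso`), and neighborhoods with
two or more cycles have total weight `O(1 / n)` (`sum_expect_two_le_numCycles`), because a connected
graph with `f` edges and at most `f - 1` nodes is expected to occur `O(n ^ (f - 1) / n ^ f)` times.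
So `n ∑ ℙ_n(G) P_b(ε, G)` over one type is, up to `O(1 / n)`, half the expected number of lassos
whose root stays erased (`exists_contribution_bound`).

*Messages.* Belief propagation is run on the whole Tanner graph, in half-iterations and with values
in `{0, 1}` such that every node sends a product of what it receives, negated on arrival (`msg`).
This agrees with belief propagation on the neighborhood (`rootMsg_eq_ind`). On a lasso, the
messages from outside enter through one *node variable* `α i j` per node `i` and time `j` only
(`nodeVar`); the state of the root is a polynomial `lassoMsg` in them (`IsLasso.rootMsg_eq`).
As messages change in one direction only as time goes on, a product `α i j * α i j'` with `j` and
`j'` of the same parity equals one of its factors, and `lassoMsg` becomes multi-affine, with at most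
one time for each node in each monomial.

*Local convergence.* Unfolding messages one edge at a time shows that, given finitely many edges,
the messages into other half-edges are asymptotically independent, with means given by density
evolution (`expect_prod_msg`). Summing over all lassos turns the expectation of a monomial in the
node variables into a product over the nodes (`productLimit_lassoSum`), whose factors are
derivatives of `λ` and `ρ`, at `1` (counting the sockets) or at the density of the node.
Substituting these means into `lassoMsg` gives the recursions `f`, `g`, `G₁`, `G₂`, `G₃` and the
formulas `F_v`, `F_c`, `F_r` (`ProductLimit.tendsto_Fv` and its companions).
-/

noncomputable section

namespace LDPC

/-! ### Messages along chains and cycles -/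

section

/-- The value of an outgoing message at time `j` that carries no information: at even times (for
variable nodes) it is an erasure, encoded by `1`; at odd times (for check nodes) an erasure is
encoded by `0`. -/
def blank (j : ℕ) : ℝ := if Even j then 1 else 0

/-- The message sent at time `j` out of a chain of `n` nodes by its first node, where `α i` tells
at which times everything outside the chain lets the `i`-th node pass on the message of its
successor (negated), and `φ` is the message fed into the last node. -/
def chain (φ : ℕ → ℝ) : ℕ → (ℕ → ℕ → ℝ) → ℕ → ℝ
  | 0, _, j => φ j
  | _ + 1, α, 0 => α 0 0
  | n + 1, α, j + 1 => α 0 (j + 1) * (1 - chain φ n (fun i => α (i + 1)) j)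

/-- The product of the two messages that a node receives, one time step after `j`, from a cycle
through it with `n` further nodes, if it feeds blank messages into both ends of the cycle. -/
def loop (n : ℕ) (α : ℕ → ℕ → ℝ) (j : ℕ) : ℝ :=
  (1 - chain blank n α j) * (1 - chain blank n (fun i => α (n - 1 - i)) j)

/-- The message sent at time `j` out of a lasso: a path with `ℓ` nodes before the node that starts
a cycle with `n` further nodes. -/
def lassoMsg (n : ℕ) : ℕ → (ℕ → ℕ → ℝ) → ℕ → ℝ
  | 0, α, j => α 0 j * loop n (fun i => α (i + 1)) (j - 1)
  | ℓ + 1, α, j => α 0 j * (1 - lassoMsg n ℓ (fun i => α (i + 1)) (j - 1))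

/-- `0`-`1`-valued node variables that behave in time as those of belief propagation: erasures can
only disappear. -/
structure Admissible (α : ℕ → ℕ → ℝ) : Prop where
  zero_or_one : ∀ i j, α i j = 0 ∨ α i j = 1
  even : ∀ i j, Even j → α i (j + 2) ≤ α i j
  odd : ∀ i j, ¬ Even j → α i j ≤ α i (j + 2)

theorem blank_add_two (j : ℕ) : blank (j + 2) = blank j := by
  simp [blank, Nat.even_add]

theorem blank_succ (j : ℕ) : blank (j + 1) = 1 - blank j := by
  by_cases h : Even j <;> simp [blank, Nat.even_add_one, h]

theorem Admissible.comp {α : ℕ → ℕ → ℝ} (h : Admissible α) (p : ℕ → ℕ) :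
    Admissible (fun i => α (p i)) :=
  ⟨fun _ => h.1 _, fun _ => h.2 _, fun _ => h.3 _⟩

theorem Admissible.nonneg {α : ℕ → ℕ → ℝ} (h : Admissible α) (i j : ℕ) : 0 ≤ α i j := by
  rcases h.1 i j with h | h <;> simp [h]

theorem Admissible.le_one {α : ℕ → ℕ → ℝ} (h : Admissible α) (i j : ℕ) : α i j ≤ 1 := by
  rcases h.1 i j with h | h <;> simp [h]

/-- A variable node that is blocked from recovery at a late time was so before. -/
theorem Admissible.eq_one_of_le {α : ℕ → ℕ → ℝ} (h : Admissible α) {i j j' : ℕ} (he : Even j)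
    (he' : Even j') (hle : j' ≤ j) (h1 : α i j = 1) : α i j' = 1 := by
  obtain ⟨a, rfl⟩ := he
  obtain ⟨b, rfl⟩ := he'
  obtain ⟨c, rfl⟩ : ∃ c, a = b + c := ⟨a - b, by omega⟩
  clear hle
  induction c with
  | zero => exact h1
  | succ c ih =>
    apply ih
    have := h.2 i (b + c + (b + c)) (by simp)
    have h3 := h.le_one i (b + c + (b + c))
    rw [show b + (c + 1) + (b + (c + 1)) = b + c + (b + c) + 2 by ring] at h1
    linarith

theorem chain_blank_zero_or_one (n : ℕ) : ∀ {α : ℕ → ℕ → ℝ} (_ : Admissible α) (j : ℕ),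
    chain blank n α j = 0 ∨ chain blank n α j = 1 := by
  induction n with
  | zero => intro α _ j; by_cases h : Even j <;> simp [chain, blank, h]
  | succ n ih =>
    intro α h j
    cases j with
    | zero => exact h.1 0 0
    | succ j =>
      rcases h.1 0 (j + 1) with h0 | h0 <;>
      rcases ih (h.comp (fun i => i + 1)) j with h1 | h1 <;> simp [chain, h0, h1]

theorem chain_blank_mono (n : ℕ) : ∀ {α : ℕ → ℕ → ℝ} (_ : Admissible α) (j : ℕ),
    (Even j → chain blank n α (j + 2) ≤ chain blank n α j) ∧
    (¬ Even j → chain blank n α j ≤ chain blank n α (j + 2)) := by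
  induction n with
  | zero => intro α _ j; simp [chain, blank_add_two]
  | succ n ih =>
    intro α h j
    have hb : ∀ j, 0 ≤ chain blank n (fun i => α (i + 1)) j ∧
        chain blank n (fun i => α (i + 1)) j ≤ 1 := fun j => by
      rcases chain_blank_zero_or_one n (h.comp (fun i => i + 1)) j with h | h <;> simp [h]
    cases j with
    | zero =>
      refine ⟨fun _ => ?_, fun h => absurd Even.zero h⟩
      have h2 := h.2 0 0 Even.zero
      have h3 := h.nonneg 0 2
      simp only [chain] at *
      have := hb 1
      simp only [zero_add] at *
      nlinarith
    | succ j =>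
      have h1 := ih (h.comp (fun i => i + 1)) j
      have hb1 := hb j
      have hb2 := hb (j + 2)
      have n1 := h.nonneg 0 (j + 1)
      have n2 := h.nonneg 0 (j + 1 + 2)
      have e1 := h.2 0 (j + 1)
      have e2 := h.3 0 (j + 1)
      simp only [Nat.even_add_one, not_not] at *
      rw [show j + 1 + 2 = (j + 2) + 1 by ring] at *
      simp only [chain]
      exact ⟨fun h => mul_le_mul (e1 h) (by linarith [h1.2 h]) (by linarith) n1,
        fun h => mul_le_mul (e2 h) (by linarith [h1.1 h]) (by linarith) n2⟩

/-- What is fed into the end of a chain of `n` nodes is felt exactly `n` time steps later. -/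
theorem chain_congr {φ ψ : ℕ → ℝ} (n : ℕ) : ∀ (α : ℕ → ℕ → ℝ) (j : ℕ),
    (n ≤ j → φ (j - n) = ψ (j - n)) → chain φ n α j = chain ψ n α j := by
  induction n with
  | zero => intro α j h; simpa [chain] using h
  | succ n ih =>
    intro α j h
    cases j with
    | zero => rfl
    | succ j =>
      simp only [chain]
      rw [ih _ j (fun hj => by simpa using h (by omega))]

theorem chain_congr_left {φ : ℕ → ℝ} (n : ℕ) : ∀ {α β : ℕ → ℕ → ℝ} (j : ℕ),
    (∀ i < n, α i = β i) → chain φ n α j = chain φ n β j := by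
  induction n with
  | zero => intro α β j h; rfl
  | succ n ih =>
    intro α β j h
    cases j with
    | zero => simp [chain, h 0]
    | succ j =>
      simp only [chain]
      rw [ih j (fun i hi => h (i + 1) (by omega)), h 0 (by omega)]

/-- The last node of a chain can be dropped if it sends blank messages at all times that matter. -/
theorem chain_succ_eq (n : ℕ) : ∀ (α : ℕ → ℕ → ℝ) (j : ℕ),
    (n ≤ j → chain blank 1 (fun i => α (n + i)) (j - n) = blank (j - n)) →
    chain blank (n + 1) α j = chain blank n α j := by
  induction n with
  | zero => intro α j h; simpa [chain] using h
  | succ n ih =>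
    intro α j h
    cases j with
    | zero => rfl
    | succ j =>
      rw [chain, ih _ j (fun hj => ?_), chain]
      have := h (by omega)
      simp only [Nat.add_sub_add_right] at this
      rw [← this]
      congr 1
      funext i
      congr 1
      ring

/-- A last node that acts at odd times, that is, a check node with an erased input, sends
erasures. -/
theorem chain_succ_of_odd (n : ℕ) (α : ℕ → ℕ → ℝ) (j : ℕ) (h : ¬ Even (j + n)) :
    chain blank (n + 1) α j = chain blank n α j := by
  apply chain_succ_eq
  intro hn
  obtain ⟨i, rfl⟩ : ∃ i, j = i + n := ⟨j - n, by omega⟩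
  have hi : ¬ Even i := by
    intro hi; apply h; rw [add_assoc]; exact hi.add (by simp)
  rw [Nat.add_sub_cancel]
  cases i with
  | zero => simp at hi
  | succ i =>
    have : Even i := by simpa [Nat.even_add_one] using hi
    simp [chain, blank, Nat.even_add_one, this]

/-- A last node that acts at even times and is blocked from recovery by everything outside the
chain sends erasures. -/
theorem chain_succ_of_even (n : ℕ) {α : ℕ → ℕ → ℝ} (hα : Admissible α) (j J : ℕ)
    (h : Even (j + n)) (hJ : Even J) (hle : j ≤ J + n) (h1 : α n J = 1) :
    chain blank (n + 1) α j = chain blank n α j := by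
  apply chain_succ_eq
  intro hn
  obtain ⟨i, rfl⟩ : ∃ i, j = i + n := ⟨j - n, by omega⟩
  have hi : Even i := by
    rw [add_assoc] at h
    exact (Nat.even_add.1 h).2 (by simp)
  have hα1 : α n i = 1 := hα.eq_one_of_le hJ hi (by omega) h1
  rw [Nat.add_sub_cancel]
  cases i with
  | zero => simpa [chain, blank] using hα1
  | succ i =>
    have : ¬ Even i := by simpa [Nat.even_add_one] using hi
    simp [chain, blank, Nat.even_add_one, this, hα1]

/-- At odd times the two end nodes of a cycle (check nodes) either have an erased input from
outside the cycle or pass on what they receive from within. -/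
theorem loop_odd (m : ℕ) (hm : ¬ Even m) {α : ℕ → ℕ → ℝ} {j : ℕ} (hj : Even j) :
    loop (m + 2) α (j + 1) =
      (1 - α 0 (j + 1)) * (1 - α (m + 1) (j + 1))
      + (1 - α (m + 1) (j + 1)) * (α 0 (j + 1) * chain blank m (fun i => α (1 + i)) j)
      + (1 - α 0 (j + 1)) * (α (m + 1) (j + 1) * chain blank m (fun i => α (1 + (m - 1 - i))) j)
      + α 0 (j + 1) * (α (m + 1) (j + 1) *
        (chain blank m (fun i => α (1 + i)) j *
          chain blank m (fun i => α (1 + (m - 1 - i))) j)) := by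
  have hjm : ¬ Even (j + m) := by rw [Nat.even_add]; simp [hj, hm]
  have e1 : chain blank (m + 1) (fun i => α (i + 1)) j = chain blank m (fun i => α (1 + i)) j := by
    rw [chain_succ_of_odd _ _ _ hjm]
    simp only [add_comm]
  have e2 : chain blank (m + 1) (fun i => α (m + 1 - (i + 1))) j =
      chain blank m (fun i => α (1 + (m - 1 - i))) j := by
    rw [chain_succ_of_odd _ _ _ hjm]
    apply chain_congr_left
    intro i hi
    congr 1
    omega
  rw [loop]
  simp only [chain, show m + 2 - 1 = m + 1 by omega, Nat.sub_zero]
  rw [e1, e2]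
  ring

/-- At even times, if both end nodes of a chain (variable nodes) send erasures out of the chain,
then they do so into the chain as well. -/
theorem chain_mul_chain_even (n : ℕ) (hn : ¬ Even n) {α : ℕ → ℕ → ℝ} (hα : Admissible α) {j : ℕ}
    (hj : ¬ Even j) :
    chain blank (n + 2) α (j + 1) * chain blank (n + 2) (fun i => α (n + 1 - i)) (j + 1) =
      α 0 (j + 1) * (α (n + 1) (j + 1) * loop n (fun i => α (1 + i)) j) := by
  have hj1 : Even (j + 1) := by simpa [Nat.even_add_one] using hj
  have hjn : Even (j + n) := by rw [Nat.even_add]; simp [hj, hn]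
  simp only [chain, Nat.sub_zero]
  rcases hα.1 0 (j + 1) with h0 | h0
  · simp [h0]
  rcases hα.1 (n + 1) (j + 1) with h1 | h1
  · simp [h1]
  rw [chain_succ_of_even n (hα.comp (fun i => i + 1)) j (j + 1) hjn hj1 (by omega) h1,
    chain_succ_of_even n (hα.comp (fun i => n + 1 - (i + 1))) j (j + 1) hjn hj1 (by omega)
      (by simpa using h0), h0, h1, loop]
  simp only [one_mul]
  congr 2
  · simp only [add_comm]
  · apply chain_congr_left
    intro i hi
    congr 1
    omega

/-- At even times (variable nodes as end nodes), and for the product over the chain itself. -/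
theorem loop_even (n : ℕ) (α : ℕ → ℕ → ℝ) (j : ℕ) :
    loop n α j = 1 - chain blank n α j - chain blank n (fun i => α (n - 1 - i)) j
      + chain blank n α j * chain blank n (fun i => α (n - 1 - i)) j := by
  rw [loop]; ring

end

/-! ### Limits of expectations of multi-affine functions of node variables -/

section

/-- The product over the first `r` nodes of the node variables `α i j` with `J i = some j`. -/
def monomial (r : ℕ) (J : ℕ → Option ℕ) (α : ℕ → ℕ → ℝ) : ℝ :=
  ∏ i ∈ Finset.range r, (J i).elim 1 (α i)

/-- The linear functionals `E k` ("expectations", of total mass tending to `c`) of functions of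
node variables converge, on products of variables of distinct nodes, as if the variables of
distinct nodes were independent with means `μ i j`. -/
structure ProductLimit (r : ℕ) (E : ℕ → ((ℕ → ℕ → ℝ) → ℝ) →ₗ[ℝ] ℝ) (c : ℝ) (μ : ℕ → ℕ → ℝ) :
    Prop where
  tendsto : ∀ J : ℕ → Option ℕ,
    Tendsto (fun k => E k (monomial r J)) atTop (𝓝 (c * monomial r J μ))
  mono : ∀ k (W W' : (ℕ → ℕ → ℝ) → ℝ), (∀ α, Admissible α → W α ≤ W' α) → E k W ≤ E k W'

/-- `W` has limit mean `v` and is independent, in the limit, of the variables of the nodes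
outside `Q`. -/
def HasMean (r : ℕ) (E : ℕ → ((ℕ → ℕ → ℝ) → ℝ) →ₗ[ℝ] ℝ) (c : ℝ) (μ : ℕ → ℕ → ℝ) (Q : Set ℕ)
    (W : (ℕ → ℕ → ℝ) → ℝ) (v : ℝ) : Prop :=
  ∀ J : ℕ → Option ℕ, (∀ i ∈ Q, J i = none) →
    Tendsto (fun k => E k (fun α => monomial r J α * W α)) atTop (𝓝 (c * (monomial r J μ * v)))

section
variable {r : ℕ} {E : ℕ → ((ℕ → ℕ → ℝ) → ℝ) →ₗ[ℝ] ℝ} {c : ℝ} {μ : ℕ → ℕ → ℝ}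
  {Q Q' : Set ℕ} {W W' : (ℕ → ℕ → ℝ) → ℝ} {v v' : ℝ}

theorem ProductLimit.congr (h : ProductLimit r E c μ) (k : ℕ) (W W' : (ℕ → ℕ → ℝ) → ℝ)
    (hW : ∀ α, Admissible α → W α = W' α) : E k W = E k W' :=
  le_antisymm (h.mono k _ _ fun α hα => (hW α hα).le) (h.mono k _ _ fun α hα => (hW α hα).ge)

theorem ProductLimit.hasMean_one (h : ProductLimit r E c μ) : HasMean r E c μ Q (fun _ => 1) 1 := by
  intro J _
  simpa using h.tendsto J

theorem ProductLimit.hasMean_congr (h : ProductLimit r E c μ) (hW : HasMean r E c μ Q W v)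
    (hv : v = v') (hWW : ∀ α, Admissible α → W' α = W α) : HasMean r E c μ Q W' v' := by
  subst hv
  intro J hJ
  refine (hW J hJ).congr fun k => h.congr k _ _ fun α hα => ?_
  rw [hWW α hα]

theorem HasMean.mono (hW : HasMean r E c μ Q W v) (hQ : Q ⊆ Q') : HasMean r E c μ Q' W v :=
  fun J hJ => hW J fun i hi => hJ i (hQ hi)

theorem HasMean.add (hW : HasMean r E c μ Q W v) (hW' : HasMean r E c μ Q W' v') :
    HasMean r E c μ Q (fun α => W α + W' α) (v + v') := by
  intro J hJ
  have := (hW J hJ).add (hW' J hJ)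
  rw [show c * (monomial r J μ * (v + v')) =
    c * (monomial r J μ * v) + c * (monomial r J μ * v') by ring]
  refine this.congr fun k => ?_
  rw [← map_add]
  congr 1
  funext α
  simp [mul_add]

theorem HasMean.const_mul (a : ℝ) (hW : HasMean r E c μ Q W v) :
    HasMean r E c μ Q (fun α => a * W α) (a * v) := by
  intro J hJ
  have := (hW J hJ).const_mul a
  rw [show c * (monomial r J μ * (a * v)) = a * (c * (monomial r J μ * v)) by ring]
  refine this.congr fun k => ?_
  rw [← smul_eq_mul, ← map_smul]
  congr 1
  funext α
  simp only [Pi.smul_apply, smul_eq_mul]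
  ring

theorem HasMean.sub (hW : HasMean r E c μ Q W v) (hW' : HasMean r E c μ Q W' v') :
    HasMean r E c μ Q (fun α => W α - W' α) (v - v') := by
  have := hW.add (hW'.const_mul (-1))
  simpa [sub_eq_add_neg] using this

theorem monomial_update {J : ℕ → Option ℕ} {i : ℕ} (hi : i < r) (hJ : J i = none) (j : ℕ)
    (α : ℕ → ℕ → ℝ) :
    monomial r (Function.update J i (some j)) α = monomial r J α * α i j := by
  have hi' : i ∈ Finset.range r := Finset.mem_range.2 hi
  rw [monomial, monomial, ← Finset.mul_prod_erase _ _ hi', ← Finset.mul_prod_erase _ _ hi', hJ]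
  simp only [Function.update_self, Option.elim_some, Option.elim_none, one_mul]
  rw [mul_comm]
  congr 1
  refine Finset.prod_congr rfl fun l hl => ?_
  rw [Function.update_of_ne (Finset.ne_of_mem_erase hl)]

/-- Multiplication by a variable of a new node. -/
theorem HasMean.mul_var {i : ℕ} (hW : HasMean r E c μ Q W v) (hi : i < r) (hQ : i ∉ Q)
    (hQ' : Q ⊆ Q') (hiQ : i ∈ Q') (j : ℕ) :
    HasMean r E c μ Q' (fun α => α i j * W α) (μ i j * v) := by
  intro J hJ
  have := hW (Function.update J i (some j)) fun l hl => by
    rw [Function.update_of_ne (by rintro rfl; exact hQ hl)]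
    exact hJ l (hQ' hl)
  simp only [monomial_update hi (hJ i hiQ)] at this
  simpa only [mul_assoc] using this

theorem ProductLimit.hasMean_chain (h : ProductLimit r E c μ) (φ : ℕ → ℝ) (n : ℕ) :
    ∀ (p : ℕ → ℕ) (j : ℕ), (∀ i < n, p i < r) → (Set.InjOn p (Set.Iio n)) →
    HasMean r E c μ (p '' Set.Iio n) (fun α => chain φ n (fun i => α (p i)) j)
      (chain φ n (fun i => μ (p i)) j) := by
  induction n with
  | zero =>
    intro p j _ _
    simpa [chain] using (h.hasMean_one (Q := p '' Set.Iio 0)).const_mul (φ j)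
  | succ n ih =>
    intro p j hp hinj
    have h0 : p 0 ∈ p '' Set.Iio (n + 1) := ⟨0, by simp, rfl⟩
    have h0' : p 0 ∉ (fun i => p (i + 1)) '' Set.Iio n := by
      rintro ⟨i, hi, h⟩
      have := hinj (by simpa using hi) (by simp) h
      omega
    have hsub : (fun i => p (i + 1)) '' Set.Iio n ⊆ p '' Set.Iio (n + 1) := by
      rintro _ ⟨i, hi, rfl⟩
      exact ⟨i + 1, by simpa using hi, rfl⟩
    cases j with
    | zero =>
      have := (h.hasMean_one (Q := ∅)).mul_var (hp 0 (by omega)) (by simp) (Set.empty_subset _) h0 0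
      simpa [chain] using this
    | succ j =>
      have := ih (fun i => p (i + 1)) j (fun i hi => hp _ (by omega))
        (fun a ha b hb hab => by
          have := hinj (by simpa using ha) (by simpa using hb) hab
          omega)
      exact (h.hasMean_one.sub this).mul_var (hp 0 (by omega)) h0' hsub h0 (j + 1)

end

section
variable {lam rho : ℝ[X]} {ε : ℝ}

/-- The probability that everything outside the cycle or path lets a node with two neighbors on
it pass on the message of its successor at time `j`: `ratioV` at even, `ratioC` at odd times. -/
def passProb (lam rho : ℝ[X]) (ε : ℝ) (j : ℕ) : ℝ :=
  if Even j then ratioV lam rho ε (j / 2) else ratioC lam rho ε ((j + 1) / 2)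

theorem passProb_even (t : ℕ) : passProb lam rho ε (2 * t) = ratioV lam rho ε t := by
  simp [passProb]

theorem passProb_odd (t : ℕ) : passProb lam rho ε (2 * t + 1) = ratioC lam rho ε (t + 1) := by
  have : ¬ Even (2 * t + 1) := by simp
  rw [passProb, if_neg this]
  congr 1
  omega

theorem f_zero_left (s : ℕ) (p : ℝ) : f lam rho ε 0 s p = ε := rfl

theorem ratioV_zero (h : lam.derivative.eval 1 ≠ 0) : ratioV lam rho ε 0 = ε := by
  simp [ratioV, deP, h]

/-- The mean message of a chain of `s + 1` variable nodes and `s` check nodes. -/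
theorem chain_passProb (h : lam.derivative.eval 1 ≠ 0) (s : ℕ) : ∀ t : ℕ,
    chain blank (2 * s + 1) (fun _ => passProb lam rho ε) (2 * t) = f lam rho ε t (s + 1) 1 := by
  have h0 : passProb lam rho ε 0 = ε := by
    rw [show (0 : ℕ) = 2 * 0 by rfl, passProb_even, ratioV_zero h]
  induction s with
  | zero =>
    intro t
    cases t with
    | zero => simp [chain, f_zero_left, h0]
    | succ t =>
      rw [f_eq, if_neg (by omega), ← passProb_even]
      simp [chain, g, blank, show 2 * (t + 1) = (2 * t + 1) + 1 by ring]
  | succ s ih =>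
    intro t
    cases t with
    | zero => simp [chain, f_zero_left, h0]
    | succ t =>
      rw [f_eq, if_neg (by omega), g, if_neg (by omega), ← passProb_even,
        show 2 * (s + 1) + 1 = (2 * s + 1) + 1 + 1 by ring,
        show 2 * (t + 1) = 2 * t + 1 + 1 by ring]
      simp only [chain]
      rw [ih t, passProb_odd]
      simp

variable {r : ℕ} {E : ℕ → ((ℕ → ℕ → ℝ) → ℝ) →ₗ[ℝ] ℝ} {c : ℝ} {μ : ℕ → ℕ → ℝ}

theorem chain_congr_parity {n : ℕ} {φ : ℕ → ℝ} : ∀ {α β : ℕ → ℕ → ℝ} {j : ℕ},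
    (∀ i < n, ∀ j', Even (j' + i + j) → α i j' = β i j') → chain φ n α j = chain φ n β j := by
  induction n with
  | zero => intro α β j h; rfl
  | succ n ih =>
    intro α β j h
    cases j with
    | zero => simpa [chain] using h 0 (by omega) 0 (by simp)
    | succ j =>
      simp only [chain]
      rw [ih (α := fun i => α (i + 1)) (β := fun i => β (i + 1)) fun i hi j' hj' =>
        h (i + 1) (by omega) j' (by
          rw [show j' + (i + 1) + (j + 1) = j' + i + j + 2 by ring]
          exact hj'.add (by simp)), h 0 (by omega) (j + 1) (by simp [parity_simps])]

/-- Messages of chains formed by the nodes at the positions `p, …, p + 2 * s`, in either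
direction. -/
theorem ProductLimit.hasMean_chains (H : ProductLimit r E c μ) (h : lam.derivative.eval 1 ≠ 0)
    (s t p : ℕ) (hp : p + (2 * s + 1) ≤ r)
    (hμ : ∀ i, p ≤ i → i < p + (2 * s + 1) → ∀ j, Even (j + (i - p)) →
      μ i j = passProb lam rho ε j) :
    HasMean r E c μ (Set.Ico p (p + (2 * s + 1)))
      (fun α => chain blank (2 * s + 1) (fun i => α (p + i)) (2 * t)) (f lam rho ε t (s + 1) 1) ∧
    HasMean r E c μ (Set.Ico p (p + (2 * s + 1)))
      (fun α => chain blank (2 * s + 1) (fun i => α (p + (2 * s + 1 - 1 - i))) (2 * t))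
      (f lam rho ε t (s + 1) 1) := by
  constructor
  · refine H.hasMean_congr ((H.hasMean_chain blank (2 * s + 1) (fun i => p + i) (2 * t)
      (fun i hi => by omega) (fun a _ b _ hab => by simpa using hab)).mono ?_) ?_ fun _ _ => rfl
    · rintro _ ⟨i, hi, rfl⟩
      simp only [Set.mem_Iio, Set.mem_Ico] at *
      omega
    · rw [← chain_passProb h s t]
      apply chain_congr_parity
      intro i hi j' hj'
      refine hμ (p + i) (by omega) (by omega) j' ?_
      rw [Nat.add_sub_cancel_left]
      simpa [parity_simps] using hj'
  · refine H.hasMean_congr ((H.hasMean_chain blank (2 * s + 1) (fun i => p + (2 * s + 1 - 1 - i))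
      (2 * t) (fun i hi => by omega) (fun a ha b hb hab => by
        simp only [Set.mem_Iio] at *; omega)).mono ?_) ?_ fun _ _ => rfl
    · rintro _ ⟨i, hi, rfl⟩
      simp only [Set.mem_Iio, Set.mem_Ico] at *
      omega
    · rw [← chain_passProb h s t]
      apply chain_congr_parity
      intro i hi j' hj'
      refine hμ _ (by omega) (by omega) j' ?_
      have : j' + (p + (2 * s + 1 - 1 - i) - p) + (j' + i + 2 * t) = 2 * (j' + s + t) := by omega
      exact (Nat.even_add.1 (this ▸ even_two_mul _)).2 hj'

/-- The formulas for `G₁` and `G₂`. The end nodes of the cycle are check nodes at the odd time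
`2 * t + 1` in the first, variable nodes at the even time `2 * t` in the second. -/
theorem ProductLimit.hasMean_loop (H : ProductLimit r E c μ) (h : lam.derivative.eval 1 ≠ 0)
    (s : ℕ) : ∀ (t p : ℕ), p + (2 * s + 1) ≤ r →
    (s ≤ 2 * t + 1 → (∀ i, p ≤ i → i < p + (2 * s + 1) → ∀ j, Even (j + (i - p) + 1) →
        μ i j = passProb lam rho ε j) →
      HasMean r E c μ (Set.Ico p (p + (2 * s + 1)))
        (fun α => loop (2 * s + 1) (fun i => α (p + i)) (2 * t + 1)) (G₁ lam rho ε (t + 1) s)) ∧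
    (s ≤ 2 * t → (∀ i, p ≤ i → i < p + (2 * s + 1) → ∀ j, Even (j + (i - p)) →
        μ i j = passProb lam rho ε j) →
      HasMean r E c μ (Set.Ico p (p + (2 * s + 1)))
        (fun α => chain blank (2 * s + 1) (fun i => α (p + i)) (2 * t) *
          chain blank (2 * s + 1) (fun i => α (p + (2 * s + 1 - 1 - i))) (2 * t))
        (G₂ lam rho ε t s)) := by
  induction s with
  | zero =>
    intro t p hp
    constructor
    · intro _ _
      refine H.hasMean_congr H.hasMean_one (by simp [G₁]) fun α _ => ?_
      simp [loop, chain, blank]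
    · intro _ hμ
      refine H.hasMean_congr (H.hasMean_one.mul_var (i := p) (by omega) (Set.notMem_empty _)
        (Set.empty_subset _) (by simp) (2 * t)) (v' := G₂ lam rho ε t 0) ?_ fun α hα => ?_
      · rw [hμ p (by omega) (by omega) _ (by simp), passProb_even, mul_one, G₂]
      · have e : chain blank (2 * 0 + 1) (fun i => α (p + i)) (2 * t) = α p (2 * t) := by
          cases t with
          | zero => simp [chain]
          | succ t => simp [chain, blank, show 2 * (t + 1) = 2 * t + 1 + 1 by ring]
        have e' : chain blank (2 * 0 + 1) (fun i => α (p + (2 * 0 + 1 - 1 - i))) (2 * t)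
            = α p (2 * t) := by
          cases t with
          | zero => simp [chain]
          | succ t => simp [chain, blank, show 2 * (t + 1) = 2 * t + 1 + 1 by ring]
        rw [e, e']
        rcases hα.1 p (2 * t) with h | h <;> simp [h]
  | succ s ih =>
    intro t p hp
    constructor
    · intro hst hμ
      have hμ' : ∀ i, p + 1 ≤ i → i < p + 1 + (2 * s + 1) → ∀ j, Even (j + (i - (p + 1))) →
          μ i j = passProb lam rho ε j := fun i hi hi' j hj => hμ i (by omega) (by omega) j (by
        rw [show j + (i - p) + 1 = j + (i - (p + 1)) + 2 by omega]
        exact hj.add (by simp))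
      obtain ⟨hc, hc'⟩ := H.hasMean_chains (E := E) h s t (p + 1) (by omega) hμ'
      have hG := (ih t (p + 1) (by omega)).2 (by omega) hμ'
      have n0 : p ∉ Set.Ico (p + 1) (p + 1 + (2 * s + 1)) := by simp
      have s0 : Set.Ico (p + 1) (p + 1 + (2 * s + 1)) ⊆ Set.Ico p (p + (2 * (s + 1) + 1)) := by
        intro i; simp only [Set.mem_Ico]; omega
      have sZ : Set.Ico (p + 1) (p + 1 + (2 * s + 1)) ⊆ Set.Ico p (p + 1 + (2 * s + 1)) := by
        intro i; simp only [Set.mem_Ico]; omega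
      have sL : Set.Ico (p + 1) (p + 1 + (2 * s + 1)) ⊆
          Set.Ico (p + 1) (p + (2 * (s + 1) + 1)) := by
        intro i; simp only [Set.mem_Ico]; omega
      have mL : p + (2 * s + 2) ∈ Set.Ico (p + 1) (p + (2 * (s + 1) + 1)) := by
        simp only [Set.mem_Ico]; omega
      have mZ : p ∈ Set.Ico p (p + (2 * (s + 1) + 1)) := by simp only [Set.mem_Ico]; omega
      have mZ' : p ∈ Set.Ico p (p + 1 + (2 * s + 1)) := by simp only [Set.mem_Ico]; omega
      have nL : p + (2 * s + 2) ∉ Set.Ico p (p + 1 + (2 * s + 1)) := by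
        simp only [Set.mem_Ico]; omega
      have nL' : p + (2 * s + 2) ∉ Set.Ico (p + 1) (p + 1 + (2 * s + 1)) := by
        simp only [Set.mem_Ico]; omega
      have s1 : Set.Ico p (p + 1 + (2 * s + 1)) ⊆ Set.Ico p (p + (2 * (s + 1) + 1)) := by
        intro i; simp only [Set.mem_Ico]; omega
      have s2 : Set.Ico (p + 1) (p + (2 * (s + 1) + 1)) ⊆
          Set.Ico p (p + (2 * (s + 1) + 1)) := by
        intro i; simp only [Set.mem_Ico]; omega
      have mL' := s2 mL
      have nZ : p ∉ Set.Ico (p + 1) (p + (2 * (s + 1) + 1)) := by simp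
      have e1 : μ p (2 * t + 1) = ratioC lam rho ε (t + 1) := by
        rw [hμ p (by omega) (by omega) _ (by simp [parity_simps]), passProb_odd]
      have e2 : μ (p + (2 * s + 2)) (2 * t + 1) = ratioC lam rho ε (t + 1) := by
        rw [hμ _ (by omega) (by omega) _ (by
          rw [Nat.add_sub_cancel_left]; simp [parity_simps]), passProb_odd]
      -- `HasMean` of the four terms of `loop_odd`
      have x0 := H.hasMean_one.mul_var (i := p) (by omega) (Set.notMem_empty _)
        (Set.empty_subset _) mZ' (2 * t + 1)
      have y0 := (H.hasMean_one (Q := Set.Ico p (p + 1 + (2 * s + 1)))).sub x0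
      have T1 := (y0.mono s1).sub (y0.mul_var (i := p + (2 * s + 2)) (by omega) nL s1 mL'
        (2 * t + 1))
      have x1 := hc.mul_var (i := p) (by omega) n0 sZ mZ' (2 * t + 1)
      have T2 := (x1.mono s1).sub (x1.mul_var (i := p + (2 * s + 2)) (by omega) nL s1 mL'
        (2 * t + 1))
      have x2 := hc'.mul_var (i := p + (2 * s + 2)) (by omega) nL' sL mL (2 * t + 1)
      have T3 := (x2.mono s2).sub (x2.mul_var (i := p) (by omega) nZ s2 mZ (2 * t + 1))
      have T4 := (hG.mul_var (i := p + (2 * s + 2)) (by omega) nL' sL mL (2 * t + 1)).mul_var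
        (i := p) (by omega) nZ s2 mZ (2 * t + 1)
      refine H.hasMean_congr (((T1.add T2).add T3).add T4) ?_ fun α hα => ?_
      · rw [e1, e2, G₁, Nat.add_sub_cancel]
        ring
      · rw [show 2 * (s + 1) + 1 = 2 * s + 1 + 2 by ring, loop_odd _ (by simp) (by simp)]
        simp only [add_zero, ← add_assoc]
        ring
    · intro hst hμ
      obtain ⟨t, rfl⟩ : ∃ t', t = t' + 1 := ⟨t - 1, by omega⟩
      have hG := (ih t (p + 1) (by omega)).1 (by omega) fun i hi hi' j hj =>
        hμ i (by omega) (by omega) j (by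
          rwa [show j + (i - p) = j + (i - (p + 1)) + 1 by omega])
      have nL' : p + (2 * s + 2) ∉ Set.Ico (p + 1) (p + 1 + (2 * s + 1)) := by
        simp only [Set.mem_Ico]; omega
      have sL : Set.Ico (p + 1) (p + 1 + (2 * s + 1)) ⊆
          Set.Ico (p + 1) (p + (2 * (s + 1) + 1)) := by
        intro i; simp only [Set.mem_Ico]; omega
      have mL : p + (2 * s + 2) ∈ Set.Ico (p + 1) (p + (2 * (s + 1) + 1)) := by
        simp only [Set.mem_Ico]; omega
      have s2 : Set.Ico (p + 1) (p + (2 * (s + 1) + 1)) ⊆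
          Set.Ico p (p + (2 * (s + 1) + 1)) := by
        intro i; simp only [Set.mem_Ico]; omega
      have mZ : p ∈ Set.Ico p (p + (2 * (s + 1) + 1)) := by simp only [Set.mem_Ico]; omega
      refine H.hasMean_congr ((hG.mul_var (i := p + (2 * s + 2)) (by omega) nL' sL mL
        (2 * t + 1 + 1)).mul_var (i := p) (by omega) (by simp) s2 mZ (2 * t + 1 + 1)) ?_
        fun α hα => ?_
      · rw [hμ p (by omega) (by omega) _ (by simp [parity_simps]),
          hμ _ (by omega) (by omega) _ (by rw [Nat.add_sub_cancel_left]; simp [parity_simps]),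
          show 2 * t + 1 + 1 = 2 * (t + 1) by ring, passProb_even, G₂]
        ring
      · have := chain_mul_chain_even (2 * s + 1) (by simp) (hα.comp (fun i => p + i))
          (j := 2 * t + 1) (by simp)
        rw [show 2 * (s + 1) + 1 = 2 * s + 1 + 2 by ring,
          show 2 * (t + 1) = 2 * t + 1 + 1 by ring]
        simp only [add_zero, ← add_assoc] at this ⊢
        exact this

/-- The formula for `G₃`: the end nodes of the cycle are variable nodes at the time `2 * t`. -/
theorem ProductLimit.hasMean_loop_even (H : ProductLimit r E c μ) (h : lam.derivative.eval 1 ≠ 0)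
    (s t p : ℕ) (hp : p + (2 * s + 1) ≤ r) (hst : s ≤ 2 * t)
    (hμ : ∀ i, p ≤ i → i < p + (2 * s + 1) → ∀ j, Even (j + (i - p)) →
      μ i j = passProb lam rho ε j) :
    HasMean r E c μ (Set.Ico p (p + (2 * s + 1)))
      (fun α => loop (2 * s + 1) (fun i => α (p + i)) (2 * t)) (G₃ lam rho ε t s) := by
  obtain ⟨hc, hc'⟩ := H.hasMean_chains (E := E) h s t p hp hμ
  have hG := (H.hasMean_loop (E := E) h s t p hp).2 hst hμ
  refine H.hasMean_congr (((H.hasMean_one.sub hc).sub hc').add hG) ?_ fun α hα => loop_even _ _ _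
  rw [G₃]
  cases s with
  | zero =>
    have : f lam rho ε t (0 + 1) 1 = ratioV lam rho ε t := by
      rw [f_eq]
      split_ifs with h0
      · rw [h0, ratioV_zero h]
      · simp [g]
    rw [if_pos rfl, this, G₂]
    ring
  | succ s =>
    rw [if_neg (by omega), G₂, Nat.add_sub_cancel]
    ring

/-- The mean of a message that reaches the root through a path. -/
def pathVal (μ : ℕ → ℕ → ℝ) (v : ℝ) : ℕ → ℕ → ℕ → ℝ
  | 0, p, j => μ p j * v
  | ℓ + 1, p, j => μ p j * (1 - pathVal μ v ℓ (p + 1) (j - 1))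

theorem ProductLimit.hasMean_lassoMsg (H : ProductLimit r E c μ) (n : ℕ) {v : ℝ} (ℓ : ℕ) :
    ∀ (p j : ℕ), p + ℓ + 1 + n ≤ r →
    HasMean r E c μ (Set.Ico (p + ℓ + 1) (p + ℓ + 1 + n))
      (fun α => loop n (fun i => α (p + ℓ + 1 + i)) (j - ℓ - 1)) v →
    HasMean r E c μ (Set.Ico p (p + ℓ + 1 + n))
      (fun α => lassoMsg n ℓ (fun i => α (p + i)) j) (pathVal μ v ℓ p j) := by
  induction ℓ with
  | zero =>
    intro p j hp hv
    refine H.hasMean_congr (hv.mul_var (i := p) (by omega) (by simp) ?_ ?_ j) rfl fun α hα => ?_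
    · intro i; simp only [Set.mem_Ico]; omega
    · simp only [Set.mem_Ico]; omega
    · simp only [lassoMsg, add_zero, Nat.sub_zero]
      congr 2
      funext i
      rw [show p + (i + 1) = p + 1 + i by ring]
  | succ ℓ ih =>
    intro p j hp hv
    have := ih (p + 1) (j - 1) (by omega) (by
      rw [show p + 1 + ℓ + 1 = p + (ℓ + 1) + 1 by ring,
        show j - 1 - ℓ - 1 = j - (ℓ + 1) - 1 by omega]
      exact hv)
    refine H.hasMean_congr ((H.hasMean_one.sub this).mul_var (i := p) (by omega) (by simp)
      ?_ ?_ j) rfl fun α hα => ?_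
    · intro i; simp only [Set.mem_Ico]; omega
    · simp only [Set.mem_Ico]; omega
    · simp only [lassoMsg, add_zero]
      congr 3
      funext i
      rw [show p + (i + 1) = p + 1 + i by ring]

theorem HasMean.tendsto {Q : Set ℕ} {W : (ℕ → ℕ → ℝ) → ℝ} {v : ℝ} (h : HasMean r E c μ Q W v) :
    Tendsto (fun k => E k W) atTop (𝓝 (c * v)) := by
  simpa [monomial] using h (fun _ => none) (fun _ _ => rfl)

end

end

/-! ### The limits in closed form -/

section

section
variable (lam rho : ℝ[X]) (ε : ℝ)

/-- Density evolution in half-iterations: the probability that the message into a socket of a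
variable node (`true`) or a check node (`false`) is `1` at time `j`, where `1` stands for an
erasure into a variable node and for a known bit into a check node. -/
def density : Bool → ℕ → ℝ
  | _, 0 => 1
  | true, j + 1 => 1 - rho.eval (density false j)
  | false, j + 1 => 1 - ε * lam.eval (density true j)

/-- The generating function of the degrees of the `i`-th node of a lasso whose cycle starts at the
`ℓ`-th node: each socket used by the lasso, beyond the one by which the node is found (or, for
the root, by which it is left), amounts to one derivative. -/
def nodePoly (ℓ i : ℕ) : ℝ[X] :=
  Polynomial.derivative^[(if i = 0 then 0 else 1) + (if i = ℓ then 1 else 0)]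
    (if Even i then lam else rho)

/-- The mean of the node variable of the `i`-th node of a lasso at time `j`. -/
def nodeMean (ℓ i j : ℕ) : ℝ :=
  (if Even i then ε else 1) * ((nodePoly lam rho ℓ i).eval (density lam rho ε (decide (Even i)) j)
    / (nodePoly lam rho ℓ i).eval 1)

/-- The limit of the expected number of (oriented) lassos with `r` edges whose cycle starts at
the `ℓ`-th node, up to the factor `n`. -/
def lassoCount (ℓ r : ℕ) : ℝ := ∏ i ∈ Finset.range r, (nodePoly lam rho ℓ i).eval 1

variable {lam rho ε}

theorem density_even_odd (τ : ℕ) : density lam rho ε true (2 * τ) = deP lam rho ε τ ∧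
    density lam rho ε false (2 * τ + 1) = 1 - deQ lam rho ε (τ + 1) := by
  induction τ with
  | zero => simp [density, deP, deQ]
  | succ τ ih =>
    have h : density lam rho ε true (2 * (τ + 1)) = deP lam rho ε (τ + 1) := by
      rw [show 2 * (τ + 1) = 2 * τ + 1 + 1 by ring, density, ih.2, deP, deQ, Nat.add_sub_cancel]
    refine ⟨h, ?_⟩
    rw [density, h, deQ, Nat.add_sub_cancel]

theorem nodeMean_eq_passProb {ℓ i : ℕ} (h0 : i ≠ 0) (hℓ : i ≠ ℓ) {j : ℕ} (h : Even (j + i)) :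
    nodeMean lam rho ε ℓ i j = passProb lam rho ε j := by
  by_cases hj : Even j
  · have hi : Even i := (Nat.even_add.1 h).1 hj
    obtain ⟨τ, rfl⟩ := hj.two_dvd
    rw [passProb_even]
    simp [nodeMean, nodePoly, hi, h0, hℓ, ratioV, density_even_odd]
  · have hi : ¬ Even i := fun hi => hj ((Nat.even_add.1 h).2 hi)
    obtain ⟨τ, rfl⟩ := Nat.not_even_iff_odd.1 hj
    rw [passProb_odd]
    simp [nodeMean, nodePoly, hi, h0, hℓ, ratioC, density_even_odd]

theorem pathVal_eq_g {μ : ℕ → ℕ → ℝ} {v : ℝ} (e s : ℕ) : ∀ {p τ : ℕ}, s ≤ τ → ¬ Even p →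
    (∀ i, p ≤ i → i < p + 2 * s → ∀ j, Even (j + i) → μ i j = passProb lam rho ε j) →
    1 - pathVal μ v (2 * s + e) p (2 * τ + 1) =
      g lam rho ε (τ + 1) s (1 - pathVal μ v e (p + 2 * s) (2 * (τ - s) + 1)) := by
  induction s with
  | zero => intro p τ _ _ _; simp [g]
  | succ s ih =>
    intro p τ hs hp hμ
    obtain ⟨τ, rfl⟩ : ∃ τ', τ = τ' + 1 := ⟨τ - 1, by omega⟩
    have h := @ih (p + 2) τ (by omega) (by simpa [parity_simps] using hp) fun i hi hi' j hj =>
      hμ i (by omega) (by omega) j hj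
    rw [g, if_neg (by omega), f_eq, if_neg (by omega), Nat.add_sub_cancel, Nat.add_sub_cancel,
      show τ + 1 - (s + 1) = τ - s by omega, show p + 2 * (s + 1) = p + 2 + 2 * s by ring, ← h,
      show 2 * (s + 1) + e = 2 * s + e + 1 + 1 by ring]
    simp only [pathVal]
    have hp1 : Even (p + 1) := by simpa [Nat.even_add_one] using hp
    rw [hμ p (by omega) (by omega) _ (by rw [Nat.even_add]; simpa [parity_simps] using hp),
      hμ (p + 1) (by omega) (by omega) _ (by rw [Nat.even_add]; simp [hp1]),
      passProb_odd, show 2 * (τ + 1) + 1 - 1 = 2 * (τ + 1) by omega, passProb_even]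
    simp [Nat.mul_add]

theorem prod_alternating (x y : ℝ) {p : ℕ} (m : ℕ) {w : ℕ → ℝ}
    (hx : ∀ i, p ≤ i → i < p + (2 * m + 1) → Even (i + p) → w i = x)
    (hy : ∀ i, p ≤ i → i < p + (2 * m + 1) → ¬ Even (i + p) → w i = y) :
    ∏ i ∈ Finset.range (2 * m + 1), w (p + i) = x ^ (m + 1) * y ^ m := by
  induction m with
  | zero => simpa using hx p (by omega) (by omega) (by simp)
  | succ m ih =>
    rw [show 2 * (m + 1) + 1 = 2 * m + 1 + 1 + 1 by ring, Finset.prod_range_succ,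
      Finset.prod_range_succ, ih (fun i h1 h2 => hx i h1 (by omega))
        (fun i h1 h2 => hy i h1 (by omega)),
      hy _ (by omega) (by omega) (by rw [show p + (2 * m + 1) + p = 2 * (p + m) + 1 by ring]; simp),
      hx _ (by omega) (by omega)
        (by rw [show p + (2 * m + 1 + 1) + p = 2 * (p + m + 1) by ring]; simp)]
    ring

theorem lassoCount_split (ℓ n : ℕ) : lassoCount lam rho ℓ (ℓ + 1 + n) =
    (∏ i ∈ Finset.range ℓ, (nodePoly lam rho ℓ i).eval 1) * (nodePoly lam rho ℓ ℓ).eval 1 *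
      ∏ i ∈ Finset.range n, (nodePoly lam rho ℓ (ℓ + 1 + i)).eval 1 := by
  rw [lassoCount, Finset.prod_range_add, Finset.prod_range_succ]

theorem nodePoly_even {ℓ i : ℕ} (h0 : i ≠ 0) (hℓ : i ≠ ℓ) (h : Even i) :
    nodePoly lam rho ℓ i = lam.derivative := by
  simp [nodePoly, h0, hℓ, h]

theorem nodePoly_odd {ℓ i : ℕ} (hℓ : i ≠ ℓ) (h : ¬ Even i) :
    nodePoly lam rho ℓ i = rho.derivative := by
  have : i ≠ 0 := by rintro rfl; simp at h
  simp [nodePoly, this, hℓ, h]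

/-- The chain of a cycle that starts at a variable node. -/
theorem prod_chain_of_even {ℓ : ℕ} (hℓ : Even ℓ) (s : ℕ) :
    ∏ i ∈ Finset.range (2 * s + 1), (nodePoly lam rho ℓ (ℓ + 1 + i)).eval 1 =
      rho.derivative.eval 1 ^ (s + 1) * lam.derivative.eval 1 ^ s := by
  apply prod_alternating (p := ℓ + 1) (w := fun i => (nodePoly lam rho ℓ i).eval 1)
  · intro i h1 h2 h3
    have : ¬ Even i := by
      rw [Nat.even_add, Nat.even_add_one] at h3; tauto
    simp only [nodePoly_odd (lam := lam) (rho := rho) (show i ≠ ℓ by omega) this]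
  · intro i h1 h2 h3
    have : Even i := by
      rw [Nat.even_add, Nat.even_add_one] at h3; tauto
    simp only [nodePoly_even (lam := lam) (rho := rho) (by omega) (show i ≠ ℓ by omega) this]

/-- The chain of a cycle that starts at a check node. -/
theorem prod_chain_of_odd {ℓ : ℕ} (hℓ : ¬ Even ℓ) (s : ℕ) :
    ∏ i ∈ Finset.range (2 * s + 1), (nodePoly lam rho ℓ (ℓ + 1 + i)).eval 1 =
      lam.derivative.eval 1 ^ (s + 1) * rho.derivative.eval 1 ^ s := by
  apply prod_alternating (p := ℓ + 1) (w := fun i => (nodePoly lam rho ℓ i).eval 1)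
  · intro i h1 h2 h3
    have : Even i := by
      rw [Nat.even_add, Nat.even_add_one] at h3; tauto
    simp only [nodePoly_even (lam := lam) (rho := rho) (by omega) (show i ≠ ℓ by omega) this]
  · intro i h1 h2 h3
    have : ¬ Even i := by
      rw [Nat.even_add, Nat.even_add_one] at h3; tauto
    simp only [nodePoly_odd (lam := lam) (rho := rho) (show i ≠ ℓ by omega) this]

theorem lassoCount_V (h1 : lam.eval 1 = 1) (a s : ℕ) :
    lassoCount lam rho (2 * (a + 1)) (2 * (a + 1) + 1 + (2 * s + 1)) =
      lam.derivative.derivative.eval 1 * rho.derivative.eval 1 ^ 2 *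
        (lam.derivative.eval 1 * rho.derivative.eval 1) ^ (a + s) := by
  rw [lassoCount_split, prod_chain_of_even (by simp), show 2 * (a + 1) = 2 * a + 1 + 1 by ring,
    Finset.prod_range_succ']
  have := prod_alternating (rho.derivative.eval 1) (lam.derivative.eval 1) (p := 1) a
    (w := fun i => (nodePoly lam rho (2 * a + 1 + 1) i).eval 1)
    (fun i h1 h2 h3 => by
      have : ¬ Even i := by simpa [Nat.even_add_one] using h3
      simp only [nodePoly_odd (lam := lam) (rho := rho) (show i ≠ 2 * a + 1 + 1 by omega) this])
    (fun i h1 h2 h3 => by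
      have : Even i := by simpa [Nat.even_add_one] using h3
      simp only [nodePoly_even (lam := lam) (rho := rho) (by omega)
        (show i ≠ 2 * a + 1 + 1 by omega) this])
  simp only [add_comm 1] at this
  rw [this]
  have e : Even (2 * a + 1 + 1) := by simp [parity_simps]
  simp only [nodePoly, e]
  simp [h1]
  ring

theorem lassoCount_C (h1 : lam.eval 1 = 1) (a s : ℕ) :
    lassoCount lam rho (2 * a + 1) (2 * a + 1 + 1 + (2 * s + 1)) =
      rho.derivative.derivative.eval 1 * lam.derivative.eval 1 *
        (lam.derivative.eval 1 * rho.derivative.eval 1) ^ (a + s) := by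
  rw [lassoCount_split, prod_chain_of_odd (by simp)]
  have e : ¬ Even (2 * a + 1) := by simp
  have : ∏ i ∈ Finset.range (2 * a + 1), (nodePoly lam rho (2 * a + 1) i).eval 1 =
      (lam.derivative.eval 1 * rho.derivative.eval 1) ^ a := by
    cases a with
    | zero => simp [nodePoly, h1]
    | succ a =>
      rw [show 2 * (a + 1) = 2 * a + 1 + 1 by ring, Finset.prod_range_succ, Finset.prod_range_succ']
      have := prod_alternating (rho.derivative.eval 1) (lam.derivative.eval 1) (p := 1) a
        (w := fun i => (nodePoly lam rho (2 * a + 1 + 1 + 1) i).eval 1)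
        (fun i h1 h2 h3 => by
          have : ¬ Even i := by simpa [Nat.even_add_one] using h3
          simp only [nodePoly_odd (lam := lam) (rho := rho) (show i ≠ 2 * a + 1 + 1 + 1 by omega)
            this])
        (fun i h1 h2 h3 => by
          have : Even i := by simpa [Nat.even_add_one] using h3
          simp only [nodePoly_even (lam := lam) (rho := rho) (by omega)
            (show i ≠ 2 * a + 1 + 1 + 1 by omega) this])
      simp only [add_comm 1] at this
      have h0 : nodePoly lam rho (2 * a + 1 + 1 + 1) 0 = lam := by simp [nodePoly]
      rw [this, nodePoly_even (by omega) (by omega)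
        (show Even (2 * a + 1 + 1) by simp [parity_simps]), h0, h1]
      ring
  rw [this]
  simp only [nodePoly, e]
  simp
  ring

theorem lassoCount_R (s : ℕ) : lassoCount lam rho 0 (0 + 1 + (2 * s + 1)) =
    (lam.derivative.eval 1 * rho.derivative.eval 1) ^ (s + 1) := by
  rw [lassoCount_split, prod_chain_of_even (by simp)]
  simp [nodePoly]
  ring

/-- `0 ≤ lassoMsg ≤ 1`. -/
theorem lassoMsg_mem (n ℓ : ℕ) : ∀ {α : ℕ → ℕ → ℝ} (_ : Admissible α) (j : ℕ),
    0 ≤ lassoMsg n ℓ α j ∧ lassoMsg n ℓ α j ≤ 1 := by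
  induction ℓ with
  | zero =>
    intro α h j
    have h1 := chain_blank_zero_or_one n (h.comp (fun i => i + 1)) (j - 1)
    have h2 := chain_blank_zero_or_one n (h.comp (fun i => n - 1 - i + 1)) (j - 1)
    rcases h.1 0 j with h0 | h0 <;> rcases h1 with h1 | h1 <;> rcases h2 with h2 | h2 <;>
      simp [lassoMsg, loop, h0, h1, h2]
  | succ ℓ ih =>
    intro α h j
    have h1 := ih (h.comp (fun i => i + 1)) (j - 1)
    rcases h.1 0 j with h0 | h0
    · simp [lassoMsg, h0]
    · simp [lassoMsg, h0, h1]

variable {r : ℕ} {E : ℕ → ((ℕ → ℕ → ℝ) → ℝ) →ₗ[ℝ] ℝ} {c : ℝ} {μ : ℕ → ℕ → ℝ}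

theorem ProductLimit.tendsto_lassoMsg_zero (H : ProductLimit r E 0 μ) (n ℓ j : ℕ) :
    Tendsto (fun k => E k (fun α => lassoMsg n ℓ α j)) atTop (𝓝 0) := by
  have h1 : Tendsto (fun k => E k (fun _ => 1)) atTop (𝓝 0) := by
    simpa using (H.hasMean_one (Q := ∅)).tendsto
  refine tendsto_of_tendsto_of_tendsto_of_le_of_le tendsto_const_nhds h1 (fun k => ?_) fun k => ?_
  · have := H.mono k 0 (fun α => lassoMsg n ℓ α j) fun α hα => (lassoMsg_mem n ℓ hα j).1
    simpa using this
  · exact H.mono k (fun α => lassoMsg n ℓ α j) _ fun α hα => (lassoMsg_mem n ℓ hα j).2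

theorem nodeMean_zero {ℓ : ℕ} (h1 : lam.eval 1 = 1) (hℓ : ℓ ≠ 0) (t : ℕ) :
    nodeMean lam rho ε ℓ 0 (2 * t) = deQ lam rho ε (t + 1) := by
  simp [nodeMean, nodePoly, hℓ.symm, density_even_odd, h1, deQ]

theorem ProductLimit.tendsto_Fv {t s₁ s₂ : ℕ} (h₁ : 1 ≤ s₁) (h₂ : 2 * s₁ + 1 ≤ s₂)
    (h₃ : s₂ ≤ 2 * t) (h1 : lam.eval 1 = 1)
    (hlam : lam.derivative.eval 1 = 0 → lam.derivative.derivative.eval 1 = 0)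
    (hr : r = 2 * s₁ + 2 * (s₂ - 2 * s₁))
    (H : ProductLimit r E (lassoCount lam rho (2 * s₁) r) (nodeMean lam rho ε (2 * s₁))) :
    Tendsto (fun k => 1 / 2 * E k (fun α => lassoMsg (2 * (s₂ - 2 * s₁) - 1) (2 * s₁) α (2 * t)))
      atTop (𝓝 (Fv lam rho ε t s₁ s₂)) := by
  obtain ⟨a, rfl⟩ : ∃ a, s₁ = a + 1 := ⟨s₁ - 1, by omega⟩
  obtain ⟨s, rfl⟩ : ∃ s, s₂ = 2 * (a + 1) + (s + 1) := ⟨s₂ - 2 * (a + 1) - 1, by omega⟩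
  obtain ⟨τ, rfl⟩ : ∃ τ, t = τ + 1 := ⟨t - 1, by omega⟩
  obtain rfl : r = 2 * (a + 1) + 1 + (2 * s + 1) := by omega
  rw [lassoCount_V h1] at H
  rw [show 2 * (2 * (a + 1) + (s + 1) - 2 * (a + 1)) - 1 = 2 * s + 1 by omega]
  by_cases hl2 : lam.derivative.derivative.eval 1 = 0
  · rw [Fv, if_pos hl2]
    rw [hl2] at H
    simp only [zero_mul] at H
    simpa only [mul_zero] using
      (H.tendsto_lassoMsg_zero (2 * s + 1) (2 * (a + 1)) (2 * (τ + 1))).const_mul (1 / 2)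
  · obtain ⟨T, hT⟩ : ∃ T, τ + 1 - (a + 1) = T + 1 := ⟨τ - a - 1, by omega⟩
    have e2 : Even (2 * (a + 1)) := by simp
    have hloop := (H.hasMean_loop (fun h => hl2 (hlam h)) s T (2 * (a + 1) + 1) (by omega)).1
      (by omega) fun i hi hi' j hj => nodeMean_eq_passProb (by omega) (by omega) (by
        rw [show j + (i - (2 * (a + 1) + 1)) + 1 = j + i - 2 * (a + 1) by omega,
          Nat.even_sub (by omega)] at hj
        simpa using hj)
    have := (H.hasMean_lassoMsg (2 * s + 1) (v := G₁ lam rho ε (T + 1) s) (2 * (a + 1)) 0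
      (2 * (τ + 1)) (by omega) (by
        simp only [zero_add]
        rwa [show 2 * (τ + 1) - 2 * (a + 1) - 1 = 2 * T + 1 by omega])).tendsto
    simp only [zero_add] at this
    convert this.const_mul (1 / 2) using 2
    rw [show 2 * (a + 1) = 2 * a + 1 + 1 by ring, pathVal, zero_add,
      show 2 * (τ + 1) - 1 = 2 * τ + 1 by omega,
      pathVal_eq_g (lam := lam) (rho := rho) (ε := ε) 1 a (by omega) (by simp)
        (fun i hi hi' j hj => nodeMean_eq_passProb (by omega) (by omega) hj),
      nodeMean_zero h1 (by omega), Fv, if_neg hl2]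
    simp only [pathVal]
    rw [nodeMean_eq_passProb (by omega) (by omega) (by simp [parity_simps]), passProb_odd,
      show 2 * (τ - a) + 1 - 1 = 2 * (T + 1) by omega, show 1 + 2 * a + 1 = 2 * a + 1 + 1 by ring]
    have e3 : Even (2 * a + 1 + 1) := by simp [parity_simps]
    simp only [nodeMean, nodePoly, e3]
    simp only [if_true, if_neg (show 2 * a + 1 + 1 ≠ 0 by omega), decide_true, density_even_odd,
      Function.iterate_succ, Function.comp_apply, Function.iterate_zero, id_eq,
      Nat.add_sub_cancel, hT, show 2 * a + 1 + 1 + (s + 1) - (a + 1) - 2 = a + s by omega,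
      show 2 * a + 1 + 1 + (s + 1) - 2 * (a + 1) - 1 = s by omega,
      show τ - a + 1 = T + 1 + 1 by omega]
    ring

theorem ProductLimit.tendsto_Fc {t s₁ s₂ : ℕ} (h₂ : 2 * s₁ + 2 ≤ s₂)
    (h₃ : s₂ ≤ 2 * t) (h1 : lam.eval 1 = 1)
    (hr : r = 2 * s₁ + 1 + 2 * (s₂ - (2 * s₁ + 1)))
    (H : ProductLimit r E (lassoCount lam rho (2 * s₁ + 1) r)
      (nodeMean lam rho ε (2 * s₁ + 1))) :
    Tendsto (fun k => 1 / 2 *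
      E k (fun α => lassoMsg (2 * (s₂ - (2 * s₁ + 1)) - 1) (2 * s₁ + 1) α (2 * t)))
      atTop (𝓝 (Fc lam rho ε t s₁ s₂)) := by
  obtain ⟨s, rfl⟩ : ∃ s, s₂ = 2 * s₁ + 1 + (s + 1) := ⟨s₂ - 2 * s₁ - 2, by omega⟩
  obtain ⟨τ, rfl⟩ : ∃ τ, t = τ + 1 := ⟨t - 1, by omega⟩
  obtain rfl : r = 2 * s₁ + 1 + 1 + (2 * s + 1) := by omega
  rw [lassoCount_C h1] at H
  rw [show 2 * (2 * s₁ + 1 + (s + 1) - (2 * s₁ + 1)) - 1 = 2 * s + 1 by omega]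
  by_cases hl2 : lam.derivative.eval 1 = 0
  · rw [Fc, hl2]
    rw [hl2] at H
    simp only [zero_mul, mul_zero] at H ⊢
    simpa only [mul_zero] using
      (H.tendsto_lassoMsg_zero (2 * s + 1) (2 * s₁ + 1) (2 * (τ + 1))).const_mul (1 / 2)
  · have hloop := (H.hasMean_loop_even hl2 s (τ - s₁) (2 * s₁ + 1 + 1) (by omega)
      (by omega) fun i hi hi' j hj => nodeMean_eq_passProb (by omega) (by omega) (by
        rw [show j + (i - (2 * s₁ + 1 + 1)) = j + i - 2 * (s₁ + 1) by omega,
          Nat.even_sub (by omega)] at hj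
        simpa using hj))
    have := (H.hasMean_lassoMsg (2 * s + 1) (v := G₃ lam rho ε (τ - s₁) s) (2 * s₁ + 1) 0
      (2 * (τ + 1)) (by omega) (by
        simp only [zero_add]
        rwa [show 2 * (τ + 1) - (2 * s₁ + 1) - 1 = 2 * (τ - s₁) by omega])).tendsto
    simp only [zero_add] at this
    convert this.const_mul (1 / 2) using 2
    rw [pathVal, zero_add, show 2 * (τ + 1) - 1 = 2 * τ + 1 by omega,
      ← add_zero (2 * s₁), pathVal_eq_g (lam := lam) (rho := rho) (ε := ε) 0 s₁ (by omega) (by simp)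
        (fun i hi hi' j hj => nodeMean_eq_passProb (by omega) (by omega) hj),
      nodeMean_zero h1 (by omega), Fc]
    simp only [pathVal, add_zero]
    have e3 : ¬ Even (2 * s₁ + 1) := by simp
    rw [show 1 + 2 * s₁ = 2 * s₁ + 1 by ring]
    simp only [nodeMean, nodePoly, e3]
    simp only [if_true, if_false, if_neg (show 2 * s₁ + 1 ≠ 0 by omega), decide_false,
      density_even_odd,
      Function.iterate_succ, Function.comp_apply, Function.iterate_zero, id_eq, one_mul,
      Nat.add_sub_cancel, show 2 * s₁ + 1 + (s + 1) - s₁ - 2 = s₁ + s by omega,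
      show 2 * s₁ + 1 + (s + 1) - 2 * s₁ - 2 = s by omega,
      show τ + 1 - s₁ = τ - s₁ + 1 by omega]
    ring

theorem ProductLimit.tendsto_Fr {t s : ℕ} (h₂ : 1 ≤ s) (h₃ : s ≤ 2 * t) (hr : r = 0 + 2 * s)
    (H : ProductLimit r E (lassoCount lam rho 0 r) (nodeMean lam rho ε 0)) :
    Tendsto (fun k => 1 / 2 * E k (fun α => lassoMsg (2 * s - 1) 0 α (2 * t)))
      atTop (𝓝 (Fr lam rho ε t s)) := by
  obtain ⟨s, rfl⟩ : ∃ s', s = s' + 1 := ⟨s - 1, by omega⟩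
  obtain ⟨τ, rfl⟩ : ∃ τ, t = τ + 1 := ⟨t - 1, by omega⟩
  obtain rfl : r = 0 + 1 + (2 * s + 1) := by omega
  rw [lassoCount_R] at H
  rw [show 2 * (s + 1) - 1 = 2 * s + 1 by omega]
  by_cases hl2 : lam.derivative.eval 1 = 0
  · rw [Fr, hl2]
    rw [hl2] at H
    simp only [zero_mul, ne_eq, Nat.succ_ne_zero, not_false_eq_true, zero_pow, mul_zero] at H ⊢
    simpa only [mul_zero] using
      (H.tendsto_lassoMsg_zero (2 * s + 1) 0 (2 * (τ + 1))).const_mul (1 / 2)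
  · have hloop := (H.hasMean_loop hl2 s τ (0 + 1) (by omega)).1
      (by omega) fun i hi hi' j hj => nodeMean_eq_passProb (by omega) (by omega) (by
        rwa [show j + (i - (0 + 1)) + 1 = j + i by omega] at hj)
    have := (H.hasMean_lassoMsg (2 * s + 1) (v := G₁ lam rho ε (τ + 1) s) 0 0
      (2 * (τ + 1)) (by omega) (by
        rwa [show 2 * (τ + 1) - 0 - 1 = 2 * τ + 1 by omega])).tendsto
    simp only [zero_add] at this
    convert this.const_mul (1 / 2) using 2
    rw [pathVal, Fr, ratioV, nodeMean, nodePoly, Nat.add_sub_cancel]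
    simp [density_even_odd]
    ring

end

end

/-! ### Belief propagation on a lasso, deterministically -/

section

/-- The equations of belief propagation on a lasso with `r` edges, where the `i`-th edge joins the
nodes `i` and `i + 1`, and the last edge joins the nodes `r - 1` and `ℓ`. Here `X i` and `Y i` are
the messages along the `i`-th edge to its first and to its second end, and the node variable
`α i` collects the messages to the node `i` from outside the lasso. -/
structure LassoEqs (r ℓ : ℕ) (α X Y : ℕ → ℕ → ℝ) : Prop where
  adm : Admissible α
  admX : Admissible X
  admY : Admissible Y
  X_zero : ∀ i, X i 0 = 1
  Y_zero : ∀ i, Y i 0 = 1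
  X_succ : ∀ i j, i + 1 < r → i + 1 ≠ ℓ → X i (j + 1) = 1 - α (i + 1) j * X (i + 1) j
  X_meet : ∀ i j, i + 1 = ℓ → X i (j + 1) = 1 - α ℓ j * (X ℓ j * Y (r - 1) j)
  X_last : ∀ j, X (r - 1) (j + 1) = 1 - α ℓ j * (X ℓ j * if ℓ = 0 then 1 else Y (ℓ - 1) j)
  Y_succ : ∀ i j, i + 1 < r → i + 1 ≠ ℓ → Y (i + 1) (j + 1) = 1 - α (i + 1) j * Y i j
  Y_zero_succ : ∀ j, ℓ ≠ 0 → Y 0 (j + 1) = 1 - α 0 j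
  Y_meet : ∀ j, Y ℓ (j + 1) = 1 - α ℓ j * (Y (r - 1) j * if ℓ = 0 then 1 else Y (ℓ - 1) j)

theorem Admissible.even_le {α : ℕ → ℕ → ℝ} (h : Admissible α) {i j j' : ℕ} (he : Even j)
    (he' : Even j') (hle : j' ≤ j) : α i j ≤ α i j' := by
  rcases h.1 i j with h1 | h1
  · rw [h1]; exact h.nonneg _ _
  · rw [h1, h.eq_one_of_le he he' hle h1]

/-- A node on a cycle whose messages into the cycle depend, among what it receives from the cycle,
only on the message from the other end, may feed blank messages into the cycle instead: if it
ever recovers, then it keeps its information. -/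
theorem eq_chain_blank_of_feedback {n J : ℕ} (hn : ¬ Even n) {β : ℕ → ℕ → ℝ} (hβ : Admissible β)
    {φ Z : ℕ → ℝ} (hZ : ∀ j, Z j = 0 ∨ Z j = 1) (hZa : Admissible (fun (_ : ℕ) => Z))
    (hZ0 : Z 0 = 1) (hZs : ∀ j, Z (j + 1) = 1 - chain φ n β j) (hφ : ∀ j, Even j → j ≤ J → φ j = Z j) :
    ∀ j, Even (j + 1) → j + 1 ≤ J → Z (j + 1) = 1 - chain blank n β j := by
  intro j
  induction j using Nat.strong_induction_on with
  | _ j ih =>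
    intro he hJ
    rw [hZs]
    by_cases hnj : n ≤ j
    · obtain ⟨i, rfl⟩ : ∃ i, j = i + n := ⟨j - n, by omega⟩
      have hi : Even i := by
        rw [add_assoc, Nat.even_add, Nat.even_add_one] at he; tauto
      have hn0 : n ≠ 0 := by rintro rfl; simp at hn
      rcases hZ i with h0 | h1
      · -- the node has recovered by time `i`
        obtain ⟨i, rfl⟩ : ∃ i', i = i' + 1 := ⟨i - 1, by
          rcases i with _ | i
          · rw [hZ0] at h0; norm_num at h0
          · omega⟩
        have h2 := ih i (by omega) hi (by omega)
        have h3 := hZa.even_le (i := 0) he hi (by omega : i + 1 ≤ i + 1 + n + 1)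
        rw [hZs (i + 1 + n)] at h3
        have h4 : 1 - chain blank n β (i + 1 + n) ≤ 1 - chain blank n β i := by
          obtain ⟨c, hc⟩ : ∃ c, n + 1 = 2 * c := by
            obtain ⟨c, hc⟩ := Nat.not_even_iff_odd.1 hn
            exact ⟨c + 1, by omega⟩
          have hi' : ¬ Even i := by simpa [Nat.even_add_one] using hi
          rw [show i + 1 + n = i + 2 * c by omega]
          clear * - hβ hi'
          induction c with
          | zero => simp
          | succ c ih =>
            have := (chain_blank_mono n hβ (i + 2 * c)).2 (by simpa [parity_simps] using hi')
            rw [show i + 2 * (c + 1) = i + 2 * c + 2 by ring]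
            linarith
        have h5 := chain_blank_zero_or_one n hβ (i + 1 + n)
        have h6 := hZ (i + 1 + n + 1)
        rw [hZs] at h6
        rcases h5 with h5 | h5 <;> rcases h6 with h6 | h6 <;> linarith
      · rw [chain_congr n β (i + n) (ψ := blank) fun _ => by
          rw [Nat.add_sub_cancel, hφ i hi (by omega), h1]; simp [blank, hi]]
    · rw [chain_congr n β j (ψ := blank) fun h => absurd h hnj]

namespace LassoEqs

variable {r ℓ n : ℕ} {α X Y : ℕ → ℕ → ℝ}

theorem X_eq_chain (H : LassoEqs r ℓ α X Y) (m : ℕ) : ∀ i j : ℕ, i + 1 + m = r → ℓ ≤ i →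
    X i (j + 1) = 1 - chain (fun j => α ℓ j * (X ℓ j * if ℓ = 0 then 1 else Y (ℓ - 1) j)) m
      (fun a => α (i + 1 + a)) j := by
  induction m with
  | zero =>
    rintro i j rfl h
    exact H.X_last j
  | succ m ih =>
    intro i j hr hi
    rw [H.X_succ i j (by omega) (by omega)]
    cases j with
    | zero => simp [chain, H.X_zero]
    | succ j =>
      rw [ih (i + 1) j (by omega) (by omega), chain]
      simp only [add_zero, add_assoc, add_comm 1]

theorem Y_eq_chain (H : LassoEqs r ℓ α X Y) (m : ℕ) : ∀ j : ℕ, ℓ + m < r →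
    Y (ℓ + m) (j + 1) = 1 - chain (fun j => α ℓ j * (Y (r - 1) j * if ℓ = 0 then 1 else Y (ℓ - 1) j))
      m (fun a => α (ℓ + m - a)) j := by
  induction m with
  | zero =>
    intro j _
    exact H.Y_meet j
  | succ m ih =>
    intro j hr
    rw [← add_assoc, H.Y_succ _ j (by omega) (by omega)]
    cases j with
    | zero => simp [chain, H.Y_zero]
    | succ j =>
      rw [ih j (by omega), chain]
      simp

/-- If the variable nodes of the path to the cycle are blocked from recovery by everything outside
the lasso, then only blank messages are sent down the path. -/
theorem Y_eq_blank (H : LassoEqs r ℓ α X Y) {J : ℕ} (hJ : Even J) (hℓr : ℓ < r)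
    (h : ∀ i < ℓ, Even i → α i (J - i) = 1) (hℓJ : ℓ ≤ J) :
    ∀ i < ℓ, ∀ j, Even (j + i + 1) → j + i + 1 ≤ J → Y i j = blank j := by
  intro i
  induction i with
  | zero =>
    intro h0 j hj hjJ
    cases j with
    | zero => simp at hj
    | succ j =>
      have hj' : Even j := by
        rwa [add_zero, add_assoc, Nat.even_add, iff_true_right (by decide)] at hj
      rw [H.Y_zero_succ j (by omega), H.adm.eq_one_of_le (j := J) hJ hj' (by omega)
        (by simpa using h 0 h0 (by simp))]
      simp [blank, Nat.even_add_one, hj']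
  | succ i ih =>
    intro h0 j hj hjJ
    cases j with
    | zero => simp [H.Y_zero, blank]
    | succ j =>
      rw [H.Y_succ i j (by omega) (by omega)]
      have hj' : Even (j + i + 1) := by
        rw [show j + 1 + (i + 1) + 1 = j + i + 1 + 2 by ring] at hj
        rwa [Nat.even_add, iff_true_right (by decide)] at hj
      rw [ih (by omega) j hj' (by omega), blank_succ]
      by_cases he : Even j
      · have hi : Even (i + 1) := (Nat.even_add.1 (by rwa [add_assoc] at hj')).1 he
        have : Even (J - (i + 1)) := (Nat.even_sub (by omega)).2 (by simp [hJ, hi])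
        rw [H.adm.eq_one_of_le this he (by omega) (h (i + 1) h0 hi)]
        simp
      · simp [blank, he]

theorem meet_eq (H : LassoEqs r ℓ α X Y) (hn : ¬ Even n) (hr : r = ℓ + 1 + n) {J : ℕ} (hJ : Even J)
    (h : ∀ i < ℓ, Even i → α i (J - i) = 1) {j : ℕ} (hℓJ : ℓ + 1 + j = J) :
    α ℓ (j + 1) * (X ℓ (j + 1) * Y (r - 1) (j + 1)) =
      α ℓ (j + 1) * loop n (fun i => α (ℓ + 1 + i)) j := by
  have hX : ∀ j, X ℓ (j + 1) = _ := fun j => H.X_eq_chain n ℓ j hr.symm le_rfl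
  have hY : ∀ j, Y (r - 1) (j + 1) = 1 - chain (fun j => α ℓ j * (Y (r - 1) j *
      if ℓ = 0 then 1 else Y (ℓ - 1) j)) n (fun i => α (ℓ + 1 + (n - 1 - i))) j := by
    intro j
    have := H.Y_eq_chain n j (by omega)
    rw [show ℓ + n = r - 1 by omega] at this
    rw [this]
    congr 1
    apply chain_congr_left
    intro i hi
    congr 1
    omega
  have hpar : ∀ i, Even (i + ℓ) → i ≤ j + 1 → (if ℓ = 0 then 1 else Y (ℓ - 1) i) = blank i := by
    intro i hi hij
    split_ifs with h0
    · subst h0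
      simp only [add_zero] at hi
      simp [blank, hi]
    · exact H.Y_eq_blank hJ (by omega) h (by omega) (ℓ - 1) (by omega) i
        (by rwa [show i + (ℓ - 1) + 1 = i + ℓ by omega]) (by omega)
  have hjℓ : Even (j + 1 + ℓ) := by rwa [show j + 1 + ℓ = J by omega]
  by_cases he : Even ℓ
  · have hj1 : Even (j + 1) := (Nat.even_add.1 hjℓ).2 he
    rcases H.adm.1 ℓ (j + 1) with h0 | h1
    · simp [h0]
    · have hfb : ∀ i, Even i → i ≤ j + 1 →
          α ℓ i = 1 ∧ (if ℓ = 0 then 1 else Y (ℓ - 1) i) = 1 := fun i hi hij =>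
        ⟨H.adm.eq_one_of_le hj1 hi hij h1, by rw [hpar i (hi.add he) hij]; simp [blank, hi]⟩
      rw [eq_chain_blank_of_feedback (J := j + 1) hn (H.adm.comp (fun i => ℓ + 1 + i)) (H.admX.1 ℓ)
          (H.admX.comp (fun _ => ℓ))
          (H.X_zero ℓ) hX (fun i hi hij => by simp [hfb i hi hij]) j hj1 le_rfl,
        eq_chain_blank_of_feedback (J := j + 1) hn
          (H.adm.comp (fun i => ℓ + 1 + (n - 1 - i))) (H.admY.1 (r - 1))
          (H.admY.comp (fun _ => r - 1))
          (H.Y_zero (r - 1)) hY (fun i hi hij => by simp [hfb i hi hij]) j hj1 le_rfl, loop]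
  · have key : n ≤ j → (if ℓ = 0 then 1 else Y (ℓ - 1) (j - n)) = 0 ∧ blank (j - n) = 0 := by
      intro hnj
      obtain ⟨i, rfl⟩ : ∃ i, j = i + n := ⟨j - n, by omega⟩
      have hi : Even (i + ℓ) := by
        rw [Nat.even_add, Nat.even_add_one, Nat.even_add] at hjℓ
        rw [Nat.even_add]; tauto
      have hi' : ¬ Even i := fun h => he ((Nat.even_add.1 hi).1 h)
      rw [Nat.add_sub_cancel, hpar i hi (by omega)]
      simp [blank, hi']
    rw [hX, hY, loop,
      chain_congr (φ := fun j => α ℓ j * (X ℓ j * if ℓ = 0 then 1 else Y (ℓ - 1) j)) n _ j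
        (ψ := blank) fun hnj => by simp [key hnj],
      chain_congr (φ := fun j => α ℓ j * (Y (r - 1) j * if ℓ = 0 then 1 else Y (ℓ - 1) j)) n _ j
        (ψ := blank) fun hnj => by simp [key hnj]]

/-- The message of a lasso: every message that runs down the path may be taken to be blank. -/
theorem root_eq (H : LassoEqs r ℓ α X Y) (hn : ¬ Even n) (hr : r = ℓ + 1 + n) {J : ℕ} (hJ : Even J)
    (hℓJ : ℓ < J) :
    (if ℓ = 0 then α 0 J * (X 0 J * Y (r - 1) J) else α 0 J * X 0 J) = lassoMsg n ℓ α J := by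
  set U : ℕ → ℕ → ℝ := fun i j =>
    if i = ℓ then α i j * (X i j * Y (r - 1) j) else α i j * X i j with hU
  have hprop : ∀ i ≤ ℓ, U i (J - i) = lassoMsg n (ℓ - i) (fun a => α (i + a)) (J - i) →
      U 0 J = lassoMsg n ℓ α J := by
    intro i
    induction i with
    | zero => intro _ h; simpa using h
    | succ i ih =>
      intro hi h
      apply ih (by omega)
      obtain ⟨j, hj⟩ : ∃ j, J - i = j + 1 := ⟨J - i - 1, by omega⟩
      rw [show J - (i + 1) = j by omega] at h
      rw [show ℓ - i = ℓ - (i + 1) + 1 by omega, lassoMsg, hj, Nat.add_sub_cancel]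
      simp only [add_zero, ← add_assoc, add_right_comm i _ 1]
      rw [← h]
      simp only [hU]
      rw [if_neg (by omega)]
      split_ifs with h1
      · rw [H.X_meet i j h1, h1]
      · rw [H.X_succ i j (by omega) h1]
  have h0 : U 0 J = lassoMsg n ℓ α J := by
    by_cases hall : ∀ i < ℓ, Even i → α i (J - i) = 1
    · apply hprop ℓ le_rfl
      obtain ⟨j, hj⟩ : ∃ j, J - ℓ = j + 1 := ⟨J - ℓ - 1, by omega⟩
      simp only [hU, if_true]
      rw [hj, H.meet_eq hn hr hJ hall (by omega), Nat.sub_self, lassoMsg]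
      simp only [add_zero, Nat.add_sub_cancel, add_assoc, add_comm 1]
    · push Not at hall
      obtain ⟨i, hi, _, hi1⟩ := hall
      have hi0 : α i (J - i) = 0 := (H.adm.1 _ _).resolve_right hi1
      apply hprop i hi.le
      obtain ⟨m, hm⟩ : ∃ m, ℓ - i = m + 1 := ⟨ℓ - i - 1, by omega⟩
      simp only [hU, if_neg hi.ne]
      rw [hm, lassoMsg, add_zero, hi0]
      simp
  rw [← h0]
  simp only [hU, eq_comm (a := ℓ)]

end LassoEqs

end

namespace Sockets

/-! ### Sockets of both sides, messages, and lassos in Tanner graphs -/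

section

variable (S : Sockets)

/-- A half-edge: a socket of a node of either side. -/
abbrev Half := S.VSocket ⊕ S.CSocket

variable {S}

/-- the node of a half-edge -/
def nd (h : S.Half) : S.Node := h.map Sigma.fst Sigma.fst

/-- the half-edge joined to a given one in the Tanner graph `T` -/
def mate (T : S.TannerGraph) : S.Half → S.Half :=
  Sum.elim (fun s => Sum.inr (T s)) (fun s => Sum.inl (T.symm s))

/-- `1` if the channel output of the variable node `x` is erased, that is, `x ∈ A`, or if `x` is a
check node -/
def opn (A : Finset (Fin S.n)) : S.Node → ℝ :=
  Sum.elim (fun v => if v ∈ A then 1 else 0) (fun _ => 1)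

/-- Belief propagation in half-iterations: the message that arrives at the half-edge `h`. Into a
variable node (at even times) `1` stands for an erasure, into a check node (at odd times) `1`
stands for a known bit. So a node sends `1` along a half-edge iff it is open and receives `1` on
all its other half-edges, and what it sends arrives negated at the other end. -/
def msg (T : S.TannerGraph) (A : Finset (Fin S.n)) : ℕ → S.Half → ℝ
  | 0, _ => 1
  | j + 1, h => 1 - opn A (nd (mate T h)) *
      ∏ h' with nd h' = nd (mate T h) ∧ h' ≠ mate T h, msg T A j h'

theorem mate_mate (T : S.TannerGraph) (h : S.Half) : mate T (mate T h) = h := by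
  rcases h with s | s <;> simp [mate]

theorem mate_injective (T : S.TannerGraph) : Function.Injective (mate T) :=
  Function.LeftInverse.injective (mate_mate T)

theorem isLeft_mate (T : S.TannerGraph) (h : S.Half) : (mate T h).isLeft = !h.isLeft := by
  rcases h with s | s <;> simp [mate]

theorem isLeft_nd (h : S.Half) : (nd h).isLeft = h.isLeft := by
  rcases h with s | s <;> rfl

theorem opn_zero_or_one (A : Finset (Fin S.n)) (x : S.Node) : opn A x = 0 ∨ opn A x = 1 := by
  rcases x with v | c
  · by_cases h : v ∈ A <;> simp [opn, h]
  · simp [opn]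

theorem prod_zero_or_one {ι : Type*} (s : Finset ι) (F : ι → ℝ) (h : ∀ i ∈ s, F i = 0 ∨ F i = 1) :
    ∏ i ∈ s, F i = 0 ∨ ∏ i ∈ s, F i = 1 := by
  by_cases h0 : ∃ i ∈ s, F i = 0
  · obtain ⟨i, hi, h0⟩ := h0
    exact Or.inl (Finset.prod_eq_zero hi h0)
  · push Not at h0
    exact Or.inr (Finset.prod_eq_one fun i hi => (h i hi).resolve_left (h0 i hi))

theorem msg_zero_or_one (T : S.TannerGraph) (A : Finset (Fin S.n)) (j : ℕ) :
    ∀ h, msg T A j h = 0 ∨ msg T A j h = 1 := by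
  induction j with
  | zero => intro h; exact Or.inr rfl
  | succ j ih =>
    intro h
    rw [msg]
    rcases opn_zero_or_one A (nd (mate T h)) with h1 | h1
    · simp [h1]
    · rcases prod_zero_or_one {h' | nd h' = nd (mate T h) ∧ h' ≠ mate T h} (msg T A j)
        (fun h _ => ih h) with h2 | h2 <;> simp [h1, h2]

theorem msg_nonneg (T : S.TannerGraph) (A : Finset (Fin S.n)) (j : ℕ) (h : S.Half) :
    0 ≤ msg T A j h := by
  rcases msg_zero_or_one T A j h with h | h <;> simp [h]

theorem msg_le_one (T : S.TannerGraph) (A : Finset (Fin S.n)) (j : ℕ) (h : S.Half) :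
    msg T A j h ≤ 1 := by
  rcases msg_zero_or_one T A j h with h | h <;> simp [h]

theorem opn_nonneg (A : Finset (Fin S.n)) (x : S.Node) : 0 ≤ opn A x := by
  rcases opn_zero_or_one A x with h | h <;> simp [h]

theorem opn_le_one (A : Finset (Fin S.n)) (x : S.Node) : opn A x ≤ 1 := by
  rcases opn_zero_or_one A x with h | h <;> simp [h]

theorem msg_add_one (T : S.TannerGraph) (A : Finset (Fin S.n)) (j : ℕ) (h : S.Half) :
    msg T A (j + 1) h = 1 - opn A (nd (mate T h)) *
      ∏ h' with nd h' = nd (mate T h) ∧ h' ≠ mate T h, msg T A j h' := rfl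

theorem msg_mono (T : S.TannerGraph) (A : Finset (Fin S.n)) (j : ℕ) :
    (Even j → ∀ h, msg T A (j + 2) h ≤ msg T A j h) ∧
    (¬ Even j → ∀ h, msg T A j h ≤ msg T A (j + 2) h) := by
  induction j with
  | zero => exact ⟨fun _ h => msg_le_one T A 2 h, fun h => absurd Even.zero h⟩
  | succ j ih =>
    constructor
    · intro hj h
      have hj' : ¬ Even j := by simpa [Nat.even_add_one] using hj
      rw [show j + 1 + 2 = j + 2 + 1 by ring, msg_add_one T A j, msg_add_one T A (j + 2)]
      have := Finset.prod_le_prod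
        (s := {h' | nd h' = nd (mate T h) ∧ h' ≠ mate T h}) (fun i _ => msg_nonneg T A j i)
        (fun i _ => ih.2 hj' i)
      linarith [mul_le_mul_of_nonneg_left this (opn_nonneg A (nd (mate T h)))]
    · intro hj h
      have hj' : Even j := by simpa [Nat.even_add_one] using hj
      rw [show j + 1 + 2 = j + 2 + 1 by ring, msg_add_one T A j, msg_add_one T A (j + 2)]
      have := Finset.prod_le_prod
        (s := {h' | nd h' = nd (mate T h) ∧ h' ≠ mate T h}) (fun i _ => msg_nonneg T A (j + 2) i)
        (fun i _ => ih.1 hj' i)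
      linarith [mul_le_mul_of_nonneg_left this (opn_nonneg A (nd (mate T h)))]

/-- The ends of the edges of a lasso with `r` edges whose cycle starts at the `ℓ`-th node: the
`i`-th edge leaves the `i`-th node by the half-edge `(i, false)` and enters the next node, which
is the `ℓ`-th one for the last edge, by `(i, true)`. This is the number of the node. -/
def endPos (r ℓ : ℕ) (a : Fin r × Bool) : ℕ :=
  if a.2 then (if a.1.1 + 1 < r then a.1.1 + 1 else ℓ) else a.1.1

/-- The half-edges `P` fit a lasso: they are distinct, belong to the same node iff they should,
and variable nodes and check nodes alternate, beginning with a variable node. -/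
structure IsLasso (r ℓ : ℕ) (P : Fin r × Bool → S.Half) : Prop where
  inj : Function.Injective P
  nd_eq_iff : ∀ a b, nd (P a) = nd (P b) ↔ endPos r ℓ a = endPos r ℓ b
  side : ∀ a, (P a).isLeft = decide (Even (endPos r ℓ a))

/-- The half-edges of a walk in `T` that leaves its nodes by `out`. -/
def walkEnds (T : S.TannerGraph) {r : ℕ} (out : Fin r → S.Half) (a : Fin r × Bool) : S.Half :=
  if a.2 then mate T (out a.1) else out a.1

open Classical in
/-- The node variable of the `i`-th node of a lasso: `1` iff the node is open and receives `1` at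
time `j` from everywhere outside the lasso. -/
def nodeVar (T : S.TannerGraph) (A : Finset (Fin S.n)) {r : ℕ} (P : Fin r × Bool → S.Half)
    (i j : ℕ) : ℝ :=
  if hi : i < r then opn A (nd (P (⟨i, hi⟩, false))) *
    ∏ h with nd h = nd (P (⟨i, hi⟩, false)) ∧ h ∉ Set.range P, msg T A j h
  else 1

theorem admissible_nodeVar (T : S.TannerGraph) (A : Finset (Fin S.n)) {r : ℕ}
    (P : Fin r × Bool → S.Half) : Admissible (nodeVar T A P) := by
  classical
  refine ⟨fun i j => ?_, fun i j hj => ?_, fun i j hj => ?_⟩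
  · rw [nodeVar]
    split_ifs with hi
    · rcases opn_zero_or_one A (nd (P (⟨i, hi⟩, false))) with h1 | h1
      · simp [h1]
      · rw [h1, one_mul]
        exact prod_zero_or_one _ _ fun h _ => msg_zero_or_one T A j h
    · exact Or.inr rfl
  · simp only [nodeVar]
    split_ifs with hi
    · exact mul_le_mul_of_nonneg_left (Finset.prod_le_prod (fun i _ => msg_nonneg T A _ i)
        (fun i _ => (msg_mono T A j).1 hj i)) (opn_nonneg A _)
    · exact le_rfl
  · simp only [nodeVar]
    split_ifs with hi
    · exact mul_le_mul_of_nonneg_left (Finset.prod_le_prod (fun i _ => msg_nonneg T A _ i)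
        (fun i _ => (msg_mono T A j).2 hj i)) (opn_nonneg A _)
    · exact le_rfl

theorem admissible_msg (T : S.TannerGraph) (A : Finset (Fin S.n)) (p : ℕ → S.Half) :
    Admissible (fun i j => msg T A j (p i)) :=
  ⟨fun _ j => msg_zero_or_one T A j _, fun _ j hj => (msg_mono T A j).1 hj _,
    fun _ j hj => (msg_mono T A j).2 hj _⟩

section
variable {T : S.TannerGraph} {A : Finset (Fin S.n)} {r ℓ : ℕ} {P : Fin r × Bool → S.Half}

theorem IsLasso.nd_eq_start (hP : IsLasso r ℓ P) (a : Fin r × Bool) (ha : endPos r ℓ a < r) :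
    nd (P a) = nd (P (⟨endPos r ℓ a, ha⟩, false)) :=
  (hP.nd_eq_iff _ _).2 (by simp [endPos])

open Classical in
/-- The product of the messages into a node of a lasso. -/
theorem IsLasso.prod_eq (hP : IsLasso r ℓ P) {i : ℕ} (hi : i < r) (j : ℕ)
    (B : Finset (Fin r × Bool)) :
    opn A (nd (P (⟨i, hi⟩, false))) *
      ∏ h with nd h = nd (P (⟨i, hi⟩, false)) ∧ h ∉ B.image P, msg T A j h =
      nodeVar T A P i j * ∏ b with endPos r ℓ b = i ∧ b ∉ B, msg T A j (P b) := by
  rw [nodeVar, dif_pos hi, mul_assoc]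
  congr 1
  rw [← Finset.prod_image (s := {b | endPos r ℓ b = i ∧ b ∉ B}) (f := msg T A j) (g := P)
    (fun a _ b _ h => hP.inj h), ← Finset.prod_union]
  · refine Finset.prod_congr ?_ fun _ _ => rfl
    ext h
    simp only [Finset.mem_filter, Finset.mem_univ, true_and, Finset.mem_image, Finset.mem_union,
      Set.mem_range, not_exists, not_and]
    constructor
    · rintro ⟨h1, h2⟩
      by_cases h3 : ∃ b, P b = h
      · obtain ⟨b, rfl⟩ := h3
        right
        exact ⟨b, ⟨by simpa [endPos] using (hP.nd_eq_iff _ _).1 h1, fun hb => h2 b hb rfl⟩, rfl⟩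
      · left
        exact ⟨h1, fun b hb => h3 ⟨b, hb⟩⟩
    · rintro (⟨h1, h2⟩ | ⟨b, ⟨h1, h2⟩, rfl⟩)
      · exact ⟨h1, fun b _ => h2 b⟩
      · exact ⟨(hP.nd_eq_iff _ _).2 (by simpa [endPos] using h1),
          fun c hc hcb => h2 (hP.inj hcb ▸ hc)⟩
  · rw [Finset.disjoint_left]
    intro h h1 h2
    simp only [Finset.mem_filter, Finset.mem_univ, true_and, Finset.mem_image] at h1 h2
    obtain ⟨b, _, rfl⟩ := h2
    exact h1.2 ⟨b, rfl⟩

open Classical in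
theorem IsLasso.msg_succ (hP : IsLasso r ℓ P) {a a' : Fin r × Bool} (ha : mate T (P a') = P a)
    (hi : endPos r ℓ a < r) (j : ℕ) :
    msg T A (j + 1) (P a') = 1 - nodeVar T A P (endPos r ℓ a) j *
      ∏ b with endPos r ℓ b = endPos r ℓ a ∧ b ≠ a, msg T A j (P b) := by
  have := hP.prod_eq (T := T) (A := A) hi j {a}
  rw [msg, ha, hP.nd_eq_start a hi]
  simp only [Finset.image_singleton, Finset.mem_singleton] at this
  rw [this]

end

theorem walkEnds_true (T : S.TannerGraph) {r : ℕ} (out : Fin r → S.Half) (i : Fin r) :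
    mate T (walkEnds T out (i, false)) = walkEnds T out (i, true) := by
  simp [walkEnds]

theorem walkEnds_false (T : S.TannerGraph) {r : ℕ} (out : Fin r → S.Half) (i : Fin r) :
    mate T (walkEnds T out (i, true)) = walkEnds T out (i, false) := by
  simp [walkEnds, mate_mate]

/-- the `i`-th element of a nonempty sequence, continued arbitrarily -/
def extend {r : ℕ} (hr : 0 < r) (i : ℕ) : Fin r := ⟨min i (r - 1), by omega⟩

theorem extend_eq {r : ℕ} (hr : 0 < r) {i : ℕ} (hi : i < r) : extend hr i = ⟨i, hi⟩ := by
  simp only [extend, Fin.mk.injEq]; omega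

theorem endPos_ends {r ℓ : ℕ} {i : ℕ} (hi : i < r) (b : Fin r × Bool) (hℓ : ℓ + 1 < r) :
    endPos r ℓ b = i ↔ b = (⟨i, hi⟩, false) ∨ (∃ h : 0 < i, b = (⟨i - 1, by omega⟩, true)) ∨
      (i = ℓ ∧ b = (⟨r - 1, by omega⟩, true)) := by
  obtain ⟨⟨a, ha⟩, _ | _⟩ := b
  · simp [endPos]
  · simp only [endPos, if_true, Prod.mk.injEq, Fin.mk.injEq, and_true, Bool.true_eq_false,
      and_false, false_or, exists_prop]
    split_ifs <;> omega

open Classical in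
theorem IsLasso.lassoEqs {T : S.TannerGraph} {A : Finset (Fin S.n)} {r ℓ : ℕ} (hr : ℓ + 1 < r)
    {out : Fin r → S.Half} (hP : IsLasso r ℓ (walkEnds T out)) :
    LassoEqs r ℓ (nodeVar T A (walkEnds T out))
      (fun i j => msg T A j (walkEnds T out (extend (by omega) i, false)))
      (fun i j => msg T A j (walkEnds T out (extend (by omega) i, true))) := by
  have hr0 : 0 < r := by omega
  have hX : ∀ i j, ∀ hi : i < r, msg T A (j + 1) (walkEnds T out (extend hr0 i, false)) =
      1 - nodeVar T A (walkEnds T out) (endPos r ℓ (⟨i, hi⟩, true)) j *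
      ∏ b with endPos r ℓ b = endPos r ℓ (⟨i, hi⟩, true) ∧ b ≠ (⟨i, hi⟩, true),
        msg T A j (walkEnds T out b) := by
    intro i j hi
    rw [extend_eq hr0 hi]
    exact hP.msg_succ (walkEnds_true T out _) (by simp only [endPos]; split_ifs <;> omega) j
  have hY : ∀ i j, ∀ hi : i < r, msg T A (j + 1) (walkEnds T out (extend hr0 i, true)) =
      1 - nodeVar T A (walkEnds T out) i j *
      ∏ b with endPos r ℓ b = i ∧ b ≠ (⟨i, hi⟩, false), msg T A j (walkEnds T out b) := by
    intro i j hi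
    rw [extend_eq hr0 hi]
    have := hP.msg_succ (A := A) (walkEnds_false T out ⟨i, hi⟩) (by simp [endPos, hi]) j
    exact this
  constructor
  · exact admissible_nodeVar T A _
  · exact admissible_msg T A _
  · exact admissible_msg T A _
  · intro i; rfl
  · intro i; rfl
  · intro i j h1 h2
    rw [hX i j (by omega), show endPos r ℓ (⟨i, by omega⟩, true) = i + 1 by simp [endPos, h1]]
    congr 2
    rw [extend_eq hr0 h1, show ({b | endPos r ℓ b = i + 1 ∧ b ≠ (⟨i, by omega⟩, true)} :
      Finset (Fin r × Bool)) = {(⟨i + 1, h1⟩, false)} from ?_, Finset.prod_singleton]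
    ext b
    simp only [Finset.mem_filter, Finset.mem_univ, true_and, endPos_ends h1 b hr,
      Finset.mem_singleton]
    constructor
    · rintro ⟨h | ⟨_, h⟩ | ⟨h, _⟩, h'⟩
      · exact h
      · exact absurd h h'
      · omega
    · rintro rfl
      simp
  · rintro i j h1
    rw [hX i j (by omega), show endPos r ℓ (⟨i, by omega⟩, true) = ℓ by
      simp only [endPos, if_true]; split_ifs <;> omega]
    congr 2
    rw [extend_eq hr0 (i := ℓ) (by omega), extend_eq hr0 (i := r - 1) (by omega),
      show ({b | endPos r ℓ b = ℓ ∧ b ≠ (⟨i, by omega⟩, true)} :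
      Finset (Fin r × Bool)) = {(⟨ℓ, by omega⟩, false), (⟨r - 1, by omega⟩, true)} from ?_,
      Finset.prod_pair (by simp)]
    ext b
    simp only [Finset.mem_filter, Finset.mem_univ, true_and,
      endPos_ends (show ℓ < r by omega) b hr, Finset.mem_singleton, Finset.mem_insert]
    have h2 : (⟨ℓ - 1, by omega⟩ : Fin r) = ⟨i, by omega⟩ := by ext; simp; omega
    constructor
    · rintro ⟨h | ⟨_, h⟩ | h, h'⟩
      · exact Or.inl h
      · exact absurd (h2 ▸ h) h'
      · exact Or.inr h
    · rintro (rfl | rfl)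
      · simp
      · refine ⟨Or.inr (Or.inr rfl), ?_⟩
        simp only [ne_eq, Prod.mk.injEq, Fin.mk.injEq, and_true]
        omega
  · intro j
    rw [hX (r - 1) j (by omega), show endPos r ℓ (⟨r - 1, by omega⟩, true) = ℓ by
      simp only [endPos, if_true]; split_ifs <;> omega]
    congr 2
    rw [extend_eq hr0 (i := ℓ) (by omega)]
    split_ifs with h0
    · subst h0
      rw [mul_one, show ({b | endPos r 0 b = 0 ∧ b ≠ (⟨r - 1, by omega⟩, true)} :
        Finset (Fin r × Bool)) = {(⟨0, by omega⟩, false)} from ?_, Finset.prod_singleton]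
      ext b
      simp only [Finset.mem_filter, Finset.mem_univ, true_and, endPos_ends hr0 b hr,
        Finset.mem_singleton]
      constructor
      · rintro ⟨h | ⟨h, _⟩ | h, h'⟩
        · exact h
        · omega
        · exact absurd h h'
      · rintro rfl
        simp
    · rw [extend_eq hr0 (i := ℓ - 1) (by omega),
        show ({b | endPos r ℓ b = ℓ ∧ b ≠ (⟨r - 1, by omega⟩, true)} :
        Finset (Fin r × Bool)) = {(⟨ℓ, by omega⟩, false), (⟨ℓ - 1, by omega⟩, true)} from ?_,
        Finset.prod_pair (by simp)]
      ext b
      simp only [Finset.mem_filter, Finset.mem_univ, true_and,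
        endPos_ends (show ℓ < r by omega) b hr, Finset.mem_singleton, Finset.mem_insert]
      constructor
      · rintro ⟨h | ⟨_, h⟩ | h, h'⟩
        · exact Or.inl h
        · exact Or.inr h
        · exact absurd h h'
      · rintro (rfl | rfl)
        · simp
        · refine ⟨Or.inr (Or.inl ⟨by omega, rfl⟩), ?_⟩
          simp only [ne_eq, Prod.mk.injEq, Fin.mk.injEq, and_true]
          omega
  · intro i j h1 h2
    rw [hY (i + 1) j h1]
    congr 2
    rw [extend_eq hr0 (i := i) (by omega), show ({b | endPos r ℓ b = i + 1 ∧
      b ≠ (⟨i + 1, h1⟩, false)} : Finset (Fin r × Bool)) = {(⟨i, by omega⟩, true)} from ?_,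
      Finset.prod_singleton]
    ext b
    simp only [Finset.mem_filter, Finset.mem_univ, true_and, endPos_ends h1 b hr,
      Finset.mem_singleton]
    constructor
    · rintro ⟨h | ⟨_, h⟩ | ⟨h, _⟩, h'⟩
      · exact absurd h h'
      · exact h
      · omega
    · rintro rfl
      simp
  · intro j h0
    rw [hY 0 j hr0, show ({b | endPos r ℓ b = 0 ∧ b ≠ (⟨0, hr0⟩, false)} :
      Finset (Fin r × Bool)) = ∅ from ?_]
    · simp
    · ext b
      simp only [Finset.mem_filter, Finset.mem_univ, true_and, endPos_ends hr0 b hr,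
        Finset.notMem_empty, iff_false]
      rintro ⟨h | ⟨h, _⟩ | ⟨h, _⟩, h'⟩
      · exact absurd h h'
      · omega
      · omega
  · intro j
    rw [hY ℓ j (by omega)]
    congr 2
    rw [extend_eq hr0 (i := r - 1) (by omega)]
    split_ifs with h0
    · subst h0
      rw [mul_one, show ({b | endPos r 0 b = 0 ∧ b ≠ (⟨0, by omega⟩, false)} :
        Finset (Fin r × Bool)) = {(⟨r - 1, by omega⟩, true)} from ?_, Finset.prod_singleton]
      ext b
      simp only [Finset.mem_filter, Finset.mem_univ, true_and, endPos_ends hr0 b hr,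
        Finset.mem_singleton]
      constructor
      · rintro ⟨h | ⟨h, _⟩ | h, h'⟩
        · exact absurd h h'
        · omega
        · exact h
      · rintro rfl
        simp
    · rw [extend_eq hr0 (i := ℓ - 1) (by omega),
        show ({b | endPos r ℓ b = ℓ ∧ b ≠ (⟨ℓ, by omega⟩, false)} :
        Finset (Fin r × Bool)) = {(⟨r - 1, by omega⟩, true), (⟨ℓ - 1, by omega⟩, true)} from ?_,
        Finset.prod_pair (by simp only [ne_eq, Prod.mk.injEq, Fin.mk.injEq, and_true]; omega)]
      ext b
      simp only [Finset.mem_filter, Finset.mem_univ, true_and,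
        endPos_ends (show ℓ < r by omega) b hr, Finset.mem_singleton, Finset.mem_insert]
      constructor
      · rintro ⟨h | ⟨_, h⟩ | h, h'⟩
        · exact absurd h h'
        · exact Or.inr h
        · exact Or.inl h
      · rintro (rfl | rfl)
        · simp
        · exact ⟨Or.inr (Or.inl ⟨by omega, rfl⟩), by simp⟩

/-- the indicator of the event that the variable node `x` is still erased after the half-iteration
`j` -/
def rootMsg (T : S.TannerGraph) (A : Finset (Fin S.n)) (j : ℕ) (x : S.Node) : ℝ :=
  opn A x * ∏ h with nd h = x, msg T A j h

open Classical in
/-- The state of the root of a lasso is a function of the node variables of the lasso only. -/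
theorem IsLasso.rootMsg_eq {T : S.TannerGraph} {A : Finset (Fin S.n)} {r ℓ n : ℕ} (hn : ¬ Even n)
    (hr : r = ℓ + 1 + n) {out : Fin r → S.Half} (hP : IsLasso r ℓ (walkEnds T out)) {J : ℕ}
    (hJ : Even J) (hℓJ : ℓ < J) :
    rootMsg T A J (nd (out ⟨0, by omega⟩)) = lassoMsg n ℓ (nodeVar T A (walkEnds T out)) J := by
  have hn0 : n ≠ 0 := by rintro rfl; simp at hn
  have hr0 : 0 < r := by omega
  have hr1 : ℓ + 1 < r := by omega
  rw [← (hP.lassoEqs (A := A) hr1).root_eq hn hr hJ hℓJ]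
  have h0 : nd (out ⟨0, hr0⟩) = nd (walkEnds T out (⟨0, hr0⟩, false)) := by simp [walkEnds]
  have := hP.prod_eq (T := T) (A := A) hr0 J ∅
  simp only [Finset.image_empty, Finset.notMem_empty, not_false_eq_true, and_true] at this
  rw [rootMsg, h0, this]
  split_ifs with hℓ
  · subst hℓ
    congr 1
    rw [extend_eq hr0 (i := 0) (by omega), extend_eq hr0 (i := r - 1) (by omega),
      show ({b | endPos r 0 b = 0} : Finset (Fin r × Bool)) =
        {(⟨0, by omega⟩, false), (⟨r - 1, by omega⟩, true)} from ?_, Finset.prod_pair (by simp)]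
    ext b
    simp only [Finset.mem_filter, Finset.mem_univ, true_and, endPos_ends hr0 b hr1,
      Finset.mem_singleton, Finset.mem_insert]
    simp
  · congr 1
    rw [extend_eq hr0 (i := 0) (by omega), show ({b | endPos r ℓ b = 0} : Finset (Fin r × Bool)) =
        {(⟨0, by omega⟩, false)} from ?_, Finset.prod_singleton]
    ext b
    simp only [Finset.mem_filter, Finset.mem_univ, true_and, endPos_ends hr0 b hr1,
      Finset.mem_singleton]
    simp [Ne.symm hℓ]

end

/-! ### The probability of a partial matching -/

section

variable {S : Sockets}

variable (S) in
/-- The expectation over a uniform Tanner graph and independent erasures of the channel outputs. -/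
def expect (ε : ℝ) : (S.TannerGraph → Finset (Fin S.n) → ℝ) →ₗ[ℝ] ℝ where
  toFun F := (Fintype.card S.TannerGraph : ℝ)⁻¹ *
    ∑ T, ∑ A : Finset (Fin S.n), ε ^ A.card * (1 - ε) ^ (S.n - A.card) * F T A
  map_add' F G := by simp [mul_add, Finset.sum_add_distrib]
  map_smul' c F := by
    simp only [Pi.smul_apply, smul_eq_mul, RingHom.id_apply, Finset.mul_sum]
    refine Finset.sum_congr rfl fun T _ => Finset.sum_congr rfl fun A _ => by ring

theorem card_VSocket (S : Sockets) : Fintype.card S.VSocket = Fintype.card S.CSocket := by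
  simp [S.sum_eq]

theorem card_TannerGraph_pos (S : Sockets) : 0 < Fintype.card S.TannerGraph := by
  rw [Fintype.card_pos_iff]
  exact ⟨Fintype.equivOfCardEq S.card_VSocket⟩

theorem expect_mono {ε : ℝ} (hε : ε ∈ Set.Icc (0 : ℝ) 1)
    {F G : S.TannerGraph → Finset (Fin S.n) → ℝ} (h : ∀ T A, F T A ≤ G T A) :
    S.expect ε F ≤ S.expect ε G := by
  have h1 : 0 ≤ 1 - ε := by linarith [hε.2]
  have h0 := hε.1
  refine mul_le_mul_of_nonneg_left (Finset.sum_le_sum fun T _ => Finset.sum_le_sum fun A _ =>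
    mul_le_mul_of_nonneg_left (h T A) (by positivity)) (by positivity)

theorem expect_nonneg {ε : ℝ} (hε : ε ∈ Set.Icc (0 : ℝ) 1)
    {F : S.TannerGraph → Finset (Fin S.n) → ℝ} (h : ∀ T A, 0 ≤ F T A) : 0 ≤ S.expect ε F := by
  have := expect_mono hε (F := 0) h
  simpa using this

/-- the probability that the channel output of a variable node is erased, and `1` for a check
node -/
def opnProb (ε : ℝ) : S.Node → ℝ := Sum.elim (fun _ => ε) (fun _ => 1)

theorem sum_prod_opn (ε : ℝ) (U : Finset S.Node) :
    ∑ A : Finset (Fin S.n), ε ^ A.card * (1 - ε) ^ (S.n - A.card) * ∏ u ∈ U, opn A u =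
      ∏ u ∈ U, opnProb ε u := by
  classical
  have h := Finset.prod_add (fun v : Fin S.n => ε)
    (fun v => (1 - ε) * if Sum.inl v ∈ U then 0 else 1) Finset.univ
  have h1 : ∏ u ∈ U, opnProb ε u =
      ∏ v : Fin S.n, (ε + (1 - ε) * if (Sum.inl v : S.Node) ∈ U then 0 else 1) := by
    have e1 : ∏ u ∈ U, opnProb ε u = ∏ u : S.Node, if u ∈ U then opnProb ε u else 1 := by
      rw [Finset.prod_ite_mem, Finset.univ_inter]
    rw [e1, Fintype.prod_sum_type]
    have e2 : ∏ x : Fin S.m, (if (Sum.inr x : S.Node) ∈ U then opnProb ε (Sum.inr x : S.Node)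
      else 1) = 1 := Finset.prod_eq_one fun c _ => by simp [opnProb]
    rw [e2, mul_one]
    refine Finset.prod_congr rfl fun v _ => ?_
    split_ifs <;> simp [opnProb]
  rw [h1, h, Finset.powerset_univ]
  refine Finset.sum_congr rfl fun A _ => ?_
  rw [Finset.prod_const, Finset.prod_mul_distrib, Finset.prod_const, mul_assoc]
  congr 2
  · rw [← Finset.compl_eq_univ_sdiff, Finset.card_compl, Fintype.card_fin]
  · have e1 : ∏ u ∈ U, opn A u = ∏ u : S.Node, if u ∈ U then opn A u else 1 := by
      rw [Finset.prod_ite_mem, Finset.univ_inter]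
    rw [e1, Fintype.prod_sum_type]
    have e2 : ∏ x : Fin S.m, (if (Sum.inr x : S.Node) ∈ U then opn A (Sum.inr x : S.Node)
      else 1) = 1 := Finset.prod_eq_one fun c _ => by simp [opn]
    rw [e2, mul_one, ← Finset.compl_eq_univ_sdiff, ← Finset.prod_mul_prod_compl A]
    have e3 : ∏ v ∈ A, (if (Sum.inl v : S.Node) ∈ U then opn A (Sum.inl v : S.Node) else 1) = 1 :=
      Finset.prod_eq_one fun v hv => by simp [opn, hv]
    rw [e3, one_mul]
    refine Finset.prod_congr rfl fun v hv => ?_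
    have hv' : v ∉ A := by simpa using hv
    simp [opn, hv']

/-- `M` is a list of edges that may belong to one Tanner graph: no half-edge is used twice. -/
inductive Matching : List (S.Half × S.Half) → Prop
  | nil : Matching []
  | cons {a b : S.Half} {M : List (S.Half × S.Half)} (ha : ∀ p ∈ M, a ≠ p.1 ∧ a ≠ p.2)
      (hb : ∀ p ∈ M, b ≠ p.1 ∧ b ≠ p.2) (hab : b.isLeft = !a.isLeft) (hM : Matching M) :
      Matching ((a, b) :: M)

/-- the Tanner graph `T` contains the edges `M` -/
def Holds (T : S.TannerGraph) (M : List (S.Half × S.Half)) : Prop :=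
  ∀ p ∈ M, mate T p.1 = p.2

open Classical in
/-- indicator of an event -/
def ind (p : Prop) : ℝ := if p then 1 else 0

theorem ind_nonneg (p : Prop) : 0 ≤ ind p := by rw [ind]; split_ifs <;> simp

theorem ind_le_one (p : Prop) : ind p ≤ 1 := by rw [ind]; split_ifs <;> simp

theorem ind_and (p q : Prop) : ind (p ∧ q) = ind p * ind q := by
  by_cases hp : p <;> by_cases hq : q <;> simp [ind, hp, hq]

/-- the half-edges of the other side -/
def opposite (a : S.Half) : Finset S.Half := {b | b.isLeft = !a.isLeft}

theorem mem_opposite {a b : S.Half} : b ∈ opposite a ↔ b.isLeft = !a.isLeft := by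
  simp [opposite]

theorem card_opposite (a : S.Half) : (opposite a).card = Fintype.card S.VSocket := by
  classical
  rcases a with s | c
  · have : opposite (Sum.inl s : S.Half) = Finset.univ.map ⟨Sum.inr, Sum.inr_injective⟩ := by
      ext b; rcases b with b | b <;> simp [opposite]
    rw [this, Finset.card_map, card_VSocket, Finset.card_univ]
  · have : opposite (Sum.inr c : S.Half) = Finset.univ.map ⟨Sum.inl, Sum.inl_injective⟩ := by
      ext b; rcases b with b | b <;> simp [opposite]
    rw [this, Finset.card_map, Finset.card_univ]

theorem sum_ind_mate (T : S.TannerGraph) (a : S.Half) (F : S.Half → ℝ) :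
    ∑ b ∈ opposite a, ind (mate T a = b) * F b = F (mate T a) := by
  classical
  rw [Finset.sum_eq_single (mate T a)]
  · simp [ind]
  · intro b _ hb
    simp [ind, hb.symm]
  · intro h
    exact absurd (mem_opposite.2 (isLeft_mate T a)) h

theorem Matching.card_touched {M : List (S.Half × S.Half)} (hM : Matching M) (a : S.Half) :
    ((opposite a).filter fun b => ∃ p ∈ M, b = p.1 ∨ b = p.2).card = M.length := by
  classical
  induction hM with
  | nil => simp
  | @cons x y M hx hy hxy hM ih =>
    rw [List.length_cons, ← ih]
    -- exactly one end of the new edge is on the other side of `a`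
    have key : ∀ z, z ∈ opposite a → (∀ p ∈ M, z ≠ p.1 ∧ z ≠ p.2) →
        (∀ w, w ∈ opposite a → (w = x ∨ w = y) → w = z) → (z = x ∨ z = y) →
        ((opposite a).filter fun b => ∃ p ∈ (x, y) :: M, b = p.1 ∨ b = p.2) =
          insert z ((opposite a).filter fun b => ∃ p ∈ M, b = p.1 ∨ b = p.2) := by
      intro z hz hzM hw hz'
      ext b
      simp only [Finset.mem_filter, Finset.mem_insert, List.mem_cons, exists_eq_or_imp]
      constructor
      · rintro ⟨h1, h2 | h2⟩
        · exact Or.inl (hw b h1 h2)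
        · exact Or.inr ⟨h1, h2⟩
      · rintro (rfl | ⟨h1, h2⟩)
        · exact ⟨hz, Or.inl hz'⟩
        · exact ⟨h1, Or.inr h2⟩
    have hnot : ∀ z, (∀ p ∈ M, z ≠ p.1 ∧ z ≠ p.2) →
        z ∉ (opposite a).filter fun b => ∃ p ∈ M, b = p.1 ∨ b = p.2 := by
      intro z hz h
      obtain ⟨p, hp, h | h⟩ := (Finset.mem_filter.1 h).2
      · exact (hz p hp).1 h
      · exact (hz p hp).2 h
    by_cases hxa : x ∈ opposite a
    · rw [key x hxa hx ?_ (Or.inl rfl), Finset.card_insert_of_notMem (hnot x hx)]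
      rintro w hw (rfl | rfl)
      · rfl
      · rw [mem_opposite] at hw hxa
        rw [hw, hxa] at hxy
        exact absurd hxy (by cases a.isLeft <;> decide)
    · have hya : y ∈ opposite a := by
        rw [mem_opposite] at hxa ⊢
        rw [hxy]
        revert hxa
        cases x.isLeft <;> cases a.isLeft <;> simp
      rw [key y hya hy ?_ (Or.inr rfl), Finset.card_insert_of_notMem (hnot y hy)]
      rintro w hw (rfl | rfl)
      · exact absurd hw hxa
      · rfl

/-- Exchanging two half-edges of the same side. -/
theorem exists_swap [DecidableEq S.Half] (b b' : S.Half) (h : b.isLeft = b'.isLeft) :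
    ∃ σ : S.TannerGraph ≃ S.TannerGraph,
      ∀ T x, mate (σ T) x = Equiv.swap b b' (mate T (Equiv.swap b b' x)) := by
  classical
  have hl : ∀ s s' u : S.VSocket, Equiv.swap (Sum.inl s : S.Half) (Sum.inl s') (Sum.inl u) =
      Sum.inl (Equiv.swap s s' u) := fun s s' u => by
    simp only [Equiv.swap_apply_def, Sum.inl.injEq]; split_ifs <;> rfl
  have hr : ∀ s s' u : S.CSocket, Equiv.swap (Sum.inr s : S.Half) (Sum.inr s') (Sum.inr u) =
      Sum.inr (Equiv.swap s s' u) := fun s s' u => by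
    simp only [Equiv.swap_apply_def, Sum.inr.injEq]; split_ifs <;> rfl
  rcases b with s | c <;> rcases b' with s' | c' <;> simp at h
  · refine ⟨Equiv.equivCongr (Equiv.swap s s') (Equiv.refl _), fun T x => ?_⟩
    rcases x with x | x
    · rw [hl]; simp [mate, Equiv.swap_apply_of_ne_of_ne]
    · rw [show Equiv.swap (Sum.inl s : S.Half) (Sum.inl s') (Sum.inr x) = Sum.inr x from
        Equiv.swap_apply_of_ne_of_ne (by simp) (by simp)]
      simp only [mate, Sum.elim_inr]
      rw [hl]
      rfl
  · refine ⟨Equiv.equivCongr (Equiv.refl _) (Equiv.swap c c'), fun T x => ?_⟩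
    rcases x with x | x
    · rw [show Equiv.swap (Sum.inr c : S.Half) (Sum.inr c') (Sum.inl x) = Sum.inl x from
        Equiv.swap_apply_of_ne_of_ne (by simp) (by simp)]
      simp only [mate, Sum.elim_inl]
      rw [hr]
      simp
    · rw [hr]; simp [mate, Equiv.swap_apply_of_ne_of_ne]

variable (S) in
/-- the probability that a Tanner graph contains the edges `M` -/
def matchProb (M : List (S.Half × S.Half)) : ℝ :=
  (Fintype.card S.TannerGraph : ℝ)⁻¹ * ∑ T : S.TannerGraph, ind (Holds T M)

theorem matchProb_nil : S.matchProb [] = 1 := by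
  have := S.card_TannerGraph_pos
  have h : (Fintype.card S.TannerGraph : ℝ) ≠ 0 := by positivity
  simp [matchProb, Holds, ind, h]

theorem holds_cons {T : S.TannerGraph} {a b : S.Half} {M : List (S.Half × S.Half)} :
    Holds T ((a, b) :: M) ↔ mate T a = b ∧ Holds T M := by
  simp [Holds]

theorem matchProb_cons {a b : S.Half} {M : List (S.Half × S.Half)} (h : Matching ((a, b) :: M)) :
    S.matchProb M = (Fintype.card S.VSocket - M.length : ℝ) * S.matchProb ((a, b) :: M) := by
  classical
  obtain ⟨ha, hb, hab, hM⟩ : (∀ p ∈ M, a ≠ p.1 ∧ a ≠ p.2) ∧ (∀ p ∈ M, b ≠ p.1 ∧ b ≠ p.2) ∧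
      b.isLeft = !a.isLeft ∧ Matching M := by
    cases h with | cons ha hb hab hM => exact ⟨ha, hb, hab, hM⟩
  have hsum : ∀ M : List (S.Half × S.Half),
      S.matchProb M = ∑ b' ∈ opposite a, S.matchProb ((a, b') :: M) := by
    intro M
    simp only [matchProb]
    rw [← Finset.mul_sum, Finset.sum_comm]
    congr 1
    refine Finset.sum_congr rfl fun T _ => ?_
    simp only [holds_cons, ind_and]
    rw [sum_ind_mate T a (fun _ => ind (Holds T M))]
  rw [hsum M, ← Finset.sum_filter_add_sum_filter_not _ (fun b' => ∃ p ∈ M, b' = p.1 ∨ b' = p.2)]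
  have h1 : ∑ b' ∈ opposite a with ∃ p ∈ M, b' = p.1 ∨ b' = p.2,
      S.matchProb ((a, b') :: M) = 0 := by
    refine Finset.sum_eq_zero fun b' hb' => ?_
    obtain ⟨-, p, hp, hbp⟩ := Finset.mem_filter.1 hb'
    have : ∀ T : S.TannerGraph, ¬ Holds T ((a, b') :: M) := by
      intro T hT
      rw [holds_cons] at hT
      have h2 := hT.2 p hp
      rcases hbp with rfl | rfl
      · exact (ha p hp).2 (by rw [← h2, ← hT.1, mate_mate])
      · exact (ha p hp).1 (mate_injective T (by rw [h2, hT.1]))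
    simp [matchProb, ind, this]
  have h2 : ∀ b' ∈ opposite a, (¬ ∃ p ∈ M, b' = p.1 ∨ b' = p.2) →
      S.matchProb ((a, b') :: M) = S.matchProb ((a, b) :: M) := by
    intro b' hb' hbM
    push Not at hbM
    rw [mem_opposite] at hb'
    obtain ⟨σ, hσ⟩ := exists_swap b b' (by rw [hab, hb'])
    rw [matchProb, matchProb]
    congr 1
    refine (Fintype.sum_equiv σ _ _ fun T => ?_).symm
    congr 1
    rw [holds_cons, holds_cons, hσ]
    have hfix : ∀ x : S.Half, x ≠ b → x ≠ b' → Equiv.swap b b' x = x :=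
      fun x h1 h2 => Equiv.swap_apply_of_ne_of_ne h1 h2
    have hab1 : a ≠ b := by
      rintro rfl; exact absurd hab (by cases a.isLeft <;> decide)
    have hab2 : a ≠ b' := by
      rintro rfl; exact absurd hb' (by cases a.isLeft <;> decide)
    rw [hfix a hab1 hab2]
    have : Holds (σ T) M ↔ Holds T M := by
      refine forall₂_congr fun p hp => ?_
      rw [hσ, hfix p.1 (hb p hp).1.symm (hbM p hp).1.symm, Equiv.swap_apply_eq_iff,
        hfix p.2 (hb p hp).2.symm (hbM p hp).2.symm]
    rw [this, Equiv.swap_apply_eq_iff, Equiv.swap_apply_right]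
  rw [h1, zero_add, Finset.sum_congr rfl fun b' hb' =>
    h2 b' (Finset.mem_filter.1 hb').1 (Finset.mem_filter.1 hb').2, Finset.sum_const, nsmul_eq_mul]
  congr 1
  have h3 := Finset.card_filter_add_card_filter_not (s := opposite a)
    (fun b' => ∃ p ∈ M, b' = p.1 ∨ b' = p.2)
  rw [hM.card_touched, card_opposite] at h3
  rw [← h3]
  push_cast
  ring

/-- The constant in the error bound for the probability of a matching. -/
def matchConst : ℕ → ℝ
  | 0 => 0
  | m + 1 => (matchConst m + m) * (m + 1)

theorem matchConst_nonneg (m : ℕ) : 0 ≤ matchConst m := by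
  induction m with
  | zero => exact le_rfl
  | succ m ih => rw [matchConst]; positivity

theorem matchConst_mono : Monotone matchConst := by
  refine monotone_nat_of_le_succ fun m => ?_
  rw [matchConst]
  have h1 := matchConst_nonneg m
  have h2 : (0 : ℝ) ≤ m := by positivity
  nlinarith

theorem Matching.length_le {M : List (S.Half × S.Half)} (hM : Matching M) :
    M.length ≤ Fintype.card S.VSocket := by
  classical
  cases hM with
  | nil => simp
  | @cons a b M ha hb hab hM =>
    rw [← (Matching.cons ha hb hab hM).card_touched a, ← card_opposite a]
    exact Finset.card_filter_le _ _

theorem Matching.prob_bound {M : List (S.Half × S.Half)} (hM : Matching M) :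
    |S.matchProb M - ((Fintype.card S.VSocket : ℝ)⁻¹) ^ M.length| ≤
      matchConst M.length / (Fintype.card S.VSocket : ℝ) ^ (M.length + 1) := by
  induction hM with
  | nil => simp [matchProb_nil, matchConst]
  | @cons a b M ha hb hab hM ih =>
    have hM' := Matching.cons ha hb hab hM
    have hlen := hM'.length_le
    have hp := matchProb_cons hM'
    set N : ℝ := (Fintype.card S.VSocket : ℝ)
    set m := M.length with hm
    rw [List.length_cons] at hlen ⊢
    have hN : (m : ℝ) + 1 ≤ N := by
      have : ((m + 1 : ℕ) : ℝ) ≤ N := Nat.cast_le.2 hlen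
      simpa using this
    have hm0 : (0 : ℝ) ≤ m := by positivity
    have hN0 : 0 < N := by linarith
    have hNm : 0 < N - m := by linarith
    have hinv : (N - m)⁻¹ ≤ (m + 1) / N := by
      rw [inv_eq_one_div, div_le_div_iff₀ hNm hN0]
      nlinarith
    have hp' : S.matchProb ((a, b) :: M) = S.matchProb M * (N - m)⁻¹ := by
      rw [hp]; field_simp
    have hid : S.matchProb ((a, b) :: M) - N⁻¹ ^ (m + 1) =
        ((S.matchProb M - N⁻¹ ^ m) + N⁻¹ ^ (m + 1) * m) * (N - m)⁻¹ := by
      rw [hp', pow_succ]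
      field_simp
      ring
    rw [hid, abs_mul, abs_of_pos (inv_pos.2 hNm)]
    have h1 : |S.matchProb M - N⁻¹ ^ m + N⁻¹ ^ (m + 1) * m| ≤ (matchConst m + m) / N ^ (m + 1) := by
      refine (abs_add_le _ _).trans ?_
      rw [add_div]
      refine add_le_add ih (le_of_eq ?_)
      rw [abs_of_nonneg (by positivity), inv_pow]
      field_simp
    calc _ ≤ (matchConst m + m) / N ^ (m + 1) * ((m + 1) / N) :=
          mul_le_mul h1 hinv (inv_pos.2 hNm).le (by
            have := matchConst_nonneg m; positivity)
      _ = matchConst (m + 1) / N ^ (m + 1 + 1) := by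
          rw [matchConst, div_mul_div_comm, ← pow_succ]

theorem Matching.prob_le {M : List (S.Half × S.Half)} (hM : Matching M)
    (hN : 0 < Fintype.card S.VSocket) :
    S.matchProb M ≤ (1 + matchConst M.length) / (Fintype.card S.VSocket : ℝ) ^ M.length := by
  have h := (abs_le.1 hM.prob_bound).2
  have hN1 : (1 : ℝ) ≤ Fintype.card S.VSocket := by exact_mod_cast hN
  have h1 : matchConst M.length / (Fintype.card S.VSocket : ℝ) ^ (M.length + 1) ≤
      matchConst M.length / (Fintype.card S.VSocket : ℝ) ^ M.length := by
    apply div_le_div_of_nonneg_left (matchConst_nonneg _) (by positivity)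
    exact pow_le_pow_right₀ hN1 (by omega)
  rw [add_div, one_div, ← inv_pow]
  linarith

theorem expect_holds_mul_opn (ε : ℝ) (M : List (S.Half × S.Half)) (U : Finset S.Node) :
    S.expect ε (fun T A => ind (Holds T M) * ∏ u ∈ U, opn A u) =
      S.matchProb M * ∏ u ∈ U, opnProb ε u := by
  rw [← sum_prod_opn, matchProb, mul_assoc, Finset.sum_mul_sum]
  simp only [expect, LinearMap.coe_mk, AddHom.coe_mk]
  congr 1
  refine Finset.sum_congr rfl fun T _ => Finset.sum_congr rfl fun A _ => by ring

theorem expect_holds (ε : ℝ) (M : List (S.Half × S.Half)) :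
    S.expect ε (fun T _ => ind (Holds T M)) = S.matchProb M := by
  simpa using expect_holds_mul_opn ε M ∅

end

/-! ### Local convergence to trees -/

section

variable {S : Sockets}

/-- the degree of a node -/
def deg (x : S.Node) : ℕ := Sum.elim S.varDeg S.chkDeg x

open Classical in
theorem card_nd_eq (x : S.Node) : ({h | nd h = x} : Finset S.Half).card = deg x := by
  rcases x with v | c
  · have : ({h | nd h = Sum.inl v} : Finset S.Half) =
        (Finset.univ : Finset (Fin (S.varDeg v))).map
          ⟨fun i => Sum.inl ⟨v, i⟩, fun i j h => by simpa using h⟩ := by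
      ext h
      rw [Finset.mem_filter, Finset.mem_map]
      rcases h with ⟨v', i⟩ | ⟨c', i⟩
      · constructor
        · rintro ⟨-, h⟩
          obtain rfl : v' = v := Sum.inl_injective h
          exact ⟨i, Finset.mem_univ _, rfl⟩
        · rintro ⟨j, -, h⟩
          exact ⟨Finset.mem_univ _, by rw [← h]; rfl⟩
      · constructor
        · rintro ⟨-, h⟩
          exact absurd h (by simp [nd])
        · rintro ⟨j, -, h⟩
          exact absurd h (by simp)
    rw [this, Finset.card_map]
    simp [deg]
  · have : ({h | nd h = Sum.inr c} : Finset S.Half) =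
        (Finset.univ : Finset (Fin (S.chkDeg c))).map
          ⟨fun i => Sum.inr ⟨c, i⟩, fun i j h => by simpa using h⟩ := by
      ext h
      rw [Finset.mem_filter, Finset.mem_map]
      rcases h with ⟨v', i⟩ | ⟨c', i⟩
      · constructor
        · rintro ⟨-, h⟩
          exact absurd h (by simp [nd])
        · rintro ⟨j, -, h⟩
          exact absurd h (by simp)
      · constructor
        · rintro ⟨-, h⟩
          obtain rfl : c' = c := Sum.inr_injective h
          exact ⟨i, Finset.mem_univ _, rfl⟩
        · rintro ⟨j, -, h⟩
          exact ⟨Finset.mem_univ _, by rw [← h]; rfl⟩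
    rw [this, Finset.card_map]
    simp [deg]

/-- The ensemble has bounded degrees, and `lam` and `rho` are its degree distributions from the
edge perspective; their derivatives count the choices of several sockets at one node. -/
structure Model (S : Sockets) (lam rho : ℝ[X]) (d : ℕ) : Prop where
  pos : 0 < Fintype.card S.VSocket
  deg_le : ∀ x : S.Node, deg x ≤ d
  sum : ∀ (b : Bool) (κ : ℕ) (x : ℝ), ∑ y : S.Node with y.isLeft = b,
    ((deg y).descFactorial (κ + 1) : ℝ) * x ^ (deg y - (κ + 1)) =
      Fintype.card S.VSocket * (Polynomial.derivative^[κ] (if b then lam else rho)).eval x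

variable {lam rho : ℝ[X]} {d : ℕ} {ε : ℝ}

theorem sum_half (F : S.Node → ℝ) (b : Bool) : ∑ h : S.Half with h.isLeft = b, F (nd h) =
    ∑ y : S.Node with y.isLeft = b, (deg y : ℝ) * F y := by
  classical
  rw [← Finset.sum_fiberwise_of_maps_to (s := {h : S.Half | h.isLeft = b})
    (t := {y : S.Node | y.isLeft = b}) (g := nd) (fun h hh => by
      simpa [isLeft_nd] using hh)]
  refine Finset.sum_congr rfl fun y hy => ?_
  rw [Finset.sum_congr rfl (g := fun _ => F y) (fun h hh => by rw [(Finset.mem_filter.1 hh).2]),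
    Finset.sum_const, nsmul_eq_mul, ← card_nd_eq]
  congr 3
  ext h
  simp only [Finset.mem_filter, Finset.mem_univ, true_and]
  refine ⟨fun h => h.2, fun h' => ⟨?_, h'⟩⟩
  rw [← isLeft_nd, h']
  simpa using hy

theorem Model.sum_opposite (H : Model S lam rho d) (a : S.Half) (x : ℝ) :
    ∑ b ∈ opposite a, opnProb ε (nd b) * x ^ (deg (nd b) - 1) = Fintype.card S.VSocket *
      if a.isLeft then rho.eval x else ε * lam.eval x := by
  have h1 := sum_half (S := S) (fun y => opnProb ε y * x ^ (deg y - 1)) (!a.isLeft)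
  have h2 := H.sum (!a.isLeft) 0 x
  rw [opposite, h1]
  have h3 : ∀ y ∈ ({y | y.isLeft = !a.isLeft} : Finset S.Node),
      (deg y : ℝ) * (opnProb ε y * x ^ (deg y - 1)) =
      (if a.isLeft then 1 else ε) * (((deg y).descFactorial (0 + 1) : ℝ) * x ^ (deg y - (0 + 1))) := by
    intro y hy
    have hy' : y.isLeft = !a.isLeft := by simpa using hy
    rcases y with v | c
    · have : a.isLeft = false := by simpa using hy'.symm
      simp [this, opnProb]
      ring
    · have : a.isLeft = true := by
        cases h : a.isLeft
        · rw [h] at hy'; simp at hy'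
        · rfl
      simp [this, opnProb]
  rw [Finset.sum_congr rfl h3, ← Finset.mul_sum, h2]
  cases a.isLeft <;> simp
  ring

theorem Model.eval_mem (H : Model S lam rho d) (b : Bool) {x : ℝ} (hx : x ∈ Set.Icc (0 : ℝ) 1) :
    (if b then lam else rho).eval x ∈ Set.Icc (0 : ℝ) 1 := by
  have h1 := H.sum b 0 x
  have hN : (0 : ℝ) < Fintype.card S.VSocket := by exact_mod_cast H.pos
  have hsum : ∑ y : S.Node with y.isLeft = b, (deg y : ℝ) = Fintype.card S.VSocket := by
    have h1 := sum_half (S := S) (fun _ => 1) b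
    simp only [mul_one, Finset.sum_const, nsmul_eq_mul] at h1
    rw [← h1]
    congr 1
    cases b
    · have : 0 < Fintype.card S.VSocket := H.pos
      obtain ⟨s⟩ := Fintype.card_pos_iff.1 this
      simpa [opposite] using card_opposite (Sum.inl s : S.Half)
    · have : 0 < Fintype.card S.VSocket := H.pos
      rw [card_VSocket] at this
      obtain ⟨s⟩ := Fintype.card_pos_iff.1 this
      simpa [opposite] using card_opposite (Sum.inr s : S.Half)
  simp only [Function.iterate_zero, id_eq, zero_add, Nat.descFactorial_one] at h1
  have hx0 := hx.1
  constructor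
  · have h2 : 0 ≤ ∑ y : S.Node with y.isLeft = b, (deg y : ℝ) * x ^ (deg y - 1) :=
      Finset.sum_nonneg fun y _ => by positivity
    rw [h1] at h2
    exact nonneg_of_mul_nonneg_right h2 hN
  · have h2 : ∑ y : S.Node with y.isLeft = b, (deg y : ℝ) * x ^ (deg y - 1) ≤
        ∑ y : S.Node with y.isLeft = b, (deg y : ℝ) :=
      Finset.sum_le_sum fun y _ => mul_le_of_le_one_right (by positivity) (pow_le_one₀ hx0 hx.2)
    rw [h1, hsum] at h2
    exact le_of_mul_le_mul_left (by linarith) hN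

theorem Model.density_mem (H : Model S lam rho d) (hε : ε ∈ Set.Icc (0 : ℝ) 1) (j : ℕ) :
    ∀ b, density lam rho ε b j ∈ Set.Icc (0 : ℝ) 1 := by
  induction j with
  | zero => intro b; simp [density]
  | succ j ih =>
    intro b
    cases b
    · have h := H.eval_mem true (ih true)
      simp only [if_true] at h
      have h1 := mul_nonneg hε.1 h.1
      have h2 := mul_le_one₀ hε.2 h.1 h.2
      exact ⟨by rw [density]; linarith, by rw [density]; linarith⟩
    · have h := H.eval_mem false (ih false)
      simp only [Bool.false_eq_true, if_false] at h
      exact ⟨by rw [density]; linarith [h.2], by rw [density]; linarith [h.1]⟩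

theorem Model.sum_density (H : Model S lam rho d) (a : S.Half) (j : ℕ) :
    ∑ b ∈ opposite a, opnProb ε (nd b) * density lam rho ε (!a.isLeft) j ^ (deg (nd b) - 1) =
      Fintype.card S.VSocket * (1 - density lam rho ε a.isLeft (j + 1)) := by
  rw [H.sum_opposite]
  cases a.isLeft <;> simp [density]

theorem opnProb_mem (hε : ε ∈ Set.Icc (0 : ℝ) 1) (x : S.Node) :
    opnProb ε x ∈ Set.Icc (0 : ℝ) 1 := by
  rcases x with v | c
  · exact hε
  · simp [opnProb]

theorem prod_mem_Icc {ι : Type*} (s : Finset ι) {F : ι → ℝ} (h : ∀ i ∈ s, F i ∈ Set.Icc (0 : ℝ) 1) :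
    ∏ i ∈ s, F i ∈ Set.Icc (0 : ℝ) 1 :=
  ⟨Finset.prod_nonneg fun i hi => (h i hi).1,
    Finset.prod_le_one (fun i hi => (h i hi).1) fun i hi => (h i hi).2⟩

theorem mul_mem_Icc {x y : ℝ} (hx : x ∈ Set.Icc (0 : ℝ) 1) (hy : y ∈ Set.Icc (0 : ℝ) 1) :
    x * y ∈ Set.Icc (0 : ℝ) 1 :=
  ⟨mul_nonneg hx.1 hy.1, mul_le_one₀ hx.2 hy.1 hy.2⟩

theorem opn_mem (A : Finset (Fin S.n)) (x : S.Node) : opn A x ∈ Set.Icc (0 : ℝ) 1 :=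
  ⟨opn_nonneg A x, opn_le_one A x⟩

theorem msg_mem (T : S.TannerGraph) (A : Finset (Fin S.n)) (j : ℕ) (h : S.Half) :
    msg T A j h ∈ Set.Icc (0 : ℝ) 1 :=
  ⟨msg_nonneg T A j h, msg_le_one T A j h⟩

open Classical in
/-- The half-edges whose nodes belong to a set of at most `k` nodes. -/
theorem Model.card_nd_mem_le (H : Model S lam rho d) (Y : Finset S.Node) :
    ({h : S.Half | nd h ∈ Y} : Finset S.Half).card ≤ d * Y.card := by
  refine Finset.card_le_mul_card_image_of_maps_to (s := {h : S.Half | nd h ∈ Y}) (t := Y) (f := nd)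
    (fun h hh => (Finset.mem_filter.1 hh).2) d
    fun y hy => ?_
  refine le_trans (Finset.card_le_card ?_) ((card_nd_eq y).le.trans (H.deg_le y))
  intro h hh
  simp only [Finset.mem_filter, Finset.mem_univ, true_and] at hh ⊢
  exact hh.2

theorem msg_succ_eq_sum (T : S.TannerGraph) (A : Finset (Fin S.n)) (j : ℕ) (h : S.Half) :
    msg T A (j + 1) h = 1 - ∑ b ∈ opposite h, ind (mate T h = b) *
      (opn A (nd b) * ∏ h' with nd h' = nd b ∧ h' ≠ b, msg T A j h') := by
  rw [sum_ind_mate T h (fun b => opn A (nd b) * ∏ h' with nd h' = nd b ∧ h' ≠ b, msg T A j h')]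
  rfl

open Classical in
theorem card_others (b : S.Half) : ({h' | nd h' = nd b ∧ h' ≠ b} : Finset S.Half).card =
    deg (nd b) - 1 := by
  rw [← card_nd_eq, ← Finset.card_erase_of_mem (a := b) (by simp)]
  congr 1
  ext h
  simp [and_comm]

open Classical in
/-- **Local convergence.** Given a bounded number of edges `M` of the Tanner graph, the messages
into finitely many half-edges outside `M` are, up to an error `O(1 / n)`, independent, with means
given by density evolution. The messages are unfolded one at a time: the next edge almost always
leads to a new node, whose messages are to be unfolded in turn. -/
theorem expect_prod_msg (lam rho : ℝ[X]) (hε : ε ∈ Set.Icc (0 : ℝ) 1) (d : ℕ) (w : ℕ) : ∀ a : ℕ,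
    ∃ C : ℝ, 0 ≤ C ∧ ∀ S : Sockets, Model S lam rho d → ∀ M : List (S.Half × S.Half), Matching M →
      M.length ≤ a → ∀ U : Finset S.Node, U.card ≤ a → ∀ (Q : Finset S.Half) (J : S.Half → ℕ),
      (∀ h ∈ Q, ∀ p ∈ M, h ≠ p.1 ∧ h ≠ p.2) → ∑ h ∈ Q, (d + 1) ^ J h ≤ w →
      |S.expect ε (fun T A => ind (Holds T M) * ((∏ u ∈ U, opn A u) * ∏ h ∈ Q, msg T A (J h) h))
        - ((Fintype.card S.VSocket : ℝ)⁻¹) ^ M.length *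
          ((∏ u ∈ U, opnProb ε u) * ∏ h ∈ Q, density lam rho ε h.isLeft (J h))| ≤
        C / (Fintype.card S.VSocket : ℝ) ^ (M.length + 1) := by
  induction w with
  | zero =>
    intro a
    refine ⟨matchConst a, matchConst_nonneg a, fun S H M hM hMa U _ Q J _ hw => ?_⟩
    have hQ : Q = ∅ := by
      by_contra hne
      obtain ⟨h, hh⟩ := Finset.nonempty_iff_ne_empty.2 hne
      have := Finset.single_le_sum (f := fun h => (d + 1) ^ J h) (fun _ _ => Nat.zero_le _) hh
      have h1 : 0 < (d + 1) ^ J h := by positivity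
      omega
    subst hQ
    simp only [Finset.prod_empty, mul_one]
    rw [expect_holds_mul_opn, ← sub_mul, abs_mul]
    have hU := prod_mem_Icc U (fun u _ => opnProb_mem hε u)
    rw [abs_of_nonneg hU.1]
    calc _ ≤ |S.matchProb M - (Fintype.card S.VSocket : ℝ)⁻¹ ^ M.length| :=
          mul_le_of_le_one_right (abs_nonneg _) hU.2
      _ ≤ _ := hM.prob_bound
      _ ≤ _ := by
        have := matchConst_mono hMa
        gcongr
  | succ w ih =>
    intro a
    obtain ⟨C₁, hC₁, ih₁⟩ := ih a
    obtain ⟨C₂, hC₂, ih₂⟩ := ih (a + 1)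
    refine ⟨C₁ + C₂ + (2 + matchConst (a + 1)) * (d * (2 * a + (w + 1) + a) : ℕ) + matchConst a, by
      have := matchConst_nonneg a; have := matchConst_nonneg (a + 1); positivity,
      fun S H M hM hMa U hUa Q J hQ hw => ?_⟩
    have hN : (0 : ℝ) < Fintype.card S.VSocket := by exact_mod_cast H.pos
    set N : ℝ := ((Fintype.card S.VSocket : ℕ) : ℝ) with hNdef
    have hc0 := matchConst_nonneg a
    have hc1 := matchConst_nonneg (a + 1)
    have hCbound : C₁ ≤ C₁ + C₂ + (2 + matchConst (a + 1)) * (d * (2 * a + (w + 1) + a) : ℕ)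
        + matchConst a := by
      have : 0 ≤ (2 + matchConst (a + 1)) * (d * (2 * a + (w + 1) + a) : ℕ) := by positivity
      linarith
    rcases Q.eq_empty_or_nonempty with rfl | ⟨h, hh⟩
    · exact (ih₁ S H M hM hMa U hUa ∅ J hQ (by simp)).trans (by gcongr)
    have hw' : (d + 1) ^ J h + ∑ h' ∈ Q.erase h, (d + 1) ^ J h' ≤ w + 1 := by
      rw [Finset.add_sum_erase _ (fun h => (d + 1) ^ J h) hh]; exact hw
    have hpos : 0 < (d + 1) ^ J h := by positivity
    have hQe : ∀ h' ∈ Q.erase h, ∀ p ∈ M, h' ≠ p.1 ∧ h' ≠ p.2 :=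
      fun h' hh' => hQ h' (Finset.mem_of_mem_erase hh')
    have hE₁ := ih₁ S H M hM hMa U hUa (Q.erase h) J hQe (by omega)
    rw [← hNdef] at hE₁
    simp only [← Finset.mul_prod_erase Q _ hh]
    rcases hJ : J h with _ | j
    · -- the message carries no information yet
      simp only [msg, density, one_mul]
      exact hE₁.trans (by gcongr)
    -- unfold the message into `h`
    set Z : S.Half → S.TannerGraph → Finset (Fin S.n) → ℝ := fun b T A =>
      ind (Holds T ((h, b) :: M)) * (((∏ u ∈ U, opn A u) * opn A (nd b)) *
        ((∏ h' ∈ Q.erase h, msg T A (J h') h') * ∏ h' with nd h' = nd b ∧ h' ≠ b, msg T A j h'))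
      with hZ
    set I : S.Half → ℝ := fun b => N⁻¹ ^ (M.length + 1) *
      (((∏ u ∈ U, opnProb ε u) * opnProb ε (nd b)) *
        ((∏ h' ∈ Q.erase h, density lam rho ε h'.isLeft (J h')) *
          density lam rho ε (!h.isLeft) j ^ (deg (nd b) - 1))) with hI
    have hE : S.expect ε (fun T A => ind (Holds T M) * ((∏ u ∈ U, opn A u) *
        (msg T A (j + 1) h * ∏ h' ∈ Q.erase h, msg T A (J h') h'))) =
        S.expect ε (fun T A => ind (Holds T M) * ((∏ u ∈ U, opn A u) *
          ∏ h' ∈ Q.erase h, msg T A (J h') h')) - ∑ b ∈ opposite h, S.expect ε (Z b) := by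
      rw [← map_sum, ← map_sub]
      congr 1
      funext T A
      rw [msg_succ_eq_sum]
      simp only [Pi.sub_apply, Finset.sum_apply, hZ, holds_cons, ind_and]
      rw [sub_mul, one_mul, mul_sub, mul_sub, Finset.sum_mul, Finset.mul_sum, Finset.mul_sum]
      congr 1
      exact Finset.sum_congr rfl fun b _ => by ring
    have hIsum : N⁻¹ ^ M.length * ((∏ u ∈ U, opnProb ε u) *
        (density lam rho ε h.isLeft (j + 1) *
          ∏ h' ∈ Q.erase h, density lam rho ε h'.isLeft (J h'))) =
        N⁻¹ ^ M.length * ((∏ u ∈ U, opnProb ε u) *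
          ∏ h' ∈ Q.erase h, density lam rho ε h'.isLeft (J h')) - ∑ b ∈ opposite h, I b := by
      have h1 : ∑ b ∈ opposite h, I b = N⁻¹ ^ (M.length + 1) * ((∏ u ∈ U, opnProb ε u) *
          ∏ h' ∈ Q.erase h, density lam rho ε h'.isLeft (J h')) *
          ∑ b ∈ opposite h, opnProb ε (nd b) *
            density lam rho ε (!h.isLeft) j ^ (deg (nd b) - 1) := by
        rw [Finset.mul_sum]
        exact Finset.sum_congr rfl fun b _ => by simp only [hI]; ring
      rw [h1, H.sum_density h j, pow_succ, ← hNdef]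
      field_simp
      ring
    rw [hE, hIsum]
    -- the nodes that a new edge should not lead to
    set Y : Finset S.Node := (M.map (fun p => nd p.1)).toFinset ∪ (M.map (fun p => nd p.2)).toFinset ∪
      Q.image nd ∪ U with hY
    have hYcard : Y.card ≤ 2 * a + (w + 1) + a := by
      have h1 := List.toFinset_card_le (M.map (fun p => nd p.1))
      have h2 := List.toFinset_card_le (M.map (fun p => nd p.2))
      rw [List.length_map] at h1 h2
      have h3 : (Q.image nd).card ≤ w + 1 := by
        refine Finset.card_image_le.trans (le_trans ?_ hw)
        rw [Finset.card_eq_sum_ones]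
        exact Finset.sum_le_sum fun _ _ => Nat.one_le_pow _ _ (by omega)
      have h4 := Finset.card_union_le ((M.map (fun p => nd p.1)).toFinset ∪
        (M.map (fun p => nd p.2)).toFinset ∪ Q.image nd) U
      have h5 := Finset.card_union_le ((M.map (fun p => nd p.1)).toFinset ∪
        (M.map (fun p => nd p.2)).toFinset) (Q.image nd)
      have h6 := Finset.card_union_le (M.map (fun p => nd p.1)).toFinset
        (M.map (fun p => nd p.2)).toFinset
      rw [hY]
      omega
    have hhM : ∀ p ∈ M, h ≠ p.1 ∧ h ≠ p.2 := hQ h hh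
    have hU1 := prod_mem_Icc U (fun u _ => opnProb_mem hε u)
    have hQ1 := prod_mem_Icc (Q.erase h) (fun h' _ => H.density_mem hε (J h') h'.isLeft)
    have hI1 : ∀ b, 0 ≤ I b ∧ I b ≤ 1 / N ^ (M.length + 1) := by
      intro b
      have := mul_mem_Icc (mul_mem_Icc hU1 (opnProb_mem hε (nd b))) (mul_mem_Icc hQ1
        (show density lam rho ε (!h.isLeft) j ^ (deg (nd b) - 1) ∈ Set.Icc (0 : ℝ) 1 from
          ⟨pow_nonneg (H.density_mem hε j _).1 _,
            pow_le_one₀ (H.density_mem hε j _).1 (H.density_mem hε j _).2⟩))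
      simp only [hI, inv_pow, one_div]
      exact ⟨mul_nonneg (by positivity) this.1, mul_le_of_le_one_right (by positivity) this.2⟩
    -- a new edge that leads to a known node
    have hbad : ∀ b ∈ opposite h, |S.expect ε (Z b) - I b| ≤
        (2 + matchConst (a + 1)) / N ^ (M.length + 1) := by
      intro b hb
      have hZ0 : 0 ≤ S.expect ε (Z b) := expect_nonneg hε fun T A => by
        have := mul_mem_Icc (mul_mem_Icc (prod_mem_Icc U (fun u _ => opn_mem A u)) (opn_mem A (nd b)))
          (mul_mem_Icc (prod_mem_Icc (Q.erase h) (fun h' _ => msg_mem T A (J h') h'))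
            (prod_mem_Icc {h' | nd h' = nd b ∧ h' ≠ b} (fun h' _ => msg_mem T A j h')))
        exact mul_nonneg (ind_nonneg _) this.1
      have hZ1 : S.expect ε (Z b) ≤ S.matchProb ((h, b) :: M) := by
        rw [← expect_holds ε]
        refine expect_mono hε fun T A => ?_
        have := mul_mem_Icc (mul_mem_Icc (prod_mem_Icc U (fun u _ => opn_mem A u)) (opn_mem A (nd b)))
          (mul_mem_Icc (prod_mem_Icc (Q.erase h) (fun h' _ => msg_mem T A (J h') h'))
            (prod_mem_Icc {h' | nd h' = nd b ∧ h' ≠ b} (fun h' _ => msg_mem T A j h')))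
        exact mul_le_of_le_one_right (ind_nonneg _) this.2
      have hZ2 : S.matchProb ((h, b) :: M) ≤ (1 + matchConst (a + 1)) / N ^ (M.length + 1) := by
        by_cases hbM : ∀ p ∈ M, b ≠ p.1 ∧ b ≠ p.2
        · have h1 := (Matching.cons hhM hbM (mem_opposite.1 hb) hM).prob_le H.pos
          refine h1.trans ?_
          rw [List.length_cons]
          have := matchConst_mono (show M.length + 1 ≤ a + 1 by omega)
          gcongr
        · have h1 : ∀ T : S.TannerGraph, ¬ Holds T ((h, b) :: M) := by
            intro T hT
            rw [holds_cons] at hT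
            apply hbM
            intro p hp
            have h2 := hT.2 p hp
            refine ⟨fun hb => (hhM p hp).2 ?_, fun hb => (hhM p hp).1 ?_⟩
            · rw [← h2, ← hb, ← hT.1, mate_mate]
            · exact mate_injective T (by rw [h2, hT.1, hb])
          have h2 : S.matchProb ((h, b) :: M) = 0 := by simp [matchProb, ind, h1]
          rw [h2]
          positivity
      rw [abs_le]
      have h3 := (hI1 b).2
      rw [show (2 + matchConst (a + 1)) / N ^ (M.length + 1) =
        (1 + matchConst (a + 1)) / N ^ (M.length + 1) + 1 / N ^ (M.length + 1) by
          rw [← add_div]; ring]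
      have h4 : 0 ≤ (1 + matchConst (a + 1)) / N ^ (M.length + 1) := by positivity
      have h5 : 0 ≤ 1 / N ^ (M.length + 1) := by positivity
      have h6 := (hI1 b).1
      constructor <;> linarith
    -- a new edge that leads to a new node
    have hgood : ∀ b ∈ opposite h, nd b ∉ Y → |S.expect ε (Z b) - I b| ≤
        C₂ / N ^ (M.length + 1 + 1) := by
      intro b hb hbY
      simp only [hY, Finset.mem_union, List.mem_toFinset, List.mem_map, Finset.mem_image,
        not_or, not_exists, not_and] at hbY
      obtain ⟨⟨⟨hy1, hy2⟩, hy3⟩, hy4⟩ := hbY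
      have hbM : ∀ p ∈ M, b ≠ p.1 ∧ b ≠ p.2 := fun p hp =>
        ⟨fun h => hy1 p hp (by rw [h]), fun h => hy2 p hp (by rw [h])⟩
      have hdisj : Disjoint (Q.erase h) ({h' | nd h' = nd b ∧ h' ≠ b} : Finset S.Half) := by
        rw [Finset.disjoint_left]
        intro h' h1 h2
        exact hy3 h' (Finset.mem_of_mem_erase h1) (Finset.mem_filter.1 h2).2.1
      have hJ1 : ∀ h' ∈ Q.erase h, (if nd h' = nd b then j else J h') = J h' := fun h' h1 =>
        if_neg (hy3 h' (Finset.mem_of_mem_erase h1))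
      have hJ2 : ∀ h' ∈ ({h' | nd h' = nd b ∧ h' ≠ b} : Finset S.Half),
          (if nd h' = nd b then j else J h') = j := fun h' h1 => if_pos (Finset.mem_filter.1 h1).2.1
      have key := ih₂ S H ((h, b) :: M) (Matching.cons hhM hbM (mem_opposite.1 hb) hM)
        (by rw [List.length_cons]; omega) (insert (nd b) U)
        (by rw [Finset.card_insert_of_notMem hy4]; omega)
        (Q.erase h ∪ ({h' | nd h' = nd b ∧ h' ≠ b} : Finset S.Half)) (fun h' => if nd h' = nd b then j else J h')
        (by
          intro h' h1 p hp
          rcases Finset.mem_union.1 h1 with h1 | h1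
          · rcases List.mem_cons.1 hp with rfl | hp
            · exact ⟨Finset.ne_of_mem_erase h1, fun hb => hy3 h' (Finset.mem_of_mem_erase h1)
                (by rw [hb])⟩
            · exact hQe h' h1 p hp
          · have h2 := (Finset.mem_filter.1 h1).2
            rcases List.mem_cons.1 hp with rfl | hp
            · exact ⟨fun hb => hy3 h hh (by rw [← h2.1, hb]), h2.2⟩
            · exact ⟨fun hb => hy1 p hp (by rw [← h2.1, hb]),
                fun hb => hy2 p hp (by rw [← h2.1, hb])⟩)
        (by
          rw [Finset.sum_union hdisj, Finset.sum_congr rfl fun h' h1 => by rw [hJ1 h' h1],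
            Finset.sum_congr (s₁ := ({h' | nd h' = nd b ∧ h' ≠ b} : Finset S.Half)) rfl
              fun h' h1 => by rw [hJ2 h' h1], Finset.sum_const, card_others, smul_eq_mul]
          rw [hJ, pow_succ] at hw'
          have h1 : (deg (nd b) - 1) * (d + 1) ^ j ≤ d * (d + 1) ^ j :=
            Nat.mul_le_mul_right _ (by have := H.deg_le (nd b); omega)
          have h2 : 0 < (d + 1) ^ j := by positivity
          nlinarith)
      have hmsg : ∀ T A, ∏ h' ∈ Q.erase h ∪ ({h' | nd h' = nd b ∧ h' ≠ b} : Finset S.Half),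
          msg T A (if nd h' = nd b then j else J h') h' =
          (∏ h' ∈ Q.erase h, msg T A (J h') h') * ∏ h' with nd h' = nd b ∧ h' ≠ b, msg T A j h' := by
        intro T A
        rw [Finset.prod_union hdisj]
        exact congrArg₂ _ (Finset.prod_congr rfl fun h' h1 => by rw [hJ1 h' h1])
          (Finset.prod_congr rfl fun h' h1 => by rw [hJ2 h' h1])
      have hdens : ∏ h' ∈ Q.erase h ∪ ({h' | nd h' = nd b ∧ h' ≠ b} : Finset S.Half),
          density lam rho ε h'.isLeft (if nd h' = nd b then j else J h') =
          (∏ h' ∈ Q.erase h, density lam rho ε h'.isLeft (J h')) *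
            density lam rho ε (!h.isLeft) j ^ (deg (nd b) - 1) := by
        rw [Finset.prod_union hdisj, ← card_others, ← Finset.prod_const]
        refine congrArg₂ _ (Finset.prod_congr rfl fun h' h1 => by rw [hJ1 h' h1])
          (Finset.prod_congr rfl fun h' h1 => ?_)
        rw [hJ2 h' h1, ← isLeft_nd, (Finset.mem_filter.1 h1).2.1, isLeft_nd, mem_opposite.1 hb]
      simp only [hmsg, hdens, Finset.prod_insert hy4, List.length_cons] at key
      simp only [hZ, hI]
      simp only [mul_comm (∏ u ∈ U, _) (opn _ _), mul_comm (∏ u ∈ U, _) (opnProb _ _)]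
      exact key
    have hsum : ∑ b ∈ opposite h, |S.expect ε (Z b) - I b| ≤
        C₂ / N ^ (M.length + 1) +
          (2 + matchConst (a + 1)) * (d * (2 * a + (w + 1) + a) : ℕ) / N ^ (M.length + 1) := by
      rw [← Finset.sum_filter_add_sum_filter_not (opposite h) (fun b => nd b ∉ Y)]
      apply add_le_add
      · refine (Finset.sum_le_sum fun b hb => hgood b (Finset.mem_filter.1 hb).1
          (Finset.mem_filter.1 hb).2).trans ?_
        rw [Finset.sum_const, nsmul_eq_mul]
        have h1 : (((opposite h).filter fun b => nd b ∉ Y).card : ℝ) ≤ N := by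
          rw [hNdef, ← card_opposite h]
          exact_mod_cast Finset.card_filter_le _ _
        calc _ ≤ N * (C₂ / N ^ (M.length + 1 + 1)) := by gcongr
          _ = _ := by rw [pow_succ N (M.length + 1)]; field_simp
      · refine (Finset.sum_le_sum fun b hb => hbad b (Finset.mem_filter.1 hb).1).trans ?_
        rw [Finset.sum_const, nsmul_eq_mul, mul_comm (2 + _) ((_ : ℕ) : ℝ), mul_div_assoc]
        have h1 : ((opposite h).filter fun b => ¬ nd b ∉ Y).card ≤ d * (2 * a + (w + 1) + a) := by
          refine le_trans (Finset.card_le_card ?_) ((H.card_nd_mem_le Y).trans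
            (Nat.mul_le_mul_left d hYcard))
          intro b hb
          have := (Finset.mem_filter.1 hb).2
          simpa using this
        gcongr
    rw [show ∀ x y x' y' : ℝ, x - y - (x' - y') = (x - x') - (y - y') by intros; ring,
      ← Finset.sum_sub_distrib]
    refine (abs_sub _ _).trans ?_
    refine (add_le_add hE₁ ((Finset.abs_sum_le_sum_abs _ _).trans hsum)).trans ?_
    rw [← add_div, ← add_div]
    refine div_le_div_of_nonneg_right ?_ (by positivity)
    linarith

end

/-! ### Degree distributions -/

section

/-- The generating function of the numbers of choices of `k` sockets in a given order. -/
theorem sum_descFactorial {ι : Type*} [Fintype ι] (D : ι → ℕ) (P : ℝ[X]) (c : ℝ)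
    (h : ∀ i, ((Finset.univ.filter fun y => D y = i).card : ℝ) = c * P.coeff i) (k : ℕ) (x : ℝ) :
    ∑ y, ((D y).descFactorial k : ℝ) * x ^ (D y - k) =
      c * (Polynomial.derivative^[k] P).eval x := by
  classical
  have hD : ∀ y ∈ (Finset.univ : Finset ι), D y ∈ Finset.range (P.natDegree + 1) := by
    intro y _
    rw [Finset.mem_range, Nat.lt_succ_iff]
    refine Polynomial.le_natDegree_of_ne_zero fun h0 => ?_
    have h1 := h (D y)
    rw [h0, mul_zero, Nat.cast_eq_zero, Finset.card_eq_zero] at h1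
    exact Finset.notMem_empty y (h1 ▸ Finset.mem_filter.2 ⟨Finset.mem_univ y, rfl⟩)
  rw [← Finset.sum_fiberwise_of_maps_to hD]
  conv_rhs => rw [P.as_sum_range_C_mul_X_pow]
  rw [Polynomial.iterate_derivative_sum, Polynomial.eval_finsetSum, Finset.mul_sum]
  refine Finset.sum_congr rfl fun i _ => ?_
  rw [Finset.sum_congr rfl (g := fun _ => ((i.descFactorial k : ℝ) * x ^ (i - k)))
    (fun y hy => by rw [(Finset.mem_filter.1 hy).2]), Finset.sum_const, nsmul_eq_mul, h,
    Polynomial.iterate_derivative_C_mul, Polynomial.iterate_derivative_X_pow_eq_natCast_mul]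
  simp
  ring

variable {S : Sockets} {L R : ℝ[X]}

theorem iterate_derivative_edgePerspective (L : ℝ[X]) (κ : ℕ) (x : ℝ) :
    (Polynomial.derivative^[κ] (edgePerspective L)).eval x =
      (L.derivative.eval 1)⁻¹ * (Polynomial.derivative^[κ + 1] L).eval x := by
  rw [edgePerspective, Polynomial.iterate_derivative_C_mul, Polynomial.eval_mul, Polynomial.eval_C,
    Function.iterate_succ_apply]

theorem HasDegreeDistributions.card_eq_var (h : S.HasDegreeDistributions L R) :
    (Fintype.card S.VSocket : ℝ) = S.n * L.derivative.eval 1 := by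
  have := sum_descFactorial S.varDeg L S.n h.var 1 1
  simp only [Nat.descFactorial_one, one_pow, mul_one, Function.iterate_one] at this
  rw [← this]
  simp

theorem HasDegreeDistributions.card_eq_chk (h : S.HasDegreeDistributions L R) :
    (Fintype.card S.VSocket : ℝ) = S.m * R.derivative.eval 1 := by
  have := sum_descFactorial S.chkDeg R S.m h.chk 1 1
  simp only [Nat.descFactorial_one, one_pow, mul_one, Function.iterate_one] at this
  rw [← this, card_VSocket]
  simp

theorem n_le_card (S : Sockets) : S.n ≤ Fintype.card S.VSocket := by
  calc S.n = ∑ _v : Fin S.n, 1 := by simp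
    _ ≤ ∑ v, S.varDeg v := Finset.sum_le_sum fun v _ => S.varDeg_pos v
    _ = _ := by simp

theorem m_le_card (S : Sockets) : S.m ≤ Fintype.card S.VSocket := by
  calc S.m = ∑ _v : Fin S.m, 1 := by simp
    _ ≤ ∑ v, S.chkDeg v := Finset.sum_le_sum fun v _ => S.chkDeg_pos v
    _ = _ := by simp [S.sum_eq]

theorem HasDegreeDistributions.model (h : S.HasDegreeDistributions L R) (hn : 0 < S.n) :
    Model S (edgePerspective L) (edgePerspective R) (max L.natDegree R.natDegree) := by
  have hN : 0 < Fintype.card S.VSocket := hn.trans_le S.n_le_card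
  have hN' : (Fintype.card S.VSocket : ℝ) ≠ 0 := by exact_mod_cast hN.ne'
  have hle : ∀ {k : ℕ} {D : Fin k → ℕ} {P : ℝ[X]},
      (∀ i, ((Finset.univ.filter fun y => D y = i).card : ℝ) = k * P.coeff i) →
      ∀ y, D y ≤ P.natDegree := by
    intro k D P h y
    refine Polynomial.le_natDegree_of_ne_zero fun h0 => ?_
    have h1 := h (D y)
    rw [h0, mul_zero, Nat.cast_eq_zero, Finset.card_eq_zero] at h1
    exact Finset.notMem_empty y (h1 ▸ Finset.mem_filter.2 ⟨Finset.mem_univ y, rfl⟩)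
  refine ⟨hN, fun x => ?_, fun b κ x => ?_⟩
  · rcases x with v | c
    · exact (hle h.var v).trans (le_max_left _ _)
    · exact (hle h.chk c).trans (le_max_right _ _)
  · rw [Finset.sum_filter, Fintype.sum_sum_type]
    cases b
    · simp only [Sum.isLeft_inl, Sum.isLeft_inr, Bool.true_eq_false, if_false, if_true,
        Bool.false_eq_true, Finset.sum_const_zero, zero_add]
      rw [iterate_derivative_edgePerspective, h.card_eq_chk]
      rw [h.card_eq_chk] at hN'
      have h2 := right_ne_zero_of_mul hN'
      refine (sum_descFactorial S.chkDeg R S.m h.chk (κ + 1) x).trans ?_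
      field_simp
    · simp only [Sum.isLeft_inl, Sum.isLeft_inr, Bool.false_eq_true, if_false, if_true,
        Finset.sum_const_zero, add_zero]
      rw [iterate_derivative_edgePerspective, h.card_eq_var]
      rw [h.card_eq_var] at hN'
      have h2 := right_ne_zero_of_mul hN'
      refine (sum_descFactorial S.varDeg L S.n h.var (κ + 1) x).trans ?_
      field_simp

theorem HasDegreeDistributions.eval_one (h : S.HasDegreeDistributions L R) (hn : 0 < S.n) :
    (edgePerspective L).eval 1 = 1 := by
  have hN' : (Fintype.card S.VSocket : ℝ) ≠ 0 := by exact_mod_cast (hn.trans_le S.n_le_card).ne'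
  rw [h.card_eq_var] at hN'
  rw [edgePerspective, Polynomial.eval_mul, Polynomial.eval_C]
  exact inv_mul_cancel₀ (right_ne_zero_of_mul hN')

variable {lam rho : ℝ[X]} {d : ℕ}

/-- If no variable node has two sockets then none has three. -/
theorem Model.second_derivative_eq_zero (H : Model S lam rho d)
    (h : lam.derivative.eval 1 = 0) : lam.derivative.derivative.eval 1 = 0 := by
  have hN : (Fintype.card S.VSocket : ℝ) ≠ 0 := by exact_mod_cast H.pos.ne'
  have h1 := H.sum true 1 1
  have h2 := H.sum true 2 1
  simp only [if_true, Function.iterate_succ, Function.iterate_zero,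
    Function.comp_apply, id_eq, h, mul_zero, one_pow, mul_one] at h1 h2
  rw [Finset.sum_eq_zero_iff_of_nonneg (fun _ _ => by positivity)] at h1
  rw [Finset.sum_eq_zero] at h2
  · exact (mul_eq_zero.1 h2.symm).resolve_left hN
  · intro y hy
    have := h1 y hy
    rw [Nat.cast_eq_zero, Nat.descFactorial_eq_zero_iff_lt] at this ⊢
    omega

end

/-! ### The expected number of lassos -/

section

variable {S : Sockets} {lam rho : ℝ[X]} {d : ℕ} {ε : ℝ} {r ℓ : ℕ}

variable (S) in
/-- The expected sum of a function `W` of the node variables over all the lassos with `r` edges,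
starting at any node, whose cycle starts at the `ℓ`-th node. -/
def lassoSum (ε : ℝ) (r ℓ : ℕ) : ((ℕ → ℕ → ℝ) → ℝ) →ₗ[ℝ] ℝ where
  toFun W := ∑ out : Fin r → S.Half, S.expect ε fun T A =>
    ind (IsLasso r ℓ (walkEnds T out)) * W (nodeVar T A (walkEnds T out))
  map_add' W W' := by
    rw [← Finset.sum_add_distrib]
    refine Finset.sum_congr rfl fun out _ => ?_
    rw [← map_add]
    congr 1
    funext T A
    simp [mul_add]
  map_smul' c W := by
    rw [smul_eq_mul, Finset.mul_sum]
    refine Finset.sum_congr rfl fun out _ => ?_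
    rw [← smul_eq_mul, ← map_smul]
    congr 1
    funext T A
    simp only [Pi.smul_apply, smul_eq_mul, RingHom.id_apply]
    ring

theorem lassoSum_apply (W : (ℕ → ℕ → ℝ) → ℝ) : S.lassoSum ε r ℓ W =
    ∑ out : Fin r → S.Half, S.expect ε fun T A =>
      ind (IsLasso r ℓ (walkEnds T out)) * W (nodeVar T A (walkEnds T out)) := rfl

/-- the edges of a lasso -/
def endPairs (P : Fin r × Bool → S.Half) : List (S.Half × S.Half) :=
  (List.finRange r).map fun i => (P (i, false), P (i, true))

theorem length_endPairs (P : Fin r × Bool → S.Half) : (endPairs P).length = r := by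
  simp [endPairs]

theorem holds_endPairs {T : S.TannerGraph} {P : Fin r × Bool → S.Half} :
    Holds T (endPairs P) ↔ P = walkEnds T fun i => P (i, false) := by
  simp only [Holds, endPairs, List.mem_map, List.mem_finRange, true_and, forall_exists_index,
    forall_apply_eq_imp_iff]
  constructor
  · intro h
    funext ⟨i, b⟩
    cases b
    · simp [walkEnds]
    · simp [walkEnds, h]
  · intro h i
    conv_rhs => rw [h]
    simp [walkEnds]

theorem sum_ind_holds_endPairs (T : S.TannerGraph) (F : (Fin r × Bool → S.Half) → ℝ) :
    ∑ P, ind (Holds T (endPairs P)) * F P = ∑ out : Fin r → S.Half, F (walkEnds T out) := by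
  classical
  have hinj : Function.Injective fun out : Fin r → S.Half => walkEnds T out := by
    intro o o' h
    funext i
    simpa [walkEnds] using congrFun h (i, false)
  rw [← Finset.sum_image (s := Finset.univ) (g := fun out : Fin r → S.Half => walkEnds T out)
    (f := F) (fun _ _ _ _ h => hinj h)]
  simp only [ind, ite_mul, one_mul, zero_mul]
  rw [← Finset.sum_filter]
  refine Finset.sum_congr ?_ fun _ _ => rfl
  ext P
  simp only [Finset.mem_filter, Finset.mem_univ, true_and, Finset.mem_image, holds_endPairs]
  constructor
  · intro h
    exact ⟨_, h.symm⟩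
  · rintro ⟨out, rfl⟩
    simp [walkEnds]

theorem lassoSum_eq (W : (ℕ → ℕ → ℝ) → ℝ) : S.lassoSum ε r ℓ W =
    ∑ P : Fin r × Bool → S.Half, ind (IsLasso r ℓ P) *
      S.expect ε fun T A => ind (Holds T (endPairs P)) * W (nodeVar T A P) := by
  rw [lassoSum_apply, ← map_sum]
  simp only [← smul_eq_mul, ← map_smul]
  rw [← map_sum]
  congr 1
  funext T A
  simp only [Finset.sum_apply, Pi.smul_apply, smul_eq_mul]
  rw [← sum_ind_holds_endPairs T fun P => ind (IsLasso r ℓ P) * W (nodeVar T A P)]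
  exact Finset.sum_congr rfl fun P _ => by ring

/-- The number of half-edges of a lasso at its `i`-th node. -/
def endCount (ℓ i : ℕ) : ℕ := (if i = 0 then 0 else 1) + (if i = ℓ then 1 else 0) + 1

theorem endPos_lt (hℓ : ℓ < r) (a : Fin r × Bool) : endPos r ℓ a < r := by
  simp only [endPos]
  have := a.1.2
  split_ifs <;> omega

open Classical in
theorem card_endPos (hℓ : ℓ + 1 < r) {i : ℕ} (hi : i < r) :
    ({a | endPos r ℓ a = i} : Finset (Fin r × Bool)).card = endCount ℓ i := by
  have h : ({a | endPos r ℓ a = i} : Finset (Fin r × Bool)) = insert (⟨i, hi⟩, false)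
      ((if i = 0 then ∅ else {(⟨i - 1, by omega⟩, true)}) ∪
        (if i = ℓ then {(⟨r - 1, by omega⟩, true)} else ∅)) := by
    ext b
    have e1 : (∃ h : 0 < i, b = (⟨i - 1, by omega⟩, true)) ↔
        i ≠ 0 ∧ b = (⟨i - 1, by omega⟩, true) :=
      ⟨fun ⟨h, e⟩ => ⟨h.ne', e⟩, fun ⟨h, e⟩ => ⟨Nat.pos_of_ne_zero h, e⟩⟩
    rw [Finset.mem_filter, endPos_ends hi b hℓ, e1]
    simp only [Finset.mem_insert, Finset.mem_union, Finset.mem_univ, true_and]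
    split_ifs with h0 h1 h1 <;> simp only [Finset.notMem_empty, Finset.mem_singleton] <;> tauto
  rw [h, Finset.card_insert_of_notMem (by split_ifs <;> simp), Finset.card_union_of_disjoint, endCount]
  · split_ifs <;> simp
  · rw [Finset.disjoint_left]
    intro b hb hb'
    split_ifs at hb hb' <;> simp at hb hb'
    rw [hb] at hb'
    simp only [Prod.mk.injEq, Fin.mk.injEq, and_true] at hb'
    omega

section
variable {P : Fin r × Bool → S.Half}

theorem IsLasso.side_node (hP : IsLasso r ℓ P) (i : Fin r) :
    (nd (P (i, false))).isLeft = decide (Even i.1) := by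
  rw [isLeft_nd, hP.side]
  simp [endPos]

theorem IsLasso.node_injective (hP : IsLasso r ℓ P) :
    Function.Injective fun i : Fin r => nd (P (i, false)) := by
  intro i j h
  have := (hP.nd_eq_iff _ _).1 h
  simpa [endPos, Fin.ext_iff] using this

theorem IsLasso.matching (hpar : Even (r + ℓ)) (hP : IsLasso r ℓ P) :
    Matching (endPairs P) := by
  have key : ∀ l : List (Fin r), l.Nodup →
      Matching (l.map fun i => (P (i, false), P (i, true))) := by
    intro l
    induction l with
    | nil => intro _; exact Matching.nil
    | cons i l ih =>
      intro hl
      obtain ⟨hi, hl⟩ := List.nodup_cons.1 hl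
      refine Matching.cons ?_ ?_ ?_ (ih hl)
      · simp only [List.mem_map, forall_exists_index, and_imp]
        rintro p j hj rfl
        refine ⟨fun h => ?_, fun h => ?_⟩
        · have := hP.inj h
          simp only [Prod.mk.injEq, and_true] at this
          exact hi (this ▸ hj)
        · simpa using hP.inj h
      · simp only [List.mem_map, forall_exists_index, and_imp]
        rintro p j hj rfl
        refine ⟨fun h => ?_, fun h => ?_⟩
        · simpa using hP.inj h
        · have := hP.inj h
          simp only [Prod.mk.injEq, and_true] at this
          exact hi (this ▸ hj)
      · rw [hP.side, hP.side]
        simp only [endPos, if_true, Bool.false_eq_true, if_false]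
        split_ifs with h
        · rw [← decide_not]
          exact decide_eq_decide.2 Nat.even_add_one
        · have h1 : i.1 + 1 = r := by have := i.2; omega
          have h2 : Even ℓ ↔ ¬ Even i.1 := by
            rw [← h1, Nat.even_add, Nat.even_add_one] at hpar
            tauto
          rw [← decide_not]
          exact decide_eq_decide.2 h2
  exact key _ (List.nodup_finRange r)

open Classical in
theorem IsLasso.card_outside (hℓ : ℓ + 1 < r) (hP : IsLasso r ℓ P) (i : Fin r) :
    ({h | nd h = nd (P (i, false)) ∧ h ∉ Set.range P} : Finset S.Half).card =
      deg (nd (P (i, false))) - endCount ℓ i := by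
  rw [← card_nd_eq, ← card_endPos hℓ i.2, ← Finset.card_image_of_injective _ hP.inj,
    ← Finset.card_sdiff_of_subset]
  · congr 1
    ext h
    simp only [Finset.mem_filter, Finset.mem_univ, true_and, Finset.mem_sdiff, Finset.mem_image,
      Set.mem_range]
    refine and_congr_right fun h1 => not_congr ⟨fun ⟨a, ha⟩ => ⟨a, ?_, ha⟩, fun ⟨a, _, ha⟩ => ⟨a, ha⟩⟩
    have := (hP.nd_eq_iff a (i, false)).1 (by rw [ha, h1])
    simpa [endPos] using this
  · intro h
    simp only [Finset.mem_filter, Finset.mem_univ, true_and, Finset.mem_image]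
    rintro ⟨a, ha, rfl⟩
    exact (hP.nd_eq_iff _ _).2 (by simpa [endPos] using ha)

end

/-- The limit of the mean of the variable at time `J i` (if any) of the `i`-th node `y` of a
lasso, given that node. -/
def nodeWeight (lam rho : ℝ[X]) (ε : ℝ) (J : ℕ → Option ℕ) (ℓ i : ℕ) (y : S.Node) : ℝ :=
  (J i).elim 1 fun j => opnProb ε y * density lam rho ε y.isLeft j ^ (deg y - endCount ℓ i)

open Classical in
/-- The node variables of a given lasso are asymptotically independent. -/
theorem expect_monomial (lam rho : ℝ[X]) (hε : ε ∈ Set.Icc (0 : ℝ) 1) (d : ℕ) (hℓ : ℓ + 1 < r)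
    (hpar : Even (r + ℓ)) (J : ℕ → Option ℕ) :
    ∃ C : ℝ, 0 ≤ C ∧ ∀ S : Sockets, Model S lam rho d → ∀ P : Fin r × Bool → S.Half,
      IsLasso r ℓ P →
      |S.expect ε (fun T A => ind (Holds T (endPairs P)) * monomial r J (nodeVar T A P))
        - ((Fintype.card S.VSocket : ℝ)⁻¹) ^ r *
          ∏ i : Fin r, nodeWeight lam rho ε J ℓ i (nd (P (i, false)))| ≤
        C / (Fintype.card S.VSocket : ℝ) ^ (r + 1) := by
  obtain ⟨C, hC, h⟩ := expect_prod_msg lam rho hε d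
    (∑ i : Fin r, d * (d + 1) ^ (J i).getD 0) r
  refine ⟨C, hC, fun S H P hP => ?_⟩
  set x : Fin r → S.Node := fun i => nd (P (i, false)) with hx
  have hxi : Function.Injective x := hP.node_injective
  set I : Finset (Fin r) := {i | J i ≠ none} with hI
  set q : Fin r → Finset S.Half := fun i => {h | nd h = x i ∧ h ∉ Set.range P} with hq
  set J' : S.Half → ℕ := fun h => Function.extend x (fun i => (J i).getD 0) (fun _ => 0) (nd h)
    with hJ'
  have hJq : ∀ i, ∀ h ∈ q i, J' h = (J i).getD 0 := by
    intro i h hh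
    simp only [hJ', (Finset.mem_filter.1 hh).2.1]
    exact hxi.extend_apply _ _ _
  have hdisj : ∀ i ∈ I, ∀ j ∈ I, i ≠ j → Disjoint (q i) (q j) := by
    intro i _ j _ hij
    rw [Finset.disjoint_left]
    intro h h1 h2
    exact hij (hxi ((Finset.mem_filter.1 h1).2.1.symm.trans (Finset.mem_filter.1 h2).2.1))
  have key := h S H (endPairs P) (hP.matching hpar) (length_endPairs P).le (I.image x)
    (Finset.card_image_le.trans ((Finset.card_le_univ I).trans (by simp))) (I.biUnion q) J'
    (by
      intro h hh p hp
      obtain ⟨i, _, hi⟩ := Finset.mem_biUnion.1 hh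
      obtain ⟨k, _, rfl⟩ := List.mem_map.1 hp
      have := (Finset.mem_filter.1 hi).2.2
      exact ⟨fun e => this ⟨_, e.symm⟩, fun e => this ⟨_, e.symm⟩⟩)
    (by
      rw [Finset.sum_biUnion hdisj]
      refine (Finset.sum_le_sum fun i _ => ?_).trans
        (Finset.sum_le_sum_of_subset (Finset.subset_univ I))
      rw [Finset.sum_congr rfl fun h hh => by rw [hJq i h hh], Finset.sum_const, smul_eq_mul]
      refine Nat.mul_le_mul_right _ ?_
      rw [hq, hx]
      simp only
      rw [hP.card_outside hℓ]
      have := H.deg_le (nd (P (i, false)))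
      omega)
  rw [length_endPairs] at key
  have hfin : ∀ F : Fin r → ℕ → ℝ, ∏ i ∈ I, F i ((J i).getD 0) = ∏ i : Fin r, (J i).elim 1 (F i) := by
    intro F
    rw [hI, Finset.prod_filter]
    refine Finset.prod_congr rfl fun i _ => ?_
    rcases J i with _ | j <;> simp
  have hmon : ∀ T A, (∏ u ∈ I.image x, opn A u) * ∏ h ∈ I.biUnion q, msg T A (J' h) h =
      monomial r J (nodeVar T A P) := by
    intro T A
    rw [Finset.prod_image fun _ _ _ _ h => hxi h, Finset.prod_biUnion hdisj,
      ← Finset.prod_mul_distrib, monomial, ← Fin.prod_univ_eq_prod_range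
        (fun i => (J i).elim 1 (nodeVar T A P i))]
    rw [← hfin fun i j => nodeVar T A P i j]
    refine Finset.prod_congr rfl fun i _ => ?_
    rw [nodeVar, dif_pos i.2]
    refine congrArg₂ _ rfl (Finset.prod_congr rfl fun h hh => by rw [hJq i h hh])
  have hwt : (∏ u ∈ I.image x, opnProb ε u) *
      ∏ h ∈ I.biUnion q, density lam rho ε h.isLeft (J' h) =
      ∏ i : Fin r, nodeWeight lam rho ε J ℓ i (x i) := by
    rw [Finset.prod_image fun _ _ _ _ h => hxi h, Finset.prod_biUnion hdisj,
      ← Finset.prod_mul_distrib]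
    simp only [nodeWeight]
    rw [← hfin fun i j => opnProb ε (x i) * density lam rho ε (x i).isLeft j ^
      (deg (x i) - endCount ℓ i)]
    refine Finset.prod_congr rfl fun i _ => ?_
    congr 1
    rw [hx, ← hP.card_outside hℓ, ← Finset.prod_const]
    refine Finset.prod_congr rfl fun h hh => ?_
    rw [hJq i h hh, ← isLeft_nd, (Finset.mem_filter.1 hh).2.1]
  simp only [hmon, hwt] at key
  exact key

/-- Choosing the half-edges of a lasso, given its nodes. -/
def portsEquiv {α β ι κ : Type*} (pos : α → ι) (nd : β → κ) (x : ι → κ)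
    (hx : Function.Injective x) :
    {P : α → β // Function.Injective P ∧ ∀ a, nd (P a) = x (pos a)} ≃
      ∀ i, ({a // pos a = i} ↪ {h // nd h = x i}) where
  toFun P i := ⟨fun a => ⟨P.1 a.1, by rw [P.2.2, a.2]⟩, fun a b h =>
    Subtype.ext (P.2.1 (Subtype.ext_iff.1 h))⟩
  invFun f := ⟨fun a => (f (pos a) ⟨a, rfl⟩).1, by
    have key : ∀ i j (a b : α) (ha : pos a = i) (hb : pos b = j),
        (f i ⟨a, ha⟩).1 = (f j ⟨b, hb⟩).1 → a = b := by
      intro i j a b ha hb h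
      have hij : i = j := hx (by rw [← (f i ⟨a, ha⟩).2, ← (f j ⟨b, hb⟩).2, h])
      subst hij
      have := (f i).injective (Subtype.ext h)
      exact Subtype.ext_iff.1 this
    exact fun a b h => key _ _ a b rfl rfl h, fun a => (f (pos a) ⟨a, rfl⟩).2⟩
  left_inv P := rfl
  right_inv f := by
    funext i
    ext ⟨a, rfl⟩
    rfl

open Classical in
theorem card_ports (hℓ : ℓ + 1 < r) {x : Fin r → S.Node} (hx : Function.Injective x) :
    (({P | Function.Injective P ∧ ∀ a, nd (P a) = x ⟨endPos r ℓ a, endPos_lt (by omega) a⟩} :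
      Finset (Fin r × Bool → S.Half)).card : ℝ) =
      ∏ i, ((deg (x i)).descFactorial (endCount ℓ i) : ℝ) := by
  rw [← Fintype.card_subtype, Fintype.card_congr (portsEquiv
    (fun a : Fin r × Bool => (⟨endPos r ℓ a, endPos_lt (by omega) a⟩ : Fin r)) nd x hx),
    Fintype.card_pi, Nat.cast_prod]
  refine Finset.prod_congr rfl fun i _ => ?_
  rw [Fintype.card_embedding_eq, Fintype.card_subtype, card_nd_eq, Fintype.card_subtype]
  congr 2
  rw [← card_endPos hℓ i.2]
  congr 1
  ext a
  simp [Fin.ext_iff]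

open Classical in
theorem sum_isLasso (hℓ : ℓ + 1 < r) (G : (Fin r → S.Node) → ℝ) :
    ∑ P : Fin r × Bool → S.Half, ind (IsLasso r ℓ P) * G (fun i => nd (P (i, false))) =
      ∑ x ∈ Fintype.piFinset fun i : Fin r => ({y | y.isLeft = decide (Even i.1)} : Finset S.Node),
        ind (Function.Injective x) *
          ((∏ i, ((deg (x i)).descFactorial (endCount ℓ i) : ℝ)) * G x) := by
  rw [← Finset.sum_fiberwise Finset.univ
    (fun P : Fin r × Bool → S.Half => fun i : Fin r => nd (P (i, false))),
    ← Finset.sum_subset (Finset.subset_univ (Fintype.piFinset fun i : Fin r =>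
      ({y | y.isLeft = decide (Even i.1)} : Finset S.Node)))]
  · refine Finset.sum_congr rfl fun x hx => ?_
    rw [Finset.sum_congr rfl (g := fun P => ind (IsLasso r ℓ P) * G x) fun P hP => by
      rw [(Finset.mem_filter.1 hP).2], ← Finset.sum_mul, ← mul_assoc]
    congr 1
    rw [Fintype.mem_piFinset] at hx
    by_cases hxi : Function.Injective x
    · rw [← card_ports hℓ hxi, ind, if_pos hxi, one_mul, Finset.card_filter, Nat.cast_sum,
        Finset.sum_filter]
      refine Finset.sum_congr rfl fun P _ => ?_
      have : IsLasso r ℓ P ∧ (fun i => nd (P (i, false))) = x ↔ Function.Injective P ∧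
          ∀ a, nd (P a) = x ⟨endPos r ℓ a, endPos_lt (by omega) a⟩ := by
        constructor
        · rintro ⟨h, rfl⟩
          exact ⟨h.inj, fun a => h.nd_eq_start a _⟩
        · rintro ⟨h1, h2⟩
          refine ⟨⟨h1, fun a b => ?_, fun a => ?_⟩, ?_⟩
          · rw [h2, h2, hxi.eq_iff, Fin.mk.injEq]
          · rw [← isLeft_nd, h2]
            simpa using hx ⟨endPos r ℓ a, endPos_lt (by omega) a⟩
          · funext i
            rw [h2]
            congr 1
      by_cases h : IsLasso r ℓ P ∧ (fun i => nd (P (i, false))) = x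
      · rw [if_pos (this.1 h), if_pos h.2, ind, if_pos h.1, Nat.cast_one]
      · rw [if_neg fun h' => h (this.2 h'), Nat.cast_zero]
        by_cases h1 : (fun i => nd (P (i, false))) = x
        · rw [if_pos h1, ind, if_neg fun h2 => h ⟨h2, h1⟩]
        · rw [if_neg h1]
    · rw [ind, if_neg hxi, zero_mul]
      refine Finset.sum_eq_zero fun P hP => ?_
      rw [ind, if_neg]
      intro h
      exact hxi ((Finset.mem_filter.1 hP).2 ▸ h.node_injective)
  · intro x _ hx
    refine Finset.sum_eq_zero fun P hP => ?_
    rw [ind, if_neg, zero_mul]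
    intro h
    apply hx
    rw [Fintype.mem_piFinset]
    intro i
    rw [← (Finset.mem_filter.1 hP).2]
    simpa using h.side_node i

theorem card_node_le (S : Sockets) :
    (Fintype.card S.Node : ℝ) ≤ 2 * Fintype.card S.VSocket := by
  have h1 : (S.n : ℝ) ≤ Fintype.card S.VSocket := by exact_mod_cast S.n_le_card
  have h2 : (S.m : ℝ) ≤ Fintype.card S.VSocket := by exact_mod_cast S.m_le_card
  have h3 : (Fintype.card S.Node : ℝ) = S.n + S.m := by simp
  linarith

open Classical in
/-- Most sequences of nodes have distinct members. -/
theorem card_not_injective {ι : Type*} [Fintype ι] (r : ℕ) :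
    ({x | ¬ Function.Injective x} : Finset (Fin (r + 1) → ι)).card ≤
      (r + 1) ^ 2 * Fintype.card ι ^ r := by
  have h1 : ({x | ¬ Function.Injective x} : Finset (Fin (r + 1) → ι)) ⊆
      (Finset.univ : Finset (Fin (r + 1) × Fin (r + 1))).biUnion fun p =>
        if p.1 ≠ p.2 then ({x | x p.1 = x p.2} : Finset (Fin (r + 1) → ι)) else ∅ := by
    intro x hx
    simp only [Finset.mem_filter, Finset.mem_univ, true_and, Function.Injective, not_forall] at hx
    obtain ⟨i, j, h, hij⟩ := hx
    simp only [Finset.mem_biUnion, Finset.mem_univ, true_and, Prod.exists]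
    refine ⟨i, j, ?_⟩
    rw [if_pos hij]
    simpa using h
  refine (Finset.card_le_card h1).trans (Finset.card_biUnion_le.trans ?_)
  refine (Finset.sum_le_card_nsmul _ _ (Fintype.card ι ^ r) fun p _ => ?_).trans ?_
  · split_ifs with hp
    · rw [show Fintype.card ι ^ r = Fintype.card (Fin r → ι) by simp, ← Finset.card_univ]
      refine Finset.card_le_card_of_injOn (fun x k => x (p.2.succAbove k))
        (fun _ _ => Finset.mem_coe.2 (Finset.mem_univ _))
        fun x hx y hy h => ?_
      simp only [Finset.coe_filter, Finset.mem_univ, true_and, Set.mem_ofPred_eq] at hx hy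
      have h' : ∀ k, k ≠ p.2 → x k = y k := by
        intro k hk
        obtain ⟨k', rfl⟩ := Fin.exists_succAbove_eq hk
        exact congrFun h k'
      funext k
      by_cases hk : k = p.2
      · rw [hk, ← hx, ← hy, h' _ hp]
      · exact h' k hk
    · simp
  · simp [sq]

theorem nodeWeight_mem (H : Model S lam rho d) (hε : ε ∈ Set.Icc (0 : ℝ) 1) (J : ℕ → Option ℕ)
    (ℓ i : ℕ) (y : S.Node) : nodeWeight lam rho ε J ℓ i y ∈ Set.Icc (0 : ℝ) 1 := by
  rw [nodeWeight]
  rcases J i with _ | j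
  · simp
  · have h := H.density_mem hε j y.isLeft
    exact mul_mem_Icc (opnProb_mem hε y) ⟨pow_nonneg h.1 _, pow_le_one₀ h.1 h.2⟩

theorem Model.sum_nodeWeight (H : Model S lam rho d) (J : ℕ → Option ℕ) (ℓ i : ℕ) :
    ∑ y : S.Node with y.isLeft = decide (Even i), ((deg y).descFactorial (endCount ℓ i) : ℝ) *
        nodeWeight lam rho ε J ℓ i y =
      Fintype.card S.VSocket * ((nodePoly lam rho ℓ i).eval 1 *
        (J i).elim 1 (nodeMean lam rho ε ℓ i)) := by
  have hsum : ∀ x : ℝ, ∑ y : S.Node with y.isLeft = decide (Even i),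
      ((deg y).descFactorial (endCount ℓ i) : ℝ) * x ^ (deg y - endCount ℓ i) =
      Fintype.card S.VSocket * (nodePoly lam rho ℓ i).eval x := by
    intro x
    have := H.sum (decide (Even i)) ((if i = 0 then 0 else 1) + (if i = ℓ then 1 else 0)) x
    simpa only [nodePoly, endCount, decide_eq_true_eq] using this
  rcases hJ : J i with _ | j
  · simpa [nodeWeight, hJ] using hsum 1
  · simp only [nodeWeight, hJ, Option.elim]
    have h1 := hsum (density lam rho ε (decide (Even i)) j)
    have h2 : (nodePoly lam rho ℓ i).eval 1 * nodeMean lam rho ε ℓ i j =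
        (if Even i then ε else 1) *
          (nodePoly lam rho ℓ i).eval (density lam rho ε (decide (Even i)) j) := by
      rw [nodeMean]
      by_cases h0 : (nodePoly lam rho ℓ i).eval 1 = 0
      · have hN : (Fintype.card S.VSocket : ℝ) ≠ 0 := by exact_mod_cast H.pos.ne'
        have h3 := hsum 1
        rw [h0, mul_zero, Finset.sum_eq_zero_iff_of_nonneg (fun _ _ => by positivity)] at h3
        rw [Finset.sum_eq_zero] at h1
        · rw [(mul_eq_zero.1 h1.symm).resolve_left hN, h0]; simp
        · intro y hy
          have := h3 y hy
          rw [one_pow, mul_one] at this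
          rw [this, zero_mul]
      · field_simp
    rw [h2, mul_left_comm, ← h1, Finset.mul_sum]
    refine Finset.sum_congr rfl fun y hy => ?_
    have hy' : y.isLeft = decide (Even i) := by simpa using hy
    have h3 : opnProb ε y = if Even i then ε else 1 := by
      rcases y with v | c
      · have : Even i := by simpa using hy'.symm
        simp [opnProb, this]
      · have : ¬ Even i := by simpa using hy'
        simp [opnProb, this]
    rw [hy', h3]
    ring

/-- The expected sums over lassos of products of node variables converge. -/
theorem lassoSum_monomial (lam rho : ℝ[X]) (hε : ε ∈ Set.Icc (0 : ℝ) 1) (d : ℕ) (hℓ : ℓ + 1 < r)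
    (hpar : Even (r + ℓ)) (J : ℕ → Option ℕ) :
    ∃ C : ℝ, ∀ S : Sockets, Model S lam rho d →
      |S.lassoSum ε r ℓ (monomial r J) -
        lassoCount lam rho ℓ r * monomial r J (nodeMean lam rho ε ℓ)| ≤
        C / Fintype.card S.VSocket := by
  classical
  obtain ⟨C, hC, h⟩ := expect_monomial lam rho hε d hℓ hpar J
  set D : ℝ := ∏ i : Fin r, (d : ℝ) ^ endCount ℓ i with hD
  have hD0 : 0 ≤ D := Finset.prod_nonneg fun i _ => by positivity
  obtain ⟨r, rfl⟩ : ∃ r', r = r' + 1 := ⟨r - 1, by omega⟩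
  refine ⟨2 ^ (r + 1) * D * C + D * ((r + 1) ^ 2 * 2 ^ r), fun S H => ?_⟩
  have hN : (0 : ℝ) < Fintype.card S.VSocket := by exact_mod_cast H.pos
  set N : ℝ := ((Fintype.card S.VSocket : ℕ) : ℝ) with hNdef
  set B := Fintype.piFinset fun i : Fin (r + 1) =>
    ({y | y.isLeft = decide (Even i.1)} : Finset S.Node) with hB
  have hdeg : ∀ x : Fin (r + 1) → S.Node,
      0 ≤ ∏ i, ((deg (x i)).descFactorial (endCount ℓ i) : ℝ) ∧
      ∏ i, ((deg (x i)).descFactorial (endCount ℓ i) : ℝ) ≤ D := by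
    intro x
    refine ⟨Finset.prod_nonneg fun i _ => by positivity,
      Finset.prod_le_prod (fun i _ => by positivity) fun i _ => ?_⟩
    exact_mod_cast (Nat.descFactorial_le_pow _ _).trans (Nat.pow_le_pow_left (H.deg_le _) _)
  have hcard : (Fintype.card (Fin (r + 1) → S.Node) : ℝ) ≤ 2 ^ (r + 1) * N ^ (r + 1) := by
    rw [Fintype.card_fun, Nat.cast_pow, Fintype.card_fin, ← mul_pow]
    exact pow_le_pow_left₀ (by positivity) S.card_node_le _
  -- the number of lassos that might occur
  have hcount : ∑ P : Fin (r + 1) × Bool → S.Half, ind (IsLasso (r + 1) ℓ P) ≤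
      2 ^ (r + 1) * N ^ (r + 1) * D := by
    have h1 := sum_isLasso (S := S) hℓ (fun _ => 1)
    simp only [mul_one] at h1
    rw [h1]
    calc _ ≤ ∑ x ∈ B, D := Finset.sum_le_sum fun x _ =>
          (mul_le_of_le_one_left (hdeg x).1 (ind_le_one _)).trans (hdeg x).2
      _ = B.card * D := by rw [Finset.sum_const, nsmul_eq_mul]
      _ ≤ _ := by
        refine mul_le_mul_of_nonneg_right (le_trans ?_ hcard) hD0
        exact_mod_cast Finset.card_le_univ B
  -- replace the expectations by products of means
  have hstep1 : |S.lassoSum ε (r + 1) ℓ (monomial (r + 1) J) -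
      ∑ P : Fin (r + 1) × Bool → S.Half, ind (IsLasso (r + 1) ℓ P) * (N⁻¹ ^ (r + 1) *
        ∏ i : Fin (r + 1), nodeWeight lam rho ε J ℓ i (nd (P (i, false))))| ≤
      2 ^ (r + 1) * D * C / N := by
    rw [lassoSum_eq, ← Finset.sum_sub_distrib]
    refine (Finset.abs_sum_le_sum_abs _ _).trans ?_
    calc _ ≤ ∑ P : Fin (r + 1) × Bool → S.Half,
          ind (IsLasso (r + 1) ℓ P) * (C / N ^ (r + 1 + 1)) := by
          refine Finset.sum_le_sum fun P _ => ?_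
          rw [← mul_sub, abs_mul, abs_of_nonneg (ind_nonneg _)]
          by_cases hP : IsLasso (r + 1) ℓ P
          · exact mul_le_mul_of_nonneg_left (h S H P hP) (ind_nonneg _)
          · simp [ind, hP]
      _ ≤ 2 ^ (r + 1) * N ^ (r + 1) * D * (C / N ^ (r + 1 + 1)) := by
          rw [← Finset.sum_mul]
          exact mul_le_mul_of_nonneg_right hcount (by positivity)
      _ = _ := by rw [pow_succ N (r + 1)]; field_simp
  -- sum over the nodes of the lasso, and drop the condition that they be distinct
  have hmain : lassoCount lam rho ℓ (r + 1) * monomial (r + 1) J (nodeMean lam rho ε ℓ) =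
      N⁻¹ ^ (r + 1) * ∑ x ∈ B, (∏ i, ((deg (x i)).descFactorial (endCount ℓ i) : ℝ)) *
        ∏ i : Fin (r + 1), nodeWeight lam rho ε J ℓ i (x i) := by
    simp only [← Finset.prod_mul_distrib]
    rw [hB, ← Finset.prod_univ_sum (fun i : Fin (r + 1) =>
      ({y | y.isLeft = decide (Even i.1)} : Finset S.Node)) (fun i y =>
        ((deg y).descFactorial (endCount ℓ i) : ℝ) * nodeWeight lam rho ε J ℓ i y)]
    rw [Finset.prod_congr rfl fun (i : Fin (r + 1)) _ => H.sum_nodeWeight (ε := ε) J ℓ i, Finset.prod_mul_distrib,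
      Finset.prod_const, Finset.card_univ, Fintype.card_fin, ← mul_assoc, ← hNdef, ← mul_pow,
      inv_mul_cancel₀ hN.ne', one_pow, one_mul, Fin.prod_univ_eq_prod_range (fun i =>
        (nodePoly lam rho ℓ i).eval 1 * (J i).elim 1 (nodeMean lam rho ε ℓ i)),
      Finset.prod_mul_distrib]
    rfl
  have hstep2 : |∑ P : Fin (r + 1) × Bool → S.Half, ind (IsLasso (r + 1) ℓ P) * (N⁻¹ ^ (r + 1) *
        ∏ i : Fin (r + 1), nodeWeight lam rho ε J ℓ i (nd (P (i, false)))) -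
      lassoCount lam rho ℓ (r + 1) * monomial (r + 1) J (nodeMean lam rho ε ℓ)| ≤
      D * ((r + 1) ^ 2 * 2 ^ r) / N := by
    rw [sum_isLasso hℓ (fun x => N⁻¹ ^ (r + 1) * ∏ i : Fin (r + 1), nodeWeight lam rho ε J ℓ i (x i)), hmain,
      Finset.mul_sum, ← Finset.sum_sub_distrib]
    refine (Finset.abs_sum_le_sum_abs _ _).trans ?_
    calc _ ≤ ∑ x ∈ B, (if ¬ Function.Injective x then N⁻¹ ^ (r + 1) * D else 0) := by
          refine Finset.sum_le_sum fun x _ => ?_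
          by_cases hx : Function.Injective x
          · rw [if_neg (not_not.2 hx), ind, if_pos hx]
            refine le_of_eq ?_
            rw [abs_eq_zero]
            ring
          · rw [if_pos hx, ind, if_neg hx, zero_mul, zero_sub, abs_neg]
            have h1 := prod_mem_Icc Finset.univ
              fun (i : Fin (r + 1)) _ => nodeWeight_mem H hε J ℓ i (x i)
            rw [abs_of_nonneg (mul_nonneg (by positivity) (mul_nonneg (hdeg x).1 h1.1))]
            refine mul_le_mul_of_nonneg_left ?_ (by positivity)
            exact (mul_le_of_le_one_right (hdeg x).1 h1.2).trans (hdeg x).2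
      _ ≤ ∑ x, (if ¬ Function.Injective x then N⁻¹ ^ (r + 1) * D else 0) :=
          Finset.sum_le_sum_of_subset_of_nonneg (Finset.subset_univ _) fun x _ _ => by
            split_ifs <;> positivity
      _ = ({x | ¬ Function.Injective x} : Finset (Fin (r + 1) → S.Node)).card *
          (N⁻¹ ^ (r + 1) * D) := by
          rw [← Finset.sum_filter, Finset.sum_const, nsmul_eq_mul]
      _ ≤ ((r + 1) ^ 2 * (2 * N) ^ r) * (N⁻¹ ^ (r + 1) * D) := by
          refine mul_le_mul_of_nonneg_right ?_ (by positivity)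
          have h1 : (({x | ¬ Function.Injective x} : Finset (Fin (r + 1) → S.Node)).card : ℝ) ≤
              (r + 1) ^ 2 * (Fintype.card S.Node : ℝ) ^ r := by
            have h0 : ({x | ¬ Function.Injective x} : Finset (Fin (r + 1) → S.Node)).card ≤
                (r + 1) ^ 2 * Fintype.card S.Node ^ r := by
              convert card_not_injective (ι := S.Node) r
            exact_mod_cast h0
          refine h1.trans (mul_le_mul_of_nonneg_left ?_ (by positivity))
          exact pow_le_pow_left₀ (by positivity) S.card_node_le _
      _ = _ := by rw [mul_pow, inv_pow]; field_simp; ring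
  rw [add_div]
  exact (abs_sub_le _ _ _).trans (add_le_add hstep1 hstep2)

theorem productLimit_lassoSum {S : ℕ → Sockets} (hε : ε ∈ Set.Icc (0 : ℝ) 1)
    (H : ∀ k, Model (S k) lam rho d)
    (hN : Tendsto (fun k => (Fintype.card (S k).VSocket : ℝ)) atTop atTop)
    (hℓ : ℓ + 1 < r) (hpar : Even (r + ℓ)) :
    ProductLimit r (fun k => (S k).lassoSum ε r ℓ) (lassoCount lam rho ℓ r)
      (nodeMean lam rho ε ℓ) := by
  refine ⟨fun J => ?_, fun k W W' hW => ?_⟩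
  · obtain ⟨C, hC⟩ := lassoSum_monomial lam rho hε d hℓ hpar J
    rw [tendsto_iff_dist_tendsto_zero]
    refine squeeze_zero (fun _ => dist_nonneg) (fun k => ?_) (hN.const_div_atTop C)
    rw [Real.dist_eq]
    exact hC (S k) (H k)
  · refine Finset.sum_le_sum fun out _ => expect_mono hε fun T A => ?_
    exact mul_le_mul_of_nonneg_left (hW _ (admissible_nodeVar T A _)) (ind_nonneg _)

end

/-! ### Levels of nodes, and the number of cycles -/

section

theorem edist_le_add_one {V : Type*} {G : SimpleGraph V} {u x y : V} (h : G.Adj x y) :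
    G.edist u y ≤ G.edist u x + 1 := by
  rw [← SimpleGraph.edist_eq_one_iff_adj.2 h]
  exact G.edist_triangle

theorem exists_adj_of_edist {V : Type*} {G : SimpleGraph V} {u y : V} {k : ℕ}
    (h : G.edist u y = (k + 1 : ℕ)) : ∃ x, G.Adj x y ∧ G.edist u x = k := by
  rw [SimpleGraph.edist_comm] at h
  obtain ⟨p, hp⟩ := SimpleGraph.exists_walk_of_edist_eq_coe h
  cases p with
  | nil => simp at hp
  | @cons _ x _ hadj q =>
    rw [SimpleGraph.Walk.length_cons, Nat.add_right_cancel_iff] at hp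
    refine ⟨x, hadj.symm, le_antisymm ?_ ?_⟩
    · rw [SimpleGraph.edist_comm, ← hp]
      exact SimpleGraph.edist_le q
    · have := edist_le_add_one (u := u) hadj.symm
      rw [SimpleGraph.edist_comm, h, Nat.cast_add, Nat.cast_one] at this
      exact (ENat.add_le_add_iff_right (by simp)).1 this

variable {S : Sockets} {T : S.TannerGraph} {v₀ : Fin S.n} {D : ℕ}

theorem mem_edges {e : S.Edge} : e ∈ T.edges ↔ T e.1 = e.2 := by
  rw [TannerGraph.edges, Finset.mem_map]
  constructor
  · rintro ⟨s, -, rfl⟩; rfl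
  · intro h; exact ⟨e.1, Finset.mem_univ _, Prod.ext rfl h⟩

theorem adj_of_edge {F : Finset S.Edge} {e : S.Edge} (he : e ∈ F) :
    (edgeGraph F).Adj (Sum.inl (Edge.var e)) (Sum.inr (Edge.chk e)) := by
  rw [edgeGraph, SimpleGraph.fromRel_adj]
  exact ⟨by simp, Or.inl ⟨e, he, rfl, rfl⟩⟩

theorem exists_edge_of_adj {F : Finset S.Edge} {x y : S.Node} (h : (edgeGraph F).Adj x y) :
    ∃ e ∈ F, (x = Sum.inl (Edge.var e) ∧ y = Sum.inr (Edge.chk e)) ∨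
      (y = Sum.inl (Edge.var e) ∧ x = Sum.inr (Edge.chk e)) := by
  rw [edgeGraph, SimpleGraph.fromRel_adj] at h
  obtain ⟨-, ⟨e, he, h⟩ | ⟨e, he, h⟩⟩ := h
  · exact ⟨e, he, Or.inl h⟩
  · exact ⟨e, he, Or.inr h⟩

variable (T) in
/-- the edge at a half-edge -/
def edgeOf : S.Half → S.Edge := Sum.elim (fun s => (s, T s)) (fun c => (T.symm c, c))

theorem edgeOf_mem (h : S.Half) : edgeOf T h ∈ T.edges := by
  rcases h with s | c <;> simp [edgeOf, mem_edges]

theorem edgeOf_mate (h : S.Half) : edgeOf T (mate T h) = edgeOf T h := by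
  rcases h with s | c <;> simp [edgeOf, mate]

theorem edgeOf_eq_iff {h h' : S.Half} : edgeOf T h = edgeOf T h' ↔ h = h' ∨ h = mate T h' := by
  rcases h with s | c <;> rcases h' with s' | c'
  · simp only [edgeOf, mate, Sum.elim_inl, Prod.mk.injEq, Sum.inl.injEq, reduceCtorEq, or_false]
    exact ⟨fun h => h.1, fun h => ⟨h, by rw [h]⟩⟩
  · simp only [edgeOf, mate, Sum.elim_inl, Sum.elim_inr, Prod.mk.injEq, Sum.inl.injEq,
      reduceCtorEq, false_or]
    exact ⟨fun h => h.1, fun h => ⟨h, by rw [h]; simp⟩⟩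
  · simp only [edgeOf, mate, Sum.elim_inl, Sum.elim_inr, Prod.mk.injEq, Sum.inr.injEq,
      reduceCtorEq, false_or]
    exact ⟨fun h => h.2, fun h => ⟨by rw [h]; simp, h⟩⟩
  · simp only [edgeOf, mate, Sum.elim_inr, Prod.mk.injEq, Sum.inr.injEq, reduceCtorEq, or_false]
    exact ⟨fun h => h.2, fun h => ⟨by rw [h], h⟩⟩

theorem exists_edgeOf {e : S.Edge} (he : e ∈ T.edges) : edgeOf T (Sum.inl e.1) = e := by
  rw [mem_edges] at he
  simp only [edgeOf, Sum.elim_inl, he]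

theorem incident_edgeOf {h : S.Half} {x : S.Node} :
    Incident (edgeOf T h) x ↔ x = nd h ∨ x = nd (mate T h) := by
  rcases h with s | c
  · rfl
  · exact or_comm

theorem adj_nd_mate (h : S.Half) : (edgeGraph T.edges).Adj (nd h) (nd (mate T h)) := by
  have := adj_of_edge (edgeOf_mem (T := T) h)
  rcases h with s | c
  · exact this
  · exact this.symm

theorem exists_half_of_adj {x y : S.Node} (h : (edgeGraph T.edges).Adj x y) :
    ∃ a, nd a = x ∧ nd (mate T a) = y := by
  obtain ⟨e, he, ⟨rfl, rfl⟩ | ⟨rfl, rfl⟩⟩ := exists_edge_of_adj h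
  · exact ⟨Sum.inl e.1, rfl, by rw [mem_edges] at he; simp [mate, he, nd, Edge.chk]⟩
  · refine ⟨mate T (Sum.inl e.1), ?_, by rw [mate_mate]; rfl⟩
    rw [mem_edges] at he; simp [mate, he, nd, Edge.chk]

variable (T v₀ D) in
/-- the distance of a node from the root `v₀`, cut off at `D + 1` -/
def level (x : S.Node) : ℕ := (min ((edgeGraph T.edges).edist (Sum.inl v₀) x) (D + 1 : ℕ)).toNat

theorem level_le_iff {x : S.Node} {k : ℕ} (hk : k ≤ D) :
    level T v₀ D x ≤ k ↔ (edgeGraph T.edges).edist (Sum.inl v₀) x ≤ k := by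
  rw [level]
  generalize (edgeGraph T.edges).edist (Sum.inl v₀) x = e
  cases e with
  | top =>
    rw [min_eq_right le_top, ENat.toNat_natCast]
    simp only [top_le_iff, ENat.natCast_ne_top, iff_false]
    omega
  | coe e =>
    rw [← Nat.mono_cast.map_min, ENat.toNat_natCast, Nat.cast_le]
    omega

theorem level_eq_iff {x : S.Node} {k : ℕ} (hk : k ≤ D) :
    level T v₀ D x = k ↔ (edgeGraph T.edges).edist (Sum.inl v₀) x = k := by
  rw [level]
  generalize (edgeGraph T.edges).edist (Sum.inl v₀) x = e
  cases e with
  | top =>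
    rw [min_eq_right le_top, ENat.toNat_natCast]
    simp only [ENat.top_ne_natCast, iff_false]
    omega
  | coe e =>
    rw [← Nat.mono_cast.map_min, ENat.toNat_natCast, Nat.cast_inj]
    omega

theorem edist_eq_level {x : S.Node} (h : level T v₀ D x ≤ D) :
    (edgeGraph T.edges).edist (Sum.inl v₀) x = level T v₀ D x := (level_eq_iff h).1 rfl

theorem level_le_add_one (x : S.Node) : level T v₀ D x ≤ D + 1 := by
  rw [level]
  exact ENat.toNat_le_of_le_natCast (min_le_right _ _)

theorem level_eq_zero_iff {x : S.Node} : level T v₀ D x = 0 ↔ x = Sum.inl v₀ := by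
  rw [level_eq_iff (Nat.zero_le _), Nat.cast_zero, SimpleGraph.edist_eq_zero_iff, eq_comm]

theorem level_root : level T v₀ D (Sum.inl v₀) = 0 := level_eq_zero_iff.2 rfl

theorem level_mate_le (h : S.Half) : level T v₀ D (nd (mate T h)) ≤ level T v₀ D (nd h) + 1 := by
  by_cases hD : level T v₀ D (nd h) + 1 ≤ D
  · rw [level_le_iff hD]
    refine (edist_le_add_one (adj_nd_mate h)).trans ?_
    rw [edist_eq_level (D := D) (by omega)]
    simp
  · have := level_le_add_one (T := T) (v₀ := v₀) (D := D) (nd (mate T h))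
    omega

theorem exists_parent {x : S.Node} (hx : level T v₀ D x ≤ D) (h0 : x ≠ Sum.inl v₀) :
    ∃ h, nd h = x ∧ level T v₀ D (nd (mate T h)) + 1 = level T v₀ D x := by
  obtain ⟨k, hk⟩ : ∃ k, level T v₀ D x = k + 1 :=
    Nat.exists_eq_succ_of_ne_zero fun h => h0 (level_eq_zero_iff.1 h)
  have h1 := edist_eq_level hx
  rw [hk] at h1
  obtain ⟨y, hadj, hy⟩ := exists_adj_of_edist h1
  obtain ⟨h, rfl, rfl⟩ := exists_half_of_adj hadj.symm
  refine ⟨h, rfl, ?_⟩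
  rw [hk, (level_eq_iff (by omega)).2 hy]

/-- The graph is bipartite. -/
theorem isLeft_eq_even_level {x : S.Node} (hx : level T v₀ D x ≤ D) :
    x.isLeft = decide (Even (level T v₀ D x)) := by
  generalize hk : level T v₀ D x = k
  induction k generalizing x with
  | zero => rw [level_eq_zero_iff] at hk; subst hk; simp
  | succ k ih =>
    obtain ⟨h, rfl, h1⟩ := exists_parent hx fun h0 => by rw [h0, level_root] at hk; omega
    have h2 := ih (x := nd (mate T h)) (by omega) (by omega)
    rw [isLeft_nd, isLeft_mate] at h2
    rw [isLeft_nd]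
    by_cases he : Even k <;> simp [he, Nat.even_add_one] at h2 ⊢ <;> exact h2

theorem level_mate {h : S.Half} (hD : level T v₀ D (nd h) ≤ D) :
    level T v₀ D (nd (mate T h)) = level T v₀ D (nd h) + 1 ∨
      level T v₀ D (nd (mate T h)) + 1 = level T v₀ D (nd h) := by
  have h1 := level_mate_le (T := T) (v₀ := v₀) (D := D) h
  have h2 := level_mate_le (T := T) (v₀ := v₀) (D := D) (mate T h)
  rw [mate_mate] at h2
  have h3 : level T v₀ D (nd (mate T h)) ≠ level T v₀ D (nd h) := by
    intro h3
    have h4 := isLeft_eq_even_level hD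
    have h5 := isLeft_eq_even_level (x := nd (mate T h)) (h3 ▸ hD)
    rw [h3, ← h4, isLeft_nd, isLeft_nd, isLeft_mate] at h5
    exact absurd h5 (Bool.not_ne_self _)
  omega

variable (T v₀ D) in
/-- the nodes within distance `D` of the root -/
def ball : Finset S.Node := {x | level T v₀ D x ≤ D}

variable (T v₀ D) in
open Classical in
/-- the half-edges of a node that lead towards the root -/
def parents (x : S.Node) : Finset S.Half :=
  {h | nd h = x ∧ level T v₀ D (nd (mate T h)) + 1 = level T v₀ D x}

theorem mem_ball {x : S.Node} : x ∈ ball T v₀ D ↔ level T v₀ D x ≤ D := by simp [ball]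

theorem mem_parents {x : S.Node} {h : S.Half} : h ∈ parents T v₀ D x ↔
    nd h = x ∧ level T v₀ D (nd (mate T h)) + 1 = level T v₀ D x := by simp [parents]

theorem parents_nonempty {x : S.Node} (hx : x ∈ ball T v₀ D) (h0 : x ≠ Sum.inl v₀) :
    0 < (parents T v₀ D x).card := by
  obtain ⟨h, h1⟩ := exists_parent (mem_ball.1 hx) h0
  exact Finset.card_pos.2 ⟨h, mem_parents.2 h1⟩

theorem root_mem_ball : Sum.inl v₀ ∈ ball T v₀ D := by simp [mem_ball, level_root]

theorem parents_root : parents T v₀ D (Sum.inl v₀) = ∅ := by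
  refine Finset.eq_empty_of_forall_notMem fun h hh => ?_
  have := (mem_parents.1 hh).2
  rw [level_root] at this
  omega

variable {t : ℕ}

theorem mem_varNodes {v : Fin S.n} :
    v ∈ (nbhd t v₀ T).varNodes ↔ Sum.inl v ∈ ball T v₀ (2 * t) := by
  rw [mem_ball, level_le_iff le_rfl]
  simp [nbhd]

theorem edist_add_one_le_iff (c : Fin S.m) :
    (edgeGraph T.edges).edist (Sum.inl v₀) (Sum.inr c) + 1 ≤ (2 * t : ℕ) ↔
      Sum.inr c ∈ ball T v₀ (2 * t) := by
  rw [mem_ball]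
  constructor
  · intro h
    rw [level_le_iff le_rfl]
    exact le_trans le_self_add h
  · intro h
    have h1 := isLeft_eq_even_level h
    have h2 : level T v₀ (2 * t) (Sum.inr c) ≠ 2 * t := by
      intro h2
      rw [h2] at h1
      simp at h1
    rw [edist_eq_level h]
    exact_mod_cast (by omega : level T v₀ (2 * t) (Sum.inr c) + 1 ≤ 2 * t)

theorem mem_chkNodes {c : Fin S.m} :
    c ∈ (nbhd t v₀ T).chkNodes ↔ Sum.inr c ∈ ball T v₀ (2 * t) := by
  rw [← edist_add_one_le_iff]
  simp [nbhd]

theorem mem_nbhd_edges {e : S.Edge} : e ∈ (nbhd t v₀ T).edges ↔ e ∈ T.edges ∧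
    Sum.inl (Edge.var e) ∈ ball T v₀ (2 * t) ∧ Sum.inr (Edge.chk e) ∈ ball T v₀ (2 * t) := by
  rw [← edist_add_one_le_iff, mem_ball, level_le_iff le_rfl]
  simp [nbhd]

theorem edgeOf_mem_nbhd {h : S.Half} : edgeOf T h ∈ (nbhd t v₀ T).edges ↔
    nd h ∈ ball T v₀ (2 * t) ∧ nd (mate T h) ∈ ball T v₀ (2 * t) := by
  rw [mem_nbhd_edges]
  refine (and_iff_right (edgeOf_mem h)).trans ?_
  rcases h with s | c
  · rfl
  · exact and_comm

open Classical in
theorem card_nbhd_edges : (nbhd t v₀ T).edges.card =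
    ∑ x ∈ ball T v₀ (2 * t), (parents T v₀ (2 * t) x).card := by
  rw [← Finset.card_biUnion]
  · symm
    refine Finset.card_bij (fun h _ => edgeOf T h) (fun h hh => ?_) (fun h hh h' hh' he => ?_)
      fun e he => ?_
    · obtain ⟨x, hx, hh⟩ := Finset.mem_biUnion.1 hh
      obtain ⟨rfl, h1⟩ := mem_parents.1 hh
      rw [edgeOf_mem_nbhd]
      rw [mem_ball] at hx
      exact ⟨mem_ball.2 hx, mem_ball.2 (by omega)⟩
    · obtain ⟨x, hx, hh⟩ := Finset.mem_biUnion.1 hh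
      obtain ⟨rfl, h1⟩ := mem_parents.1 hh
      obtain ⟨x', hx', hh'⟩ := Finset.mem_biUnion.1 hh'
      obtain ⟨rfl, h2⟩ := mem_parents.1 hh'
      rcases edgeOf_eq_iff.1 he with h | h
      · exact h
      · rw [h, mate_mate] at h1
        omega
    · have h0 := exists_edgeOf (mem_nbhd_edges.1 he).1
      rw [← h0, edgeOf_mem_nbhd, mem_ball, mem_ball] at he
      rcases level_mate he.1 with h1 | h1
      · refine ⟨mate T (Sum.inl e.1), Finset.mem_biUnion.2 ⟨_, mem_ball.2 he.2,
          mem_parents.2 ⟨rfl, by rw [mate_mate, h1]⟩⟩, by rw [edgeOf_mate, h0]⟩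
      · exact ⟨Sum.inl e.1, Finset.mem_biUnion.2 ⟨_, mem_ball.2 he.1,
          mem_parents.2 ⟨rfl, h1⟩⟩, h0⟩
  · intro x _ y _ hxy
    rw [Function.onFun, Finset.disjoint_left]
    intro h h1 h2
    exact hxy ((mem_parents.1 h1).1.symm.trans (mem_parents.1 h2).1)

theorem card_nbhd_nodes :
    (nbhd t v₀ T).varNodes.card + (nbhd t v₀ T).chkNodes.card = (ball T v₀ (2 * t)).card := by
  rw [← Finset.card_disjSum]
  congr 1
  ext x
  rcases x with v | c
  · rw [Finset.inl_mem_disjSum, mem_varNodes]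
  · rw [Finset.inr_mem_disjSum, mem_chkNodes]

/-- Each node other than the root contributes one cycle for each of its parents but one. -/
theorem numCycles_nbhd : (nbhd t v₀ T).numCycles =
    ((∑ x ∈ (ball T v₀ (2 * t)).erase (Sum.inl v₀),
      ((parents T v₀ (2 * t) x).card - 1) : ℕ) : ℤ) := by
  rw [RootedGraph.numCycles, card_nbhd_edges, ← Finset.sum_erase_add _ _ root_mem_ball, parents_root,
    Finset.card_empty, add_zero]
  have h1 := card_nbhd_nodes (t := t) (v₀ := v₀) (T := T)
  rw [← Finset.card_erase_add_one root_mem_ball] at h1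
  have h2 : ∑ x ∈ (ball T v₀ (2 * t)).erase (Sum.inl v₀), (parents T v₀ (2 * t) x).card =
      ∑ x ∈ (ball T v₀ (2 * t)).erase (Sum.inl v₀), ((parents T v₀ (2 * t) x).card - 1) +
        ((ball T v₀ (2 * t)).erase (Sum.inl v₀)).card := by
    rw [Finset.card_eq_sum_ones, ← Finset.sum_add_distrib]
    refine Finset.sum_congr rfl fun x hx => ?_
    have := parents_nonempty (Finset.mem_of_mem_erase hx) (Finset.ne_of_mem_erase hx)
    omega
  rw [h2]
  push_cast
  have h3 : ((nbhd t v₀ T).varNodes.card : ℤ) + (nbhd t v₀ T).chkNodes.card =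
      ((ball T v₀ (2 * t)).erase (Sum.inl v₀)).card + 1 := by exact_mod_cast h1
  rw [h3]
  ring

theorem rootDist_nbhd {x : S.Node} (hx : x ∈ ball T v₀ (2 * t)) :
    (nbhd t v₀ T).rootDist x = level T v₀ (2 * t) x := by
  rw [mem_ball] at hx
  apply le_antisymm
  · generalize hk : level T v₀ (2 * t) x = k
    induction k generalizing x with
    | zero =>
      rw [level_eq_zero_iff] at hk
      subst hk
      simp [RootedGraph.rootDist, nbhd]
    | succ k ih =>
      obtain ⟨h, rfl, h1⟩ := exists_parent hx fun h0 => by rw [h0, level_root] at hk; omega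
      have h2 := ih (x := nd (mate T h)) (by omega) (by omega)
      have h3 : edgeOf T h ∈ (nbhd t v₀ T).edges :=
        edgeOf_mem_nbhd.2 ⟨mem_ball.2 hx, mem_ball.2 (by omega)⟩
      have h4 : (edgeGraph (nbhd t v₀ T).edges).Adj (nd (mate T h)) (nd h) := by
        have := adj_of_edge h3
        rcases h with s | c
        · exact this.symm
        · exact this
      refine (edist_le_add_one h4).trans ?_
      rw [Nat.cast_add, Nat.cast_one]
      exact add_le_add_left h2 1
  · rw [← edist_eq_level hx]
    refine SimpleGraph.edist_anti fun a b hab => ?_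
    obtain ⟨e, he, ⟨rfl, rfl⟩ | ⟨rfl, rfl⟩⟩ := exists_edge_of_adj hab
    · exact adj_of_edge (mem_nbhd_edges.1 he).1
    · exact (adj_of_edge (mem_nbhd_edges.1 he).1).symm

end

/-! ### Lassos of single-cycle neighborhood graphs -/

section

/-- The levels along a lasso of a graph with one cycle: they increase up to the deepest node of
the cycle, which is the only one (`P`) with two parents, and decrease afterwards. -/
theorem level_profile {r ℓ k : ℕ} (hk : 1 ≤ k) (hr : r = ℓ + 2 * k) {lv nxt : ℕ → ℕ}
    {P : ℕ → Prop} (hn : ∀ i, i + 1 < r → nxt i = i + 1) (hn' : nxt (r - 1) = ℓ) (h0 : lv 0 = 0)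
    (hs : ∀ i, i < r → lv (nxt i) = lv i + 1 ∨ lv (nxt i) + 1 = lv i)
    (h1 : ∀ i, i < r → lv (nxt i) = lv i + 1 → lv (nxt (nxt i)) + 1 = lv (nxt i) → P (nxt i))
    (h2 : 0 < ℓ → lv ℓ = lv (ℓ - 1) + 1 → lv ℓ = lv (r - 1) + 1 →
      P ℓ ∧ ¬ lv (nxt ℓ) + 1 = lv ℓ)
    (hP : ∀ i j, i < r → j < r → P i → P j → i = j) :
    P (ℓ + k) ∧ (∀ i ≤ ℓ + k, lv i = i) ∧ ∀ j, ℓ + k + j < r → lv (ℓ + k + j) + j = ℓ + k := by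
  classical
  have hex : ∃ i, i < r ∧ lv (nxt i) + 1 = lv i := by
    by_contra! hne
    have h3 : ∀ i, i < r → lv i = i := by
      intro i
      induction i with
      | zero => intro _; exact h0
      | succ i ih =>
        intro hi
        have h4 := (hs i (by omega)).resolve_right (hne i (by omega))
        rw [hn i hi, ih (by omega)] at h4
        exact h4
    have h4 := (hs (r - 1) (by omega)).resolve_right (hne (r - 1) (by omega))
    rw [hn', h3 ℓ (by omega), h3 (r - 1) (by omega)] at h4
    omega
  set c := Nat.find hex with hc
  obtain ⟨hcr, hcd⟩ : c < r ∧ lv (nxt c) + 1 = lv c := Nat.find_spec hex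
  have hup : ∀ i, i < c → lv (nxt i) = lv i + 1 := fun i hi =>
    (hs i (by omega)).resolve_right fun h => Nat.find_min hex hi ⟨by omega, h⟩
  have hlv : ∀ i ≤ c, lv i = i := by
    intro i
    induction i with
    | zero => intro _; exact h0
    | succ i ih =>
      intro hi
      rw [← hn i (by omega), hup i (by omega), ih (by omega), hn i (by omega)]
  have hc0 : 0 < c := by
    rcases Nat.eq_zero_or_pos c with h | h
    · rw [h, h0] at hcd; omega
    · exact h
  have hPc : P c := by
    have h3 := hn (c - 1) (by omega)
    rw [show c - 1 + 1 = c by omega] at h3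
    have h4 := h1 (c - 1) (by omega) (hup _ (by omega))
    rw [h3] at h4
    exact h4 hcd
  have hdown : ∀ e, c ≤ e → e < r → lv (nxt e) + 1 = lv e := by
    by_contra! hne
    obtain ⟨he1, he2, he3⟩ := Nat.find_spec hne
    have hemin : ∀ e', c ≤ e' → e' < Nat.find hne → lv (nxt e') + 1 = lv e' := fun e' h3 h4 => by
      by_contra h5
      exact Nat.find_min hne h4 ⟨h3, by omega, h5⟩
    set e := Nat.find hne with he
    have hec : c ≠ e := fun h => he3 (h ▸ hcd)
    have hupe : ∀ j, e + j < r → lv (nxt (e + j)) = lv (e + j) + 1 := by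
      intro j
      induction j with
      | zero => intro _; exact (hs e he2).resolve_right he3
      | succ j ih =>
        intro hj
        refine (hs _ hj).resolve_right fun h3 => ?_
        have h4 := h1 (e + j) (by omega) (ih (by omega))
        rw [hn (e + j) (by omega)] at h4
        have := hP _ _ (by omega) hcr (h4 h3) hPc
        omega
    have hlast := hupe (r - 1 - e) (by omega)
    rw [show e + (r - 1 - e) = r - 1 by omega, hn'] at hlast
    have hℓ0 : 0 < ℓ := by
      rcases Nat.eq_zero_or_pos ℓ with h | h
      · rw [h, h0] at hlast; omega
      · exact h
    have hnℓ : nxt (ℓ - 1) = ℓ := by rw [hn (ℓ - 1) (by omega)]; omega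
    by_cases hℓup : lv ℓ = lv (ℓ - 1) + 1
    · obtain ⟨h3, h4⟩ := h2 hℓ0 hℓup hlast
      have := hP _ _ (by omega) hcr h3 hPc
      exact h4 (this ▸ hcd)
    · have hcℓ : c < ℓ := by
        by_contra h3
        have := hup (ℓ - 1) (by omega)
        rw [hnℓ] at this
        exact hℓup this
      by_cases h3 : lv (nxt ℓ) + 1 = lv ℓ
      · have h4 := h1 (r - 1) (by omega)
        rw [hn'] at h4
        have := hP _ _ (by omega) hcr (h4 hlast h3) hPc
        omega
      · have heℓ : e ≤ ℓ := by
          by_contra h4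
          exact h3 (hemin ℓ hcℓ.le (by omega))
        have h4 : ∀ j, ℓ + j < r → lv (ℓ + j) = lv ℓ + j := by
          intro j
          induction j with
          | zero => intro _; rfl
          | succ j ih =>
            intro hj
            have h5 := hupe (ℓ - e + j) (by omega)
            rw [show e + (ℓ - e + j) = ℓ + j by omega, hn _ (by omega), ih (by omega)] at h5
            exact h5
        have h5 := h4 (r - 1 - ℓ) (by omega)
        rw [show ℓ + (r - 1 - ℓ) = r - 1 by omega] at h5
        omega
  have hlvd : ∀ j, c + j < r → lv (c + j) + j = c := by
    intro j
    induction j with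
    | zero => intro _; exact hlv c le_rfl
    | succ j ih =>
      intro hj
      have h3 := hdown (c + j) (by omega) (by omega)
      rw [hn _ (by omega)] at h3
      have h4 := ih (by omega)
      change lv (c + j + 1) + (j + 1) = c
      omega
  have hlast := hdown (r - 1) (by omega) (by omega)
  rw [hn'] at hlast
  have h3 := hlvd (r - 1 - c) (by omega)
  rw [show c + (r - 1 - c) = r - 1 by omega] at h3
  have hck : c = ℓ + k := by
    by_cases hℓc : ℓ ≤ c
    · have := hlv ℓ hℓc
      omega
    · have h4 := hlvd (ℓ - c) (by omega)
      rw [show c + (ℓ - c) = ℓ by omega] at h4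
      omega
  rw [← hck]
  exact ⟨hPc, hlv, hlvd⟩

variable {S : Sockets} {T : S.TannerGraph} {v₀ : Fin S.n} {D r ℓ k : ℕ}

/-- `out` is a lasso in `T` that starts at the variable node `v₀`. -/
def RootedLasso (T : S.TannerGraph) (v₀ : Fin S.n) (r ℓ : ℕ) (out : Fin r → S.Half) : Prop :=
  IsLasso r ℓ (walkEnds T out) ∧ ∀ hr : 0 < r, nd (out ⟨0, hr⟩) = Sum.inl v₀

/-- `y` is the only node within distance `D` of the root that may have two parents. -/
structure OnlyDoubled (T : S.TannerGraph) (v₀ : Fin S.n) (D : ℕ) (y : S.Node) : Prop where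
  eq : ∀ x ∈ ball T v₀ D, ∀ p ∈ parents T v₀ D x, ∀ q ∈ parents T v₀ D x, p ≠ q → x = y
  card_le : (parents T v₀ D y).card ≤ 2

/-- the number after `i` along a lasso -/
def nextPos (r ℓ i : ℕ) : ℕ := if i + 1 < r then i + 1 else ℓ

section
variable {out : Fin r → S.Half}

theorem RootedLasso.nd_mate (h : RootedLasso T v₀ r ℓ out) {i : ℕ} (hi : i < r)
    (hn : nextPos r ℓ i < r) :
    nd (mate T (out ⟨i, hi⟩)) = nd (out ⟨nextPos r ℓ i, hn⟩) := by
  have := h.1.nd_eq_start (⟨i, hi⟩, true) (by simpa [endPos, nextPos] using hn)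
  simpa [walkEnds, endPos, nextPos] using this

theorem RootedLasso.node_injective (h : RootedLasso T v₀ r ℓ out) {i j : ℕ} (hi : i < r)
    (hj : j < r) (he : nd (out ⟨i, hi⟩) = nd (out ⟨j, hj⟩)) : i = j := by
  have := h.1.node_injective (a₁ := ⟨i, hi⟩) (a₂ := ⟨j, hj⟩) (by simpa [walkEnds] using he)
  simpa using this

theorem RootedLasso.out_ne_mate (h : RootedLasso T v₀ r ℓ out) (i j : Fin r) :
    mate T (out i) ≠ out j := by
  intro he
  have := h.1.inj (a₁ := (i, true)) (a₂ := (j, false)) (by simpa [walkEnds] using he)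
  simp at this

theorem RootedLasso.out_injective (h : RootedLasso T v₀ r ℓ out) : Function.Injective out := by
  intro i j he
  have := h.1.inj (a₁ := (i, false)) (a₂ := (j, false)) (by simpa [walkEnds] using he)
  simpa using this

theorem nextPos_lt (hℓ : ℓ < r) (i : ℕ) : nextPos r ℓ i < r := by
  rw [nextPos]; split_ifs <;> omega

theorem RootedLasso.level_le (h : RootedLasso T v₀ r ℓ out) (hk : 1 ≤ k) (hr : r = ℓ + 2 * k)
    (i : ℕ) (hi : i < r) : level T v₀ D (nd (out ⟨i, hi⟩)) ≤ ℓ + k := by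
  have h1 : ∀ i, ∀ hi : i < r, level T v₀ D (nd (out ⟨i, hi⟩)) ≤ i := by
    intro i
    induction i with
    | zero => intro hi; rw [h.2 hi, level_root]
    | succ i ih =>
      intro hi
      have h2 := h.nd_mate (i := i) (by omega) (nextPos_lt (by omega) i)
      have h3 := level_mate_le (T := T) (v₀ := v₀) (D := D) (out ⟨i, by omega⟩)
      rw [h2] at h3
      have h4 := ih (by omega)
      simp only [nextPos, if_pos hi] at h3
      omega
  have h2 : ∀ j, ∀ _ : j + 1 ≤ r, level T v₀ D (nd (out ⟨r - (j + 1), by omega⟩)) ≤ ℓ + (j + 1) := by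
    intro j
    induction j with
    | zero =>
      intro hj
      have h2 := h.nd_mate (i := r - 1) (by omega) (nextPos_lt (by omega) _)
      have h3 := level_mate_le (T := T) (v₀ := v₀) (D := D) (mate T (out ⟨r - 1, by omega⟩))
      rw [mate_mate, h2] at h3
      have h4 := h1 ℓ (by omega)
      have h5 : nextPos r ℓ (r - 1) = ℓ := by rw [nextPos, if_neg (by omega)]
      simp only [h5] at h3
      simp only [zero_add]
      omega
    | succ j ih =>
      intro hj
      have h2 := h.nd_mate (i := r - (j + 1 + 1)) (by omega) (nextPos_lt (by omega) _)
      have h3 := level_mate_le (T := T) (v₀ := v₀) (D := D) (mate T (out ⟨r - (j + 1 + 1), by omega⟩))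
      rw [mate_mate, h2] at h3
      have h4 := ih (by omega)
      have h5 : nextPos r ℓ (r - (j + 1 + 1)) = r - (j + 1) := by
        rw [nextPos, if_pos (by omega)]; omega
      simp only [h5] at h3
      omega
  by_cases hc : i ≤ ℓ + k
  · exact (h1 i hi).trans hc
  · have := h2 (r - i - 1) (by omega)
    have h3 : r - (r - i - 1 + 1) = i := by omega
    simp only [h3] at this
    omega

theorem card_le_two {α : Type*} [DecidableEq α] {s : Finset α} (hs : s.card ≤ 2)
    {a b c : α} (ha : a ∈ s) (hb : b ∈ s)
    (hc : c ∈ s) (hab : a ≠ b) (hac : a ≠ c) : b = c := by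
  by_contra hbc
  have h1 : ({a, b, c} : Finset α) ⊆ s := by
    intro x hx
    simp only [Finset.mem_insert, Finset.mem_singleton] at hx
    rcases hx with rfl | rfl | rfl <;> assumption
  have h2 : ({a, b, c} : Finset α).card = 3 := by
    rw [Finset.card_insert_of_notMem (by simp [hab, hac]), Finset.card_pair hbc]
  have := Finset.card_le_card h1
  omega

theorem RootedLasso.profile (h : RootedLasso T v₀ r ℓ out) (hk : 1 ≤ k) (hr : r = ℓ + 2 * k)
    (hD : ℓ + k ≤ D) {y : S.Node} (hy : OnlyDoubled T v₀ D y) :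
    nd (out ⟨ℓ + k, by omega⟩) = y ∧
    (∀ i, ∀ hi : i ≤ ℓ + k, level T v₀ D (nd (out ⟨i, by omega⟩)) = i) ∧
    ∀ j, ∀ hj : ℓ + k + j < r, level T v₀ D (nd (out ⟨ℓ + k + j, hj⟩)) + j = ℓ + k := by
  classical
  have hr0 : 0 < r := by omega
  have hlev := fun i hi => (h.level_le (D := D) hk hr i hi).trans hD
  have hnd : ∀ i, ∀ hi : i < r, nd (mate T (out (extend hr0 i))) =
      nd (out (extend hr0 (nextPos r ℓ i))) := by
    intro i hi
    rw [extend_eq hr0 hi, extend_eq hr0 (nextPos_lt (by omega) i), h.nd_mate hi]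
  have hball : ∀ i, nd (out (extend hr0 i)) ∈ ball T v₀ D := fun i => mem_ball.2 (hlev _ _)
  have hpar : ∀ i, i < r → level T v₀ D (nd (out (extend hr0 (nextPos r ℓ i)))) =
      level T v₀ D (nd (out (extend hr0 i))) + 1 →
      mate T (out (extend hr0 i)) ∈ parents T v₀ D (nd (out (extend hr0 (nextPos r ℓ i)))) :=
    fun i hi h1 => mem_parents.2 ⟨hnd i hi, by rw [mate_mate, h1]⟩
  have hpar' : ∀ i, i < r → level T v₀ D (nd (out (extend hr0 (nextPos r ℓ i)))) + 1 =
      level T v₀ D (nd (out (extend hr0 i))) →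
      out (extend hr0 i) ∈ parents T v₀ D (nd (out (extend hr0 i))) :=
    fun i hi h1 => mem_parents.2 ⟨rfl, by rw [hnd i hi, h1]⟩
  have key := level_profile (r := r) (ℓ := ℓ) (k := k) hk hr
    (lv := fun i => level T v₀ D (nd (out (extend hr0 i)))) (nxt := nextPos r ℓ)
    (P := fun i => nd (out (extend hr0 i)) = y)
    (fun i hi => by rw [nextPos, if_pos hi]) (by rw [nextPos, if_neg (by omega)])
    (by rw [extend_eq hr0 hr0, h.2 hr0, level_root])
    (fun i hi => by
      have := level_mate (T := T) (v₀ := v₀) (D := D) (h := out (extend hr0 i))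
        (mem_ball.1 (hball i))
      rwa [hnd i hi] at this)
    (fun i hi h1 h2 => hy.eq _ (hball _) _ (hpar i hi h1) _ (hpar' _ (nextPos_lt (by omega) i) h2)
      (h.out_ne_mate _ _))
    (fun h0 h1 h2 => by
      have e1 : nextPos r ℓ (ℓ - 1) = ℓ := by rw [nextPos, if_pos (by omega)]; omega
      have e2 : nextPos r ℓ (r - 1) = ℓ := by rw [nextPos, if_neg (by omega)]
      have p1 := hpar (ℓ - 1) (by omega) (by rw [e1]; exact h1)
      have p2 := hpar (r - 1) (by omega) (by rw [e2]; exact h2)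
      rw [e1] at p1
      rw [e2] at p2
      have hne : mate T (out (extend hr0 (ℓ - 1))) ≠ mate T (out (extend hr0 (r - 1))) := by
        intro he
        have := h.out_injective (mate_injective T he)
        rw [extend_eq hr0 (by omega), extend_eq hr0 (by omega), Fin.mk.injEq] at this
        omega
      have hPℓ := hy.eq _ (hball _) _ p1 _ p2 hne
      refine ⟨hPℓ, fun h3 => ?_⟩
      have p3 := hpar' ℓ (by omega) h3
      rw [hPℓ] at p1 p2 p3
      exact h.out_ne_mate _ _ (card_le_two hy.card_le p1 p2 p3 hne (h.out_ne_mate _ _)))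
    (fun i j hi hj h1 h2 => h.node_injective hi hj (by
      rw [extend_eq hr0 hi] at h1
      rw [extend_eq hr0 hj] at h2
      rw [h1, h2]))
  refine ⟨?_, fun i hi => ?_, fun j hj => ?_⟩
  · have := key.1
    rwa [extend_eq hr0 (by omega)] at this
  · have := key.2.1 i hi
    rwa [extend_eq hr0 (by omega)] at this
  · have := key.2.2 j hj
    rwa [extend_eq hr0 (by omega)] at this

/-- The half-edges of a lasso that lead towards the root. -/
theorem RootedLasso.mem_parents_first (h : RootedLasso T v₀ r ℓ out) (hk : 1 ≤ k)
    (hr : r = ℓ + 2 * k) (hD : ℓ + k ≤ D) {y : S.Node} (hy : OnlyDoubled T v₀ D y) (i : ℕ)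
    (hi : i < ℓ + k) :
    mate T (out ⟨i, by omega⟩) ∈ parents T v₀ D (nd (out ⟨i + 1, by omega⟩)) := by
  obtain ⟨-, h1, -⟩ := h.profile hk hr hD hy
  have e : nextPos r ℓ i = i + 1 := by rw [nextPos, if_pos (by omega)]
  refine mem_parents.2 ⟨?_, ?_⟩
  · rw [h.nd_mate (by omega) (nextPos_lt (by omega) i)]
    simp only [e]
  · rw [mate_mate, h1 i (by omega), h1 (i + 1) (by omega)]

theorem RootedLasso.mem_parents_second (h : RootedLasso T v₀ r ℓ out) (hk : 1 ≤ k)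
    (hr : r = ℓ + 2 * k) (hD : ℓ + k ≤ D) {y : S.Node} (hy : OnlyDoubled T v₀ D y) (j : ℕ)
    (hj : ℓ + k + j < r) :
    out ⟨ℓ + k + j, hj⟩ ∈ parents T v₀ D (nd (out ⟨ℓ + k + j, hj⟩)) := by
  obtain ⟨-, h1, h2⟩ := h.profile hk hr hD hy
  refine mem_parents.2 ⟨rfl, ?_⟩
  rw [h.nd_mate hj (nextPos_lt (by omega) _)]
  have h3 := h2 j hj
  by_cases hl : ℓ + k + j + 1 < r
  · have e : nextPos r ℓ (ℓ + k + j) = ℓ + k + (j + 1) := by rw [nextPos, if_pos hl]; omega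
    have h4 := h2 (j + 1) (by omega)
    simp only [e]
    omega
  · have e : nextPos r ℓ (ℓ + k + j) = ℓ := by rw [nextPos, if_neg hl]
    have h4 := h1 ℓ (by omega)
    simp only [e]
    omega

end

end

/-! ### Descending from the deepest node of the cycle -/

section

variable {S : Sockets} {T : S.TannerGraph} {v₀ : Fin S.n} {D r ℓ k : ℕ}

variable (T v₀ D) in
open Classical in
/-- the half-edges on a path towards the root that starts with the half-edge `p` -/
def descend (p : S.Half) : ℕ → S.Half
  | 0 => p
  | j + 1 => if h : (parents T v₀ D (nd (mate T (descend p j)))).Nonempty then h.choose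
      else descend p j

variable (T v₀ D) in
/-- the node below the `j`-th half-edge of the path -/
def below (p : S.Half) (j : ℕ) : S.Node := nd (mate T (descend T v₀ D p j))

variable (T v₀ D) in
/-- the first place where the paths meet -/
def meet (p q : S.Half) : ℕ := sInf {j | below T v₀ D p j = below T v₀ D q j}

theorem meet_comm (p q : S.Half) : meet T v₀ D p q = meet T v₀ D q p := by
  simp only [meet, eq_comm]

theorem descend_succ_mem {p : S.Half} {j : ℕ} (h : (parents T v₀ D (below T v₀ D p j)).Nonempty) :
    descend T v₀ D p (j + 1) ∈ parents T v₀ D (below T v₀ D p j) := by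
  unfold below at h ⊢
  rw [descend, dif_pos h]
  exact h.choose_spec

theorem parents_nonempty_of_pos {x : S.Node} (hx : level T v₀ D x ≤ D) (h0 : 0 < level T v₀ D x) :
    (parents T v₀ D x).Nonempty :=
  Finset.card_pos.1 (parents_nonempty (mem_ball.2 hx) fun h => by rw [h, level_root] at h0; omega)

theorem level_descend_below {y : S.Node} (hy : y ∈ ball T v₀ D) {p : S.Half}
    (hp : p ∈ parents T v₀ D y) (j : ℕ) (hj : j < level T v₀ D y) :
    level T v₀ D (nd (descend T v₀ D p j)) + j = level T v₀ D y ∧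
    level T v₀ D (below T v₀ D p j) + (j + 1) = level T v₀ D y := by
  induction j with
  | zero =>
    obtain ⟨h1, h2⟩ := mem_parents.1 hp
    rw [below, descend, h1]
    exact ⟨rfl, h2⟩
  | succ j ih =>
    obtain ⟨-, h2⟩ := ih (by omega)
    rw [mem_ball] at hy
    obtain ⟨h5, h6⟩ := mem_parents.1 (descend_succ_mem
      (parents_nonempty_of_pos (x := below T v₀ D p j) (by omega) (by omega)))
    rw [below, h5]
    omega

theorem level_descend {y : S.Node} (hy : y ∈ ball T v₀ D) {p : S.Half}
    (hp : p ∈ parents T v₀ D y) {j : ℕ} (hj : j < level T v₀ D y) :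
    level T v₀ D (nd (descend T v₀ D p j)) + j = level T v₀ D y :=
  (level_descend_below hy hp j hj).1

theorem level_below {y : S.Node} (hy : y ∈ ball T v₀ D) {p : S.Half}
    (hp : p ∈ parents T v₀ D y) {j : ℕ} (hj : j < level T v₀ D y) :
    level T v₀ D (below T v₀ D p j) + (j + 1) = level T v₀ D y :=
  (level_descend_below hy hp j hj).2

theorem nd_descend {y : S.Node} (hy : y ∈ ball T v₀ D) {p : S.Half}
    (hp : p ∈ parents T v₀ D y) {j : ℕ} (hj : j + 1 < level T v₀ D y) :
    nd (descend T v₀ D p (j + 1)) = below T v₀ D p j := by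
  have h2 := level_below hy hp (j := j) (by omega)
  rw [mem_ball] at hy
  exact (mem_parents.1 (descend_succ_mem
    (parents_nonempty_of_pos (x := below T v₀ D p j) (by omega) (by omega)))).1

theorem descend_mem {y : S.Node} (hy : y ∈ ball T v₀ D) {p : S.Half}
    (hp : p ∈ parents T v₀ D y) {j : ℕ} (hj : j < level T v₀ D y) :
    descend T v₀ D p j ∈ parents T v₀ D (nd (descend T v₀ D p j)) := by
  have h1 := level_descend hy hp hj
  have h2 := level_below hy hp hj
  rw [below] at h2
  exact mem_parents.2 ⟨rfl, by omega⟩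

theorem level_pos_of_parent {y : S.Node} {p : S.Half} (hp : p ∈ parents T v₀ D y) :
    0 < level T v₀ D y := by
  have := (mem_parents.1 hp).2
  omega

theorem below_meet {y : S.Node} (hy : y ∈ ball T v₀ D) {p q : S.Half}
    (hp : p ∈ parents T v₀ D y) (hq : q ∈ parents T v₀ D y) :
    below T v₀ D p (meet T v₀ D p q) = below T v₀ D q (meet T v₀ D p q) ∧
      meet T v₀ D p q < level T v₀ D y := by
  have h0 := level_pos_of_parent hp
  have h1 : level T v₀ D y - 1 ∈ {j | below T v₀ D p j = below T v₀ D q j} := by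
    have h2 := level_below hy hp (j := level T v₀ D y - 1) (by omega)
    have h3 := level_below hy hq (j := level T v₀ D y - 1) (by omega)
    have h4 := level_eq_zero_iff.1 (show level T v₀ D (below T v₀ D p (level T v₀ D y - 1)) = 0 by
      omega)
    have h5 := level_eq_zero_iff.1 (show level T v₀ D (below T v₀ D q (level T v₀ D y - 1)) = 0 by
      omega)
    exact h4.trans h5.symm
  refine ⟨Nat.sInf_mem ⟨_, h1⟩, ?_⟩
  have := Nat.sInf_le h1
  rw [meet]
  omega

theorem below_ne {p q : S.Half} {j : ℕ} (hj : j < meet T v₀ D p q) :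
    below T v₀ D p j ≠ below T v₀ D q j := Nat.notMem_of_lt_sInf hj

variable (T v₀ D) in
/-- The lasso that enters the node of level `h` with parents `p` and `q` by `p` and leaves it
by `q`. -/
def lassoOut (r h : ℕ) (p q : S.Half) (i : Fin r) : S.Half :=
  if i.1 < h then mate T (descend T v₀ D p (h - 1 - i)) else descend T v₀ D q (i - h)

/-- the half-edges of a lasso that lead towards the root, if its deepest node is the `h`-th one -/
def IsTop (h : ℕ) (a : Fin r × Bool) : Prop := if a.1.1 < h then a.2 = true else a.2 = false

set_option maxHeartbeats 1000000 in
/-- Every node with two parents is the deepest node of the cycle of a lasso. -/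
theorem rootedLasso_lassoOut {y : S.Node} (hy : y ∈ ball T v₀ D) {p q : S.Half}
    (hp : p ∈ parents T v₀ D y) (hq : q ∈ parents T v₀ D y) (hpq : p ≠ q)
    (hk : k = meet T v₀ D p q + 1) (hh : ℓ + k = level T v₀ D y) (hr : r = ℓ + 2 * k) :
    RootedLasso T v₀ r ℓ (lassoOut T v₀ D r (ℓ + k) p q) := by
  obtain ⟨hmeet, hmlt⟩ := below_meet hy hp hq
  have hmin : ∀ j, j + 1 < k → below T v₀ D p j ≠ below T v₀ D q j :=
    fun j hj => below_ne (by omega)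
  have hmeet' : below T v₀ D p (k - 1) = below T v₀ D q (k - 1) := by
    rw [show k - 1 = meet T v₀ D p q by omega]; exact hmeet
  set h := ℓ + k with hhdef
  have hyD := mem_ball.1 hy
  set X : ℕ → S.Node := fun n => if n < h then below T v₀ D p (h - 1 - n)
    else nd (descend T v₀ D q (n - h)) with hX
  have hXlt : ∀ n, n < h → X n = below T v₀ D p (h - 1 - n) := fun n hn => by
    simp only [hX, if_pos hn]
  have hXge : ∀ j, X (h + j) = nd (descend T v₀ D q j) := fun j => by
    simp only [hX, if_neg (show ¬ h + j < h by omega), Nat.add_sub_cancel_left]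
  have hlevX : ∀ n, n < h → level T v₀ D (X n) = n := by
    intro n hn
    have := level_below hy hp (j := h - 1 - n) (by omega)
    rw [hXlt n hn]
    omega
  have hlevX' : ∀ j, j < k → level T v₀ D (X (h + j)) + j = h := by
    intro j hj
    have := level_descend hy hq (j := j) (by omega)
    rw [hXge j]
    omega
  have hXh : X h = y := by
    have := hXge 0
    rw [add_zero] at this
    rw [this, descend, (mem_parents.1 hq).1]
  set P := walkEnds T (lassoOut T v₀ D r h p q) with hP
  have hPf : ∀ i : Fin r, i.1 < h → P (i, true) = descend T v₀ D p (h - 1 - i) := fun i hi => by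
    simp only [hP, walkEnds, lassoOut, if_pos hi, if_true, mate_mate]
  have hPs : ∀ i : Fin r, ¬ i.1 < h → P (i, false) = descend T v₀ D q (i - h) := fun i hi => by
    simp [hP, walkEnds, lassoOut, if_neg hi]
  have hflip : ∀ a : Fin r × Bool, mate T (P a) = P (a.1, !a.2) := by
    rintro ⟨i, _ | _⟩
    · exact walkEnds_true T _ i
    · exact walkEnds_false T _ i
  have hnd : ∀ a, nd (P a) = X (endPos r ℓ a) := by
    rintro ⟨i, b⟩
    have hi := i.2
    by_cases hih : i.1 < h
    · cases b
      · have := hflip (i, true)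
        rw [hPf i hih] at this
        simp only [Bool.not_true] at this
        rw [← this]
        simp only [endPos, Bool.false_eq_true, if_false]
        rw [hXlt _ hih, below]
      · rw [hPf i hih]
        simp only [endPos, if_true]
        rw [if_pos (by omega)]
        by_cases h1 : i.1 + 1 < h
        · rw [hXlt _ h1, ← nd_descend hy hp (by omega), show h - 1 - (i.1 + 1) + 1 = h - 1 - i by omega]
        · rw [show i.1 + 1 = h by omega, hXh, show h - 1 - i.1 = 0 by omega, descend,
            (mem_parents.1 hp).1]
    · cases b
      · rw [hPs i hih]
        simp only [endPos, Bool.false_eq_true, if_false]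
        rw [← hXge, show h + (i.1 - h) = i by omega]
      · have := hflip (i, false)
        rw [hPs i hih] at this
        simp only [Bool.not_false] at this
        rw [← this]
        simp only [endPos, if_true]
        split_ifs with h1
        · rw [show i.1 + 1 = h + (i.1 - h + 1) by omega, hXge, nd_descend hy hq (by omega), below]
        · rw [hXlt ℓ (by omega), show h - 1 - ℓ = k - 1 by omega, hmeet', below,
            show i.1 - h = k - 1 by omega]
  have hXinj : ∀ n n', n < r → n' < r → n < n' → X n ≠ X n' := by
    intro n n' hn hn' hlt he
    have e := congrArg (level T v₀ D) he
    by_cases h1 : n' < h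
    · rw [hlevX n (by omega), hlevX n' h1] at e
      omega
    · have h2 := hlevX' (n' - h) (by omega)
      rw [show h + (n' - h) = n' by omega, ← e] at h2
      by_cases h3 : n < h
      · rw [hlevX n h3] at h2
        rw [hXlt n h3, show n' = h + (n' - h - 1 + 1) by omega, hXge,
          nd_descend hy hq (by omega), show n' - h - 1 = h - 1 - n by omega] at he
        exact hmin (h - 1 - n) (by omega) he
      · have h4 := hlevX' (n - h) (by omega)
        rw [show h + (n - h) = n by omega] at h4
        omega
  have hℓr : ℓ < r := by omega
  have hXeq : ∀ a b : Fin r × Bool, nd (P a) = nd (P b) ↔ endPos r ℓ a = endPos r ℓ b := by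
    intro a b
    rw [hnd, hnd]
    refine ⟨fun he => ?_, fun he => by rw [he]⟩
    by_contra hne
    rcases Nat.lt_or_gt_of_ne hne with h1 | h1
    · exact hXinj _ _ (endPos_lt hℓr a) (endPos_lt hℓr b) h1 he
    · exact hXinj _ _ (endPos_lt hℓr b) (endPos_lt hℓr a) h1 he.symm
  have hpqne : ∀ i j, i < h → j < k → descend T v₀ D p i ≠ descend T v₀ D q j := by
    intro i j hi hj he
    have h1 := level_descend hy hp (j := i) (by omega)
    have h2 := level_descend hy hq (j := j) (by omega)
    rw [he] at h1
    obtain rfl : i = j := by omega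
    rcases i with _ | i
    · exact hpq he
    · have h3 := congrArg nd he
      rw [nd_descend hy hp (by omega), nd_descend hy hq (by omega)] at h3
      exact hmin i hj h3
  -- the half-edges that lead towards the root
  have htop : ∀ a b : Fin r × Bool, IsTop h a → IsTop h b → P a = P b → a = b := by
    rintro ⟨i, bi⟩ ⟨j, bj⟩ ha hb he
    have hi := i.2
    have hj := j.2
    by_cases hih : i.1 < h <;> by_cases hjh : j.1 < h
    · simp only [IsTop, if_pos hih, if_pos hjh] at ha hb
      subst ha hb
      have h1 := (hXeq _ _).1 (congrArg nd he)
      simp only [endPos, if_true, if_pos (show i.1 + 1 < r by omega),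
        if_pos (show j.1 + 1 < r by omega)] at h1
      exact Prod.ext (Fin.ext (show i.1 = j.1 by omega)) rfl
    · simp only [IsTop, if_pos hih, if_neg hjh] at ha hb
      subst ha hb
      rw [hPf i hih, hPs j hjh] at he
      exact absurd he (hpqne _ _ (by omega) (by omega))
    · simp only [IsTop, if_neg hih, if_pos hjh] at ha hb
      subst ha hb
      rw [hPs i hih, hPf j hjh] at he
      exact absurd he.symm (hpqne _ _ (by omega) (by omega))
    · simp only [IsTop, if_neg hih, if_neg hjh] at ha hb
      subst ha hb
      have h1 := (hXeq _ _).1 (congrArg nd he)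
      simp only [endPos, Bool.false_eq_true, if_false] at h1
      exact Prod.ext (Fin.ext h1) rfl
  have htopmem : ∀ a : Fin r × Bool, IsTop h a → P a ∈ parents T v₀ D (nd (P a)) := by
    rintro ⟨i, bi⟩ ha
    have hi := i.2
    by_cases hih : i.1 < h
    · simp only [IsTop, if_pos hih] at ha
      subst ha
      rw [hPf i hih]
      exact descend_mem hy hp (by omega)
    · simp only [IsTop, if_neg hih] at ha
      subst ha
      rw [hPs i hih]
      exact descend_mem hy hq (by omega)
  have hntop : ∀ a : Fin r × Bool, ¬ IsTop h a → IsTop h (a.1, !a.2) := by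
    rintro ⟨i, bi⟩ ha
    by_cases hih : i.1 < h
    · simp only [IsTop, if_pos hih] at ha ⊢
      revert ha
      cases bi <;> simp
    · simp only [IsTop, if_neg hih] at ha ⊢
      revert ha
      cases bi <;> simp
  have hnot : ∀ a b : Fin r × Bool, IsTop h a → ¬ IsTop h b → P a ≠ P b := by
    intro a b ha hb he
    have h1 := (mem_parents.1 (htopmem a ha)).2
    have h2 := (mem_parents.1 (htopmem _ (hntop b hb))).2
    rw [← hflip b, mate_mate, ← he] at h2
    omega
  refine ⟨⟨fun a b he => ?_, hXeq, fun a => ?_⟩, fun hr0 => ?_⟩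
  · by_cases ha : IsTop h a <;> by_cases hb : IsTop h b
    · exact htop a b ha hb he
    · exact absurd he (hnot a b ha hb)
    · exact absurd he.symm (hnot b a hb ha)
    · have h1 := htop _ _ (hntop a ha) (hntop b hb) (by rw [← hflip, ← hflip]; exact congrArg (mate T) he)
      have h2 := congrArg (fun c : Fin r × Bool => ((c.1, !c.2) : Fin r × Bool)) h1
      simpa using h2
  · have hlt := endPos_lt hℓr a
    have hpar : level T v₀ D (X (endPos r ℓ a)) ≤ D ∧
        (Even (level T v₀ D (X (endPos r ℓ a))) ↔ Even (endPos r ℓ a)) := by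
      generalize endPos r ℓ a = n at hlt
      by_cases hn : n < h
      · rw [hlevX n hn]
        exact ⟨by omega, Iff.rfl⟩
      · have h2 := hlevX' (n - h) (by omega)
        rw [show h + (n - h) = n by omega] at h2
        refine ⟨by omega, ?_⟩
        rw [show n = level T v₀ D (X n) + 2 * (n - h) by omega]
        rw [show level T v₀ D (X n) + 2 * (n - h) = n by omega, Nat.even_iff, Nat.even_iff]
        omega
    rw [← isLeft_nd, hnd, isLeft_eq_even_level hpar.1]
    exact decide_eq_decide.2 hpar.2
  · have h1 := hnd (⟨0, hr0⟩, false)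
    simp only [endPos, Bool.false_eq_true, if_false] at h1
    have h2 : P (⟨0, hr0⟩, false) = lassoOut T v₀ D r h p q ⟨0, hr0⟩ := by simp [hP, walkEnds]
    rw [← h2, h1, ← level_eq_zero_iff (T := T) (D := D), hlevX 0 (by omega)]

/-- Conversely, a lasso is determined by the parents by which it enters and leaves the deepest
node of its cycle. -/
theorem RootedLasso.eq_lassoOut {out : Fin r → S.Half} (h : RootedLasso T v₀ r ℓ out) (hk : 1 ≤ k)
    (hr : r = ℓ + 2 * k) (hD : ℓ + k ≤ D) {y : S.Node} (hy : OnlyDoubled T v₀ D y) :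
    ∃ p q, p ∈ parents T v₀ D y ∧ q ∈ parents T v₀ D y ∧ p ≠ q ∧ level T v₀ D y = ℓ + k ∧
      k = meet T v₀ D p q + 1 ∧ out = lassoOut T v₀ D r (ℓ + k) p q := by
  obtain ⟨h1, h2, h3⟩ := h.profile hk hr hD hy
  have hlevy : level T v₀ D y = ℓ + k := by rw [← h1]; exact h2 _ le_rfl
  have hyb : y ∈ ball T v₀ D := by rw [mem_ball]; omega
  set p := mate T (out ⟨ℓ + k - 1, by omega⟩) with hp
  set q := out ⟨ℓ + k, by omega⟩ with hq
  have hpy : p ∈ parents T v₀ D y := by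
    have := h.mem_parents_first hk hr hD hy (ℓ + k - 1) (by omega)
    simp only [show ℓ + k - 1 + 1 = ℓ + k by omega] at this
    rwa [← hq, h1] at this
  have hqy : q ∈ parents T v₀ D y := by
    have := h.mem_parents_second hk hr hD hy 0 (by omega)
    simp only [add_zero] at this
    rwa [← hq, h1] at this
  have hne : p ≠ q := h.out_ne_mate _ _
  have hiny : ∀ i, ∀ hi : i < r, nd (out ⟨i, hi⟩) = y → i = ℓ + k := fun i hi he =>
    h.node_injective hi (by omega) (he.trans h1.symm)
  -- away from the deepest node, parents are unique
  have hfirst : ∀ j, ∀ hj : j < ℓ + k, mate T (out ⟨ℓ + k - 1 - j, by omega⟩) =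
      descend T v₀ D p j := by
    intro j
    induction j with
    | zero => intro _; rfl
    | succ j ih =>
      intro hj
      by_contra hne'
      have h4 := h.mem_parents_first hk hr hD hy (ℓ + k - 1 - (j + 1)) (by omega)
      simp only [show ℓ + k - 1 - (j + 1) + 1 = ℓ + k - 1 - j by omega] at h4
      have h5 := descend_mem hyb hpy (j := j + 1) (by omega)
      rw [nd_descend hyb hpy (by omega), below, ← ih (by omega), mate_mate] at h5
      have h6 := hy.eq _ (mem_ball.2 (by rw [h2 _ (by omega)]; omega)) _ h4 _ h5 hne'
      have := hiny _ _ h6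
      omega
  have hsecond : ∀ j, ∀ hj : ℓ + k + j < r, out ⟨ℓ + k + j, hj⟩ = descend T v₀ D q j := by
    intro j
    induction j with
    | zero => intro _; rfl
    | succ j ih =>
      intro hj
      by_contra hne'
      have h4 := h.mem_parents_second hk hr hD hy (j + 1) hj
      have h5 := descend_mem hyb hqy (j := j + 1) (by omega)
      have e : nextPos r ℓ (ℓ + k + j) = ℓ + k + (j + 1) := by
        rw [nextPos, if_pos (by omega)]; omega
      have h7 := h.nd_mate (i := ℓ + k + j) (by omega) (nextPos_lt (by omega) _)
      simp only [e] at h7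
      rw [nd_descend hyb hqy (by omega), below, ← ih (by omega), h7] at h5
      have h8 := h3 (j + 1) hj
      have h6 := hy.eq _ (mem_ball.2 (by omega)) _ h4 _ h5 hne'
      have := hiny _ _ h6
      omega
  have hbp : ∀ j, ∀ hj : j < ℓ + k, below T v₀ D p j = nd (out ⟨ℓ + k - 1 - j, by omega⟩) := by
    intro j hj
    rw [below, ← hfirst j hj, mate_mate]
  have hbq : ∀ j, ∀ hj : ℓ + k + j < r, below T v₀ D q j =
      nd (out ⟨nextPos r ℓ (ℓ + k + j), nextPos_lt (by omega) _⟩) := by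
    intro j hj
    rw [below, ← hsecond j hj, h.nd_mate hj]
  refine ⟨p, q, hpy, hqy, hne, hlevy, ?_, ?_⟩
  · have h4 : below T v₀ D p (k - 1) = below T v₀ D q (k - 1) := by
      rw [hbp _ (by omega), hbq _ (by omega)]
      congr 3
      rw [nextPos, if_neg (by omega)]
      omega
    have h5 : meet T v₀ D p q ≤ k - 1 := Nat.sInf_le h4
    have h6 : ¬ meet T v₀ D p q < k - 1 := by
      intro hlt
      obtain ⟨h7, -⟩ := below_meet hyb hpy hqy
      rw [hbp _ (by omega), hbq _ (by omega)] at h7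
      have := h.node_injective _ _ h7
      rw [nextPos, if_pos (by omega)] at this
      omega
    omega
  · funext i
    have hi := i.2
    rw [lassoOut]
    split_ifs with h4
    · rw [← hfirst (ℓ + k - 1 - i) (by omega), mate_mate]
      congr 1
      exact Fin.ext (by simp only; omega)
    · rw [← hsecond (i - (ℓ + k)) (by omega)]
      congr 1
      exact Fin.ext (by simp only; omega)

/-- The neighborhood has one cycle, whose deepest node is `y`. -/
structure Unicyclic (T : S.TannerGraph) (v₀ : Fin S.n) (D : ℕ) (y : S.Node) : Prop
    extends OnlyDoubled T v₀ D y where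
  mem : y ∈ ball T v₀ D
  card_eq : (parents T v₀ D y).card = 2

/-- A neighborhood with one cycle has lassos of exactly one type, and these are two, one for each
orientation of the cycle. -/
theorem Unicyclic.card_lassos {y : S.Node} (hy : Unicyclic T v₀ D y) :
    ∃ ℓ₀ k₀, 1 ≤ k₀ ∧ ℓ₀ + k₀ = level T v₀ D y ∧ ∀ ℓ k, 1 ≤ k → ℓ + k ≤ D →
      ∑ out : Fin (ℓ + 2 * k) → S.Half, ind (RootedLasso T v₀ (ℓ + 2 * k) ℓ out) =
        if ℓ = ℓ₀ ∧ k = k₀ then 2 else 0 := by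
  classical
  obtain ⟨p, q, hpq, hpar⟩ := Finset.card_eq_two.1 hy.card_eq
  have hp : p ∈ parents T v₀ D y := by rw [hpar]; simp
  have hq : q ∈ parents T v₀ D y := by rw [hpar]; simp
  obtain ⟨-, hm⟩ := below_meet hy.mem hp hq
  refine ⟨level T v₀ D y - (meet T v₀ D p q + 1), meet T v₀ D p q + 1, by omega, by omega,
    fun ℓ k hk hD => ?_⟩
  have hcases : ∀ p' q', p' ∈ parents T v₀ D y → q' ∈ parents T v₀ D y → p' ≠ q' →
      (p' = p ∧ q' = q) ∨ (p' = q ∧ q' = p) := by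
    intro p' q' hp' hq' hne
    rw [hpar] at hp' hq'
    simp only [Finset.mem_insert, Finset.mem_singleton] at hp' hq'
    rcases hp' with rfl | rfl <;> rcases hq' with rfl | rfl <;> simp_all
  split_ifs with hc
  · obtain ⟨hc1, hc2⟩ := hc
    have hset : ∀ out : Fin (ℓ + 2 * k) → S.Half, RootedLasso T v₀ (ℓ + 2 * k) ℓ out ↔
        out = lassoOut T v₀ D (ℓ + 2 * k) (ℓ + k) p q ∨
          out = lassoOut T v₀ D (ℓ + 2 * k) (ℓ + k) q p := by
      intro out
      constructor
      · intro h
        obtain ⟨p', q', hp', hq', hne, -, -, he⟩ := h.eq_lassoOut hk rfl hD hy.toOnlyDoubled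
        rcases hcases p' q' hp' hq' hne with ⟨rfl, rfl⟩ | ⟨rfl, rfl⟩
        · exact Or.inl he
        · exact Or.inr he
      · rintro (rfl | rfl)
        · exact rootedLasso_lassoOut hy.mem hp hq hpq hc2 (by omega) rfl
        · exact rootedLasso_lassoOut hy.mem hq hp hpq.symm (by rw [meet_comm, hc2]) (by omega) rfl
    have hne : lassoOut T v₀ D (ℓ + 2 * k) (ℓ + k) p q ≠
        lassoOut T v₀ D (ℓ + 2 * k) (ℓ + k) q p := by
      intro he
      have := congrFun he ⟨ℓ + k, by omega⟩
      simp only [lassoOut, lt_irrefl, if_false, Nat.sub_self, descend] at this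
      exact hpq this.symm
    simp only [ind, hset]
    rw [← Finset.sum_filter, Finset.sum_const, Finset.filter_or, Finset.filter_eq',
      Finset.filter_eq', if_pos (Finset.mem_univ _), if_pos (Finset.mem_univ _),
      ← Finset.insert_eq, Finset.card_pair hne]
    norm_num
  · refine Finset.sum_eq_zero fun out _ => ?_
    rw [ind, if_neg]
    intro h
    obtain ⟨p', q', hp', hq', hne, hl, hm', -⟩ := h.eq_lassoOut hk rfl hD hy.toOnlyDoubled
    apply hc
    rcases hcases p' q' hp' hq' hne with ⟨rfl, rfl⟩ | ⟨rfl, rfl⟩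
    · exact ⟨by omega, by omega⟩
    · rw [meet_comm] at hm'
      exact ⟨by omega, by omega⟩

/-- A tree has no lassos. -/
theorem not_rootedLasso (hy : ∀ x ∈ ball T v₀ D, (parents T v₀ D x).card ≤ 1) (hk : 1 ≤ k)
    (hD : ℓ + k ≤ D) (out : Fin (ℓ + 2 * k) → S.Half) :
    ¬ RootedLasso T v₀ (ℓ + 2 * k) ℓ out := by
  intro h
  have hroot : OnlyDoubled T v₀ D (Sum.inl v₀) := by
    refine ⟨fun x hx p hp q hq hne => absurd (Finset.card_le_one.1 (hy x hx) p hp q hq) hne, ?_⟩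
    rw [parents_root]
    simp
  obtain ⟨p, q, hp, -⟩ := h.eq_lassoOut hk rfl hD hroot
  rw [parents_root] at hp
  simp at hp

theorem exists_unicyclic {t : ℕ} (h : (nbhd t v₀ T).numCycles = 1) :
    ∃ y, Unicyclic T v₀ (2 * t) y := by
  classical
  rw [numCycles_nbhd, Nat.cast_eq_one] at h
  obtain ⟨y, hy, hy0⟩ := Finset.exists_ne_zero_of_sum_ne_zero (by rw [h]; exact one_ne_zero)
  rw [← Finset.add_sum_erase _ _ hy] at h
  have h1 : ∑ x ∈ ((ball T v₀ (2 * t)).erase (Sum.inl v₀)).erase y,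
      ((parents T v₀ (2 * t) x).card - 1) = 0 := by omega
  rw [Finset.sum_eq_zero_iff] at h1
  have hc : (parents T v₀ (2 * t) y).card = 2 := by omega
  refine ⟨y, ⟨⟨fun x hx p hp q hq hne => ?_, hc.le⟩, Finset.mem_of_mem_erase hy, hc⟩⟩
  by_contra hxy
  by_cases hx0 : x = Sum.inl v₀
  · rw [hx0, parents_root] at hp
    simp at hp
  · have := h1 x (Finset.mem_erase.2 ⟨hxy, Finset.mem_erase.2 ⟨hx0, hx⟩⟩)
    exact hne (Finset.card_le_one.1 (by omega) p hp q hq)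

theorem card_parents_le_one {t : ℕ} (h : (nbhd t v₀ T).numCycles = 0) :
    ∀ x ∈ ball T v₀ (2 * t), (parents T v₀ (2 * t) x).card ≤ 1 := by
  rw [numCycles_nbhd, Nat.cast_eq_zero, Finset.sum_eq_zero_iff] at h
  intro x hx
  by_cases hx0 : x = Sum.inl v₀
  · rw [hx0, parents_root]
    simp
  · have := h x (Finset.mem_erase.2 ⟨hx0, hx⟩)
    omega

end

/-! ### The nodes on the cycle -/

section

variable {S : Sockets} {T : S.TannerGraph} {v₀ : Fin S.n} {D r ℓ k t : ℕ}

variable (T v₀ D) in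
open Classical in
/-- A set of half-edges that contains none or two half-edges of each node, and with every
half-edge the other end of its edge: the half-edges of disjoint cycles. -/
structure CycleSet (W : Finset S.Half) : Prop where
  mate_mem : ∀ h ∈ W, mate T h ∈ W
  nd_mem : ∀ h ∈ W, nd h ∈ ball T v₀ D
  card_eq : ∀ h ∈ W, (W.filter fun h' => nd h' = nd h).card = 2

theorem CycleSet.exists_other {W : Finset S.Half} (hW : CycleSet T v₀ D W) {w : S.Half}
    (hw : w ∈ W) : ∃ w' ∈ W, nd w' = nd w ∧ w' ≠ w := by
  classical
  have h1 : 1 < (W.filter fun h' => nd h' = nd w).card := by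
    have := hW.card_eq w hw
    convert (by omega : 1 < 2)
  obtain ⟨w', hw', hne⟩ := Finset.exists_mem_ne h1 w
  rw [Finset.mem_filter] at hw'
  exact ⟨w', hw'.1, hw'.2, hne⟩

theorem CycleSet.eq_of_ne {W : Finset S.Half} (hW : CycleSet T v₀ D W) {a b c : S.Half}
    (ha : a ∈ W) (hb : b ∈ W) (hc : c ∈ W) (hab : nd b = nd a) (hac : nd c = nd a)
    (h1 : a ≠ b) (h2 : a ≠ c) : b = c := by
  classical
  have h := hW.card_eq a ha
  refine card_le_two (s := W.filter fun h' => nd h' = nd a) ?_ (Finset.mem_filter.2 ⟨ha, rfl⟩)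
    (Finset.mem_filter.2 ⟨hb, hab⟩) (Finset.mem_filter.2 ⟨hc, hac⟩) h1 h2
  convert h.le

theorem CycleSet.parent_or_child {W : Finset S.Half} (hW : CycleSet T v₀ D W) {w : S.Half}
    (hw : w ∈ W) : w ∈ parents T v₀ D (nd w) ∨
      (mate T w ∈ parents T v₀ D (nd (mate T w)) ∧
        level T v₀ D (nd (mate T w)) = level T v₀ D (nd w) + 1) := by
  rcases level_mate (mem_ball.1 (hW.nd_mem w hw)) with h | h
  · exact Or.inr ⟨mem_parents.2 ⟨rfl, by rw [mate_mate, h]⟩, h⟩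
  · exact Or.inl (mem_parents.2 ⟨rfl, h⟩)

theorem not_mate_mem_parents {w : S.Half} (hw : w ∈ parents T v₀ D (nd w)) :
    mate T w ∉ parents T v₀ D (nd (mate T w)) := by
  intro h
  have h1 := (mem_parents.1 hw).2
  have h2 := (mem_parents.1 h).2
  rw [mate_mate] at h2
  omega

/-- The highest nodes of cycles have two parents. -/
theorem CycleSet.level_le {W : Finset S.Half} (hW : CycleSet T v₀ D W) {y : S.Node}
    (hy : OnlyDoubled T v₀ D y) {w : S.Half} (hw : w ∈ W) :
    level T v₀ D (nd w) ≤ level T v₀ D y := by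
  classical
  obtain ⟨m, hm, hmax⟩ := W.exists_max_image (fun h => level T v₀ D (nd h)) ⟨w, hw⟩
  obtain ⟨m', hm', h1, h2⟩ := hW.exists_other hm
  have hp : ∀ a ∈ W, nd a = nd m → a ∈ parents T v₀ D (nd m) := by
    intro a ha ham
    rcases hW.parent_or_child ha with h | ⟨-, h⟩
    · rwa [ham] at h
    · have := hmax _ (hW.mate_mem a ha)
      rw [ham] at h
      omega
  have := hy.eq _ (hW.nd_mem m hm) _ (hp m' hm' h1) _ (hp m hm rfl) h2
  rw [← this]
  exact hmax w hw

theorem CycleSet.eq_of_level {W : Finset S.Half} (hW : CycleSet T v₀ D W) {y : S.Node}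
    (hy : OnlyDoubled T v₀ D y) {w : S.Half} (hw : w ∈ W)
    (hl : level T v₀ D (nd w) = level T v₀ D y) : nd w = y := by
  obtain ⟨m', hm', h1, h2⟩ := hW.exists_other hw
  have hp : ∀ a ∈ W, nd a = nd w → a ∈ parents T v₀ D (nd w) := by
    intro a ha ham
    rcases hW.parent_or_child ha with h | ⟨-, h⟩
    · rwa [ham] at h
    · have := hW.level_le hy (hW.mate_mem a ha)
      rw [ham] at h
      omega
  exact hy.eq _ (hW.nd_mem w hw) _ (hp m' hm' h1) _ (hp w hw rfl) h2

section
variable {out : Fin r → S.Half} {y : S.Node} {W : Finset S.Half}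

/-- Going down from the deepest node, a cycle has to follow the lasso. -/
theorem CycleSet.follows_lasso (hW : CycleSet T v₀ D W) (hne : W.Nonempty)
    (h : RootedLasso T v₀ r ℓ out) (hk : 1 ≤ k) (hr : r = ℓ + 2 * k) (hD : ℓ + k ≤ D)
    (hy : Unicyclic T v₀ D y) (j : ℕ) : ∀ hj : j < k,
    (mate T (out ⟨ℓ + k - 1 - j, by omega⟩) ∈ W ∧ out ⟨ℓ + k + j, by omega⟩ ∈ W) ∧
    ∀ w ∈ W, w ∈ parents T v₀ D (nd w) → level T v₀ D (nd w) + j = ℓ + k →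
      w = mate T (out ⟨ℓ + k - 1 - j, by omega⟩) ∨ w = out ⟨ℓ + k + j, by omega⟩ := by
  classical
  obtain ⟨hhy, hl1, hl2⟩ := h.profile hk hr hD hy.toOnlyDoubled
  have hlevy : level T v₀ D y = ℓ + k := by rw [← hhy]; exact hl1 _ le_rfl
  have hnode : ∀ i, ∀ hi : i < r, i ≠ ℓ + k → nd (out ⟨i, hi⟩) ≠ y := fun i hi hne he =>
    hne (h.node_injective hi (by omega) (he.trans hhy.symm))
  have hball : ∀ i, ∀ hi : i < r, nd (out ⟨i, hi⟩) ∈ ball T v₀ D := fun i hi =>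
    mem_ball.2 ((h.level_le hk hr i hi).trans hD)
  have huniq : ∀ i, ∀ hi : i < r, i ≠ ℓ + k → ∀ a ∈ parents T v₀ D (nd (out ⟨i, hi⟩)),
      ∀ b ∈ parents T v₀ D (nd (out ⟨i, hi⟩)), a = b := by
    intro i hi hne a ha b hb
    by_contra hab
    exact hnode i hi hne (hy.eq _ (hball i hi) a ha b hb hab)
  have hmf := h.mem_parents_first hk hr hD hy.toOnlyDoubled
  have hms := h.mem_parents_second hk hr hD hy.toOnlyDoubled
  induction j with
  | zero =>
    intro _
    have hp : mate T (out ⟨ℓ + k - 1 - 0, by omega⟩) ∈ parents T v₀ D y := by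
      have := hmf (ℓ + k - 1) (by omega)
      simp only [show ℓ + k - 1 + 1 = ℓ + k by omega] at this
      rwa [hhy] at this
    have hq : out ⟨ℓ + k + 0, by omega⟩ ∈ parents T v₀ D y := by
      have := hms 0 (by omega)
      simp only [add_zero] at this ⊢
      rwa [hhy] at this
    have hpq : mate T (out ⟨ℓ + k - 1 - 0, by omega⟩) ≠ out ⟨ℓ + k + 0, by omega⟩ :=
      h.out_ne_mate _ _
    have hall : ∀ w ∈ parents T v₀ D y, w = mate T (out ⟨ℓ + k - 1 - 0, by omega⟩) ∨
        w = out ⟨ℓ + k + 0, by omega⟩ := by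
      intro w hw
      by_contra! hcon
      exact hpq (card_le_two hy.card_eq.le hw hp hq hcon.1 hcon.2)
    refine ⟨?_, fun w hw hwp hwl => ?_⟩
    · -- a cycle reaches the deepest node
      obtain ⟨m, hm, hmax⟩ := W.exists_max_image (fun h => level T v₀ D (nd h)) hne
      have hpm : ∀ a ∈ W, nd a = nd m → a ∈ parents T v₀ D (nd m) := by
        intro a ha ham
        rcases hW.parent_or_child ha with h | ⟨-, h⟩
        · rwa [ham] at h
        · have := hmax _ (hW.mate_mem a ha)
          rw [ham] at h
          omega
      obtain ⟨m', hm', h1, h2⟩ := hW.exists_other hm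
      have e := hy.eq _ (hW.nd_mem m hm) _ (hpm m' hm' h1) _ (hpm m hm rfl) h2
      have p1 := hpm m hm rfl
      have p2 := hpm m' hm' h1
      rw [e] at p1 p2
      rcases hall _ p1 with e1 | e1 <;> rcases hall _ p2 with e2 | e2
      · exact absurd (e2.trans e1.symm) h2
      · exact ⟨e1 ▸ hm, e2 ▸ hm'⟩
      · exact ⟨e2 ▸ hm', e1 ▸ hm⟩
      · exact absurd (e2.trans e1.symm) h2
    · have e := hW.eq_of_level hy.toOnlyDoubled hw (by omega)
      exact hall w (e ▸ hwp)
  | succ j ih =>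
    intro hj
    obtain ⟨⟨hA, hB⟩, hC⟩ := ih (by omega)
    have hA' : out ⟨ℓ + k - 1 - j, by omega⟩ ∈ W := by
      have := hW.mate_mem _ hA
      rwa [mate_mate] at this
    have hB' := hW.mate_mem _ hB
    have hnext : nd (mate T (out ⟨ℓ + k + j, by omega⟩)) = nd (out ⟨ℓ + k + (j + 1), by omega⟩) := by
      rw [h.nd_mate (by omega) (nextPos_lt (by omega) _)]
      simp only [nextPos, if_pos (show ℓ + k + j + 1 < r by omega)]
      rfl
    have hparA := hmf (ℓ + k - 1 - (j + 1)) (by omega)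
    simp only [show ℓ + k - 1 - (j + 1) + 1 = ℓ + k - 1 - j by omega] at hparA
    have hparB := hms (j + 1) (by omega)
    have hlA : level T v₀ D (nd (out ⟨ℓ + k - 1 - j, by omega⟩)) + (j + 1) = ℓ + k := by
      rw [hl1 _ (by omega)]; omega
    have hlB := hl2 (j + 1) (by omega)
    have hAB : nd (out ⟨ℓ + k - 1 - j, by omega⟩) ≠ nd (out ⟨ℓ + k + (j + 1), by omega⟩) :=
      fun he => by have := h.node_injective _ _ he; omega
    -- the half-edges of the cycle that lead upwards from the present level
    have hup : ∀ w ∈ W, level T v₀ D (nd w) + (j + 1) = ℓ + k → w ∉ parents T v₀ D (nd w) →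
        w = out ⟨ℓ + k - 1 - j, by omega⟩ ∨ w = mate T (out ⟨ℓ + k + j, by omega⟩) := by
      intro w hw hwl hwp
      obtain ⟨h1, h2⟩ := (hW.parent_or_child hw).resolve_left hwp
      rcases hC _ (hW.mate_mem w hw) h1 (by omega) with e | e
      · exact Or.inl (mate_injective T e)
      · right
        rw [← e, mate_mate]
    refine ⟨⟨?_, ?_⟩, fun w hw hwp hwl => ?_⟩
    · obtain ⟨w, hw, hwn, hwne⟩ := hW.exists_other hA'
      have hwp : w ∈ parents T v₀ D (nd w) := by
        by_contra hwp
        rcases hup w hw (by rw [hwn, hlA]) hwp with e | e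
        · exact hwne e
        · rw [e, hnext] at hwn
          exact hAB hwn.symm
      rw [hwn] at hwp
      rwa [huniq _ (by omega) (by omega) _ hwp _ hparA] at hw
    · obtain ⟨w, hw, hwn, hwne⟩ := hW.exists_other hB'
      have hwp : w ∈ parents T v₀ D (nd w) := by
        by_contra hwp
        rcases hup w hw (by rw [hwn, hnext, hlB]) hwp with e | e
        · rw [e, hnext] at hwn
          exact hAB hwn
        · exact hwne e
      rw [hwn, hnext] at hwp
      rwa [huniq _ (by omega) (by omega) _ hwp _ hparB] at hw
    · obtain ⟨w', hw', hwn, hwne⟩ := hW.exists_other hw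
      have hwp' : w' ∉ parents T v₀ D (nd w') := by
        intro hwp'
        rw [hwn] at hwp'
        have e := hy.eq _ (hW.nd_mem w hw) _ hwp' _ hwp hwne
        rw [e] at hwl
        omega
      rcases hup w' hw' (by rw [hwn, hwl]) hwp' with e | e
      · left
        rw [e] at hwn
        rw [← hwn] at hwp
        exact huniq _ (by omega) (by omega) _ hwp _ hparA
      · right
        rw [e, hnext] at hwn
        rw [← hwn] at hwp
        exact huniq _ (by omega) (by omega) _ hwp _ hparB

theorem CycleSet.le_level (hW : CycleSet T v₀ D W)
    (h : RootedLasso T v₀ r ℓ out) (hk : 1 ≤ k) (hr : r = ℓ + 2 * k) (hD : ℓ + k ≤ D)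
    (hy : Unicyclic T v₀ D y) {w : S.Half} (hw : w ∈ W) : ℓ ≤ level T v₀ D (nd w) := by
  classical
  obtain ⟨hhy, hl1, hl2⟩ := h.profile hk hr hD hy.toOnlyDoubled
  have hlevy : level T v₀ D y = ℓ + k := by rw [← hhy]; exact hl1 _ le_rfl
  obtain ⟨⟨hA, hB⟩, hC⟩ := hW.follows_lasso ⟨w, hw⟩ h hk hr hD hy (k - 1) (by omega)
  simp only [show ℓ + k - 1 - (k - 1) = ℓ by omega] at hA hC
  have hA' := hW.mate_mem _ hA
  rw [mate_mate] at hA'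
  have hB' := hW.mate_mem _ hB
  have hlast : nd (mate T (out ⟨ℓ + k + (k - 1), by omega⟩)) = nd (out ⟨ℓ, by omega⟩) := by
    rw [h.nd_mate (by omega) (nextPos_lt (by omega) _)]
    simp only [nextPos, if_neg (show ¬ ℓ + k + (k - 1) + 1 < r by omega)]
  have hchild : ∀ w ∈ W, level T v₀ D (nd w) ≤ ℓ → ∃ w' ∈ W, nd w' = nd w ∧
      w' ∉ parents T v₀ D (nd w') := by
    intro w hw hl
    obtain ⟨w', hw', hwn, hwne⟩ := hW.exists_other hw
    by_contra! hcon
    have h1 := hcon w hw rfl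
    have h2 := hcon w' hw' hwn
    rw [hwn] at h2
    have e := hy.eq _ (hW.nd_mem w hw) _ h2 _ h1 hwne
    rw [e] at hl
    omega
  -- the cycle has no half-edge that leads further down
  have hbase : ∀ w ∈ W, level T v₀ D (nd w) = ℓ → w ∉ parents T v₀ D (nd w) := by
    intro w hw hl hwp
    obtain ⟨w', hw', hwn, hwp'⟩ := hchild w hw hl.le
    obtain ⟨h1, h2⟩ := (hW.parent_or_child hw').resolve_left hwp'
    have hx : nd w = nd (out ⟨ℓ, by omega⟩) := by
      rw [← hwn]
      rcases hC _ (hW.mate_mem w' hw') h1 (by rw [h2, hwn, hl]; omega) with e | e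
      · rw [mate_injective T e]
      · rw [← hlast, ← e, mate_mate]
    have hn1 : out ⟨ℓ, by omega⟩ ≠ w := by
      intro e
      have := h.mem_parents_first hk hr hD hy.toOnlyDoubled ℓ (by omega)
      rw [← (mem_parents.1 this).1] at this
      refine not_mate_mem_parents hwp ?_
      rw [← e]
      exact this
    have hn2 : mate T (out ⟨ℓ + k + (k - 1), by omega⟩) ≠ w := by
      intro e
      have := h.mem_parents_second hk hr hD hy.toOnlyDoubled (k - 1) (by omega)
      refine not_mate_mem_parents hwp ?_
      rw [← e, mate_mate]
      exact this
    have := hW.eq_of_ne hw hA' hB' hx.symm (hlast.trans hx.symm) hn1.symm hn2.symm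
    exact h.out_ne_mate _ _ this.symm
  by_contra! hlt
  obtain ⟨m, hm, hmax⟩ := (W.filter fun h => level T v₀ D (nd h) < ℓ).exists_max_image
    (fun h => level T v₀ D (nd h)) ⟨w, Finset.mem_filter.2 ⟨hw, hlt⟩⟩
  obtain ⟨hmW, hml⟩ := Finset.mem_filter.1 hm
  obtain ⟨w', hw', hwn, hwp'⟩ := hchild m hmW hml.le
  obtain ⟨h1, h2⟩ := (hW.parent_or_child hw').resolve_left hwp'
  rw [hwn] at h2
  have hmate := hW.mate_mem w' hw'
  by_cases h3 : level T v₀ D (nd m) + 1 = ℓ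
  · exact hbase _ hmate (by omega) h1
  · have := hmax (mate T w') (Finset.mem_filter.2 ⟨hmate, by omega⟩)
    omega

end

theorem nd_mate_ne (h : S.Half) : nd (mate T h) ≠ nd h := fun he => by
  have := isLeft_nd (mate T h)
  rw [he, isLeft_nd, isLeft_mate] at this
  exact absurd this.symm (Bool.not_ne_self _)

open Classical in
/-- A node on a cycle, in terms of half-edges. -/
theorem exists_cycleSet {x : S.Node} (hx : (nbhd t v₀ T).OnCycle x) :
    ∃ W, CycleSet T v₀ (2 * t) W ∧ ∃ w ∈ W, nd w = x := by
  obtain ⟨Z, hZ, ⟨e, he, hex⟩, hcard⟩ := hx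
  have hZT : ∀ e ∈ Z, e ∈ T.edges := fun e he => (mem_nbhd_edges.1 (hZ he)).1
  refine ⟨({h | edgeOf T h ∈ Z} : Finset S.Half), ⟨fun h hh => ?_, fun h hh => ?_, fun h hh => ?_⟩, ?_⟩
  · simp only [Finset.mem_filter, Finset.mem_univ, true_and] at hh ⊢
    rwa [edgeOf_mate]
  · simp only [Finset.mem_filter, Finset.mem_univ, true_and] at hh
    exact (edgeOf_mem_nbhd.1 (hZ hh)).1
  · simp only [Finset.mem_filter, Finset.mem_univ, true_and] at hh
    rw [← hcard _ hh (nd h) (incident_edgeOf.2 (Or.inl rfl))]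
    refine Finset.card_bij (fun h' _ => edgeOf T h') (fun h' hh' => ?_) (fun a ha b hb he => ?_)
      fun e he => ?_
    · simp only [Finset.mem_filter, Finset.mem_univ, true_and] at hh' ⊢
      exact ⟨hh'.1, incident_edgeOf.2 (Or.inl hh'.2.symm)⟩
    · simp only [Finset.mem_filter, Finset.mem_univ, true_and] at ha hb
      rcases edgeOf_eq_iff.1 he with h1 | h1
      · exact h1
      · exact absurd (by rw [← h1, ha.2, hb.2]) (nd_mate_ne (T := T) b)
    · obtain ⟨he1, he2⟩ := Finset.mem_filter.1 he
      have h0 := exists_edgeOf (hZT e he1)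
      rw [← h0, incident_edgeOf] at he2
      rcases he2 with h1 | h1
      · exact ⟨Sum.inl e.1, by simp [h0, he1, h1], h0⟩
      · exact ⟨mate T (Sum.inl e.1), by simp [edgeOf_mate, h0, he1, h1], by rw [edgeOf_mate, h0]⟩
  · have h0 := exists_edgeOf (hZT e he)
    rw [← h0, incident_edgeOf] at hex
    rcases hex with h1 | h1
    · exact ⟨Sum.inl e.1, by simp [h0, he], h1.symm⟩
    · exact ⟨mate T (Sum.inl e.1), by simp [edgeOf_mate, h0, he], h1.symm⟩

open Classical in
theorem RootedLasso.onCycle {out : Fin r → S.Half} (h : RootedLasso T v₀ r ℓ out) (hk : 1 ≤ k)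
    (hr : r = ℓ + 2 * k) (hD : ℓ + k ≤ 2 * t) {n : ℕ} (hn : ℓ ≤ n) (hnr : n < r) :
    (nbhd t v₀ T).OnCycle (nd (out ⟨n, hnr⟩)) := by
  have hmate : ∀ i, ∀ hi : i < r, nd (mate T (out ⟨i, hi⟩)) =
      nd (out ⟨nextPos r ℓ i, nextPos_lt (by omega) i⟩) := fun i hi => h.nd_mate hi _
  set Z : Finset S.Edge :=
    (Finset.univ.filter fun i : Fin r => ℓ ≤ i.1).image fun i => edgeOf T (out i) with hZ
  have hmem : ∀ i, ∀ hi : i < r, ℓ ≤ i → edgeOf T (out ⟨i, hi⟩) ∈ Z := fun i hi hℓ =>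
    Finset.mem_image.2 ⟨⟨i, hi⟩, by simpa using hℓ, rfl⟩
  have hinc : ∀ i j, ∀ hi : i < r, ∀ hj : j < r,
      Incident (edgeOf T (out ⟨i, hi⟩)) (nd (out ⟨j, hj⟩)) ↔ j = i ∨ j = nextPos r ℓ i := by
    intro i j hi hj
    rw [incident_edgeOf, hmate]
    constructor
    · rintro (he | he)
      · exact Or.inl (h.node_injective _ _ he)
      · exact Or.inr (h.node_injective _ _ he)
    · rintro (rfl | rfl)
      · exact Or.inl rfl
      · exact Or.inr rfl
  have hcard : ∀ j, ∀ hj : j < r, ℓ ≤ j →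
      (Z.filter fun e' => Incident e' (nd (out ⟨j, hj⟩))).card = 2 := by
    intro j hj hℓj
    set j' := if j = ℓ then r - 1 else j - 1 with hj'
    have hj'r : j' < r := by rw [hj']; split_ifs <;> omega
    have hj'ℓ : ℓ ≤ j' := by rw [hj']; split_ifs <;> omega
    have hprev : ∀ i, i < r → ℓ ≤ i → (j = nextPos r ℓ i ↔ i = j') := by
      intro i hi hℓi
      rw [hj', nextPos]
      split_ifs <;> omega
    have hset : (Z.filter fun e' => Incident e' (nd (out ⟨j, hj⟩))) =
        {edgeOf T (out ⟨j, hj⟩), edgeOf T (out ⟨j', hj'r⟩)} := by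
      ext e
      simp only [Finset.mem_filter, Finset.mem_insert, Finset.mem_singleton]
      constructor
      · rintro ⟨he, hi⟩
        obtain ⟨i, hiℓ, rfl⟩ := Finset.mem_image.1 he
        simp only [Finset.mem_filter, Finset.mem_univ, true_and] at hiℓ
        rcases (hinc i j i.2 hj).1 hi with e1 | e1
        · left; congr 2; exact Fin.ext e1.symm
        · right; congr 2; exact Fin.ext ((hprev i i.2 hiℓ).1 e1)
      · rintro (rfl | rfl)
        · exact ⟨hmem j hj hℓj, (hinc j j hj hj).2 (Or.inl rfl)⟩
        · exact ⟨hmem j' hj'r hj'ℓ, (hinc j' j hj'r hj).2 (Or.inr ((hprev j' hj'r hj'ℓ).2 rfl))⟩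
    rw [hset, Finset.card_pair]
    intro he
    rcases edgeOf_eq_iff.1 he with e1 | e1
    · have := h.out_injective e1
      rw [Fin.mk.injEq, hj'] at this
      split_ifs at this <;> omega
    · exact h.out_ne_mate _ _ e1.symm
  refine ⟨Z, fun e he => ?_, ⟨_, hmem n hnr hn, incident_edgeOf.2 (Or.inl rfl)⟩, fun e he y hy => ?_⟩
  · obtain ⟨i, hiℓ, rfl⟩ := Finset.mem_image.1 he
    rw [edgeOf_mem_nbhd, mem_ball, mem_ball, hmate i i.2]
    exact ⟨(h.level_le hk hr _ _).trans hD, (h.level_le hk hr _ _).trans hD⟩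
  · obtain ⟨i, hiℓ, rfl⟩ := Finset.mem_image.1 he
    simp only [Finset.mem_filter, Finset.mem_univ, true_and] at hiℓ
    rw [incident_edgeOf, hmate i i.2] at hy
    rcases hy with rfl | rfl
    · convert hcard i i.2 hiℓ
    · convert hcard _ _ _
      rw [nextPos]; split_ifs <;> omega

section
variable {out : Fin r → S.Half} {y : S.Node}

theorem RootedLasso.onCycle_bounds (h : RootedLasso T v₀ r ℓ out) (hk : 1 ≤ k)
    (hr : r = ℓ + 2 * k) (hD : ℓ + k ≤ 2 * t) (hy : Unicyclic T v₀ (2 * t) y) {x : S.Node}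
    (hx : (nbhd t v₀ T).OnCycle x) :
    (ℓ : ℕ∞) ≤ (nbhd t v₀ T).rootDist x ∧ (nbhd t v₀ T).rootDist x ≤ (ℓ + k : ℕ) := by
  obtain ⟨W, hW, w, hw, rfl⟩ := exists_cycleSet hx
  obtain ⟨hhy, hl1, -⟩ := h.profile hk hr hD hy.toOnlyDoubled
  have h1 := hl1 _ le_rfl
  rw [hhy] at h1
  rw [rootDist_nbhd (hW.nd_mem w hw), ← h1]
  exact ⟨Nat.cast_le.2 (hW.le_level h hk hr hD hy hw),
    Nat.cast_le.2 (hW.level_le hy.toOnlyDoubled hw)⟩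

theorem RootedLasso.rootDist_start (h : RootedLasso T v₀ r ℓ out) (hk : 1 ≤ k)
    (hr : r = ℓ + 2 * k) (hD : ℓ + k ≤ 2 * t) (hy : Unicyclic T v₀ (2 * t) y) {i : ℕ}
    (hi : i ≤ ℓ + k) : (nbhd t v₀ T).rootDist (nd (out ⟨i, by omega⟩)) = i := by
  obtain ⟨-, hl1, -⟩ := h.profile hk hr hD hy.toOnlyDoubled
  rw [rootDist_nbhd (mem_ball.2 (by rw [hl1 i hi]; omega)), hl1 i hi]

theorem RootedLasso.isShallowest_iff (h : RootedLasso T v₀ r ℓ out) (hk : 1 ≤ k)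
    (hr : r = ℓ + 2 * k) (hD : ℓ + k ≤ 2 * t) (hy : Unicyclic T v₀ (2 * t) y) {x : S.Node} :
    (nbhd t v₀ T).IsShallowest x ↔ (nbhd t v₀ T).OnCycle x ∧ (nbhd t v₀ T).rootDist x = ℓ := by
  constructor
  · rintro ⟨h1, h2⟩
    refine ⟨h1, le_antisymm ?_ (h.onCycle_bounds hk hr hD hy h1).1⟩
    rw [← h.rootDist_start hk hr hD hy (i := ℓ) (by omega)]
    exact h2 _ (h.onCycle hk hr hD le_rfl (by omega))
  · rintro ⟨h1, h2⟩
    exact ⟨h1, fun z hz => h2 ▸ (h.onCycle_bounds hk hr hD hy hz).1⟩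

theorem RootedLasso.deepest_iff (h : RootedLasso T v₀ r ℓ out) (hk : 1 ≤ k)
    (hr : r = ℓ + 2 * k) (hD : ℓ + k ≤ 2 * t) (hy : Unicyclic T v₀ (2 * t) y) {s : ℕ} :
    (∃ z, (nbhd t v₀ T).IsDeepest z ∧ (nbhd t v₀ T).rootDist z = s) ↔ ℓ + k = s := by
  have h3 := h.rootDist_start hk hr hD hy (i := ℓ + k) le_rfl
  have h4 := h.onCycle hk hr hD (n := ℓ + k) (by omega) (by omega)
  constructor
  · rintro ⟨z, ⟨h1, h2⟩, hz⟩
    have h5 := h2 _ h4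
    rw [h3, hz] at h5
    have h6 := (h.onCycle_bounds hk hr hD hy h1).2
    rw [hz] at h6
    exact le_antisymm (Nat.cast_le.1 h5) (Nat.cast_le.1 h6)
  · rintro rfl
    exact ⟨_, ⟨h4, fun z hz => h3 ▸ (h.onCycle_bounds hk hr hD hy hz).2⟩, h3⟩

theorem RootedLasso.isLeft_start (h : RootedLasso T v₀ r ℓ out) (i : Fin r) :
    (nd (out i)).isLeft = decide (Even i.1) := by
  have := h.1.side_node i
  simpa [walkEnds] using this

theorem RootedLasso.mem_singleCycleV_iff (h : RootedLasso T v₀ r ℓ out) (hk : 1 ≤ k)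
    (hr : r = ℓ + 2 * k) (hD : ℓ + k ≤ 2 * t) (hy : Unicyclic T v₀ (2 * t) y)
    (h1 : (nbhd t v₀ T).numCycles = 1) {s₁ s₂ : ℕ} (hs : 1 ≤ s₁) :
    nbhd t v₀ T ∈ RootedGraph.singleCycleV S s₁ s₂ ↔ ℓ = 2 * s₁ ∧ ℓ + k = s₂ := by
  rw [RootedGraph.singleCycleV, Set.mem_ofPred_eq, h.deepest_iff hk hr hD hy]
  refine (and_iff_right h1).trans (and_congr_left fun _ => ?_)
  constructor
  · rintro ⟨w, -, hw1, hw2⟩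
    have := ((h.isShallowest_iff hk hr hD hy).1 hw1).2
    rw [hw2] at this
    exact (Nat.cast_inj.1 this).symm
  · intro hℓ
    have h2 := h.isLeft_start ⟨ℓ, by omega⟩
    have h3 := h.rootDist_start hk hr hD hy (i := ℓ) (by omega)
    have h4 := h.onCycle hk hr hD (n := ℓ) (by omega) (by omega)
    have h5 : Even ℓ := by rw [hℓ]; simp
    simp only [h5, decide_true] at h2
    obtain ⟨w, hw⟩ := Sum.isLeft_iff.1 h2
    rw [hw] at h3 h4
    refine ⟨w, ?_, (h.isShallowest_iff hk hr hD hy).2 ⟨h4, h3⟩, by rw [h3, hℓ]⟩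
    intro hwr
    have hwv : w = v₀ := hwr
    rw [hwv, rootDist_nbhd root_mem_ball] at h3
    have h6 : level T v₀ (2 * t) (Sum.inl v₀ : S.Node) = ℓ := Nat.cast_inj.1 h3
    rw [level_root] at h6
    omega

theorem RootedLasso.mem_singleCycleC_iff (h : RootedLasso T v₀ r ℓ out) (hk : 1 ≤ k)
    (hr : r = ℓ + 2 * k) (hD : ℓ + k ≤ 2 * t) (hy : Unicyclic T v₀ (2 * t) y)
    (h1 : (nbhd t v₀ T).numCycles = 1) {s₁ s₂ : ℕ} :
    nbhd t v₀ T ∈ RootedGraph.singleCycleC S s₁ s₂ ↔ ℓ = 2 * s₁ + 1 ∧ ℓ + k = s₂ := by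
  rw [RootedGraph.singleCycleC, Set.mem_ofPred_eq, h.deepest_iff hk hr hD hy]
  refine (and_iff_right h1).trans (and_congr_left fun _ => ?_)
  constructor
  · rintro ⟨w, hw1, hw2⟩
    have := ((h.isShallowest_iff hk hr hD hy).1 hw1).2
    rw [hw2] at this
    exact (Nat.cast_inj.1 this).symm
  · intro hℓ
    have h2 := h.isLeft_start ⟨ℓ, by omega⟩
    have h3 := h.rootDist_start hk hr hD hy (i := ℓ) (by omega)
    have h4 := h.onCycle hk hr hD (n := ℓ) (by omega) (by omega)
    have h5 : ¬ Even ℓ := by rw [hℓ]; simp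
    simp only [h5, decide_false, Sum.isLeft_eq_false, Sum.isRight_iff] at h2
    obtain ⟨c, hc⟩ := h2
    rw [hc] at h3 h4
    exact ⟨c, (h.isShallowest_iff hk hr hD hy).2 ⟨h4, h3⟩, by rw [h3, hℓ]⟩

theorem RootedLasso.mem_singleCycleR_iff (h : RootedLasso T v₀ r ℓ out) (hk : 1 ≤ k)
    (hr : r = ℓ + 2 * k) (hD : ℓ + k ≤ 2 * t) (hy : Unicyclic T v₀ (2 * t) y)
    (h1 : (nbhd t v₀ T).numCycles = 1) {s : ℕ} :
    nbhd t v₀ T ∈ RootedGraph.singleCycleR S s ↔ ℓ = 0 ∧ ℓ + k = s := by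
  rw [RootedGraph.singleCycleR, Set.mem_ofPred_eq, h.deepest_iff hk hr hD hy]
  refine (and_iff_right h1).trans (and_congr_left fun _ => ?_)
  rw [h.isShallowest_iff hk hr hD hy]
  have h3 : (nbhd t v₀ T).rootDist (Sum.inl (nbhd t v₀ T).root) = 0 := by
    simp [RootedGraph.rootDist]
  constructor
  · rintro ⟨-, hw⟩
    rw [h3] at hw
    exact_mod_cast hw.symm
  · rintro rfl
    have h4 := h.onCycle hk hr hD (n := 0) (by omega) (by omega)
    rw [h.2 (by omega)] at h4
    exact ⟨h4, h3⟩

end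

end

/-! ### Neighborhoods with several cycles are rare -/

section

variable {S : Sockets} {T : S.TannerGraph} {v₀ : Fin S.n} {lam rho : ℝ[X]} {d : ℕ} {ε : ℝ}

theorem Model.card_ball_le (H : Model S lam rho d) (T : S.TannerGraph) (v₀ : Fin S.n) (D : ℕ) :
    (ball T v₀ D).card ≤ (d + 1) ^ D := by
  classical
  have key : ∀ j ≤ D, ({x | level T v₀ D x ≤ j} : Finset S.Node).card ≤ (d + 1) ^ j := by
    intro j
    induction j with
    | zero =>
      intro _
      rw [pow_zero, Finset.card_le_one]
      intro a ha b hb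
      simp only [Finset.mem_filter, Finset.mem_univ, true_and, Nat.le_zero,
        level_eq_zero_iff] at ha hb
      rw [ha, hb]
    | succ j ih =>
      intro hj
      set Y : Finset S.Node := {x | level T v₀ D x ≤ j} with hY
      have hsub : ({x | level T v₀ D x ≤ j + 1} : Finset S.Node) ⊆
          Y ∪ ({h : S.Half | nd h ∈ Y} : Finset S.Half).image fun h => nd (mate T h) := by
        intro x hx
        simp only [Finset.mem_filter, Finset.mem_univ, true_and] at hx
        rw [Finset.mem_union]
        by_cases h0 : level T v₀ D x ≤ j
        · exact Or.inl (by simpa [hY] using h0)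
        · right
          have hne : x ≠ Sum.inl v₀ := by
            rintro rfl
            rw [level_root] at h0
            omega
          obtain ⟨h, rfl, h2⟩ := exists_parent (hx.trans hj) hne
          refine Finset.mem_image.2 ⟨mate T h, ?_, by rw [mate_mate]⟩
          simp only [hY, Finset.mem_filter, Finset.mem_univ, true_and]
          omega
      refine (Finset.card_le_card hsub).trans ((Finset.card_union_le _ _).trans ?_)
      have h1 := Finset.card_image_le (s := ({h : S.Half | nd h ∈ Y} : Finset S.Half))
        (f := fun h => nd (mate T h))
      have h2 := H.card_nd_mem_le Y
      have h3 := ih (by omega)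
      have h4 : d * Y.card ≤ d * (d + 1) ^ j := Nat.mul_le_mul_left _ h3
      rw [pow_succ]
      nlinarith
  exact key D le_rfl

open Classical in
/-- the pairs of sockets of nodes in `Y` -/
def edgesWithin (Y : Finset S.Node) : Finset S.Edge :=
  {e | Sum.inl (Edge.var e) ∈ Y ∧ Sum.inr (Edge.chk e) ∈ Y}

open Classical in
theorem Model.card_edgesWithin_le (H : Model S lam rho d) (Y : Finset S.Node) :
    (edgesWithin Y).card ≤ (d * Y.card) ^ 2 := by
  rw [sq]
  refine le_trans ?_ (Nat.mul_le_mul (H.card_nd_mem_le Y) (H.card_nd_mem_le Y))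
  rw [← Finset.card_product]
  refine Finset.card_le_card_of_injOn (fun e => (Sum.inl e.1, Sum.inr e.2)) (fun e he => ?_)
    fun a _ b _ hab => ?_
  · have he' := he
    simp only [edgesWithin, Finset.coe_filter, Finset.mem_univ, true_and, Set.mem_ofPred_eq] at he'
    simp only [Finset.coe_product, Finset.coe_filter, Finset.mem_univ, true_and, Set.mem_prod,
      Set.mem_ofPred_eq]
    exact he'
  · simp only [Prod.mk.injEq, Sum.inl.injEq, Sum.inr.injEq] at hab
    exact Prod.ext hab.1 hab.2

theorem nbhd_edges_subset {t : ℕ} :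
    (nbhd t v₀ T).edges ⊆ edgesWithin (ball T v₀ (2 * t)) := fun e he => by
  simpa [edgesWithin] using (mem_nbhd_edges.1 he).2

open Classical in
theorem Model.card_nbhd_edges_le (H : Model S lam rho d) (T : S.TannerGraph) (v₀ : Fin S.n)
    (t : ℕ) : (nbhd t v₀ T).edges.card ≤ d * (d + 1) ^ (2 * t) := by
  refine le_trans ?_ ((H.card_nd_mem_le (ball T v₀ (2 * t))).trans
    (Nat.mul_le_mul_left _ (H.card_ball_le T v₀ _)))
  refine Finset.card_le_card_of_injOn (fun e => Sum.inl e.1) (fun e he => ?_) fun a ha b hb hab => ?_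
  · simp only [Finset.coe_filter, Finset.mem_univ, true_and, Set.mem_ofPred_eq]
    exact (mem_nbhd_edges.1 he).2.1
  · have h1 := mem_edges.1 (mem_nbhd_edges.1 ha).1
    have h2 := mem_edges.1 (mem_nbhd_edges.1 hb).1
    have h3 : a.1 = b.1 := Sum.inl_injective hab
    exact Prod.ext h3 (by rw [← h1, ← h2, h3])

theorem matching_of_edges (l : List S.Edge) (hl : l.Nodup) (h : ∀ e ∈ l, T e.1 = e.2) :
    Matching (l.map fun e => ((Sum.inl e.1 : S.Half), (Sum.inr e.2 : S.Half))) := by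
  induction l with
  | nil => exact Matching.nil
  | cons e l ih =>
    rw [List.nodup_cons] at hl
    have he := h e (by simp)
    refine Matching.cons ?_ ?_ rfl (ih hl.2 fun e' he' => h e' (by simp [he']))
    all_goals
      intro p hp
      obtain ⟨e', he', rfl⟩ := List.mem_map.1 hp
      have hne : e ≠ e' := fun hee => hl.1 (hee ▸ he')
      have h' := h e' (by simp [he'])
      refine ⟨fun hc => ?_, fun hc => ?_⟩
      all_goals simp only [Sum.inl.injEq, Sum.inr.injEq, reduceCtorEq] at hc
    · exact hne (Prod.ext hc (by rw [← he, ← h', hc]))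
    · exact hne (Prod.ext (T.injective (by rw [he, h', hc])) hc)

/-- The probability that a Tanner graph contains given edges. -/
theorem expect_subset_edges_le (F : Finset S.Edge) (hN : 0 < Fintype.card S.VSocket) :
    S.expect ε (fun T _ => ind (F ⊆ T.edges)) ≤
      (1 + matchConst F.card) / (Fintype.card S.VSocket : ℝ) ^ F.card := by
  classical
  by_cases h : ∃ T : S.TannerGraph, F ⊆ T.edges
  · obtain ⟨T, hT⟩ := h
    set M := F.toList.map fun e => ((Sum.inl e.1 : S.Half), (Sum.inr e.2 : S.Half)) with hMdef
    have hM : Matching M := matching_of_edges (T := T) _ F.nodup_toList fun e he =>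
      mem_edges.1 (hT (Finset.mem_toList.1 he))
    have hlen : M.length = F.card := by simp [hMdef]
    have := hM.prob_le hN
    rw [hlen, ← expect_holds ε] at this
    convert this using 6 with T' A
    simp only [Holds, hMdef, List.mem_map, Finset.mem_toList, forall_exists_index, and_imp,
      forall_apply_eq_imp_iff₂]
    refine forall₂_congr fun e _ => ?_
    rw [mem_edges]
    simp [mate]
  · push Not at h
    have : (fun (T : S.TannerGraph) (_ : Finset (Fin S.n)) => ind (F ⊆ T.edges)) = 0 := by
      funext T A
      simp [ind, h T]
    rw [this, map_zero]
    have := matchConst_nonneg F.card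
    positivity

open Classical in
/-- A neighborhood with at least two cycles has more edges than nodes. -/
theorem ind_two_le_numCycles_le {K t : ℕ} (hK : (nbhd t v₀ T).edges.card ≤ K) :
    ind (2 ≤ (nbhd t v₀ T).numCycles) ≤ ∑ f ∈ Finset.range (K + 1), ∑ b ∈ Finset.range f,
      ∑ Y ∈ Finset.univ.powersetCard b, ∑ F ∈ (edgesWithin Y).powersetCard f,
        ind (Sum.inl v₀ ∈ Y) * ind (F ⊆ T.edges) := by
  have hnn : ∀ (Y : Finset S.Node) (F : Finset S.Edge),
      0 ≤ ind (Sum.inl v₀ ∈ Y) * ind (F ⊆ T.edges) := fun _ _ =>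
    mul_nonneg (ind_nonneg _) (ind_nonneg _)
  by_cases h : 2 ≤ (nbhd t v₀ T).numCycles
  · have hb : (ball T v₀ (2 * t)).card < (nbhd t v₀ T).edges.card := by
      rw [RootedGraph.numCycles, ← Nat.cast_add, card_nbhd_nodes] at h
      omega
    have hF : (nbhd t v₀ T).edges ⊆ T.edges := fun e he => (mem_nbhd_edges.1 he).1
    have h1 : ind (2 ≤ (nbhd t v₀ T).numCycles) =
        ind (Sum.inl v₀ ∈ ball T v₀ (2 * t)) * ind ((nbhd t v₀ T).edges ⊆ T.edges) := by
      simp [ind, h, hF, root_mem_ball]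
    rw [h1]
    refine le_trans ?_ (Finset.single_le_sum (fun f _ => Finset.sum_nonneg fun b _ =>
      Finset.sum_nonneg fun Y _ => Finset.sum_nonneg fun F _ => hnn Y F)
      (Finset.mem_range.2 (Nat.lt_succ_of_le hK)))
    refine le_trans ?_ (Finset.single_le_sum (fun b _ =>
      Finset.sum_nonneg fun Y _ => Finset.sum_nonneg fun F _ => hnn Y F)
      (Finset.mem_range.2 hb))
    refine le_trans ?_ (Finset.single_le_sum (fun Y _ => Finset.sum_nonneg fun F _ => hnn Y F)
      (Finset.mem_powersetCard.2 ⟨Finset.subset_univ _, rfl⟩))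
    exact Finset.single_le_sum (fun F _ => hnn _ F)
      (Finset.mem_powersetCard.2 ⟨nbhd_edges_subset, rfl⟩)
  · rw [ind, if_neg h]
    exact Finset.sum_nonneg fun f _ => Finset.sum_nonneg fun b _ =>
      Finset.sum_nonneg fun Y _ => Finset.sum_nonneg fun F _ => hnn Y F

theorem sum_ind_mem_le (Y : Finset S.Node) :
    ∑ v₀ : Fin S.n, ind ((Sum.inl v₀ : S.Node) ∈ Y) ≤ Y.card := by
  classical
  have h : ∑ v₀ : Fin S.n, ind ((Sum.inl v₀ : S.Node) ∈ Y) =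
      ((Finset.univ.filter fun v₀ : Fin S.n => (Sum.inl v₀ : S.Node) ∈ Y).card : ℝ) := by
    rw [← Finset.sum_boole]
    exact Finset.sum_congr rfl fun v _ => by simp [ind]
  rw [h]
  exact_mod_cast Finset.card_le_card_of_injOn (Sum.inl : Fin S.n → S.Node)
    (fun v hv => by simpa using hv) Sum.inl_injective.injOn

/-- The expected number of variable nodes whose neighborhood has several cycles is `O(1 / n)`: the
expected number of copies of a connected graph in the Tanner graph is of order `n` to the number
of its nodes minus the number of its edges. -/
theorem sum_expect_two_le_numCycles (lam rho : ℝ[X]) (hε : ε ∈ Set.Icc (0 : ℝ) 1) (d t : ℕ) :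
    ∃ C : ℝ, ∀ S : Sockets, Model S lam rho d →
      ∑ v₀ : Fin S.n, S.expect ε (fun T _ => ind (2 ≤ (nbhd t v₀ T).numCycles)) ≤
        C / Fintype.card S.VSocket := by
  classical
  set K := d * (d + 1) ^ (2 * t) with hK
  refine ⟨∑ f ∈ Finset.range (K + 1), ∑ b ∈ Finset.range f,
    (2 ^ b * (2 ^ ((d * b) ^ 2) * (b * (1 + matchConst f)))), fun S H => ?_⟩
  have hN := H.pos
  set N : ℝ := (Fintype.card S.VSocket : ℝ) with hNdef
  have hN1 : 1 ≤ N := by rw [hNdef]; exact_mod_cast hN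
  have hN0 : 0 < N := by linarith
  have hstep : ∀ v₀ : Fin S.n, S.expect ε (fun T _ => ind (2 ≤ (nbhd t v₀ T).numCycles)) ≤
      ∑ f ∈ Finset.range (K + 1), ∑ b ∈ Finset.range f,
      ∑ Y ∈ Finset.univ.powersetCard b, ∑ F ∈ (edgesWithin Y).powersetCard f,
        ind ((Sum.inl v₀ : S.Node) ∈ Y) * S.expect ε (fun T _ => ind (F ⊆ T.edges)) := by
    intro v₀
    refine (expect_mono hε fun T A =>
      ind_two_le_numCycles_le (H.card_nbhd_edges_le T v₀ t)).trans (le_of_eq ?_)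
    have : (fun (T : S.TannerGraph) (_ : Finset (Fin S.n)) =>
        ∑ f ∈ Finset.range (d * (d + 1) ^ (2 * t) + 1), ∑ b ∈ Finset.range f,
          ∑ Y ∈ Finset.univ.powersetCard b, ∑ F ∈ (edgesWithin Y).powersetCard f,
            ind ((Sum.inl v₀ : S.Node) ∈ Y) * ind (F ⊆ T.edges)) =
        ∑ f ∈ Finset.range (K + 1), ∑ b ∈ Finset.range f,
          ∑ Y ∈ Finset.univ.powersetCard b, ∑ F ∈ (edgesWithin Y).powersetCard f,
            ind ((Sum.inl v₀ : S.Node) ∈ Y) •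
              fun (T : S.TannerGraph) (_ : Finset (Fin S.n)) => ind (F ⊆ T.edges) := by
      funext T A
      simp [Finset.sum_apply, hK]
    rw [this]
    simp only [map_sum, map_smul, smul_eq_mul]
  refine (Finset.sum_le_sum fun v₀ _ => hstep v₀).trans ?_
  rw [Finset.sum_comm, Finset.sum_div]
  refine Finset.sum_le_sum fun f _ => ?_
  rw [Finset.sum_comm, Finset.sum_div]
  refine Finset.sum_le_sum fun b hb => ?_
  rw [Finset.sum_comm]
  have hbf := Finset.mem_range.1 hb
  have hmc := matchConst_nonneg f
  have hterm : ∀ Y ∈ (Finset.univ : Finset S.Node).powersetCard b,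
      ∑ v₀ : Fin S.n, ∑ F ∈ (edgesWithin Y).powersetCard f,
        ind ((Sum.inl v₀ : S.Node) ∈ Y) * S.expect ε (fun T _ => ind (F ⊆ T.edges)) ≤
      2 ^ ((d * b) ^ 2) * (b * ((1 + matchConst f) / N ^ f)) := by
    intro Y hY
    have hYb := (Finset.mem_powersetCard.1 hY).2
    rw [Finset.sum_comm]
    have hF : ∀ F ∈ (edgesWithin Y).powersetCard f,
        ∑ v₀ : Fin S.n, ind ((Sum.inl v₀ : S.Node) ∈ Y) *
          S.expect ε (fun T _ => ind (F ⊆ T.edges)) ≤ b * ((1 + matchConst f) / N ^ f) := by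
      intro F hF
      rw [← Finset.sum_mul]
      have h1 := sum_ind_mem_le Y
      have h2 := expect_subset_edges_le (ε := ε) F hN
      rw [(Finset.mem_powersetCard.1 hF).2] at h2
      rw [hYb] at h1
      exact mul_le_mul h1 h2 (expect_nonneg hε fun _ _ => ind_nonneg _) (by positivity)
    refine (Finset.sum_le_card_nsmul _ _ _ hF).trans ?_
    rw [nsmul_eq_mul]
    refine mul_le_mul_of_nonneg_right ?_ (by positivity)
    have h3 : ((edgesWithin Y).powersetCard f).card ≤ 2 ^ ((d * b) ^ 2) := by
      rw [Finset.card_powersetCard]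
      refine (Nat.choose_le_two_pow _ _).trans (Nat.pow_le_pow_right (by norm_num) ?_)
      rw [← hYb]
      exact H.card_edgesWithin_le Y
    exact_mod_cast h3
  refine (Finset.sum_le_card_nsmul _ _ _ hterm).trans ?_
  rw [nsmul_eq_mul, Finset.card_powersetCard, Finset.card_univ]
  have h4 : ((Fintype.card S.Node).choose b : ℝ) ≤ 2 ^ b * N ^ b := by
    refine le_trans ?_ (pow_le_pow_left₀ (by positivity) (card_node_le S) b) |>.trans
      (mul_pow _ _ _).le
    exact_mod_cast Nat.choose_le_pow _ _
  refine (mul_le_mul_of_nonneg_right h4 (by positivity)).trans ?_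
  have h5 : N ^ b / N ^ f ≤ 1 / N := by
    rw [div_le_div_iff₀ (by positivity) hN0, one_mul, ← pow_succ]
    exact pow_le_pow_right₀ hN1 hbf
  calc 2 ^ b * N ^ b * (2 ^ ((d * b) ^ 2) * (b * ((1 + matchConst f) / N ^ f)))
      = 2 ^ b * (2 ^ ((d * b) ^ 2) * (b * (1 + matchConst f))) * (N ^ b / N ^ f) := by ring
    _ ≤ 2 ^ b * (2 ^ ((d * b) ^ 2) * (b * (1 + matchConst f))) * (1 / N) :=
        mul_le_mul_of_nonneg_left h5 (by positivity)
    _ = _ := by ring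

/-- The number of lassos at a node is bounded. -/
theorem Model.sum_ind_rootedLasso_le (H : Model S lam rho d) (T : S.TannerGraph) (v₀ : Fin S.n)
    {r ℓ k : ℕ} (hk : 1 ≤ k) (hr : r = ℓ + 2 * k) :
    ∑ out : Fin r → S.Half, ind (RootedLasso T v₀ r ℓ out) ≤ (d * (d + 1) ^ (ℓ + k) : ℕ) ^ r := by
  classical
  set Y := ball T v₀ (ℓ + k)
  have hsub : (Finset.univ.filter fun out : Fin r → S.Half => RootedLasso T v₀ r ℓ out) ⊆
      Fintype.piFinset fun _ : Fin r => ({h : S.Half | nd h ∈ Y} : Finset S.Half) := by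
    intro out hout
    simp only [Finset.mem_filter, Finset.mem_univ, true_and] at hout
    simp only [Fintype.mem_piFinset, Finset.mem_filter, Finset.mem_univ, true_and]
    exact fun i => mem_ball.2 (hout.level_le hk hr i i.2)
  have h1 := Finset.card_le_card hsub
  rw [Fintype.card_piFinset_const] at h1
  have h2 := (H.card_nd_mem_le Y).trans (Nat.mul_le_mul_left d (H.card_ball_le T v₀ (ℓ + k)))
  have h3 := h1.trans (Nat.pow_le_pow_left h2 r)
  simp only [ind, Finset.sum_boole]
  exact_mod_cast h3

end

/-! ### Invariants of the equivalence of rooted graphs -/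

section
namespace RootedGraph

variable {S : Sockets} {G G' : RootedGraph S}

/-- The root and the ends of the edges are nodes of the graph. -/
structure WellFormed (G : RootedGraph S) : Prop where
  root_mem : G.root ∈ G.varNodes
  var_mem : ∀ e ∈ G.edges, Edge.var e ∈ G.varNodes
  chk_mem : ∀ e ∈ G.edges, Edge.chk e ∈ G.chkNodes

theorem wellFormed_nbhd {t : ℕ} {v₀ : Fin S.n} {T : S.TannerGraph} : (nbhd t v₀ T).WellFormed where
  root_mem := mem_varNodes.2 root_mem_ball
  var_mem _ he := mem_varNodes.2 (mem_nbhd_edges.1 he).2.1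
  chk_mem _ he := mem_chkNodes.2 (mem_nbhd_edges.1 he).2.2

variable (G G') in
/-- An isomorphism of rooted graphs that forgets the order of the sockets. It is the restriction
of permutations of all the nodes and of all pairs of sockets. -/
structure Iso where
  edge : Equiv.Perm S.Edge
  var : Equiv.Perm (Fin S.n)
  chk : Equiv.Perm (Fin S.m)
  edge_mem : ∀ e, e ∈ G.edges ↔ edge e ∈ G'.edges
  var_edge : ∀ e ∈ G.edges, Edge.var (edge e) = var (Edge.var e)
  chk_edge : ∀ e ∈ G.edges, Edge.chk (edge e) = chk (Edge.chk e)
  var_mem : ∀ v, v ∈ G.varNodes ↔ var v ∈ G'.varNodes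
  chk_mem : ∀ c, c ∈ G.chkNodes ↔ chk c ∈ G'.chkNodes
  root : var G.root = G'.root

/-- A permutation of sockets that maps the sockets of one node to the sockets of one node comes
from a permutation of the nodes. -/
theorem exists_perm_nodes {n : ℕ} {D : Fin n → ℕ} (hD : ∀ v, 0 < D v)
    (σ : Equiv.Perm (Σ v, Fin (D v))) {V V' : Finset (Fin n)} (hV : ∀ s, s.1 ∈ V ↔ (σ s).1 ∈ V')
    (h : ∀ v ∈ V, ∃ v', ∀ s, s.1 = v ↔ (σ s).1 = v') :
    ∃ φ : Equiv.Perm (Fin n), (∀ v, v ∈ V ↔ φ v ∈ V') ∧ ∀ s, s.1 ∈ V → (σ s).1 = φ s.1 := by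
  choose! f hf using h
  have hmem : ∀ v ∈ V, f v ∈ V' := fun v hv => by
    rw [← (hf v hv ⟨v, ⟨0, hD v⟩⟩).1 rfl]
    exact (hV ⟨v, ⟨0, hD v⟩⟩).1 hv
  let g : {v // v ∈ V} → {v // v ∈ V'} := fun v => ⟨f v, hmem v v.2⟩
  have hg : Function.Bijective g := by
    refine ⟨fun a b hab => Subtype.ext ?_, fun b => ?_⟩
    · have h1 : f a = f b := congrArg Subtype.val hab
      have h2 := (hf a a.2 ⟨a, ⟨0, hD a⟩⟩).1 rfl
      rw [h1] at h2
      exact (hf b b.2 _).2 h2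
    · have h1 : (σ (σ⁻¹ ⟨b.1, ⟨0, hD b.1⟩⟩)).1 = b.1 := by simp
      have h2 := (hV _).2 (h1.symm ▸ b.2)
      exact ⟨⟨_, h2⟩, Subtype.ext (((hf _ h2 _).1 rfl).symm.trans h1)⟩
  let e := Equiv.ofBijective g hg
  refine ⟨e.extendSubtype, fun v => ⟨fun hv => e.extendSubtype_mem v hv, fun hv => ?_⟩,
    fun s hs => ?_⟩
  · by_contra hn
    exact e.extendSubtype_not_mem v hn hv
  · rw [e.extendSubtype_apply_of_mem _ hs]
    exact (hf _ hs s).1 rfl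

theorem map_tuple_iff {α : Type*} {D : α → ℕ} (σ : Equiv.Perm (Σ a, Fin (D a))) {v v' : α}
    (h : List.IsRotated ((tuple D v).map σ) (tuple D v')) (s : Σ a, Fin (D a)) :
    s.1 = v ↔ (σ s).1 = v' := by
  rw [← mem_tuple, ← mem_tuple, ← h.mem_iff, List.mem_map_of_injective σ.injective]

theorem Equivalent.exists_iso (h : G.Equivalent G') (hG : G.WellFormed) : Nonempty (Iso G G') := by
  obtain ⟨σV, σC, hV, hC, hE, hr, hv, hc⟩ := h
  have hr' := map_tuple_iff σV (v := G.root) (v' := G'.root) (by rw [hr])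
  obtain ⟨φ, hφ, hφ'⟩ := exists_perm_nodes S.varDeg_pos σV hV fun v hvm => by
    by_cases h0 : v = G.root
    · exact ⟨_, h0 ▸ hr'⟩
    · obtain ⟨v', -, -, h1⟩ := hv v hvm h0
      exact ⟨v', map_tuple_iff σV h1⟩
  obtain ⟨ψ, hψ, hψ'⟩ := exists_perm_nodes S.chkDeg_pos σC hC fun c hcm => by
    obtain ⟨c', -, h1⟩ := hc c hcm
    exact ⟨c', map_tuple_iff σC h1⟩
  refine ⟨⟨Equiv.prodCongr σV σC, φ, ψ, fun e => hE e.1 e.2, fun e he => hφ' _ (hG.var_mem e he),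
    fun e he => hψ' _ (hG.chk_mem e he), hφ, hψ, ?_⟩⟩
  rw [← (hr' ⟨G.root, ⟨0, S.varDeg_pos _⟩⟩).1 rfl]
  exact (hφ' ⟨G.root, ⟨0, S.varDeg_pos _⟩⟩ hG.root_mem).symm

namespace Iso

/-- the inverse isomorphism -/
def symm (i : Iso G G') : Iso G' G where
  edge := i.edge.symm
  var := i.var.symm
  chk := i.chk.symm
  edge_mem e := by rw [i.edge_mem]; simp
  var_edge e he := by
    rw [Equiv.eq_symm_apply, ← i.var_edge _ ((i.edge_mem _).2 (by simpa using he)),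
      Equiv.apply_symm_apply]
  chk_edge e he := by
    rw [Equiv.eq_symm_apply, ← i.chk_edge _ ((i.edge_mem _).2 (by simpa using he)),
      Equiv.apply_symm_apply]
  var_mem v := by rw [i.var_mem]; simp
  chk_mem c := by rw [i.chk_mem]; simp
  root := by rw [Equiv.symm_apply_eq]; exact i.root.symm

/-- the action on nodes -/
def node (i : Iso G G') : Equiv.Perm S.Node := Equiv.sumCongr i.var i.chk

theorem symm_node (i : Iso G G') (x : S.Node) : i.symm.node (i.node x) = x := by
  rcases x with v | c <;> simp [node, symm]

theorem card_edges (i : Iso G G') : G'.edges.card = G.edges.card :=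
  (Finset.card_equiv i.edge i.edge_mem).symm

theorem card_varNodes (i : Iso G G') : G'.varNodes.card = G.varNodes.card :=
  (Finset.card_equiv i.var i.var_mem).symm

theorem numCycles_eq (i : Iso G G') : G'.numCycles = G.numCycles := by
  rw [numCycles, numCycles, i.card_edges, i.card_varNodes, Finset.card_equiv i.chk i.chk_mem]

theorem incident_iff (i : Iso G G') {e : S.Edge} (he : e ∈ G.edges) (x : S.Node) :
    Incident (i.edge e) (i.node x) ↔ Incident e x := by
  rw [Incident, Incident, i.var_edge e he, i.chk_edge e he]
  rcases x with v | c <;> simp [node]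

theorem onCycle (i : Iso G G') {x : S.Node} (h : G.OnCycle x) : G'.OnCycle (i.node x) := by
  classical
  obtain ⟨Z, hZ, ⟨e, he, hex⟩, hcard⟩ := h
  refine ⟨Z.map i.edge.toEmbedding, fun e he => ?_,
    ⟨_, Finset.mem_map_of_mem _ he, (i.incident_iff (hZ he) x).2 hex⟩, fun e he y hy => ?_⟩
  · obtain ⟨e₁, he₁, rfl⟩ := Finset.mem_map.1 he
    exact (i.edge_mem e₁).1 (hZ he₁)
  · obtain ⟨e₁, he₁, rfl⟩ := Finset.mem_map.1 he
    obtain ⟨y, rfl⟩ := i.node.surjective y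
    have h1 := hcard e₁ he₁ y ((i.incident_iff (hZ he₁) y).1 hy)
    rw [Finset.filter_map, Finset.card_map]
    convert h1 using 2
    refine Finset.filter_congr fun e' he' => ?_
    exact i.incident_iff (hZ he') y

theorem onCycle_iff (i : Iso G G') {x : S.Node} : G'.OnCycle (i.node x) ↔ G.OnCycle x :=
  ⟨fun h => by simpa only [i.symm_node] using i.symm.onCycle h, i.onCycle⟩

theorem adj (i : Iso G G') {x y : S.Node} (h : (edgeGraph G.edges).Adj x y) :
    (edgeGraph G'.edges).Adj (i.node x) (i.node y) := by
  obtain ⟨e, he, ⟨rfl, rfl⟩ | ⟨rfl, rfl⟩⟩ := exists_edge_of_adj h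
  all_goals
    have := adj_of_edge ((i.edge_mem e).1 he)
    rw [i.var_edge e he, i.chk_edge e he] at this
  · exact this
  · exact this.symm

theorem rootDist_le (i : Iso G G') (x : S.Node) : G'.rootDist (i.node x) ≤ G.rootDist x := by
  rw [rootDist, rootDist]
  by_cases h : (edgeGraph G.edges).edist (Sum.inl G.root) x = ⊤
  · rw [h]; exact le_top
  · obtain ⟨p, hp⟩ := SimpleGraph.exists_walk_of_edist_ne_top h
    have hr : i.node (Sum.inl G.root) = Sum.inl G'.root := by simp [node, i.root]
    let F : edgeGraph G.edges →g edgeGraph G'.edges := ⟨i.node, i.adj⟩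
    have := SimpleGraph.edist_le (p.map F)
    rw [SimpleGraph.Walk.length_map, hp] at this
    rwa [← hr]

theorem rootDist_eq (i : Iso G G') (x : S.Node) : G'.rootDist (i.node x) = G.rootDist x := by
  refine le_antisymm (i.rootDist_le x) ?_
  simpa only [i.symm_node] using i.symm.rootDist_le (i.node x)

theorem isShallowest_iff (i : Iso G G') {x : S.Node} :
    G'.IsShallowest (i.node x) ↔ G.IsShallowest x := by
  rw [IsShallowest, IsShallowest, i.onCycle_iff, i.node.surjective.forall]
  simp only [i.onCycle_iff, i.rootDist_eq]

theorem isDeepest_iff (i : Iso G G') {x : S.Node} :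
    G'.IsDeepest (i.node x) ↔ G.IsDeepest x := by
  rw [IsDeepest, IsDeepest, i.onCycle_iff, i.node.surjective.forall]
  simp only [i.onCycle_iff, i.rootDist_eq]

theorem exists_isDeepest_iff (i : Iso G G') (s : ℕ) :
    (∃ y, G'.IsDeepest y ∧ G'.rootDist y = s) ↔ ∃ y, G.IsDeepest y ∧ G.rootDist y = s := by
  rw [i.node.surjective.exists]
  simp only [i.isDeepest_iff, i.rootDist_eq]

theorem mem_singleCycle_iff (i : Iso G G') : G' ∈ singleCycle S ↔ G ∈ singleCycle S := by
  simp only [singleCycle, Set.mem_ofPred_eq, i.numCycles_eq]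

theorem node_inl (i : Iso G G') (v : Fin S.n) : i.node (Sum.inl v) = Sum.inl (i.var v) := rfl

theorem node_inr (i : Iso G G') (c : Fin S.m) : i.node (Sum.inr c) = Sum.inr (i.chk c) := rfl

theorem mem_singleCycleV_iff (i : Iso G G') {s₁ s₂ : ℕ} :
    G' ∈ singleCycleV S s₁ s₂ ↔ G ∈ singleCycleV S s₁ s₂ := by
  refine and_congr i.mem_singleCycle_iff (and_congr ?_ (i.exists_isDeepest_iff s₂))
  rw [i.var.surjective.exists]
  simp only [← i.node_inl, i.isShallowest_iff, i.rootDist_eq, ← i.root, ne_eq,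
    i.var.apply_eq_iff_eq]

theorem mem_singleCycleC_iff (i : Iso G G') {s₁ s₂ : ℕ} :
    G' ∈ singleCycleC S s₁ s₂ ↔ G ∈ singleCycleC S s₁ s₂ := by
  refine and_congr i.mem_singleCycle_iff (and_congr ?_ (i.exists_isDeepest_iff s₂))
  rw [i.chk.surjective.exists]
  simp only [← i.node_inr, i.isShallowest_iff, i.rootDist_eq]

theorem mem_singleCycleR_iff (i : Iso G G') {s : ℕ} :
    G' ∈ singleCycleR S s ↔ G ∈ singleCycleR S s := by
  refine and_congr i.mem_singleCycle_iff (and_congr ?_ (i.exists_isDeepest_iff s))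
  rw [← i.root, ← i.node_inl, i.isShallowest_iff]

theorem chkErased_iff (i : Iso G G') (A : Finset (Fin S.n)) (τ : ℕ) : ∀ e ∈ G.edges,
    G'.chkErased (A.map i.var.toEmbedding) τ (i.edge e) ↔ G.chkErased A τ e := by
  induction τ with
  | zero => intro e _; rfl
  | succ τ ih =>
    intro e he
    rw [chkErased, chkErased, i.edge.surjective.exists]
    refine exists_congr fun e' => ?_
    rw [← i.edge_mem]
    refine and_congr_right fun he' => ?_
    rw [i.chk_edge e he, i.chk_edge e' he', i.var_edge e' he', i.chk.apply_eq_iff_eq, ne_eq,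
      i.edge.apply_eq_iff_eq]
    refine and_congr_right fun _ => and_congr_right fun _ => and_congr (by simp) ?_
    rw [i.edge.surjective.forall]
    refine forall_congr' fun e'' => ?_
    rw [← i.edge_mem]
    refine forall_congr' fun he'' => ?_
    rw [i.var_edge e'' he'', i.var.apply_eq_iff_eq, ne_eq, i.edge.apply_eq_iff_eq, ih e'' he'']

theorem rootErased_iff (i : Iso G G') (A : Finset (Fin S.n)) (t : ℕ) :
    G'.rootErased (A.map i.var.toEmbedding) t ↔ G.rootErased A t := by
  rw [rootErased, rootErased, ← i.root, i.edge.surjective.forall]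
  refine and_congr (by simp) (forall_congr' fun e => ?_)
  rw [← i.edge_mem]
  refine forall_congr' fun he => ?_
  rw [i.var_edge e he, i.var.apply_eq_iff_eq, i.chkErased_iff A t e he]

theorem errorProb_eq (i : Iso G G') (ε : ℝ) (t : ℕ) : G'.errorProb ε t = G.errorProb ε t := by
  classical
  rw [errorProb, errorProb, i.card_varNodes]
  symm
  refine Finset.sum_equiv (Equiv.finsetCongr i.var) (fun A => ?_) fun A _ => ?_
  · rw [Finset.mem_filter, Finset.mem_filter, Equiv.finsetCongr_apply, i.rootErased_iff,
      Finset.mem_powerset, Finset.mem_powerset]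
    refine and_congr_left fun _ => ?_
    constructor
    · intro h v hv
      obtain ⟨v₁, hv₁, rfl⟩ := Finset.mem_map.1 hv
      exact (i.var_mem v₁).1 (h hv₁)
    · intro h v hv
      exact (i.var_mem v).2 (h (Finset.mem_map_of_mem _ hv))
  · simp

end Iso

/-! ### Belief propagation on neighborhoods -/

theorem chkErased_inter (hG : G.WellFormed) (A : Finset (Fin S.n)) (τ : ℕ) : ∀ e,
    G.chkErased (A ∩ G.varNodes) τ e ↔ G.chkErased A τ e := by
  induction τ with
  | zero => intro e; rfl
  | succ τ ih =>
    intro e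
    rw [chkErased, chkErased]
    refine exists_congr fun e' => and_congr_right fun he' => ?_
    simp only [ih, Finset.mem_inter, hG.var_mem e' he', and_true]

theorem rootErased_inter (hG : G.WellFormed) (A : Finset (Fin S.n)) (t : ℕ) :
    G.rootErased (A ∩ G.varNodes) t ↔ G.rootErased A t := by
  simp only [rootErased, chkErased_inter hG, Finset.mem_inter, hG.root_mem, and_true]

/-- The channel outputs outside of the graph do not matter. -/
theorem errorProb_eq_sum (hG : G.WellFormed) (ε : ℝ) (t : ℕ) : G.errorProb ε t =
    ∑ A : Finset (Fin S.n), ε ^ A.card * (1 - ε) ^ (S.n - A.card) * ind (G.rootErased A t) := by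
  classical
  rw [errorProb]
  set V := G.varNodes
  have hV : V.card + Vᶜ.card = S.n := by simp [Finset.card_add_card_compl]
  have h1 : ∑ C ∈ Vᶜ.powerset, ε ^ C.card * (1 - ε) ^ (Vᶜ.card - C.card) = 1 := by
    rw [Finset.sum_pow_mul_eq_add_pow]; simp
  have hmul : ∀ x : ℝ, x = x * ∑ C ∈ Vᶜ.powerset, ε ^ C.card * (1 - ε) ^ (Vᶜ.card - C.card) :=
    fun x => by rw [h1, mul_one]
  refine (hmul _).trans ?_
  rw [Finset.sum_filter, Finset.sum_mul_sum, ← Finset.sum_product']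
  refine Finset.sum_bij' (fun p _ => p.1 ∪ p.2) (fun A _ => (A ∩ V, A ∩ Vᶜ))
    (fun _ _ => Finset.mem_univ _) (fun A _ => ?_) (fun p hp => ?_) (fun A _ => ?_) fun p hp => ?_
  · simp [Finset.inter_subset_right]
  · simp only [Finset.mem_product, Finset.mem_powerset] at hp
    have h2 : Disjoint p.1 Vᶜ := Finset.disjoint_of_subset_left hp.1 disjoint_compl_right
    have h3 : Disjoint p.2 V := Finset.disjoint_of_subset_left hp.2 disjoint_compl_left
    refine Prod.ext ?_ ?_
    · simp only [Finset.union_inter_distrib_right, Finset.disjoint_iff_inter_eq_empty.1 h3,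
        Finset.union_empty, Finset.inter_eq_left.2 hp.1]
    · simp only [Finset.union_inter_distrib_right, Finset.disjoint_iff_inter_eq_empty.1 h2,
        Finset.empty_union, Finset.inter_eq_left.2 hp.2]
  · simp only [← Finset.inter_union_distrib_left, Finset.union_compl, Finset.inter_univ]
  · simp only [Finset.mem_product, Finset.mem_powerset] at hp
    have h2 : Disjoint p.1 p.2 := Finset.disjoint_of_subset_left hp.1
      (Finset.disjoint_of_subset_right hp.2 disjoint_compl_right)
    have h3 : Disjoint p.2 V := Finset.disjoint_of_subset_left hp.2 disjoint_compl_left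
    have h4 := Finset.card_le_card hp.1
    have h5 := Finset.card_le_card hp.2
    have h6 : (p.1 ∪ p.2) ∩ V = p.1 := by
      simp only [Finset.union_inter_distrib_right, Finset.disjoint_iff_inter_eq_empty.1 h3,
        Finset.union_empty, Finset.inter_eq_left.2 hp.1]
    have h7 : G.rootErased (p.1 ∪ p.2) t ↔ G.rootErased p.1 t := by
      rw [← rootErased_inter hG, show (p.1 ∪ p.2) ∩ G.varNodes = p.1 from h6]
    rw [Finset.card_union_of_disjoint h2,
      show S.n - (p.1.card + p.2.card) = (V.card - p.1.card) + (Vᶜ.card - p.2.card) by omega,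
      pow_add, pow_add]
    simp only [ind, h7]
    split_ifs <;> ring

end RootedGraph

variable {S : Sockets} {T : S.TannerGraph} {v₀ : Fin S.n} {A : Finset (Fin S.n)}

theorem one_sub_opn_mul_prod_eq_one {ι : Type*} {x : S.Node} {s : Finset ι} {F : ι → ℝ} :
    1 - opn A x * ∏ i ∈ s, F i = 1 ↔ opn A x = 0 ∨ ∃ i ∈ s, F i = 0 := by
  rw [sub_eq_self, mul_eq_zero, Finset.prod_eq_zero_iff]

theorem one_sub_opn_mul_prod_eq_zero {ι : Type*} {x : S.Node} {s : Finset ι} {F : ι → ℝ}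
    (hF : ∀ i ∈ s, F i = 0 ∨ F i = 1) :
    1 - opn A x * ∏ i ∈ s, F i = 0 ↔ opn A x = 1 ∧ ∀ i ∈ s, F i = 1 := by
  constructor
  · intro h
    have h0 : opn A x ≠ 0 := fun h0 => by rw [h0] at h; simp at h
    refine ⟨(opn_zero_or_one A x).resolve_left h0, fun i hi => (hF i hi).resolve_left fun h1 => ?_⟩
    rw [Finset.prod_eq_zero hi h1] at h
    simp at h
  · rintro ⟨h1, h2⟩
    rw [h1, Finset.prod_eq_one h2]
    simp

/-- one iteration of belief propagation -/
theorem msg_add_two_eq_one {j : ℕ} {s : S.VSocket} : msg T A (j + 2) (Sum.inl s) = 1 ↔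
    ∃ s', (T s').1 = (T s).1 ∧ s' ≠ s ∧ s'.1 ∈ A ∧
      ∀ s'', s''.1 = s'.1 → s'' ≠ s' → msg T A j (Sum.inl s'') = 1 := by
  classical
  have h1 : ∀ c : S.CSocket, msg T A (j + 1) (Sum.inr c) = 0 ↔ (T.symm c).1 ∈ A ∧
      ∀ s'', s''.1 = (T.symm c).1 → s'' ≠ T.symm c → msg T A j (Sum.inl s'') = 1 := by
    intro c
    rw [msg_add_one, one_sub_opn_mul_prod_eq_zero fun h _ => msg_zero_or_one T A j h]
    simp only [Finset.mem_filter, Finset.mem_univ, true_and]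
    simp only [mate, Sum.elim_inr, nd, Sum.map_inl, opn, Sum.elim_inl, ite_eq_left_iff,
      zero_ne_one, imp_false, not_not, Sum.forall,
      Sum.inl.injEq, ne_eq, Sum.map_inr, reduceCtorEq, IsEmpty.forall_iff,
      implies_true, and_true, and_imp]
  rw [show j + 2 = j + 1 + 1 from rfl, msg_add_one, one_sub_opn_mul_prod_eq_one]
  simp only [Finset.mem_filter, Finset.mem_univ, true_and]
  simp only [mate, Sum.elim_inl, nd, Sum.map_inr, opn, Sum.elim_inr, one_ne_zero, false_or,
    Sum.exists, Sum.map_inl, reduceCtorEq, false_and,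
    exists_false, Sum.inr.injEq, ne_eq, h1]
  rw [T.surjective.exists]
  refine exists_congr fun s' => ?_
  simp only [T.symm_apply_apply, T.apply_eq_iff_eq, and_assoc]

/-- Inside the neighborhood, belief propagation does not depend on the rest of the Tanner graph. -/
theorem msg_eq_one_iff {t : ℕ} (τ : ℕ) : ∀ s : S.VSocket,
    level T v₀ (2 * t) (Sum.inr (T s).1) + 2 * τ ≤ 2 * t + 1 →
    (msg T A (2 * τ) (Sum.inl s) = 1 ↔ (nbhd t v₀ T).chkErased A τ (s, T s)) := by
  induction τ with
  | zero => intro s _; simp [msg, RootedGraph.chkErased]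
  | succ τ ih =>
    intro s hs
    have hl : level T v₀ (2 * t) (Sum.inr (T s).1) + 1 ≤ 2 * t := by omega
    have hside := isLeft_eq_even_level (T := T) (v₀ := v₀) (x := Sum.inr (T s).1)
      (show _ ≤ 2 * t by omega)
    rw [show 2 * (τ + 1) = 2 * τ + 2 by ring, msg_add_two_eq_one, RootedGraph.chkErased]
    have hvar : ∀ s', (T s').1 = (T s).1 → level T v₀ (2 * t) (Sum.inl s'.1 : S.Node) ≤
        level T v₀ (2 * t) (Sum.inr (T s).1) + 1 := by
      intro s' hs'
      have := level_mate_le (T := T) (v₀ := v₀) (D := 2 * t) (Sum.inr (T s'))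
      simpa [mate, nd, hs'] using this
    have hchk : ∀ s', level T v₀ (2 * t) (Sum.inr (T s').1 : S.Node) ≤
        level T v₀ (2 * t) (Sum.inl s'.1 : S.Node) + 1 := fun s' => by
      have := level_mate_le (T := T) (v₀ := v₀) (D := 2 * t) (Sum.inl s')
      simpa [mate, nd] using this
    have hmem : ∀ s', (s', T s') ∈ (nbhd t v₀ T).edges ↔
        level T v₀ (2 * t) (Sum.inl s'.1 : S.Node) ≤ 2 * t ∧
          level T v₀ (2 * t) (Sum.inr (T s').1 : S.Node) ≤ 2 * t := fun s' => by
      rw [mem_nbhd_edges, mem_edges, mem_ball, mem_ball]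
      exact and_iff_right rfl
    have hform : ∀ e ∈ (nbhd t v₀ T).edges, e = (e.1, T e.1) := fun e he =>
      Prod.ext rfl (mem_edges.1 (mem_nbhd_edges.1 he).1).symm
    have hinner : ∀ s', (T s').1 = (T s).1 →
        ((∀ s'', s''.1 = s'.1 → s'' ≠ s' → msg T A (2 * τ) (Sum.inl s'') = 1) ↔
          ∀ e'' ∈ (nbhd t v₀ T).edges, e'' ≠ (s', T s') → Edge.var e'' = s'.1 →
            (nbhd t v₀ T).chkErased A τ e'') := by
      intro s' hs'
      rcases Nat.eq_zero_or_pos τ with rfl | hτ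
      · simp [msg, RootedGraph.chkErased]
      have h1 := hvar s' hs'
      constructor
      · intro h e he hne hv
        rw [hform e he] at hne ⊢
        have h2 := hchk e.1
        rw [show e.1.1 = s'.1 from hv] at h2
        refine (ih e.1 (by omega)).1 (h _ hv fun hee => hne (by rw [hee]))
      · intro h s'' hv hne
        have h2 := hchk s''
        rw [hv] at h2
        refine (ih s'' (by omega)).2 (h _ ((hmem _).2 ⟨by rw [hv]; omega, by omega⟩)
          (fun hee => hne (congrArg Prod.fst hee)) hv)
    constructor
    · rintro ⟨s', hs', hne, hA, h⟩
      have h1 := hvar s' hs'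
      refine ⟨(s', T s'), (hmem _).2 ⟨by omega, by rw [hs']; omega⟩,
        fun hee => hne (congrArg Prod.fst hee), hs', hA, (hinner s' hs').1 h⟩
    · rintro ⟨e', he', hne, hc, hA, h⟩
      rw [hform e' he'] at hne hc h
      exact ⟨e'.1, hc, fun hee => hne (by rw [hee]), hA, (hinner _ hc).2 h⟩

theorem rootMsg_eq_ind {t : ℕ} :
    rootMsg T A (2 * t) (Sum.inl v₀) = ind ((nbhd t v₀ T).rootErased A t) := by
  classical
  have h0 : rootMsg T A (2 * t) (Sum.inl v₀) = 0 ∨ rootMsg T A (2 * t) (Sum.inl v₀) = 1 := by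
    rw [rootMsg]
    rcases opn_zero_or_one A (Sum.inl v₀ : S.Node) with h | h
    · simp [h]
    · rw [h, one_mul]
      exact prod_zero_or_one _ _ fun h _ => msg_zero_or_one T A _ h
  have hroot : ∀ s : S.VSocket, s.1 = v₀ →
      (msg T A (2 * t) (Sum.inl s) = 1 ↔ (nbhd t v₀ T).chkErased A t (s, T s)) := by
    rintro s rfl
    refine msg_eq_one_iff t s ?_
    have := level_mate_le (T := T) (v₀ := s.1) (D := 2 * t) (Sum.inl s)
    simp only [mate, nd, Sum.elim_inl, Sum.map_inr, Sum.map_inl, level_root] at this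
    omega
  have h1 : rootMsg T A (2 * t) (Sum.inl v₀) = 1 ↔ (nbhd t v₀ T).rootErased A t := by
    have h2 : rootMsg T A (2 * t) (Sum.inl v₀) = 1 ↔
        1 - opn A (Sum.inl v₀ : S.Node) *
          ∏ h : S.Half with nd h = Sum.inl v₀, msg T A (2 * t) h = 0 := by
      rw [rootMsg, sub_eq_zero, eq_comm]
    rw [h2, one_sub_opn_mul_prod_eq_zero fun h _ => msg_zero_or_one T A _ h,
      RootedGraph.rootErased]
    refine and_congr (by simp [opn, nbhd]) ?_
    constructor
    · intro h e he hv
      have hv' : e.1.1 = v₀ := hv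
      have hm := mem_edges.1 (mem_nbhd_edges.1 he).1
      have := (hroot e.1 hv').1 (h (Sum.inl e.1)
        (Finset.mem_filter.2 ⟨Finset.mem_univ _, congrArg Sum.inl hv'⟩))
      rwa [hm] at this
    · intro h x hx
      simp only [Finset.mem_filter, Finset.mem_univ, true_and] at hx
      rcases x with s | c
      · have hs : s.1 = v₀ := Sum.inl_injective hx
        rw [hroot s hs]
        rcases Nat.eq_zero_or_pos t with rfl | ht
        · simp [RootedGraph.chkErased]
        refine h _ ?_ hs
        rw [mem_nbhd_edges, mem_edges, mem_ball, mem_ball]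
        refine ⟨rfl, ?_, ?_⟩
        · show level T v₀ (2 * t) (Sum.inl s.1) ≤ 2 * t
          rw [hs, level_root]; omega
        · have := level_mate_le (T := T) (v₀ := v₀) (D := 2 * t) (Sum.inl s)
          simp only [mate, nd, Sum.elim_inl, Sum.map_inr, Sum.map_inl, hs, level_root] at this
          exact this.trans (by omega)
      · simp [nd] at hx
  by_cases h : (nbhd t v₀ T).rootErased A t
  · rw [h1.2 h]; simp [ind, h]
  · rw [h0.resolve_right (mt h1.1 h)]; simp [ind, h]

end

/-! ### The contribution of a class of neighborhoods -/

section

variable {S : Sockets} {ε : ℝ} {t : ℕ}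

open Classical in
theorem RootedGraph.prob_eq (G : RootedGraph S) : G.prob t =
    ∑ x : Fin S.n × S.TannerGraph, ind ((nbhd t x.1 x.2).Equivalent G) /
      Fintype.card (Fin S.n × S.TannerGraph) := by
  simp only [prob, labelledProb]
  rw [← Finset.sum_div, ← Finset.sum_div]
  congr 1
  have h1 : ∑ x : Fin S.n × S.TannerGraph, ind ((nbhd t x.1 x.2).Equivalent G) =
      ((Finset.univ.filter fun x : Fin S.n × S.TannerGraph =>
        (nbhd t x.1 x.2).Equivalent G).card : ℝ) := by
    rw [← Finset.sum_boole]
    exact Finset.sum_congr rfl fun x _ => by simp [ind]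
  rw [h1, Finset.card_eq_sum_card_fiberwise (t := Finset.univ.filter fun G' => G'.Equivalent G)
    (f := fun x : Fin S.n × S.TannerGraph => nbhd t x.1 x.2) (fun x hx => by simpa using hx),
    Nat.cast_sum]
  refine Finset.sum_congr rfl fun G' hG' => ?_
  rw [Finset.filter_filter]
  congr 2
  refine Finset.filter_congr fun x _ => ⟨fun h => ⟨?_, h⟩, fun h => h.2⟩
  rw [h]
  exact (Finset.mem_filter.1 hG').2

/-- A sum over equivalence classes is a sum over root and Tanner graph. -/
theorem contribution_eq (hn : 0 < S.n) {X : Set (RootedGraph S)}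
    (hX : ∀ G G', RootedGraph.Iso G G' → (G' ∈ X ↔ G ∈ X)) :
    (S.n : ℝ) * S.contribution X ε t = ∑ v₀ : Fin S.n, S.expect ε fun T A =>
      ind (nbhd t v₀ T ∈ X) * rootMsg T A (2 * t) (Sum.inl v₀) := by
  classical
  set F : RootedGraph S → ℝ := fun G => ind (G ∈ X) * G.errorProb ε t with hFdef
  have hF : ∀ (v₀ : Fin S.n) (T : S.TannerGraph) (G : RootedGraph S),
      (nbhd t v₀ T).Equivalent G → F G = F (nbhd t v₀ T) := by
    intro v₀ T G h
    obtain ⟨i⟩ := h.exists_iso RootedGraph.wellFormed_nbhd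
    simp only [hFdef, i.errorProb_eq, hX _ _ i]
  have h1 : S.contribution X ε t = ∑ x : Fin S.n × S.TannerGraph,
      F (nbhd t x.1 x.2) / Fintype.card (Fin S.n × S.TannerGraph) := by
    have h2 : S.contribution X ε t = ∑ q : Quotient (RootedGraph.equivalence S),
        q.out.prob t * F q.out := by
      rw [contribution, Finset.sum_filter]
      refine Finset.sum_congr rfl fun q _ => ?_
      simp only [hFdef, ind]
      split_ifs <;> simp
    rw [h2]
    simp only [RootedGraph.prob_eq, Finset.sum_mul]
    rw [Finset.sum_comm]
    refine Finset.sum_congr rfl fun x _ => ?_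
    have hq : ∀ q : Quotient (RootedGraph.equivalence S),
        (nbhd t x.1 x.2).Equivalent q.out ↔ q = Quotient.mk _ (nbhd t x.1 x.2) := by
      intro q
      constructor
      · intro h
        rw [← q.out_eq]
        exact (Quotient.sound (s := RootedGraph.equivalence S) h).symm
      · rintro rfl
        exact RootedGraph.Equivalent.symm
          (Quotient.mk_out (s := RootedGraph.equivalence S) (nbhd t x.1 x.2))
    rw [Finset.sum_eq_single (Quotient.mk (RootedGraph.equivalence S) (nbhd t x.1 x.2))]
    · have h3 := (hq _).2 rfl
      rw [hF _ _ _ h3, ind, if_pos h3]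
      ring
    · intro q _ hne
      rw [ind, if_neg (mt (hq q).1 hne)]
      simp
    · simp
  have hn' : (S.n : ℝ) ≠ 0 := by positivity
  rw [h1, Fintype.sum_prod_type, Finset.mul_sum]
  refine Finset.sum_congr rfl fun v₀ _ => ?_
  simp only [expect, LinearMap.coe_mk, AddHom.coe_mk]
  rw [Finset.mul_sum, Finset.mul_sum]
  refine Finset.sum_congr rfl fun T _ => ?_
  simp only [hFdef, RootedGraph.errorProb_eq_sum RootedGraph.wellFormed_nbhd, rootMsg_eq_ind]
  have h4 : ∑ A : Finset (Fin S.n), ε ^ A.card * (1 - ε) ^ (S.n - A.card) *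
      (ind (nbhd t v₀ T ∈ X) * ind ((nbhd t v₀ T).rootErased A t)) =
      ind (nbhd t v₀ T ∈ X) * ∑ A : Finset (Fin S.n), ε ^ A.card * (1 - ε) ^ (S.n - A.card) *
        ind ((nbhd t v₀ T).rootErased A t) := by
    rw [Finset.mul_sum]
    exact Finset.sum_congr rfl fun A _ => by ring
  have hT : (Fintype.card S.TannerGraph : ℝ) ≠ 0 := by
    have := S.card_TannerGraph_pos
    positivity
  rw [h4, Fintype.card_prod, Fintype.card_fin, Nat.cast_mul]
  field_simp

/-- Sorting lassos by their first node. -/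
theorem lassoSum_lassoMsg {ℓ k : ℕ} (hk : 1 ≤ k) (hD : ℓ + k ≤ 2 * t) :
    S.lassoSum ε (ℓ + 2 * k) ℓ (fun α => lassoMsg (2 * k - 1) ℓ α (2 * t)) =
      ∑ v₀ : Fin S.n, S.expect ε fun T A =>
        (∑ out : Fin (ℓ + 2 * k) → S.Half, ind (RootedLasso T v₀ (ℓ + 2 * k) ℓ out)) *
          rootMsg T A (2 * t) (Sum.inl v₀) := by
  classical
  rw [lassoSum_apply, ← map_sum, ← map_sum]
  congr 1
  funext T A
  simp only [Finset.sum_apply, Finset.sum_mul]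
  rw [Finset.sum_comm]
  refine Finset.sum_congr rfl fun out _ => ?_
  by_cases h : IsLasso (ℓ + 2 * k) ℓ (walkEnds T out)
  · have h1 := h.rootMsg_eq (A := A) (n := 2 * k - 1) (J := 2 * t)
      (by rw [Nat.not_even_iff_odd]; exact ⟨k - 1, by omega⟩) (by omega) (by simp) (by omega)
    have h2 := h.side_node ⟨0, by omega⟩
    simp only [walkEnds, Bool.false_eq_true, if_false, Even.zero, decide_true] at h2
    obtain ⟨v, hv⟩ := Sum.isLeft_iff.1 h2
    rw [← h1, hv, Finset.sum_eq_single v]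
    · congr 1
      rw [ind, ind, if_pos h, if_pos ⟨h, fun _ => hv⟩]
    · intro v' _ hne
      rw [ind, if_neg, zero_mul]
      rintro ⟨-, h3⟩
      exact hne (Sum.inl_injective ((h3 (by omega)).symm.trans hv))
    · simp
  · rw [ind, if_neg h, zero_mul, Finset.sum_eq_zero]
    intro v _
    rw [ind, if_neg fun h' => h h'.1, zero_mul]

variable {lam rho : ℝ[X]} {d : ℕ}

theorem exists_lasso {T : S.TannerGraph} {v₀ : Fin S.n} (h1 : (nbhd t v₀ T).numCycles = 1) :
    ∃ y ℓ₀ k₀, Unicyclic T v₀ (2 * t) y ∧ 1 ≤ k₀ ∧ ℓ₀ + k₀ ≤ 2 * t ∧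
      (∃ out, RootedLasso T v₀ (ℓ₀ + 2 * k₀) ℓ₀ out) ∧ ∀ ℓ k, 1 ≤ k → ℓ + k ≤ 2 * t →
      ∑ out : Fin (ℓ + 2 * k) → S.Half, ind (RootedLasso T v₀ (ℓ + 2 * k) ℓ out) =
        if ℓ = ℓ₀ ∧ k = k₀ then 2 else 0 := by
  obtain ⟨y, hy⟩ := exists_unicyclic h1
  obtain ⟨ℓ₀, k₀, hk₀, hl, hsum⟩ := hy.card_lassos
  have hD : ℓ₀ + k₀ ≤ 2 * t := hl.trans_le (mem_ball.1 hy.mem)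
  refine ⟨y, ℓ₀, k₀, hy, hk₀, hD, ?_, hsum⟩
  by_contra! hno
  have := hsum ℓ₀ k₀ hk₀ hD
  rw [Finset.sum_eq_zero fun out _ => by rw [ind, if_neg (hno out)]] at this
  simp at this

/-- The neighborhoods in `X` are the single-cycle neighborhoods whose cycle has highest level
`ℓ + k` and lowest level `ℓ`. -/
def IsCycleType (t ℓ k : ℕ) (X : Set (RootedGraph S)) : Prop :=
  X ⊆ RootedGraph.singleCycle S ∧ ∀ (T : S.TannerGraph) (v₀ : Fin S.n) (y : S.Node) (ℓ₀ k₀ : ℕ)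
    (out : Fin (ℓ₀ + 2 * k₀) → S.Half), RootedLasso T v₀ (ℓ₀ + 2 * k₀) ℓ₀ out → 1 ≤ k₀ →
    ℓ₀ + k₀ ≤ 2 * t → Unicyclic T v₀ (2 * t) y → (nbhd t v₀ T).numCycles = 1 →
    (nbhd t v₀ T ∈ X ↔ ℓ₀ = ℓ ∧ ℓ₀ + k₀ = ℓ + k)

/-- Each neighborhood of the type in question contains its lasso in both directions. -/
theorem abs_ind_mem_sub_le (H : Model S lam rho d) {ℓ k : ℕ} (hk : 1 ≤ k) (hD : ℓ + k ≤ 2 * t)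
    {X : Set (RootedGraph S)} (hX : IsCycleType t ℓ k X) (T : S.TannerGraph) (v₀ : Fin S.n) :
    |ind (nbhd t v₀ T ∈ X) - 1 / 2 * ∑ out : Fin (ℓ + 2 * k) → S.Half,
        ind (RootedLasso T v₀ (ℓ + 2 * k) ℓ out)| ≤
      (d * (d + 1) ^ (ℓ + k) : ℕ) ^ (ℓ + 2 * k) * ind (2 ≤ (nbhd t v₀ T).numCycles) := by
  have hb := H.sum_ind_rootedLasso_le T v₀ (ℓ := ℓ) hk rfl
  have h0 : 0 ≤ ∑ out : Fin (ℓ + 2 * k) → S.Half, ind (RootedLasso T v₀ (ℓ + 2 * k) ℓ out) :=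
    Finset.sum_nonneg fun _ _ => ind_nonneg _
  have hnn : 0 ≤ (nbhd t v₀ T).numCycles := by rw [numCycles_nbhd]; positivity
  have hmem : (nbhd t v₀ T).numCycles ≠ 1 → nbhd t v₀ T ∉ X := fun h hx => h (hX.1 hx)
  obtain h | h | h : (nbhd t v₀ T).numCycles = 0 ∨ (nbhd t v₀ T).numCycles = 1 ∨
      2 ≤ (nbhd t v₀ T).numCycles := by omega
  · have h1 : ∑ out : Fin (ℓ + 2 * k) → S.Half, ind (RootedLasso T v₀ (ℓ + 2 * k) ℓ out) = 0 :=
      Finset.sum_eq_zero fun out _ => by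
        rw [ind, if_neg (not_rootedLasso (card_parents_le_one h) hk hD out)]
    rw [h1, ind, ind, if_neg (hmem (by omega)), if_neg (by omega)]
    simp
  · obtain ⟨y, ℓ₀, k₀, hy, hk₀, hD₀, ⟨out, hout⟩, hsum⟩ := exists_lasso h
    have h1 := hX.2 T v₀ y ℓ₀ k₀ out hout hk₀ hD₀ hy h
    have h2 : nbhd t v₀ T ∈ X ↔ ℓ = ℓ₀ ∧ k = k₀ := by
      rw [h1]; omega
    rw [hsum ℓ k hk hD, ind, ind, if_neg (show ¬ 2 ≤ (nbhd t v₀ T).numCycles by omega)]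
    by_cases h3 : ℓ = ℓ₀ ∧ k = k₀
    · rw [if_pos (h2.2 h3), if_pos h3]; norm_num
    · rw [if_neg (mt h2.1 h3), if_neg h3]; norm_num
  · rw [ind, ind, if_neg (hmem (by omega)), if_pos h, mul_one, abs_le]
    constructor <;> linarith

theorem mul_expect (c : ℝ) (F : S.TannerGraph → Finset (Fin S.n) → ℝ) :
    c * S.expect ε F = S.expect ε fun T A => c * F T A := (map_smul (S.expect ε) c F).symm

theorem rootMsg_mem (T : S.TannerGraph) (A : Finset (Fin S.n)) (j : ℕ) (x : S.Node) :
    rootMsg T A j x ∈ Set.Icc (0 : ℝ) 1 :=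
  mul_mem_Icc (opn_mem A x) (prod_mem_Icc _ fun h _ => msg_mem T A j h)

/-- The contribution of one type of neighborhoods is half a sum over lassos: a cycle can be
traversed in two directions. -/
theorem exists_contribution_bound (lam rho : ℝ[X]) (hε : ε ∈ Set.Icc (0 : ℝ) 1) (d t : ℕ)
    {ℓ k : ℕ} (hk : 1 ≤ k) (hD : ℓ + k ≤ 2 * t) :
    ∃ C : ℝ, ∀ S : Sockets, 0 < S.n → Model S lam rho d → ∀ X : Set (RootedGraph S),
      IsCycleType t ℓ k X → (∀ G G', RootedGraph.Iso G G' → (G' ∈ X ↔ G ∈ X)) →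
      |(S.n : ℝ) * S.contribution X ε t -
        1 / 2 * S.lassoSum ε (ℓ + 2 * k) ℓ (fun α => lassoMsg (2 * k - 1) ℓ α (2 * t))| ≤
        C / Fintype.card S.VSocket := by
  obtain ⟨C, hC⟩ := sum_expect_two_le_numCycles lam rho hε d t
  set K : ℝ := (d * (d + 1) ^ (ℓ + k) : ℕ) ^ (ℓ + 2 * k) with hK
  have hK0 : 0 ≤ K := by positivity
  refine ⟨K * C, fun S hn H X hX hinv => ?_⟩
  rw [contribution_eq hn hinv, lassoSum_lassoMsg hk hD, Finset.mul_sum, ← Finset.sum_sub_distrib]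
  refine (Finset.abs_sum_le_sum_abs _ _).trans ?_
  rw [mul_div_assoc]
  refine le_trans ?_ (mul_le_mul_of_nonneg_left (hC S H) hK0)
  rw [Finset.mul_sum]
  refine Finset.sum_le_sum fun v₀ _ => ?_
  have hpt : ∀ (T : S.TannerGraph) (A : Finset (Fin S.n)),
      |ind (nbhd t v₀ T ∈ X) * rootMsg T A (2 * t) (Sum.inl v₀) -
        1 / 2 * ((∑ out : Fin (ℓ + 2 * k) → S.Half, ind (RootedLasso T v₀ (ℓ + 2 * k) ℓ out)) *
          rootMsg T A (2 * t) (Sum.inl v₀))| ≤ K * ind (2 ≤ (nbhd t v₀ T).numCycles) := by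
    intro T A
    have hR := rootMsg_mem T A (2 * t) (Sum.inl v₀)
    rw [← mul_assoc, ← sub_mul, abs_mul, abs_of_nonneg hR.1]
    exact (mul_le_of_le_one_right (abs_nonneg _) hR.2).trans (abs_ind_mem_sub_le H hk hD hX T v₀)
  rw [mul_expect, mul_expect, ← map_sub, abs_le, ← map_neg]
  exact ⟨expect_mono hε fun T A => (abs_le.1 (hpt T A)).1,
    expect_mono hε fun T A => (abs_le.1 (hpt T A)).2⟩

/-- The limit of the contribution of one type of neighborhoods. -/
theorem tendsto_contribution {S : ℕ → Sockets} (hε : ε ∈ Set.Icc (0 : ℝ) 1)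
    (hn : ∀ j, 0 < (S j).n) (H : ∀ j, Model (S j) lam rho d)
    (hN : Tendsto (fun j => (Fintype.card (S j).VSocket : ℝ)) atTop atTop)
    {ℓ k : ℕ} (hk : 1 ≤ k) (hD : ℓ + k ≤ 2 * t) {X : ∀ j, Set (RootedGraph (S j))}
    (hX : ∀ j, IsCycleType t ℓ k (X j))
    (hinv : ∀ j G G', RootedGraph.Iso G G' → (G' ∈ X j ↔ G ∈ X j)) {F : ℝ}
    (hF : Tendsto (fun j => 1 / 2 * (S j).lassoSum ε (ℓ + 2 * k) ℓ
      (fun α => lassoMsg (2 * k - 1) ℓ α (2 * t))) atTop (𝓝 F)) :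
    Tendsto (fun j => ((S j).n : ℝ) * (S j).contribution (X j) ε t) atTop (𝓝 F) := by
  obtain ⟨C, hC⟩ := exists_contribution_bound lam rho hε d t hk hD
  have h0 : Tendsto (fun j => ((S j).n : ℝ) * (S j).contribution (X j) ε t -
      1 / 2 * (S j).lassoSum ε (ℓ + 2 * k) ℓ (fun α => lassoMsg (2 * k - 1) ℓ α (2 * t)))
      atTop (𝓝 0) :=
    squeeze_zero_norm (fun j => hC (S j) (hn j) (H j) (X j) (hX j) (hinv j))
      (hN.const_div_atTop C)
  simpa using h0.add hF

theorem isCycleType_singleCycleV {s₁ s₂ : ℕ} (h₁ : 1 ≤ s₁) (h₂ : 2 * s₁ + 1 ≤ s₂) :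
    IsCycleType t (2 * s₁) (s₂ - 2 * s₁) (RootedGraph.singleCycleV S s₁ s₂) :=
  ⟨fun _ hG => hG.1, fun T v₀ y ℓ₀ k₀ out h hk hD hy h1 => by
    rw [h.mem_singleCycleV_iff hk rfl hD hy h1 h₁]; omega⟩

theorem isCycleType_singleCycleC {s₁ s₂ : ℕ} (h₂ : 2 * s₁ + 2 ≤ s₂) :
    IsCycleType t (2 * s₁ + 1) (s₂ - (2 * s₁ + 1)) (RootedGraph.singleCycleC S s₁ s₂) :=
  ⟨fun _ hG => hG.1, fun T v₀ y ℓ₀ k₀ out h hk hD hy h1 => by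
    rw [h.mem_singleCycleC_iff hk rfl hD hy h1]; omega⟩

theorem isCycleType_singleCycleR {s : ℕ} :
    IsCycleType t 0 s (RootedGraph.singleCycleR S s) :=
  ⟨fun _ hG => hG.1, fun T v₀ y ℓ₀ k₀ out h hk hD hy h1 => by
    rw [h.mem_singleCycleR_iff hk rfl hD hy h1]; omega⟩

/-! ### The classification of single-cycle neighborhoods -/

theorem sum_ind_eq_one {ι : Type*} {I : Finset ι} {P : ι → Prop} {a : ι} (ha : a ∈ I)
    (h : ∀ x ∈ I, P x ↔ x = a) : ∑ x ∈ I, ind (P x) = 1 := by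
  rw [Finset.sum_eq_single_of_mem a ha fun x hx hne => by rw [ind, if_neg (mt (h x hx).1 hne)],
    ind, if_pos ((h a ha).2 rfl)]

theorem sum_ind_eq_zero {ι : Type*} {I : Finset ι} {P : ι → Prop} (h : ∀ x ∈ I, ¬ P x) :
    ∑ x ∈ I, ind (P x) = 0 :=
  Finset.sum_eq_zero fun x hx => by rw [ind, if_neg (h x hx)]

/-- A single-cycle neighborhood belongs to exactly one of the types. -/
theorem ind_mem_singleCycle (T : S.TannerGraph) (v₀ : Fin S.n) :
    ind (nbhd t v₀ T ∈ RootedGraph.singleCycle S) =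
      ((∑ p ∈ (Finset.Ico 1 t).sigma fun s₁ => Finset.Icc (2 * s₁ + 1) (2 * t),
          ind (nbhd t v₀ T ∈ RootedGraph.singleCycleV S p.1 p.2))
        + ∑ p ∈ (Finset.range t).sigma fun s₁ => Finset.Icc (2 * s₁ + 2) (2 * t),
          ind (nbhd t v₀ T ∈ RootedGraph.singleCycleC S p.1 p.2))
        + ∑ s ∈ Finset.Icc 1 (2 * t), ind (nbhd t v₀ T ∈ RootedGraph.singleCycleR S s) := by
  by_cases h : nbhd t v₀ T ∈ RootedGraph.singleCycle S
  · rw [ind, if_pos h]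
    obtain ⟨y, ℓ₀, k₀, hy, hk₀, hD₀, ⟨out, hout⟩, -⟩ := exists_lasso h
    have hV : ∀ p ∈ (Finset.Ico 1 t).sigma fun s₁ => Finset.Icc (2 * s₁ + 1) (2 * t),
        nbhd t v₀ T ∈ RootedGraph.singleCycleV S p.1 p.2 ↔ ℓ₀ = 2 * p.1 ∧ ℓ₀ + k₀ = p.2 := by
      intro p hp
      rw [Finset.mem_sigma, Finset.mem_Ico] at hp
      exact hout.mem_singleCycleV_iff hk₀ rfl hD₀ hy h hp.1.1
    have hC : ∀ s₁ s₂, nbhd t v₀ T ∈ RootedGraph.singleCycleC S s₁ s₂ ↔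
        ℓ₀ = 2 * s₁ + 1 ∧ ℓ₀ + k₀ = s₂ := fun s₁ s₂ =>
      hout.mem_singleCycleC_iff hk₀ rfl hD₀ hy h
    have hR : ∀ s, nbhd t v₀ T ∈ RootedGraph.singleCycleR S s ↔ ℓ₀ = 0 ∧ ℓ₀ + k₀ = s := fun s =>
      hout.mem_singleCycleR_iff hk₀ rfl hD₀ hy h
    have hext : ∀ p : (_ : ℕ) × ℕ, ∀ a b, p.1 = a → p.2 = b → p = ⟨a, b⟩ := by
      rintro ⟨x, y⟩ a b rfl rfl; rfl
    obtain ⟨s, rfl | rfl⟩ := Nat.even_or_odd' ℓ₀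
    · rw [sum_ind_eq_zero
        (P := fun p : (_ : ℕ) × ℕ => nbhd t v₀ T ∈ RootedGraph.singleCycleC S p.1 p.2)
        fun p _ => by rw [hC]; omega]
      rcases Nat.eq_zero_or_pos s with rfl | hs
      · rw [sum_ind_eq_zero fun p hp => by
            rw [hV p hp]
            rw [Finset.mem_sigma, Finset.mem_Ico] at hp
            omega,
          sum_ind_eq_one (a := k₀) (by rw [Finset.mem_Icc]; omega) fun x _ => by rw [hR]; omega]
        norm_num
      · rw [sum_ind_eq_one (a := (⟨s, 2 * s + k₀⟩ : (_ : ℕ) × ℕ))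
            (by simp only [Finset.mem_sigma, Finset.mem_Ico, Finset.mem_Icc]; omega) fun p hp => by
              rw [hV p hp]
              exact ⟨fun h => hext p _ _ (by omega) h.2.symm, by rintro rfl; exact ⟨rfl, rfl⟩⟩,
          sum_ind_eq_zero fun x _ => by rw [hR]; omega]
        norm_num
    · rw [sum_ind_eq_zero fun p hp => by rw [hV p hp]; omega,
        sum_ind_eq_one (a := (⟨s, 2 * s + 1 + k₀⟩ : (_ : ℕ) × ℕ))
          (by simp only [Finset.mem_sigma, Finset.mem_range, Finset.mem_Icc]; omega) fun p _ => by
            rw [hC]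
            exact ⟨fun h => hext p _ _ (by omega) h.2.symm, by rintro rfl; exact ⟨rfl, rfl⟩⟩,
        sum_ind_eq_zero fun x _ => by rw [hR]; omega]
      norm_num
  · rw [ind, if_neg h, sum_ind_eq_zero fun p _ hp => h hp.1, sum_ind_eq_zero fun p _ hp => h hp.1,
      sum_ind_eq_zero fun p _ hp => h hp.1]
    norm_num

theorem sum_sum_comm {ι : Type*} [Fintype ι] (I : Finset ℕ) (J : ℕ → Finset ℕ)
    (F : ℕ → ℕ → ι → ℝ) : ∑ x ∈ I, ∑ y ∈ J x, ∑ v, F x y v = ∑ v, ∑ p ∈ I.sigma J, F p.1 p.2 v :=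
  (Finset.sum_sigma' I J fun x y => ∑ v, F x y v).trans Finset.sum_comm

theorem contribution_singleCycle (hn : 0 < S.n) :
    (S.n : ℝ) * S.contribution (RootedGraph.singleCycle S) ε t =
      (∑ s₁ ∈ Finset.Ico 1 t, ∑ s₂ ∈ Finset.Icc (2 * s₁ + 1) (2 * t),
          (S.n : ℝ) * S.contribution (RootedGraph.singleCycleV S s₁ s₂) ε t)
        + (∑ s₁ ∈ Finset.range t, ∑ s₂ ∈ Finset.Icc (2 * s₁ + 2) (2 * t),
          (S.n : ℝ) * S.contribution (RootedGraph.singleCycleC S s₁ s₂) ε t)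
        + ∑ s ∈ Finset.Icc 1 (2 * t),
          (S.n : ℝ) * S.contribution (RootedGraph.singleCycleR S s) ε t := by
  rw [contribution_eq hn fun G G' i => i.mem_singleCycle_iff]
  simp only [contribution_eq hn fun G G' i => i.mem_singleCycleV_iff,
    contribution_eq hn fun G G' i => i.mem_singleCycleC_iff,
    contribution_eq hn fun G G' i => i.mem_singleCycleR_iff]
  rw [sum_sum_comm, sum_sum_comm, Finset.sum_comm (s := Finset.Icc 1 (2 * t)),
    ← Finset.sum_add_distrib, ← Finset.sum_add_distrib]
  refine Finset.sum_congr rfl fun v₀ _ => ?_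
  simp only [← map_sum, ← map_add]
  congr 1
  funext T A
  simp only [Pi.add_apply, Finset.sum_apply, ← Finset.sum_mul, ← add_mul]
  rw [ind_mem_singleCycle]

end

end Sockets

/-- The limits of all contributions, if no blocklength is zero. -/
theorem tendsto_contributions (L R : ℝ[X]) {ε : ℝ} (hε : ε ∈ Set.Icc (0 : ℝ) 1) (t : ℕ)
    (S : ℕ → Sockets) (hS : ∀ k, (S k).HasDegreeDistributions L R) (hpos : ∀ k, 0 < (S k).n)
    (hn : Tendsto (fun k => (S k).n) atTop atTop) :
    Tendsto (fun k => ((S k).n : ℝ) *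
        (S k).contribution (Sockets.RootedGraph.singleCycle (S k)) ε t) atTop
      (𝓝 ((∑ s₁ ∈ Finset.Ico 1 t, ∑ s₂ ∈ Finset.Icc (2 * s₁ + 1) (2 * t),
              Fv (edgePerspective L) (edgePerspective R) ε t s₁ s₂)
          + (∑ s₁ ∈ Finset.range t, ∑ s₂ ∈ Finset.Icc (2 * s₁ + 2) (2 * t),
              Fc (edgePerspective L) (edgePerspective R) ε t s₁ s₂)
          + ∑ s ∈ Finset.Icc 1 (2 * t), Fr (edgePerspective L) (edgePerspective R) ε t s)) ∧
    (∀ s₁ ∈ Finset.Ico 1 t, ∀ s₂ ∈ Finset.Icc (2 * s₁ + 1) (2 * t),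
      Tendsto (fun k => ((S k).n : ℝ) *
          (S k).contribution (Sockets.RootedGraph.singleCycleV (S k) s₁ s₂) ε t) atTop
        (𝓝 (Fv (edgePerspective L) (edgePerspective R) ε t s₁ s₂))) ∧
    (∀ s₁ ∈ Finset.range t, ∀ s₂ ∈ Finset.Icc (2 * s₁ + 2) (2 * t),
      Tendsto (fun k => ((S k).n : ℝ) *
          (S k).contribution (Sockets.RootedGraph.singleCycleC (S k) s₁ s₂) ε t) atTop
        (𝓝 (Fc (edgePerspective L) (edgePerspective R) ε t s₁ s₂))) ∧
    (∀ s ∈ Finset.Icc 1 (2 * t),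
      Tendsto (fun k => ((S k).n : ℝ) *
          (S k).contribution (Sockets.RootedGraph.singleCycleR (S k) s) ε t) atTop
        (𝓝 (Fr (edgePerspective L) (edgePerspective R) ε t s))) := by
  have H := fun k => (hS k).model (hpos k)
  have hN : Tendsto (fun k => (Fintype.card (S k).VSocket : ℝ)) atTop atTop :=
    tendsto_natCast_atTop_atTop.comp (tendsto_atTop_mono (fun k => (S k).n_le_card) hn)
  have h1 := (hS 0).eval_one (hpos 0)
  have hV : ∀ s₁ ∈ Finset.Ico 1 t, ∀ s₂ ∈ Finset.Icc (2 * s₁ + 1) (2 * t),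
      Tendsto (fun k => ((S k).n : ℝ) *
          (S k).contribution (Sockets.RootedGraph.singleCycleV (S k) s₁ s₂) ε t) atTop
        (𝓝 (Fv (edgePerspective L) (edgePerspective R) ε t s₁ s₂)) := by
    intro s₁ hs₁ s₂ hs₂
    rw [Finset.mem_Ico] at hs₁
    rw [Finset.mem_Icc] at hs₂
    exact Sockets.tendsto_contribution hε hpos H hN (by omega) (by omega)
      (fun _ => Sockets.isCycleType_singleCycleV hs₁.1 hs₂.1)
      (fun _ G G' i => i.mem_singleCycleV_iff)
      (ProductLimit.tendsto_Fv hs₁.1 hs₂.1 hs₂.2 h1 (H 0).second_derivative_eq_zero rfl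
        (Sockets.productLimit_lassoSum hε H hN (by omega)
          ⟨2 * s₁ + (s₂ - 2 * s₁), by omega⟩))
  have hC : ∀ s₁ ∈ Finset.range t, ∀ s₂ ∈ Finset.Icc (2 * s₁ + 2) (2 * t),
      Tendsto (fun k => ((S k).n : ℝ) *
          (S k).contribution (Sockets.RootedGraph.singleCycleC (S k) s₁ s₂) ε t) atTop
        (𝓝 (Fc (edgePerspective L) (edgePerspective R) ε t s₁ s₂)) := by
    intro s₁ _ s₂ hs₂
    rw [Finset.mem_Icc] at hs₂
    exact Sockets.tendsto_contribution hε hpos H hN (by omega) (by omega)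
      (fun _ => Sockets.isCycleType_singleCycleC hs₂.1)
      (fun _ G G' i => i.mem_singleCycleC_iff)
      (ProductLimit.tendsto_Fc hs₂.1 hs₂.2 h1 rfl
        (Sockets.productLimit_lassoSum hε H hN (by omega)
          ⟨2 * s₁ + 1 + (s₂ - (2 * s₁ + 1)), by omega⟩))
  have hR : ∀ s ∈ Finset.Icc 1 (2 * t),
      Tendsto (fun k => ((S k).n : ℝ) *
          (S k).contribution (Sockets.RootedGraph.singleCycleR (S k) s) ε t) atTop
        (𝓝 (Fr (edgePerspective L) (edgePerspective R) ε t s)) := by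
    intro s hs
    rw [Finset.mem_Icc] at hs
    exact Sockets.tendsto_contribution hε hpos H hN hs.1 (by omega)
      (fun _ => Sockets.isCycleType_singleCycleR)
      (fun _ G G' i => i.mem_singleCycleR_iff)
      (ProductLimit.tendsto_Fr hs.1 hs.2 rfl
        (Sockets.productLimit_lassoSum hε H hN (by omega) ⟨s, by omega⟩))
  refine ⟨?_, hV, hC, hR⟩
  simp only [fun k => Sockets.contribution_singleCycle (ε := ε) (t := t) (hpos k)]
  exact ((tendsto_finsetSum _ fun s₁ hs₁ => tendsto_finsetSum _ fun s₂ hs₂ => hV s₁ hs₁ s₂ hs₂).add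
    (tendsto_finsetSum _ fun s₁ hs₁ => tendsto_finsetSum _ fun s₂ hs₂ => hC s₁ hs₁ s₂ hs₂)).add
    (tendsto_finsetSum _ fun s hs => hR s hs)

end LDPC

end

theorem theorem2 (L R lam rho : ℝ[X]) (hlam : lam = LDPC.edgePerspective L)
    (hrho : rho = LDPC.edgePerspective R) (ε : ℝ) (hε : ε ∈ Set.Icc (0 : ℝ) 1) (t : ℕ)
    (S : ℕ → LDPC.Sockets) (hS : ∀ k, (S k).HasDegreeDistributions L R)
    (hn : Tendsto (fun k => (S k).n) atTop atTop) :
    Tendsto (fun k => ((S k).n : ℝ) *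
        (S k).contribution (LDPC.Sockets.RootedGraph.singleCycle (S k)) ε t) atTop
      (𝓝 ((∑ s₁ ∈ Finset.Ico 1 t, ∑ s₂ ∈ Finset.Icc (2 * s₁ + 1) (2 * t),
              LDPC.Fv lam rho ε t s₁ s₂)
          + (∑ s₁ ∈ Finset.range t, ∑ s₂ ∈ Finset.Icc (2 * s₁ + 2) (2 * t),
              LDPC.Fc lam rho ε t s₁ s₂)
          + ∑ s ∈ Finset.Icc 1 (2 * t), LDPC.Fr lam rho ε t s)) ∧
    (∀ s₁ ∈ Finset.Ico 1 t, ∀ s₂ ∈ Finset.Icc (2 * s₁ + 1) (2 * t),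
      Tendsto (fun k => ((S k).n : ℝ) *
          (S k).contribution (LDPC.Sockets.RootedGraph.singleCycleV (S k) s₁ s₂) ε t) atTop
        (𝓝 (LDPC.Fv lam rho ε t s₁ s₂))) ∧
    (∀ s₁ ∈ Finset.range t, ∀ s₂ ∈ Finset.Icc (2 * s₁ + 2) (2 * t),
      Tendsto (fun k => ((S k).n : ℝ) *
          (S k).contribution (LDPC.Sockets.RootedGraph.singleCycleC (S k) s₁ s₂) ε t) atTop
        (𝓝 (LDPC.Fc lam rho ε t s₁ s₂))) ∧
    (∀ s ∈ Finset.Icc 1 (2 * t),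
      Tendsto (fun k => ((S k).n : ℝ) *
          (S k).contribution (LDPC.Sockets.RootedGraph.singleCycleR (S k) s) ε t) atTop
        (𝓝 (LDPC.Fr lam rho ε t s))) := by
  subst hlam hrho
  -- only finitely many blocklengths can be zero
  obtain ⟨K, hK⟩ := eventually_atTop.1 (hn.eventually_gt_atTop 0)
  obtain ⟨h0, hV, hC, hR⟩ := LDPC.tendsto_contributions L R hε t (fun k => S (k + K))
    (fun k => hS _) (fun k => hK _ (by omega)) ((tendsto_add_atTop_iff_nat K).2 hn)
  exact ⟨(tendsto_add_atTop_iff_nat K).1 h0,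
    fun s₁ hs₁ s₂ hs₂ => (tendsto_add_atTop_iff_nat K).1 (hV s₁ hs₁ s₂ hs₂),
    fun s₁ hs₁ s₂ hs₂ => (tendsto_add_atTop_iff_nat K).1 (hC s₁ hs₁ s₂ hs₂),
    fun s hs => (tendsto_add_atTop_iff_nat K).1 (hR s hs)⟩
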